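/- **Model.** The Faulty RAM with safe memory is a unit-cost RAM (addition, truncated subtraction, multiplication, integer division, comparisons, direct and indirect addressing) whose words hold numbers in $\{0,\dots,M-1\}$. It has a faulty memory, accessed word by word, and a safe memory of a bounded number of words; apart from the fixed program code, everything that the program uses is kept in these two memories. An adaptive adversary, which sees both memories, may at any moment (also several times at once) overwrite any word of the faulty memory by an arbitrary value; each overwriting is one fault. It can never alter the safe memory. At most $\delta$ faults occur, and $\alpha\le\delta$ denotes the number of faults that actually occur. A copy of an input key held in a word is *faithful* if it was obtained from the input by moves only and was never overwritten by the adversary on the way; an input key is *uncorrupted* if no fault ever hits a word that holds a faithful copy of it. A program *faithfully sorts* $n$ distinct input keys, given in faulty memory words $0,\dots,n-1$, if upon halting these words contain a faithful copy of every uncorrupted input key, and all faithful keys in them appear in strictly increasing order (corrupted keys may be placed arbitrarily). **Theorem.** There are a single program ($S$-Sort) and an absolute constant $C$ such that for all integers $n\ge 0$, $1\le S\le\delta$ and $M\ge (n+\delta+2)^C$ (that is, words of at least $C\log_2(n+\delta+2)$ bits), for every sequence $X$ of $n$ distinct keys from $\{0,\dots,M-1\}$, and against every adversary as above, the program, given $n$,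 $S$ and $\delta$ and run with a safe memory of $C\cdot S$ words, halts after at most $$C\Bigl(1+n\log_2 n+\alpha\Bigl(\frac{\delta}{S}+\log_2 S\Bigr)\Bigr)$$ steps (where $n\log_2 n=0$ for $n=0$) and faithfully sorts $X$. -/

import Mathlib

/-! A unit-cost RAM whose main memory is faulty, with an additional safe memory of bounded size.

A program is one fixed finite piece of code. All of its working data lives either in the safe
memory (a bounded number of words, directly or indirectly addressed) or in the faulty memory
(addressed indirectly through safe words). Every word holds a number below a modulus `M`. -/

namespace FaultyRAM

/-- A memory word: its numerical content `val`, and bookkeeping information `src` that no program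
can observe. `src = some i` records that the content is a copy of the `i`-th input key that was
obtained from the input by moves only and was never corrupted on the way (a faithful key). -/
structure Word where
  val : ℕ
  src : Option ℕ

/-- Arithmetic operations of the RAM. -/
inductive Op
  | add
  | sub
  | mul
  | div

/-- Arithmetic on words below `M` (subtraction is truncated, division rounds down). -/
def Op.apply (M : ℕ) : Op → ℕ → ℕ → ℕ
  | .add, x, y => (x + y) % M
  | .sub, x, y => x - y
  | .mul, x, y => (x * y) % M
  | .div, x, y => x / y

/-- Comparisons between the contents of the safe words at addresses `a` and `b`. -/
inductive Test
  | lt (a b : ℕ)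
  | eq (a b : ℕ)

/-- Programs. All operands are addresses of safe words, except the literal `k`. -/
inductive Cmd
  | skip
  /-- `safe[d] := k` -/
  | const (d k : ℕ)
  /-- `safe[d] := safe[s]` -/
  | move (d s : ℕ)
  /-- `safe[d] := safe[a] op safe[b]` -/
  | arith (op : Op) (d a b : ℕ)
  /-- `safe[d] := safe[safe[a]]` -/
  | loadSafe (d a : ℕ)
  /-- `safe[safe[a]] := safe[s]` -/
  | storeSafe (a s : ℕ)
  /-- `safe[d] := faulty[safe[a]]` -/
  | load (d a : ℕ)
  /-- `faulty[safe[a]] := safe[s]` -/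
  | store (a s : ℕ)
  | seq (p q : Cmd)
  | cond (b : Test) (p q : Cmd)
  /-- repeat `p` as long as `b` holds -/
  | loop (b : Test) (p : Cmd)

/-- A configuration: the code that remains to be executed, the two memories, and the set of
(indices of) input keys one of whose copies has been hit by a fault. -/
structure Config where
  code : List Cmd
  safe : ℕ → Word
  faulty : ℕ → Word
  corrupted : Set ℕ

/-- Only the safe addresses below `cap` exist: reading elsewhere gives a zero word. -/
def Config.readSafe (cap : ℕ) (c : Config) (a : ℕ) : Word :=
  if a < cap then c.safe a else ⟨0, none⟩

/-- Only the safe addresses below `cap` exist: writing elsewhere has no effect. -/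
def Config.writeSafe (cap : ℕ) (c : Config) (a : ℕ) (w : Word) : Config :=
  if a < cap then { c with safe := Function.update c.safe a w } else c

def Test.holds (cap : ℕ) (c : Config) : Test → Prop
  | .lt a b => (c.readSafe cap a).val < (c.readSafe cap b).val
  | .eq a b => (c.readSafe cap a).val = (c.readSafe cap b).val

open Classical in
/-- One step of the machine with words below `M` and `cap` safe words; `none` means halted.
Moves, loads and stores transport a word together with its bookkeeping information, literals
and results of arithmetic carry none. -/
noncomputable def step (M cap : ℕ) (c : Config) : Option Config :=
  match c.code with
  | [] => none
  | cmd :: k =>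
    let c' : Config := { c with code := k }
    let r := c.readSafe cap
    some <| match cmd with
      | .skip => c'
      | .const d v => c'.writeSafe cap d ⟨v % M, none⟩
      | .move d s => c'.writeSafe cap d (r s)
      | .arith op d a b => c'.writeSafe cap d ⟨op.apply M (r a).val (r b).val, none⟩
      | .loadSafe d a => c'.writeSafe cap d (r (r a).val)
      | .storeSafe a s => c'.writeSafe cap (r a).val (r s)
      | .load d a => c'.writeSafe cap d (c.faulty (r a).val)
      | .store a s => { c' with faulty := Function.update c.faulty (r a).val (r s) }
      | .seq p q => { c with code := p :: q :: k }
      | .cond b p q => { c with code := (if b.holds cap c then p else q) :: k }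
      | .loop b p => { c with code := if b.holds cap c then p :: .loop b p :: k else k }

/-- The machine never gets stuck: it stops exactly when no code is left. -/
theorem step_eq_none_iff (M cap : ℕ) (c : Config) : step M cap c = none ↔ c.code = [] := by
  unfold step
  split <;> simp_all

/-- A memory fault: the adversary replaces the content of the faulty word `a` by `v`. If the word
held a faithful copy of an input key, that key now counts as corrupted. -/
def Config.fault (M : ℕ) (c : Config) (a v : ℕ) : Config :=
  { c with
    faulty := Function.update c.faulty a ⟨v % M, none⟩
    corrupted := {i | i ∈ c.corrupted ∨ (c.faulty a).src = some i} }

/-- `Reaches M cap c₀ t α c`: some behaviour of the adversary leads from `c₀` to `c` with `t` steps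
of the program and `α` faults. Faults may strike at any time, any number of them between two
steps, and as the program is deterministic, quantifying over all such runs covers every adaptive
adversary that sees both memories. -/
inductive Reaches (M cap : ℕ) (c₀ : Config) : ℕ → ℕ → Config → Prop
  | start : Reaches M cap c₀ 0 0 c₀
  | step {t α : ℕ} {c c' : Config} :
      Reaches M cap c₀ t α c → step M cap c = some c' → Reaches M cap c₀ (t + 1) α c'
  | fault {t α : ℕ} {c : Config} (a v : ℕ) :
      Reaches M cap c₀ t α c → Reaches M cap c₀ t (α + 1) (c.fault M a v)

/-- Initial configuration: the parameters `n`, `S`, `δ` are in the safe words `0`, `1`, `2`, the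
input keys are in the faulty words `0, …, n - 1`, all other words are zero. -/
def initial (P : Cmd) (n S δ : ℕ) (X : Fin n → ℕ) : Config where
  code := [P]
  safe a := ⟨if a = 0 then n else if a = 1 then S else if a = 2 then δ else 0, none⟩
  faulty a := if h : a < n then ⟨X ⟨a, h⟩, some a⟩ else ⟨0, none⟩
  corrupted := ∅

/-- The faulty words `0, …, n - 1` hold the faithfully sorted sequence `X`: every input key that has
never been corrupted occurs, and all faithful keys that occur are in strictly increasing order
(in particular none of them occurs twice). Corrupted keys may be anywhere. -/
def FaithfullySorted (n : ℕ) (X : Fin n → ℕ) (c : Config) : Prop :=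
  (∀ i : Fin n, (i : ℕ) ∉ c.corrupted → ∃ p < n, c.faulty p = ⟨X i, some i⟩) ∧
  ∀ p q : ℕ, p < q → q < n → ∀ i j : Fin n,
    (c.faulty p).src = some (i : ℕ) → (c.faulty q).src = some (j : ℕ) → X i < X j

end FaultyRAM

namespace FaultyRAM

open Function (update)

/-! The program is a bottom-up mergesort. Besides the provenance of keys, the proof follows a finite
set `bad` that contains all live addresses hit by a fault since they were last written. Words
outside `bad` are in order wherever the algorithm relies on it, even if their values were corrupted
in an earlier round. Hence two neighbouring words of a run that are found out of order include a bad
one. Both are taken out of the run and put into a priority queue, which joins the merge as a third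
input. A removal strikes at least one address from `bad` and raises the number `ins` of insertions
by two, so `2 * bad.card + ins ≤ 2 * a` persists (`Core.card`, `wp_remove`): there are at most two
insertions per fault.

The difficulty is to emit keys although any word may change after it was checked. Each run keeps in
safe memory a table of at most `S + 1` verified blocks of at most `K = δ / S + 1` words. The
separator `C k` bounds the good words of block `k` from above and those of block `k + 1` from below.
If all slots are in use and unverified words remain, the blocks behind the front have `S * K > δ`
words, so one of these words is good, and it forces every good unverified word to be at least the
first separator (`Run.Val.cover`). Let `th` be the least of the two first separators and the queue
minimum, raised to the bound reached before. Then the good words outside the queue that are below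
`th` all lie in the two front blocks, and merging these up to `th`, with one extraction if the queue
provides `th`, is safe (`Run.Val.raise`, `Merging.commit`). The output of such a phase stays
tentative until both front blocks have been read completely. A disorder discovered meanwhile
discards it and sends a pair to the queue.

The queue distributes its elements over `S` groups in turn. The minimum of each group and a
tournament tree over the groups are safe, the other elements lie in faulty words. As `ins ≤ 2 * δ`,
a group has `O(δ / S)` words; an insertion costs `O(log S)` and an extraction `O(δ / S + log S)`
(`wp_pqInsert`, `wp_pqPop`).

Time is amortised (`Inv.time`). Unverified words and verified blocks carry credit (`Run.pot`), and
so does every element of the queue (`Ctx.cp`). A removed pair brings in `2 * Bh`, which is of order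
`δ / S + log S` and pays for the wasted work and for the two new elements. Blocks are charged by
`min K w`, so a merge of runs of length `w` starts with `O(w)` credit and the work not paid by
faults sums up to `O(n log n)`.

No key gets lost or doubled, because all movements are bijective relocations of the live locations
(`Good.map`). Together with `Reaches.truthful` this turns order of values into faithful sorting
(`Outer.sorts`).

Programs are verified by weakest preconditions `wp` for assertions that are stable under faults.
Only loads and stores see the faulty memory, so faults need to be considered only there. Each step
is checked against the limit; thus `wp_sound` yields the time bound in every reachable
configuration, and therefore halting, as well as the final assertion. -/

/-- Machine parameters, and the time limit `A0 + B * a` as a function of the number `a` of faults. -/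
structure Par where
  M : ℕ
  cap : ℕ
  δ : ℕ
  A0 : ℕ
  B : ℕ

def Par.lim (P : Par) (a : ℕ) : ℕ := P.A0 + P.B * a

theorem Par.lim_mono (P : Par) {a b : ℕ} (h : a ≤ b) : P.lim a ≤ P.lim b :=
  Nat.add_le_add_left (Nat.mul_le_mul_left _ h) _

/-! ### Evolution of the faulty memory under faults. -/

/-- The faulty memory, the set of corrupted keys and the number of faults so far. -/
structure FState where
  mem : ℕ → Word
  cor : Set ℕ
  a : ℕ

/-- `m'` arises from `m` by faults at the addresses in `F`, where cells in `Z` may change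
arbitrarily. -/
structure EvF (δ : ℕ) (Z : Set ℕ) (F : Finset ℕ) (m m' : FState) : Prop where
  card : F.card + m.a ≤ m'.a
  le : m.a ≤ δ → m'.a ≤ δ
  cor : m.cor ⊆ m'.cor
  same : ∀ p, p ∉ Z → p ∉ F → m'.mem p = m.mem p
  lost : ∀ p, p ∉ Z → p ∈ F → (m'.mem p).src = none ∧
    ∀ i, (m.mem p).src = some i → i ∈ m'.cor

theorem EvF.refl (δ : ℕ) (Z : Set ℕ) (m : FState) : EvF δ Z ∅ m m :=
  ⟨by simp, id, subset_rfl, fun _ _ _ => rfl, fun _ _ h => by simp at h⟩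

theorem EvF.a_le {δ Z F m m'} (h : EvF δ Z F m m') : m.a ≤ m'.a := by have := h.card; omega

theorem EvF.trans {δ : ℕ} {Z Z' : Set ℕ} {F F' : Finset ℕ} {m m' m'' : FState}
    (h : EvF δ Z F m m') (h' : EvF δ Z' F' m' m'') : EvF δ (Z ∪ Z') (F ∪ F') m m'' where
  card := by have := Finset.card_union_le F F'; have := h.card; have := h'.card; omega
  le := fun x => h'.le (h.le x)
  cor := h.cor.trans h'.cor
  same := fun p hp hF => by
    simp only [Set.mem_union, not_or, Finset.mem_union] at hp hF
    rw [h'.same p hp.2 hF.2, h.same p hp.1 hF.1]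
  lost := fun p hp hF => by
    simp only [Set.mem_union, not_or, Finset.mem_union] at hp hF
    by_cases h1 : p ∈ F
    · have l1 := h.lost p hp.1 h1
      refine ⟨?_, fun i hi => h'.cor (l1.2 i hi)⟩
      by_cases h2 : p ∈ F'
      · exact (h'.lost p hp.2 h2).1
      · rw [h'.same p hp.2 h2]; exact l1.1
    · have h2 : p ∈ F' := hF.resolve_left h1
      have l2 := h'.lost p hp.2 h2
      rw [← h.same p hp.1 h1]; exact l2

theorem EvF.mono {δ : ℕ} {Z Z' : Set ℕ} {F : Finset ℕ} {m m' : FState}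
    (h : EvF δ Z F m m') (hZ : Z ⊆ Z') : EvF δ Z' F m m' :=
  ⟨h.card, h.le, h.cor, fun p hp => h.same p (fun x => hp (hZ x)),
    fun p hp => h.lost p (fun x => hp (hZ x))⟩

/-- The adversary acting alone: no cell is exempt, as the program writes nothing meanwhile. -/
def Ev (δ : ℕ) (m m' : FState) : Prop := ∃ F, EvF δ ∅ F m m'

theorem Ev.refl (δ : ℕ) (m : FState) : Ev δ m m := ⟨_, EvF.refl δ ∅ m⟩

theorem Ev.trans {δ : ℕ} {m m' m'' : FState} (h : Ev δ m m') (h' : Ev δ m' m'') : Ev δ m m'' := by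
  obtain ⟨F, h⟩ := h
  obtain ⟨F', h'⟩ := h'
  exact ⟨F ∪ F', by simpa using h.trans h'⟩

theorem Ev.a_le {δ m m'} (h : Ev δ m m') : m.a ≤ m'.a := by obtain ⟨F, h⟩ := h; exact h.a_le

theorem EvF.trans_ev {δ : ℕ} {Z : Set ℕ} {F : Finset ℕ} {m m' m'' : FState}
    (h : EvF δ Z F m m') (h' : Ev δ m' m'') : ∃ F', F ⊆ F' ∧ EvF δ Z F' m m'' := by
  obtain ⟨F', h'⟩ := h'
  exact ⟨F ∪ F', Finset.subset_union_left, by simpa using h.trans h'⟩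

/-- The state of the faulty memory after a fault. -/
def FState.fault (M : ℕ) (m : FState) (x v : ℕ) : FState :=
  ⟨Function.update m.mem x ⟨v % M, none⟩, {i | i ∈ m.cor ∨ (m.mem x).src = some i}, m.a + 1⟩

theorem Ev.fault {δ M : ℕ} (m : FState) (x v : ℕ) (h : m.a + 1 ≤ δ) :
    Ev δ m (m.fault M x v) := by
  refine ⟨{x}, ⟨?_, fun _ => h, fun i hi => Or.inl hi, ?_, ?_⟩⟩
  · simp [FState.fault, Nat.add_comm]
  · intro p _ hp
    simp at hp
    simp [FState.fault, hp]
  · intro p _ hp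
    simp at hp
    subst hp
    simp +contextual [FState.fault]

/-- Write a word of the faulty memory. -/
def FState.put (m : FState) (x : ℕ) (w : Word) : FState := ⟨Function.update m.mem x w, m.cor, m.a⟩

/-! ### Weakest preconditions in the presence of the adversary. -/

/-- Assertions on registers (safe words below `128`), arrays (the other safe words), the faulty
memory, and the elapsed time. -/
abbrev Post := (ℕ → Word) → (ℕ → Word) → FState → ℕ → Prop

def Test.ev (r : ℕ → Word) : Test → Prop
  | .lt a b => (r a).val < (r b).val
  | .eq a b => (r a).val = (r b).val

/-- No overflow occurs. -/
def Op.ok (M : ℕ) : Op → ℕ → ℕ → Prop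
  | .add, x, y => x + y < M
  | .mul, x, y => x * y < M
  | _, _, _ => True

def Op.ev : Op → ℕ → ℕ → ℕ
  | .add, x, y => x + y
  | .sub, x, y => x - y
  | .mul, x, y => x * y
  | .div, x, y => x / y

theorem Op.apply_eq {M : ℕ} {op : Op} {x y : ℕ} (h : op.ok M x y) : op.apply M x y = op.ev x y := by
  cases op <;> simp_all [Op.ok, Op.apply, Op.ev, Nat.mod_eq_of_lt]

/-- Faults may strike between any two instructions. Assertions closed under `Ev` need not say so. -/
def Stable (δ : ℕ) (Q : Post) : Prop :=
  ∀ r A m t m', Q r A m t → Ev δ m m' → Q r A m' t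

/-- Weakest preconditions in the presence of the adversary, within the time limit. -/
def wp (P : Par) : Cmd → Post → Post
  | .skip, Q => fun r A m t => t + 1 ≤ P.lim m.a ∧ Q r A m (t + 1)
  | .const d v, Q => fun r A m t =>
      t + 1 ≤ P.lim m.a ∧ v < P.M ∧ Q (Function.update r d ⟨v, none⟩) A m (t + 1)
  | .move d s, Q => fun r A m t =>
      t + 1 ≤ P.lim m.a ∧ Q (Function.update r d (r s)) A m (t + 1)
  | .arith op d a b, Q => fun r A m t =>
      t + 1 ≤ P.lim m.a ∧ op.ok P.M (r a).val (r b).val ∧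
        Q (Function.update r d ⟨op.ev (r a).val (r b).val, none⟩) A m (t + 1)
  | .loadSafe d a, Q => fun r A m t =>
      t + 1 ≤ P.lim m.a ∧ (128 ≤ (r a).val ∧ (r a).val < P.cap) ∧
        Q (Function.update r d (A (r a).val)) A m (t + 1)
  | .storeSafe a s, Q => fun r A m t =>
      t + 1 ≤ P.lim m.a ∧ (128 ≤ (r a).val ∧ (r a).val < P.cap) ∧
        Q r (Function.update A (r a).val (r s)) m (t + 1)
  | .load d a, Q => fun r A m t => t + 1 ≤ P.lim m.a ∧
      ∀ m', Ev P.δ m m' → Q (Function.update r d (m'.mem (r a).val)) A m' (t + 1)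
  | .store a s, Q => fun r A m t => t + 1 ≤ P.lim m.a ∧
      ∀ m', Ev P.δ m m' → Q r A (m'.put (r a).val (r s)) (t + 1)
  | .seq p q, Q => fun r A m t => t + 1 ≤ P.lim m.a ∧ wp P p (wp P q Q) r A m (t + 1)
  | .cond b p q, Q => fun r A m t => t + 1 ≤ P.lim m.a ∧
      (b.ev r → wp P p Q r A m (t + 1)) ∧ (¬ b.ev r → wp P q Q r A m (t + 1))
  | .loop b p, Q => fun r A m t => ∃ I : Post, Stable P.δ I ∧ I r A m t ∧
      ∀ r A m t, I r A m t → t + 1 ≤ P.lim m.a ∧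
        (b.ev r → wp P p I r A m (t + 1)) ∧ (¬ b.ev r → Q r A m (t + 1))

theorem wp_mono {P : Par} (p : Cmd) : ∀ {Q Q' : Post} {r A : ℕ → Word} {m : FState} {t : ℕ},
    wp P p Q r A m t → (∀ r A m t, Q r A m t → Q' r A m t) → wp P p Q' r A m t := by
  induction p with
  | skip => intro Q Q' r A m t h k; exact ⟨h.1, k _ _ _ _ h.2⟩
  | const d v => intro Q Q' r A m t h k; exact ⟨h.1, h.2.1, k _ _ _ _ h.2.2⟩
  | move d v => intro Q Q' r A m t h k; exact ⟨h.1, k _ _ _ _ h.2⟩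
  | arith op d a b => intro Q Q' r A m t h k; exact ⟨h.1, h.2.1, k _ _ _ _ h.2.2⟩
  | loadSafe d a => intro Q Q' r A m t h k; exact ⟨h.1, h.2.1, k _ _ _ _ h.2.2⟩
  | storeSafe d a => intro Q Q' r A m t h k; exact ⟨h.1, h.2.1, k _ _ _ _ h.2.2⟩
  | load d a => intro Q Q' r A m t h k; exact ⟨h.1, fun m' e => k _ _ _ _ (h.2 m' e)⟩
  | store d a => intro Q Q' r A m t h k; exact ⟨h.1, fun m' e => k _ _ _ _ (h.2 m' e)⟩
  | seq p q hp hq =>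
    intro Q Q' r A m t h k
    exact ⟨h.1, hp h.2 fun _ _ _ _ h' => hq h' k⟩
  | cond b p q hp hq =>
    intro Q Q' r A m t h k
    exact ⟨h.1, fun hb => hp (h.2.1 hb) k, fun hb => hq (h.2.2 hb) k⟩
  | loop b p hp =>
    intro Q Q' r A m t h k
    obtain ⟨I, h1, h2, h3⟩ := h
    refine ⟨I, h1, h2, fun r A m t hI => ?_⟩
    obtain ⟨x, y, z⟩ := h3 r A m t hI
    exact ⟨x, y, fun hb => k _ _ _ _ (z hb)⟩

/-- Faults can be postponed: instructions on safe memory do not look at the faulty words, loads and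
stores quantify over a later memory already, and `Ev` is transitive. The time limit only grows with
the number of faults. -/
theorem wp_stable {P : Par} (p : Cmd) : ∀ {Q : Post}, Stable P.δ Q → Stable P.δ (wp P p Q) := by
  induction p with
  | skip =>
    intro Q hQ r A m t m' h e
    exact ⟨h.1.trans (P.lim_mono e.a_le), hQ _ _ _ _ _ h.2 e⟩
  | const d v =>
    intro Q hQ r A m t m' h e
    exact ⟨h.1.trans (P.lim_mono e.a_le), h.2.1, hQ _ _ _ _ _ h.2.2 e⟩
  | move d v =>
    intro Q hQ r A m t m' h e
    exact ⟨h.1.trans (P.lim_mono e.a_le), hQ _ _ _ _ _ h.2 e⟩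
  | arith op d a b =>
    intro Q hQ r A m t m' h e
    exact ⟨h.1.trans (P.lim_mono e.a_le), h.2.1, hQ _ _ _ _ _ h.2.2 e⟩
  | loadSafe d a =>
    intro Q hQ r A m t m' h e
    exact ⟨h.1.trans (P.lim_mono e.a_le), h.2.1, hQ _ _ _ _ _ h.2.2 e⟩
  | storeSafe d a =>
    intro Q hQ r A m t m' h e
    exact ⟨h.1.trans (P.lim_mono e.a_le), h.2.1, hQ _ _ _ _ _ h.2.2 e⟩
  | load d a =>
    intro Q hQ r A m t m' h e
    exact ⟨h.1.trans (P.lim_mono e.a_le), fun m'' e' => h.2 m'' (e.trans e')⟩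
  | store d a =>
    intro Q hQ r A m t m' h e
    exact ⟨h.1.trans (P.lim_mono e.a_le), fun m'' e' => h.2 m'' (e.trans e')⟩
  | seq p q hp hq =>
    intro Q hQ r A m t m' h e
    exact ⟨h.1.trans (P.lim_mono e.a_le), hp (hq hQ) _ _ _ _ _ h.2 e⟩
  | cond b p q hp hq =>
    intro Q hQ r A m t m' h e
    exact ⟨h.1.trans (P.lim_mono e.a_le), fun hb => hp hQ _ _ _ _ _ (h.2.1 hb) e,
      fun hb => hq hQ _ _ _ _ _ (h.2.2 hb) e⟩
  | loop b p hp =>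
    intro Q hQ r A m t m' h e
    obtain ⟨I, h1, h2, h3⟩ := h
    exact ⟨I, h1, h1 _ _ _ _ _ h2 e, h3⟩

/-- Every clause of `wp` pays for its first step; for a loop the invariant does. This bounds the
elapsed time wherever code is left. -/
theorem wp_time {P : Par} {p : Cmd} {Q : Post} {r A : ℕ → Word} {m : FState} {t : ℕ}
    (h : wp P p Q r A m t) : t + 1 ≤ P.lim m.a := by
  cases p with
  | loop b p =>
    obtain ⟨I, h1, h2, h3⟩ := h
    exact (h3 _ _ _ _ h2).1
  | _ => exact h.1

/-- Registers that a program may write. -/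
def Cmd.clob : Cmd → ℕ → Bool
  | .const d _, x | .move d _, x | .arith _ d _ _, x | .loadSafe d _, x | .load d _, x => x == d
  | .seq p q, x | .cond _ p q, x => p.clob x || q.clob x
  | .loop _ p, x => p.clob x
  | _, _ => false

/-- The program writes no array. -/
def Cmd.pureArr : Cmd → Bool
  | .storeSafe _ _ => false
  | .seq p q | .cond _ p q => p.pureArr && q.pureArr
  | .loop _ p => p.pureArr
  | _ => true

/-- The program does not write the faulty memory. -/
def Cmd.pureMem : Cmd → Bool
  | .store _ _ => false
  | .seq p q | .cond _ p q => p.pureMem && q.pureMem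
  | .loop _ p => p.pureMem
  | _ => true

def Frame (δ : ℕ) (p : Cmd) (r A : ℕ → Word) (m : FState) (r' A' : ℕ → Word) (m' : FState) : Prop :=
  (∀ x, p.clob x = false → r' x = r x) ∧ (p.pureArr = true → A' = A) ∧
    (p.pureMem = true → Ev δ m m') ∧ m.a ≤ m'.a

/-- With this, specifications need not list what a program leaves alone: the syntactic checks
`clob`, `pureArr` and `pureMem` are settled by `decide`. -/
theorem wp_frame {P : Par} (p : Cmd) : ∀ {Q : Post} {r A : ℕ → Word} {m : FState} {t : ℕ},
    wp P p Q r A m t → wp P p (fun r' A' m' t' => Q r' A' m' t' ∧ Frame P.δ p r A m r' A' m')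
      r A m t := by
  induction p with
  | skip => intro Q r A m t h; exact ⟨h.1, h.2, by simp [Frame, Ev.refl]⟩
  | const d v =>
    intro Q r A m t h
    refine ⟨h.1, h.2.1, h.2.2, ?_⟩
    simp +contextual [Frame, Ev.refl, Cmd.clob]
  | move d v =>
    intro Q r A m t h
    refine ⟨h.1, h.2, ?_⟩
    simp +contextual [Frame, Ev.refl, Cmd.clob]
  | arith op d a b =>
    intro Q r A m t h
    refine ⟨h.1, h.2.1, h.2.2, ?_⟩
    simp +contextual [Frame, Ev.refl, Cmd.clob]
  | loadSafe d a =>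
    intro Q r A m t h
    refine ⟨h.1, h.2.1, h.2.2, ?_⟩
    simp +contextual [Frame, Ev.refl, Cmd.clob]
  | storeSafe d a =>
    intro Q r A m t h
    refine ⟨h.1, h.2.1, h.2.2, ?_⟩
    simp +contextual [Frame, Ev.refl, Cmd.pureArr]
  | load d a =>
    intro Q r A m t h
    refine ⟨h.1, fun m' e => ⟨h.2 m' e, ?_⟩⟩
    simp +contextual [Frame, e, e.a_le, Cmd.clob]
  | store d a =>
    intro Q r A m t h
    refine ⟨h.1, fun m' e => ⟨h.2 m' e, ?_⟩⟩
    simp +contextual [Frame, e.a_le, Cmd.pureMem, FState.put]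
  | seq p q hp hq =>
    intro Q r A m t h
    refine ⟨h.1, wp_mono p (hp h.2) fun r1 A1 m1 t1 h1 => wp_mono q (hq h1.1) ?_⟩
    rintro r2 A2 m2 t2 ⟨h2, f2⟩
    obtain ⟨-, f1⟩ := h1
    refine ⟨h2, fun x hx => ?_, fun hx => ?_, fun hx => ?_, f1.2.2.2.trans f2.2.2.2⟩
    · simp [Cmd.clob] at hx
      rw [f2.1 x hx.2, f1.1 x hx.1]
    · simp [Cmd.pureArr] at hx
      rw [f2.2.1 hx.2, f1.2.1 hx.1]
    · simp [Cmd.pureMem] at hx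
      exact (f1.2.2.1 hx.1).trans (f2.2.2.1 hx.2)
  | cond b p q hp hq =>
    intro Q r A m t h
    refine ⟨h.1, fun hb => wp_mono p (hp (h.2.1 hb)) ?_, fun hb => wp_mono q (hq (h.2.2 hb)) ?_⟩
    all_goals
      rintro r2 A2 m2 t2 ⟨h2, f2⟩
      refine ⟨h2, fun x hx => f2.1 x ?_, fun hx => f2.2.1 ?_, fun hx => f2.2.2.1 ?_, f2.2.2.2⟩
      · simp [Cmd.clob] at hx
        simp [hx]
      · simp [Cmd.pureArr] at hx
        simp [hx]
      · simp [Cmd.pureMem] at hx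
        simp [hx]
  | loop b p hp =>
    intro Q r A m t h
    obtain ⟨I, h1, h2, h3⟩ := h
    -- The frame relative to the start of the loop joins the invariant. Its memory clause is
    -- transitive, so it survives both the body and the faults.
    refine ⟨fun r' A' m' t' => I r' A' m' t' ∧ Frame P.δ (.loop b p) r A m r' A' m', ?_,
      ⟨h2, by simp [Frame, Ev.refl]⟩, ?_⟩
    · rintro r1 A1 m1 t1 m2 ⟨hI, f⟩ e
      exact ⟨h1 _ _ _ _ _ hI e, f.1, f.2.1, fun hx => (f.2.2.1 hx).trans e, f.2.2.2.trans e.a_le⟩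
    · rintro r1 A1 m1 t1 ⟨hI, f⟩
      obtain ⟨x, y, z⟩ := h3 r1 A1 m1 t1 hI
      refine ⟨x, fun hb => wp_mono p (hp (y hb)) ?_, fun hb => ⟨z hb, f⟩⟩
      rintro r2 A2 m2 t2 ⟨h2, f2⟩
      refine ⟨h2, fun x hx => ?_, fun hx => ?_, fun hx => ?_, f.2.2.2.trans f2.2.2.2⟩
      · rw [f2.1 x hx, f.1 x hx]
      · rw [f2.2.1 hx, f.2.1 hx]
      · exact (f.2.2.1 hx).trans (f2.2.2.1 hx)

/-! ### Soundness with respect to the machine. -/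

/-- All directly addressed words are registers. -/
def Cmd.wf : Cmd → Bool
  | .skip => true
  | .const d _ => d < 128
  | .move d s | .loadSafe d s | .storeSafe d s | .load d s | .store d s => d < 128 && s < 128
  | .arith _ d a b => d < 128 && a < 128 && b < 128
  | .seq p q => p.wf && q.wf
  | .cond (.lt a b) p q | .cond (.eq a b) p q => a < 128 && b < 128 && p.wf && q.wf
  | .loop (.lt a b) p | .loop (.eq a b) p => a < 128 && b < 128 && p.wf

def Test.wf : Test → Prop
  | .lt a b | .eq a b => a < 128 ∧ b < 128

/-- The one safe memory of the machine is split into two functions, so that array writes cannot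
interfere with registers. -/
def Rep (cap : ℕ) (s r A : ℕ → Word) : Prop :=
  (∀ x < 128, s x = r x) ∧ ∀ x, 128 ≤ x → x < cap → s x = A x

def okL (P : Par) (Q : Post) : List Cmd → Post
  | [] => Q
  | p :: k => wp P p (okL P Q k)

theorem okL_stable {P : Par} {Q : Post} (hQ : Stable P.δ Q) (k : List Cmd) :
    Stable P.δ (okL P Q k) := by
  induction k with
  | nil => exact hQ
  | cons p k ih => exact wp_stable p ih

theorem Rep.reg {cap : ℕ} {s r A : ℕ → Word} (h : Rep cap s r A) {d : ℕ} (hd : d < 128) (w : Word) :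
    Rep cap (Function.update s d w) (Function.update r d w) A := by
  refine ⟨fun x hx => ?_, fun x h1 h2 => ?_⟩
  · by_cases hxd : x = d
    · subst hxd; simp
    · simp [hxd, h.1 x hx]
  · rw [Function.update_of_ne (by omega), h.2 x h1 h2]

theorem Rep.arr {cap : ℕ} {s r A : ℕ → Word} (h : Rep cap s r A) {d : ℕ} (hd : 128 ≤ d) (w : Word) :
    Rep cap (Function.update s d w) r (Function.update A d w) := by
  refine ⟨fun x hx => ?_, fun x h1 h2 => ?_⟩
  · rw [Function.update_of_ne (by omega), h.1 x hx]
  · by_cases hxd : x = d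
    · subst hxd; simp
    · simp [hxd, h.2 x h1 h2]

/-- Along a run, the current configuration satisfies the weakest precondition of the code that is
left. A step unfolds one clause of `wp`, a fault is absorbed by stability. -/
theorem wp_sound {P : Par} {Q : Post} (hcap : 128 ≤ P.cap) (hQ : Stable P.δ Q)
    {c₀ : Config} {p : Cmd} (hc : c₀.code = [p]) (hp : p.wf = true) {r₀ A₀ : ℕ → Word}
    (hr : Rep P.cap c₀.safe r₀ A₀) (h : wp P p Q r₀ A₀ ⟨c₀.faulty, c₀.corrupted, 0⟩ 0)
    {t α : ℕ} {c : Config} (hR : Reaches P.M P.cap c₀ t α c) (hα : α ≤ P.δ) :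
    ∃ r A, Rep P.cap c.safe r A ∧ (∀ q ∈ c.code, q.wf = true) ∧
      okL P Q c.code r A ⟨c.faulty, c.corrupted, α⟩ t := by
  induction hR with
  | start => exact ⟨r₀, A₀, hr, by simp [hc, hp], by rw [hc]; exact h⟩
  | fault x v hR ih =>
    obtain ⟨r, A, h1, h2, h3⟩ := ih (by omega)
    refine ⟨r, A, h1, h2, ?_⟩
    exact okL_stable hQ _ _ _ _ _ _ h3 (Ev.fault (M := P.M) _ x v hα)
  | @step t α c c' hR hs ih =>
    obtain ⟨r, A, h1, h2, h3⟩ := ih hα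
    obtain ⟨code, safe, faulty, cor⟩ := c
    cases code with
    | nil => simp [step] at hs
    | cons q k =>
      simp only [List.mem_cons, forall_eq_or_imp] at h2
      obtain ⟨hq, hk⟩ := h2
      simp only at h1 h3
      have rd : ∀ x < 128, Config.readSafe P.cap ⟨q :: k, safe, faulty, cor⟩ x = r x := by
        intro x hx
        simp [Config.readSafe, lt_of_lt_of_le hx hcap, h1.1 x hx]
      have rdA : ∀ x, 128 ≤ x → x < P.cap →
          Config.readSafe P.cap ⟨q :: k, safe, faulty, cor⟩ x = A x := by
        intro x hx hx'
        simp [Config.readSafe, hx', h1.2 x hx hx']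
      have tv : ∀ b : Test, b.wf →
          (b.holds P.cap ⟨q :: k, safe, faulty, cor⟩ ↔ b.ev r) := by
        intro b hb
        cases b <;> simp only [Test.holds, Test.ev, rd _ hb.1, rd _ hb.2]
      simp only [step, Option.some.injEq] at hs
      subst hs
      cases q with
      | skip => exact ⟨r, A, h1, hk, h3.2⟩
      | const d v =>
        simp [Cmd.wf] at hq
        simp only [Config.writeSafe, lt_of_lt_of_le hq hcap, if_true, Nat.mod_eq_of_lt h3.2.1]
        exact ⟨_, A, h1.reg hq _, hk, h3.2.2⟩
      | move d s =>
        simp [Cmd.wf] at hq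
        simp only [Config.writeSafe, lt_of_lt_of_le hq.1 hcap, if_true, rd s hq.2]
        exact ⟨_, A, h1.reg hq.1 _, hk, h3.2⟩
      | arith op d a b =>
        simp [Cmd.wf] at hq
        simp only [Config.writeSafe, lt_of_lt_of_le hq.1.1 hcap, if_true, rd a hq.1.2, rd b hq.2,
          Op.apply_eq h3.2.1]
        exact ⟨_, A, h1.reg hq.1.1 _, hk, h3.2.2⟩
      | loadSafe d a =>
        simp [Cmd.wf] at hq
        obtain ⟨-, ⟨l1, l2⟩, h3⟩ := h3
        simp only [Config.writeSafe, lt_of_lt_of_le hq.1 hcap, if_true, rd a hq.2,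
          rdA _ l1 l2]
        exact ⟨_, A, h1.reg hq.1 _, hk, h3⟩
      | storeSafe d a =>
        simp [Cmd.wf] at hq
        obtain ⟨-, ⟨l1, l2⟩, h3⟩ := h3
        simp only [Config.writeSafe, if_true, rd a hq.2, rd d hq.1, l2]
        exact ⟨r, _, h1.arr l1 _, hk, h3⟩
      | load d a =>
        simp [Cmd.wf] at hq
        simp only [Config.writeSafe, lt_of_lt_of_le hq.1 hcap, if_true, rd a hq.2]
        exact ⟨_, A, h1.reg hq.1 _, hk, h3.2 _ (Ev.refl _ _)⟩
      | store d a =>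
        simp [Cmd.wf] at hq
        simp only [rd a hq.2, rd d hq.1]
        exact ⟨_, A, h1, hk, h3.2 _ (Ev.refl _ _)⟩
      | seq p q =>
        simp [Cmd.wf] at hq
        exact ⟨r, A, h1, by simpa [hq] using hk, h3.2⟩
      | cond b p q =>
        have hb : b.wf ∧
            p.wf = true ∧ q.wf = true := by
          cases b <;> simp [Cmd.wf] at hq <;> simp [hq, Test.wf]
        by_cases hbb : b.ev r
        · simp only [if_pos ((tv b hb.1).2 hbb)]
          exact ⟨r, A, h1, by simpa [hb.2.1] using hk, h3.2.1 hbb⟩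
        · simp only [if_neg (mt (tv b hb.1).1 hbb)]
          exact ⟨r, A, h1, by simpa [hb.2.2] using hk, h3.2.2 hbb⟩
      | loop b p =>
        have hb : b.wf ∧
            p.wf = true := by
          cases b <;> simp [Cmd.wf] at hq <;> simp [hq, Test.wf]
        obtain ⟨I, i1, i2, i3⟩ := h3
        obtain ⟨j1, j2, j3⟩ := i3 _ _ _ _ i2
        by_cases hbb : b.ev r
        · simp only [if_pos ((tv b hb.1).2 hbb)]
          -- After the body, the same loop heads the code again, and the same invariant witnesses
          -- its precondition.
          refine ⟨r, A, h1, by simpa [hb.2, hq] using hk, wp_mono p (j2 hbb) ?_⟩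
          intro r A m t hI
          exact ⟨I, i1, hI, i3⟩
        · simp only [if_neg (mt (tv b hb.1).1 hbb)]
          exact ⟨r, A, h1, hk, j3 hbb⟩

/-! ### Provenance determines the value. -/

/-- Provenance is truthful in every reachable configuration. -/
theorem Reaches.truthful {M cap n S δ : ℕ} {p : Cmd} {X : Fin n → ℕ} {t α : ℕ} {c : Config}
    (h : Reaches M cap (initial p n S δ X) t α c) :
    (∀ a i, (c.safe a).src = some i → ∃ hi : i < n, (c.safe a).val = X ⟨i, hi⟩) ∧
    (∀ a i, (c.faulty a).src = some i → ∃ hi : i < n, (c.faulty a).val = X ⟨i, hi⟩) := by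
  induction h with
  | start =>
    refine ⟨by simp [initial], fun a i => ?_⟩
    simp only [initial]
    split
    · rintro h; simp at h; subst h; exact ⟨by assumption, rfl⟩
    · simp
  | fault x v hR ih =>
    refine ⟨ih.1, fun a i => ?_⟩
    simp only [Config.fault]
    by_cases hx : a = x
    · subst hx; simp
    · rw [Function.update_of_ne hx]; exact ih.2 a i
  | @step t α c c' hR hs ih =>
    have rd : ∀ a i, (c.readSafe cap a).src = some i →
        ∃ hi : i < n, (c.readSafe cap a).val = X ⟨i, hi⟩ := by
      intro a i
      unfold Config.readSafe
      split
      · exact ih.1 a i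
      · simp
    have wr : ∀ (k : List Cmd) d w,
        (∀ i, w.src = some i → ∃ hi : i < n, w.val = X ⟨i, hi⟩) →
        (∀ a i, ((Config.writeSafe cap { c with code := k } d w).safe a).src = some i →
          ∃ hi : i < n, ((Config.writeSafe cap { c with code := k } d w).safe a).val = X ⟨i, hi⟩) ∧
        (∀ a i, ((Config.writeSafe cap { c with code := k } d w).faulty a).src = some i →
          ∃ hi : i < n, ((Config.writeSafe cap { c with code := k } d w).faulty a).val = X ⟨i, hi⟩) := by
      intro k d w hw
      unfold Config.writeSafe
      split
      · refine ⟨fun a i => ?_, ih.2⟩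
        by_cases ha : a = d
        · subst ha; simpa using hw i
        · simpa [ha] using ih.1 a i
      · exact ih
    obtain ⟨code, safe, faulty, cor⟩ := c
    cases code with
    | nil => simp [FaultyRAM.step] at hs
    | cons q k =>
      simp only [FaultyRAM.step, Option.some.injEq] at hs
      subst hs
      cases q with
      | skip | seq _ _ | cond _ _ _ | loop _ _ => exact ih
      | const d v => exact wr k _ _ (by simp)
      | arith op d a b => exact wr k _ _ (by simp)
      | move d s => exact wr k _ _ (rd s)
      | loadSafe d s => exact wr k _ _ (rd _)
      | storeSafe d s => exact wr k _ _ (rd _)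
      | load d s => exact wr k _ _ (ih.2 _)
      | store d s =>
        refine ⟨ih.1, fun a i => ?_⟩
        simp only
        by_cases ha : a = (Config.readSafe cap ⟨.store d s :: k, safe, faulty, cor⟩ d).val
        · subst ha; simpa using rd s i
        · rw [Function.update_of_ne ha]; exact ih.2 a i

/-! ### Straight-line code and proof rules. -/

/-- Instructions on the safe memory. -/
inductive Ins
  | set (d k : ℕ)
  | mov (d s : ℕ)
  | op (o : Op) (d a b : ℕ)
  | lds (d a : ℕ)
  | sts (a s : ℕ)

def Ins.toCmd : Ins → Cmd
  | .set d k => .const d k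
  | .mov d s => .move d s
  | .op o d a b => .arith o d a b
  | .lds d a => .loadSafe d a
  | .sts a s => .storeSafe a s

def blk : List Ins → Cmd
  | [] => .skip
  | i :: l => .seq i.toCmd (blk l)

/-- Weakest preconditions of instruction sequences, without time and faults. -/
def wpB (P : Par) : List Ins → ((ℕ → Word) → (ℕ → Word) → Prop) → (ℕ → Word) → (ℕ → Word) → Prop
  | [], Q, r, A => Q r A
  | .set d k :: l, Q, r, A => k < P.M ∧ wpB P l Q (Function.update r d ⟨k, none⟩) A
  | .mov d s :: l, Q, r, A => wpB P l Q (Function.update r d (r s)) A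
  | .op o d a b :: l, Q, r, A => o.ok P.M (r a).val (r b).val ∧
      wpB P l Q (Function.update r d ⟨o.ev (r a).val (r b).val, none⟩) A
  | .lds d a :: l, Q, r, A => (128 ≤ (r a).val ∧ (r a).val < P.cap) ∧
      wpB P l Q (Function.update r d (A (r a).val)) A
  | .sts a s :: l, Q, r, A => (128 ≤ (r a).val ∧ (r a).val < P.cap) ∧
      wpB P l Q r (Function.update A (r a).val (r s))

/-- Each instruction costs two steps, one of them for `seq`, and the final `skip` costs one. No
fault matters inside, since nothing touches the faulty memory. -/
theorem wp_blk {P : Par} {Q : Post} {m : FState} (l : List Ins) :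
    ∀ {r A : ℕ → Word} {t : ℕ}, t + (2 * l.length + 1) ≤ P.lim m.a →
    wpB P l (fun r A => Q r A m (t + (2 * l.length + 1))) r A → wp P (blk l) Q r A m t := by
  induction l with
  | nil => intro r A t ht h; exact ⟨ht, h⟩
  | cons i l ih =>
    intro r A t ht h
    simp only [List.length_cons] at ht h
    have e : t + (2 * (l.length + 1) + 1) = (t + 1 + 1) + (2 * l.length + 1) := by omega
    rw [e] at h ht
    refine ⟨by omega, ?_⟩
    cases i with
    | set d k => exact ⟨by omega, h.1, ih ht h.2⟩
    | mov d s => exact ⟨by omega, ih ht h⟩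
    | op o d a b => exact ⟨by omega, h.1, ih ht h.2⟩
    | lds d a => exact ⟨by omega, h.1, ih ht h.2⟩
    | sts d a => exact ⟨by omega, h.1, ih ht h.2⟩

infixr:60 " ;; " => Cmd.seq

theorem wp_seq {P : Par} {Q : Post} {p q : Cmd} {r A : ℕ → Word} {m : FState} {t : ℕ}
    (ht : t + 1 ≤ P.lim m.a) (h : wp P p (wp P q Q) r A m (t + 1)) :
    wp P (p ;; q) Q r A m t := ⟨ht, h⟩

theorem wp_blk_seq {P : Par} {Q : Post} {m : FState} {l : List Ins} {q : Cmd}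
    {r A : ℕ → Word} {t : ℕ} (ht : t + (2 * l.length + 2) ≤ P.lim m.a)
    (h : wpB P l (fun r A => wp P q Q r A m (t + (2 * l.length + 2))) r A) :
    wp P (blk l ;; q) Q r A m t := by
  have e : t + (2 * l.length + 2) = (t + 1) + (2 * l.length + 1) := by omega
  rw [e] at h ht
  exact ⟨by omega, wp_blk l ht h⟩

theorem wp_cond {P : Par} {Q : Post} {b : Test} {p q : Cmd} {r A : ℕ → Word} {m : FState} {t : ℕ}
    (ht : t + 1 ≤ P.lim m.a) (h : b.ev r → wp P p Q r A m (t + 1))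
    (h' : ¬ b.ev r → wp P q Q r A m (t + 1)) : wp P (.cond b p q) Q r A m t := ⟨ht, h, h'⟩

theorem wp_skip {P : Par} {Q : Post} {r A : ℕ → Word} {m : FState} {t : ℕ}
    (ht : t + 1 ≤ P.lim m.a) (h : Q r A m (t + 1)) : wp P .skip Q r A m t := ⟨ht, h⟩

theorem wp_load {P : Par} {Q : Post} {d a : ℕ} {r A : ℕ → Word} {m : FState} {t : ℕ}
    (ht : t + 1 ≤ P.lim m.a)
    (h : ∀ m', Ev P.δ m m' → Q (Function.update r d (m'.mem (r a).val)) A m' (t + 1)) :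
    wp P (.load d a) Q r A m t := ⟨ht, h⟩

theorem wp_store {P : Par} {Q : Post} {d a : ℕ} {r A : ℕ → Word} {m : FState} {t : ℕ}
    (ht : t + 1 ≤ P.lim m.a)
    (h : ∀ m', Ev P.δ m m' → Q r A (m'.put (r d).val (r a)) (t + 1)) :
    wp P (.store d a) Q r A m t := ⟨ht, h⟩

theorem wp_abs {P : Par} {Q : Post} {p : Cmd} {r A : ℕ → Word} {m : FState} {t : ℕ}
    (h : ∀ r', r' = r → wp P p Q r' A m t) : wp P p Q r A m t := h r rfl

/-- Abstract from the postcondition. -/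
theorem wp_hide {P : Par} {Q : Post} {p : Cmd} {r A : ℕ → Word} {m : FState} {t : ℕ}
    (h : ∀ Q' : Post, (∀ r A m t, Q r A m t → Q' r A m t) → wp P p Q' r A m t) :
    wp P p Q r A m t := h Q fun _ _ _ _ h => h

/-! ### Conservation of the faithful keys. -/

/-- Storage locations: words of the faulty memory, words of safe arrays, registers. -/
inductive Loc
  | f (p : ℕ)
  | a (x : ℕ)
  | g (x : ℕ)
  deriving DecidableEq

def rd (r A mem : ℕ → Word) : Loc → Option ℕ
  | .f p => (mem p).src
  | .a x => (A x).src
  | .g x => (r x).src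

/-- No faithful key occurs at two live locations, and every uncorrupted key occurs. -/
def Good (n : ℕ) (s : Loc → Option ℕ) (cor : Set ℕ) (live : Set Loc) : Prop :=
  (∀ x ∈ live, ∀ y ∈ live, ∀ i, s x = some i → s y = some i → x = y) ∧
  ∀ i < n, i ∉ cor → ∃ x ∈ live, s x = some i

/-- Moves, exchanges and faults are all of one kind: `φ` tells where the content of a live location
came from. Injectivity of `φ` prevents duplicates and surjectivity prevents losses. A source may
vanish only if its key counts as corrupted from now on. -/
theorem Good.map {n : ℕ} {s s' : Loc → Option ℕ} {cor cor' : Set ℕ} {live live' : Set Loc}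
    (h : Good n s cor live) (φ : Loc → Loc) (hc : cor ⊆ cor')
    (hm : ∀ x ∈ live', φ x ∈ live ∧
      (s' x = s (φ x) ∨ (s' x = none ∧ ∀ i, s (φ x) = some i → i ∈ cor')))
    (hi : ∀ x ∈ live', ∀ y ∈ live', φ x = φ y → x = y)
    (hs : ∀ y ∈ live, ∃ x ∈ live', φ x = y) : Good n s' cor' live' := by
  constructor
  · intro x hx y hy i h1 h2
    obtain ⟨a1, b1⟩ := hm x hx
    obtain ⟨a2, b2⟩ := hm y hy
    have c1 : s (φ x) = some i := by
      rcases b1 with b | b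
      · rw [← b, h1]
      · simp [b.1] at h1
    have c2 : s (φ y) = some i := by
      rcases b2 with b | b
      · rw [← b, h2]
      · simp [b.1] at h2
    exact hi x hx y hy (h.1 _ a1 _ a2 i c1 c2)
  · intro i hi hcor
    obtain ⟨y, hy, e⟩ := h.2 i hi (fun x => hcor (hc x))
    obtain ⟨x, hx, rfl⟩ := hs y hy
    refine ⟨x, hx, ?_⟩
    rcases (hm x hx).2 with b | b
    · rw [b, e]
    · exact absurd (b.2 i e) hcor

theorem Good.congr {n : ℕ} {s s' : Loc → Option ℕ} {cor : Set ℕ} {live live' : Set Loc}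
    (h : Good n s cor live) (hl : ∀ x, x ∈ live' ↔ x ∈ live) (hs : ∀ x ∈ live, s' x = s x) :
    Good n s' cor live' :=
  h.map id subset_rfl (fun x hx => ⟨(hl x).1 hx, Or.inl (hs x ((hl x).1 hx))⟩)
    (fun _ _ _ _ e => e) (fun y hy => ⟨y, (hl y).2 hy, rfl⟩)

theorem Good.move {n : ℕ} {s s' : Loc → Option ℕ} {cor : Set ℕ} {live live' : Set Loc}
    (h : Good n s cor live) (y z : Loc) (hy : y ∈ live) (hz : z ∉ live)
    (hl : ∀ x, x ∈ live' ↔ x = z ∨ (x ∈ live ∧ x ≠ y)) (hsz : s' z = s y)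
    (hs : ∀ x ∈ live, x ≠ y → s' x = s x) : Good n s' cor live' := by
  classical
  refine h.map (fun x => if x = z then y else x) subset_rfl ?_ ?_ ?_
  · intro x hx
    by_cases e : x = z
    · subst e; simp [hy, hsz]
    · have := ((hl x).1 hx).resolve_left e
      simp [e, this.1, hs x this.1 this.2]
  · intro x hx x' hx' e
    have h1 := (hl x).1 hx
    have h2 := (hl x').1 hx'
    by_cases e1 : x = z <;> by_cases e2 : x' = z
    · rw [e1, e2]
    · simp only [e1, e2, if_true, if_false] at e
      exact absurd e.symm (h2.resolve_left e2).2
    · simp only [e1, e2, if_true, if_false] at e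
      exact absurd e (h1.resolve_left e1).2
    · simpa [e1, e2] using e
  · intro x hx
    by_cases e : x = y
    · exact ⟨z, (hl z).2 (Or.inl rfl), by simp [e]⟩
    · have : x ≠ z := fun e' => hz (e' ▸ hx)
      exact ⟨x, (hl x).2 (Or.inr ⟨hx, e⟩), by simp [this]⟩

/-- Here the relocation is the identity, and the exception for vanished sources covers exactly the
words that were hit. -/
theorem Good.ev {n δ : ℕ} {Z : Set ℕ} {F : Finset ℕ} {m m' : FState} {r A : ℕ → Word}
    {live : Set Loc} (h : Good n (rd r A m.mem) m.cor live) (e : EvF δ Z F m m')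
    (hZ : ∀ p, Loc.f p ∈ live → p ∉ Z) : Good n (rd r A m'.mem) m'.cor live := by
  refine h.map id e.cor (fun x hx => ⟨hx, ?_⟩) (fun _ _ _ _ e => e) (fun y hy => ⟨y, hy, rfl⟩)
  cases x with
  | f p =>
    simp only [rd, id]
    by_cases hp : p ∈ F
    · exact Or.inr (e.lost p (hZ p hx) hp)
    · exact Or.inl (by rw [e.same p (hZ p hx) hp])
  | a x => exact Or.inl rfl
  | g x => exact Or.inl rfl

/-! ### Memory layout and the tournament tree. -/

/-- The parameters fit into words, and the arrays into the safe memory. -/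
structure Par.Ok (P : Par) (n S : ℕ) : Prop where
  hS : 1 ≤ S
  hSδ : S ≤ P.δ
  hM : 1000 * (n + P.δ + 2) ≤ P.M
  hcap : 128 + 32 * S ≤ P.cap

/-- The block length. -/
def Par.K (P : Par) (S : ℕ) : ℕ := P.δ / S + 1

/-- Registers that hold constants. -/
structure Consts (P : Par) (n S : ℕ) (r : ℕ → Word) : Prop where
  c0 : (r 0).val = n
  c1 : (r 1).val = S
  c3 : r 3 = ⟨0, none⟩
  c4 : (r 4).val = 1
  c5 : (r 5).val = 16
  c6 : (r 6).val = P.K S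
  c7 : (r 7).val = S + 1
  c12 : (r 12).val = 2
  c13 : (r 13).val = 128
  c14 : (r 14).val = 134
  c15 : (r 15).val = 136
  c16 : (r 16).val = 2 * n

theorem Consts.congr {P : Par} {n S : ℕ} {r r' : ℕ → Word} (h : Consts P n S r)
    (e : ∀ x < 17, x ≠ 2 → x ≠ 8 → x ≠ 9 → x ≠ 10 → x ≠ 11 → r' x = r x) : Consts P n S r' where
  c0 := by rw [e 0] <;> simp [h.c0]
  c1 := by rw [e 1] <;> simp [h.c1]
  c3 := by rw [e 3] <;> simp [h.c3]
  c4 := by rw [e 4] <;> simp [h.c4]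
  c5 := by rw [e 5] <;> simp [h.c5]
  c6 := by rw [e 6] <;> simp [h.c6]
  c7 := by rw [e 7] <;> simp [h.c7]
  c12 := by rw [e 12] <;> simp [h.c12]
  c13 := by rw [e 13] <;> simp [h.c13]
  c14 := by rw [e 14] <;> simp [h.c14]
  c15 := by rw [e 15] <;> simp [h.c15]
  c16 := by rw [e 16] <;> simp [h.c16]

/-- Node `i` of the tournament tree: the group (plus one) that provides the minimum, or zero. -/
def nwin (A : ℕ → Word) (i : ℕ) : ℕ := (A (128 + 16 * i + 6)).val

/-- The minimum stored in node `i` of the tournament tree. -/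
def nval (A : ℕ → Word) (i : ℕ) : Word := A (128 + 16 * i + 7)

/-- The number of faulty words of group `g`. -/
def ncnt (A : ℕ → Word) (g : ℕ) : ℕ := (A (128 + 16 * g + 8)).val

/-- Only values matter in the inner nodes: their words serve for comparison, while the key itself
counts as stored in the leaf. -/
structure TreeAt (A : ℕ → Word) (i : ℕ) : Prop where
  l : nwin A (2 * i) ≠ 0 → nwin A i ≠ 0 ∧ (nval A i).val ≤ (nval A (2 * i)).val
  r : nwin A (2 * i + 1) ≠ 0 → nwin A i ≠ 0 ∧ (nval A i).val ≤ (nval A (2 * i + 1)).val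
  c : nwin A i = 0 ∨ (nwin A i = nwin A (2 * i) ∧ (nval A i).val = (nval A (2 * i)).val) ∨
    (nwin A i = nwin A (2 * i + 1) ∧ (nval A i).val = (nval A (2 * i + 1)).val)

/-- Restore the tree on the path from the node in register `65` to the root. -/
def treeUpdate : Cmd :=
  blk [.op .div 65 65 12] ;;
  .loop (.lt 3 65) (
    blk [.op .mul 111 65 5, .op .add 112 111 111, .op .add 111 111 14, .op .add 112 112 14,
      .op .add 113 112 5, .lds 114 112, .lds 115 113, .op .add 116 112 4, .op .add 117 113 4,
      .lds 118 116, .lds 119 117] ;;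
    .cond (.eq 114 3) (blk [.mov 114 115, .mov 118 119])
      (.cond (.eq 115 3) .skip
        (.cond (.lt 119 118) (blk [.mov 114 115, .mov 118 119]) .skip)) ;;
    blk [.sts 111 114, .op .add 111 111 4, .sts 111 118, .op .div 65 65 12])

/-- `i` is an ancestor of the tree node `x`, or `x` itself. -/
def Anc (i x : ℕ) : Prop := ∃ k, i = x / 2 ^ k

theorem Anc.half {i x : ℕ} (h : Anc i x) : i = x ∨ Anc i (x / 2) := by
  obtain ⟨k, hk⟩ := h
  cases k with
  | zero => left; simpa using hk
  | succ k =>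
    right
    exact ⟨k, by rw [hk, Nat.div_div_eq_div_mul, pow_succ, mul_comm]⟩

theorem TreeAt.congr {A A' : ℕ → Word} {i : ℕ} (h : TreeAt A i)
    (e : ∀ j, j = i ∨ j = 2 * i ∨ j = 2 * i + 1 → nwin A' j = nwin A j ∧ (nval A' j).val = (nval A j).val) :
    TreeAt A' i := by
  obtain ⟨a1, a2⟩ := e i (by simp)
  obtain ⟨b1, b2⟩ := e (2 * i) (by simp)
  obtain ⟨c1, c2⟩ := e (2 * i + 1) (by simp)
  constructor
  · rw [a1, a2, b1, b2]; exact h.l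
  · rw [a1, a2, c1, c2]; exact h.r
  · rw [a1, a2, b1, b2, c1, c2]; exact h.c

/-- Only inner tree nodes differ. -/
def ArrTree (S : ℕ) (A A' : ℕ → Word) : Prop :=
  ∀ x, (∀ i, 1 ≤ i → i < S → x ≠ 128 + 16 * i + 6 ∧ x ≠ 128 + 16 * i + 7) → A' x = A x

/-- A changed leaf can spoil only its ancestors. The invariant exempts the ancestors of the current
node; repairing that node and halving the index shrinks the exception. The index stays below `2 ^ k`
with `k` falling from `l`, which gives the factor `l` in the time. -/
theorem wp_treeUpdate {P : Par} {n S : ℕ} (hP : P.Ok n S) {r A : ℕ → Word} {m : FState} {t : ℕ}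
    {Q : Post} (hc : Consts P n S r) {l : ℕ} (hl : S ≤ 2 ^ l) (hSn : S ≤ P.δ)
    (hx : (r 65).val < 2 * S)
    (hT : ∀ i, 1 ≤ i → i < S → ¬ Anc i ((r 65).val / 2) → TreeAt A i)
    (ht : t + 60 * l + 10 ≤ P.lim m.a)
    (hQ : ∀ r' A' m' t', Frame P.δ treeUpdate r A m r' A' m' → (∀ i, 1 ≤ i → i < S → TreeAt A' i) →
      ArrTree S A A' → t' ≤ t + 60 * l + 10 → Q r' A' m' t') :
    wp P treeUpdate Q r A m t := by
  obtain ⟨hS, hSδ, hM, hcap⟩ := hP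
  suffices h : wp P treeUpdate (fun r' A' m' t' => (∀ i, 1 ≤ i → i < S → TreeAt A' i) ∧
      ArrTree S A A' ∧ t' ≤ t + 60 * l + 10) r A m t from
    wp_mono _ (wp_frame _ h) fun r' A' m' t' h => hQ r' A' m' t' h.2 h.1.1 h.1.2.1 h.1.2.2
  have h3 := hc.c3
  have h12 := hc.c12
  refine wp_blk_seq (by simp; omega) ?_
  simp only [wpB, Op.ok, Op.ev, h12, true_and]
  refine ⟨fun r' A' m' t' => Consts P n S r' ∧ (∀ i, 1 ≤ i → i < S → ¬ Anc i (r' 65).val → TreeAt A' i) ∧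
      ArrTree S A A' ∧ P.lim m.a ≤ P.lim m'.a ∧ ∃ k, (r' 65).val < 2 ^ k ∧ (r' 65).val < S ∧
        t' + 60 * k ≤ t + 60 * l + 8, ?_, ?_, ?_⟩
  · rintro r1 A1 m1 t1 m2 ⟨a, b, c, d, e⟩ ev
    exact ⟨a, b, c, d.trans (P.lim_mono ev.a_le), e⟩
  · refine ⟨hc.congr (fun x _ _ _ _ _ _ => Function.update_of_ne (by omega) _ _), by simpa using hT, fun _ _ => rfl, le_rfl, l, ?_⟩
    simp
    omega
  · rintro r1 A1 m1 t1 ⟨hc1, hT1, hA1, hm1, k, hk, hxS, hk1⟩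
    refine ⟨by omega, ?_, ?_⟩
    · intro hb
      simp only [Test.ev, hc1.c3] at hb
      have hk0 : k ≠ 0 := by rintro rfl; simp at hk; omega
      obtain ⟨k, rfl⟩ := Nat.exists_eq_succ_of_ne_zero hk0
      have e5 := hc1.c5
      have e14 := hc1.c14
      have e4 := hc1.c4
      have e3 := hc1.c3
      set x := (r1 65).val with hx1
      refine wp_blk_seq (by simp; omega) ?_
      simp [wpB, Op.ok, Op.ev, e5, e14, e4, ← hx1]
      refine ⟨by omega, by omega, by omega, by omega, by omega, by omega, by omega, by omega, by omega,
        by omega, by omega, ?_⟩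
      refine wp_abs fun r2 hr2 => ?_
      have f : ∀ y, y ∉ [111, 112, 113, 114, 115, 116, 117, 118, 119] → r2 y = r1 y := by
        intro y hy; simp at hy; simp [hr2, hy]
      have g111 : (r2 111).val = 128 + 16 * x + 6 := by simp [hr2]; omega
      have g114 : (r2 114).val = nwin A1 (2 * x) := by
        simp [hr2, nwin, show x * 16 + x * 16 + 134 = 128 + 16 * (2 * x) + 6 by omega]
      have g115 : (r2 115).val = nwin A1 (2 * x + 1) := by
        simp [hr2, nwin, show x * 16 + x * 16 + 134 + 16 = 128 + 16 * (2 * x + 1) + 6 by omega]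
      have g118 : (r2 118) = nval A1 (2 * x) := by
        simp [hr2, nval, show x * 16 + x * 16 + 134 + 1 = 128 + 16 * (2 * x) + 7 by omega]
      have g119 : (r2 119) = nval A1 (2 * x + 1) := by
        simp [hr2, nval, show x * 16 + x * 16 + 134 + 16 + 1 = 128 + 16 * (2 * x + 1) + 7 by omega]
      clear hr2
      have q3 : r2 3 = ⟨0, none⟩ := by rw [f 3 (by decide), e3]
      suffices hs : wp P (Cmd.cond (Test.eq 114 3) (blk [Ins.mov 114 115, Ins.mov 118 119])
        (Cmd.cond (Test.eq 115 3) Cmd.skip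
          (Cmd.cond (Test.lt 119 118) (blk [Ins.mov 114 115, Ins.mov 118 119]) Cmd.skip)))
          (fun r' A' m' t' => (∀ y, y ≠ 114 → y ≠ 118 → r' y = r2 y) ∧ A' = A1 ∧ m' = m1 ∧
            t' ≤ t1 + 34 ∧
            ((r' 114).val = nwin A1 (2 * x) ∧ (r' 118) = nval A1 (2 * x) ∨
             (r' 114).val = nwin A1 (2 * x + 1) ∧ (r' 118) = nval A1 (2 * x + 1)) ∧
            (nwin A1 (2 * x) ≠ 0 → (r' 114).val ≠ 0 ∧ (r' 118).val ≤ (nval A1 (2 * x)).val) ∧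
            (nwin A1 (2 * x + 1) ≠ 0 → (r' 114).val ≠ 0 ∧ (r' 118).val ≤ (nval A1 (2 * x + 1)).val))
          r2 A1 m1 (t1 + 26) by
        refine wp_seq (by omega) (wp_mono _ hs ?_)
        rintro r3 A3 m3 t3 ⟨f3, rfl, rfl, ht3, hv1, hv2, hv3⟩
        have k111 : (r3 111).val = 128 + 16 * x + 6 := by rw [f3 _ (by decide) (by decide), g111]
        have k65 : (r3 65).val = x := by rw [f3 _ (by decide) (by decide), f _ (by decide)]
        have k4 : (r3 4).val = 1 := by rw [f3 _ (by decide) (by decide), f _ (by decide), e4]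
        have k12 : (r3 12).val = 2 := by rw [f3 _ (by decide) (by decide), f _ (by decide), hc1.c12]
        refine wp_blk _ (by simp; omega) ?_
        simp [wpB, Op.ok, Op.ev, k111, k65, k4, k12]
        have hA4 : ∀ B : ℕ → Word, B = update (update A3 (128 + 16 * x + 6) (r3 114))
            (128 + 16 * x + 6 + 1) (r3 118) → (∀ i, 1 ≤ i → i < S → ¬ Anc i (x / 2) → TreeAt B i) ∧
            ArrTree S A B := by
          intro B hB
          have b1 : nwin B x = (r3 114).val := by simp [hB, nwin]
          have b2 : nval B x = r3 118 := by simp [hB, nval, add_assoc]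
          have b3 : ∀ j, j ≠ x → nwin B j = nwin A3 j ∧ nval B j = nval A3 j := by
            intro j hj
            simp only [nwin, nval, hB]
            rw [Function.update_of_ne (by omega), Function.update_of_ne (by omega),
              Function.update_of_ne (by omega), Function.update_of_ne (by omega)]
            simp
          constructor
          · intro i i1 i2 ha
            by_cases hix : i = x
            · rw [hix]
              constructor
              · rw [(b3 (2 * x) (by omega)).1, (b3 (2 * x) (by omega)).2, b1, b2]; exact hv2
              · rw [(b3 (2 * x + 1) (by omega)).1, (b3 (2 * x + 1) (by omega)).2, b1, b2]; exact hv3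
              · rw [(b3 (2 * x) (by omega)).1, (b3 (2 * x) (by omega)).2,
                  (b3 (2 * x + 1) (by omega)).1, (b3 (2 * x + 1) (by omega)).2, b1, b2]
                right
                rcases hv1 with ⟨h, h'⟩ | ⟨h, h'⟩ <;> simp [h, h']
            · refine (hT1 i i1 i2 fun h => ?_).congr ?_
              · rcases h.half with h | h
                · exact hix h
                · exact ha h
              · intro j hj
                have : j ≠ x := by
                  rintro rfl
                  rcases hj with hj | hj | hj
                  · exact hix hj.symm
                  · exact ha ⟨0, by omega⟩
                  · exact ha ⟨0, by omega⟩
                rw [(b3 j this).1, (b3 j this).2]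
                simp
          · intro y hy
            rw [hB, Function.update_of_ne, Function.update_of_ne, hA1 y hy]
            · exact (hy x (by omega) hxS).1
            · exact (hy x (by omega) hxS).2
        obtain ⟨u1, u2⟩ := hA4 _ rfl
        refine ⟨by omega, by omega, by omega, hc1.congr ?_, u1, u2, hm1, k, ?_, by omega, by omega⟩
        · intro y y1 y2 y3 y4 y5 y6
          rw [Function.update_of_ne (by omega), Function.update_of_ne (by omega),
            f3 _ (by omega) (by omega), f _ (by simp; omega)]
        · rw [pow_succ] at hk; omega
      refine wp_cond (by omega) ?_ fun h1 => wp_cond (by omega) ?_ fun h2 => wp_cond (by omega) ?_ ?_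
      · intro h1
        simp only [Test.ev, q3, g114] at h1
        refine wp_blk _ (by simp; omega) ?_
        simp +contextual [wpB, g115, g119, h1]
        try omega
      · intro h2
        simp only [Test.ev, q3, g115, g114] at h1 h2
        refine wp_skip (by omega) ?_
        simp [g114, g118, h1, h2]
        try omega
      · intro h3
        simp only [Test.ev, q3, g115, g114, g118, g119] at h1 h2 h3
        refine wp_blk _ (by simp; omega) ?_
        simp +contextual [wpB, g115, g119, h1, h2]
        try omega
      · intro h3
        simp only [Test.ev, q3, g115, g114, g118, g119] at h1 h2 h3
        refine wp_skip (by omega) ?_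
        simp [g114, g118, h1]
        try omega
    · intro hb
      simp only [Test.ev, hc1.c3] at hb
      -- The index has become zero, and no node `i ≥ 1` is an ancestor of zero, so no exception is
      -- left.
      refine ⟨fun i i1 i2 => hT1 i i1 i2 ?_, hA1, by omega⟩
      rintro ⟨j, hj⟩
      have : (r1 65).val = 0 := by omega
      simp [this] at hj
      omega

/-! ### Moving a segment of faulty words. -/

/-- Copy the `r 94` cells below `r 92` to the cells below `r 93`, from top to bottom. -/
def moveDown : Cmd :=
  .loop (.lt 3 94) (blk [.op .sub 92 92 4, .op .sub 93 93 4, .op .sub 94 94 4] ;;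
    .load 95 92 ;; .store 93 95)

/-- The state after an instantaneous copy of `c` cells below `s` to the cells below `d`. -/
def FState.moved (m : FState) (s d c : ℕ) : FState :=
  ⟨fun p => if d - c ≤ p ∧ p < d then m.mem (p + s - d) else m.mem p, m.cor, m.a⟩

/-- The vacated source cells. Stale copies remain there, so nothing may be claimed about them. -/
def deadZone (s d c : ℕ) : Set ℕ := {p | s - c ≤ p ∧ p < s ∧ ¬ (d - c ≤ p ∧ p < d)}

/-- A copy interleaved with faults looks like an instantaneous move followed by faults at renamed
addresses. A fault at the source before the load becomes one at the destination; a fault at the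
destination before the store is overwritten and does not count there. So the number of faults does
not increase. -/
theorem EvF.moved_succ {δ : ℕ} {F1 F2 : Finset ℕ} {m0 m1 m2 : FState} {s d c j : ℕ}
    (hs : c ≤ s) (hd : c ≤ d) (hsd : s ≤ d ∨ d + c ≤ s) (hj : j < c)
    (h1 : EvF δ (deadZone s d j) F1 (m0.moved s d j) m1) (h2 : EvF δ ∅ F2 m1 m2) :
    ∃ F, EvF δ (deadZone s d (j + 1)) F (m0.moved s d (j + 1))
      (m2.put (d - j - 1) (m1.mem (s - j - 1))) := by
  classical
  have hp1 : s - j - 1 ∉ deadZone s d j := by simp only [deadZone, Set.mem_ofPred_eq]; omega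
  have mp : (m0.moved s d j).mem (s - j - 1) = m0.mem (s - j - 1) := by
    simp only [FState.moved]; rw [if_neg (by omega)]
  have mq : (m0.moved s d (j + 1)).mem (d - j - 1) = m0.mem (s - j - 1) := by
    simp only [FState.moved]; rw [if_pos (by omega)]; congr 1; omega
  have mo : ∀ x, x ≠ d - j - 1 → (m0.moved s d (j + 1)).mem x = (m0.moved s d j).mem x := by
    intro x hx
    simp only [FState.moved]
    by_cases h : d - j ≤ x ∧ x < d
    · rw [if_pos h, if_pos (by omega)]
    · rw [if_neg h, if_neg (by omega)]
  have key : ∀ x, x ∉ deadZone s d (j + 1) → x ≠ d - j - 1 → x ≠ s - j - 1 ∧ x ∉ deadZone s d j := by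
    intro x hx hq
    simp only [deadZone, Set.mem_ofPred_eq] at hx ⊢
    omega
  generalize hp : s - j - 1 = p at *
  generalize hq : d - j - 1 = q at *
  have hF : ∀ x, x ∈ F1.image (Equiv.swap p q) ↔ Equiv.swap p q x ∈ F1 := by
    intro x
    rw [Finset.mem_image]
    constructor
    · rintro ⟨y, hy, rfl⟩; simpa using hy
    · intro h; exact ⟨_, h, by simp⟩
  have h12 := h1.trans h2
  rw [Set.union_empty] at h12
  -- The swap carries earlier hits from source to destination, and those of the overwritten
  -- destination to the source, which is dead from now on. The later hits `F2` at `q` precede the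
  -- store and are erased.
  refine ⟨F1.image (Equiv.swap p q) ∪ F2.erase q, ?_, h12.le, h12.cor, ?_, ?_⟩
  · have c1 := Finset.card_union_le (F1.image (Equiv.swap p q)) (F2.erase q)
    have c2 := Finset.card_image_le (s := F1) (f := Equiv.swap p q)
    have c3 := Finset.card_le_card (Finset.erase_subset q F2)
    have c4 := h1.card
    have c5 := h2.card
    simp only [FState.put, FState.moved] at c4 ⊢
    omega
  · intro x hx hxF
    rw [Finset.mem_union, hF, not_or] at hxF
    by_cases hxq : x = q
    · subst hxq
      simp only [Equiv.swap_apply_right] at hxF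
      rw [mq, ← mp, ← h1.same p hp1 hxF.1]
      simp [FState.put]
    · obtain ⟨k1, k2⟩ := key x hx hxq
      rw [Equiv.swap_apply_of_ne_of_ne k1 hxq] at hxF
      rw [mo x hxq, ← h12.same x k2 (by simp_all)]
      simp [FState.put, hxq]
  · intro x hx hxF
    rw [Finset.mem_union, hF] at hxF
    by_cases hxq : x = q
    · subst hxq
      simp only [Equiv.swap_apply_right, Finset.mem_erase, ne_eq, not_true, false_and, or_false] at hxF
      rw [mq, ← mp]
      have := h1.lost p hp1 hxF
      exact ⟨by simp [FState.put, this.1], fun i hi => h2.cor (this.2 i hi)⟩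
    · obtain ⟨k1, k2⟩ := key x hx hxq
      rw [Equiv.swap_apply_of_ne_of_ne k1 hxq] at hxF
      rw [mo x hxq]
      have := h12.lost x k2 (by simp at hxF ⊢; tauto)
      exact ⟨by simp [FState.put, hxq, this.1], this.2⟩

/-- The segments are disjoint, or the words move upwards. Going from top to bottom, no source word
is overwritten before it has been read. -/
theorem wp_moveDown {P : Par} {r A : ℕ → Word} {m : FState} {t : ℕ} {Q : Post} {s d c : ℕ}
    (h3 : (r 3).val = 0) (h4 : (r 4).val = 1) (h92 : (r 92).val = s) (h93 : (r 93).val = d)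
    (h94 : (r 94).val = c) (hs : c ≤ s) (hd : c ≤ d) (hsd : s ≤ d ∨ d + c ≤ s)
    (ht : t + 20 * c + 5 ≤ P.lim m.a)
    (hQ : ∀ r' A' m' t' F, Frame P.δ moveDown r A m r' A' m' →
      EvF P.δ (deadZone s d c) F (m.moved s d c) m' → (r' 93).val = d - c →
      t' ≤ t + 20 * c + 5 → Q r' A' m' t') :
    wp P moveDown Q r A m t := by
  suffices h : wp P moveDown (fun r' A' m' t' => ∃ F,
      EvF P.δ (deadZone s d c) F (m.moved s d c) m' ∧ (r' 93).val = d - c ∧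
      t' ≤ t + 20 * c + 5) r A m t from
    wp_mono _ (wp_frame _ h) fun r' A' m' t' h => by
      obtain ⟨⟨F, h1, h2, h3⟩, hf⟩ := h
      exact hQ r' A' m' t' F hf h1 h2 h3
  refine ⟨fun r' A' m' t' => ∃ j F, j ≤ c ∧ (r' 3).val = 0 ∧ (r' 4).val = 1 ∧ (r' 92).val = s - j ∧
      (r' 93).val = d - j ∧ (r' 94).val = c - j ∧ EvF P.δ (deadZone s d j) F (m.moved s d j) m' ∧
      t' + 20 * (c - j) ≤ t + 20 * c, ?_, ?_, ?_⟩
  · rintro r1 A1 m1 t1 m2 ⟨j, F, a, b, c, d, e, f, g, h⟩ ⟨F', ev⟩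
    exact ⟨j, F ∪ F', a, b, c, d, e, f, by simpa using g.trans ev, h⟩
  · refine ⟨0, ∅, by omega, h3, h4, h92, h93, h94, ?_, by omega⟩
    have : m.moved s d 0 = m := by
      simp only [FState.moved]
      congr 1
      funext p
      rw [if_neg (by omega)]
    rw [this]
    exact EvF.refl _ _ _
  · rintro r1 A1 m1 t1 ⟨j, F, hj, e3, e4, e92, e93, e94, ev, ht1⟩
    have hlim : P.lim m.a ≤ P.lim m1.a := P.lim_mono ev.a_le
    refine ⟨by omega, ?_, ?_⟩
    · intro hb
      simp only [Test.ev] at hb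
      refine wp_hide fun Q' hQ' => ?_
      refine wp_blk_seq (by simp; omega) ?_
      simp [wpB, Op.ok, Op.ev, e4, e92, e93, e94]
      refine wp_seq (by omega) (wp_load (by omega) fun m2 ⟨F2, ev2⟩ => ?_)
      have hlim2 : P.lim m1.a ≤ P.lim m2.a := P.lim_mono ev2.a_le
      refine wp_store (by omega) fun m3 ⟨F3, ev3⟩ => ?_
      have ev12 := ev.trans ev2
      rw [Set.union_empty] at ev12
      obtain ⟨F', ev'⟩ := ev12.moved_succ hs hd hsd (by omega) ev3
      refine hQ' _ _ _ _ ⟨j + 1, F', by omega, ?_⟩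
      simp [e3, e4]
      exact ⟨by omega, by omega, by omega, ev', by omega⟩
    · intro hb
      simp only [Test.ev] at hb
      obtain rfl : j = c := by omega
      exact ⟨F, ev, e93, by omega⟩

/-! ### The priority queue and insertion. -/

/-- The number of elements of group `g` of the priority queue. -/
def gsz (S : ℕ) (A : ℕ → Word) (g : ℕ) : ℕ := ncnt A g + if nwin A (S + g) = 0 then 0 else 1

/-- The address of the `i`-th faulty word of group `g`. -/
def pcell (n S g i : ℕ) : ℕ := 2 * n + i * S + g

theorem pcell_inj {n S g i g' i' : ℕ} (hg : g < S) (hg' : g' < S)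
    (h : pcell n S g i = pcell n S g' i') : g = g' ∧ i = i' := by
  have h' : g + S * i = g' + S * i' := by
    unfold pcell at h
    linarith [mul_comm S i, mul_comm S i']
  have h1 : g = g' := by
    have := congrArg (· % S) h'
    simpa [Nat.mod_eq_of_lt hg, Nat.mod_eq_of_lt hg'] using this
  subst h1
  exact ⟨rfl, Nat.eq_of_mul_eq_mul_left (by omega) (Nat.add_left_cancel h')⟩

/-- The priority queue, except for the inner nodes of its tree. -/
structure PQ0 (n S : ℕ) (A mem : ℕ → Word) (ins pn lo : ℕ) : Prop where
  leaf : ∀ g < S, nwin A (S + g) = 0 ∨ nwin A (S + g) = g + 1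
  occ : ∀ g < S, ncnt A g ≠ 0 → nwin A (S + g) ≠ 0
  size : ∀ g < S, gsz S A g ≤ ins / S + if g < ins % S then 1 else 0
  min : ∀ g < S, ∀ i < ncnt A g, (mem (pcell n S g i)).src ≠ none →
    (nval A (S + g)).val ≤ (mem (pcell n S g i)).val
  loc : ∀ g < S, ∀ i < ncnt A g, (mem (pcell n S g i)).src ≠ none → lo ≤ (mem (pcell n S g i)).val
  lol : ∀ g < S, nwin A (S + g) ≠ 0 → (nval A (S + g)).src ≠ none → lo ≤ (nval A (S + g)).val
  sum : ∑ g ∈ Finset.range S, gsz S A g = pn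

/-- The priority queue: `ins` elements have been inserted altogether, it holds `pn` elements, and
its faithful keys are at least `lo`. -/
structure PQ (n S : ℕ) (A mem : ℕ → Word) (ins pn lo : ℕ) : Prop extends
    PQ0 n S A mem ins pn lo where
  tree : ∀ i, 1 ≤ i → i < S → TreeAt A i

/-- A fault erases provenance. A word that still has one was therefore not hit and is unchanged;
this is how claims restricted to faithful words survive faults. -/
theorem EvF.src_ne {δ : ℕ} {Z : Set ℕ} {F : Finset ℕ} {m m' : FState} (h : EvF δ Z F m m') {p : ℕ}
    (hZ : p ∉ Z) (hp : (m'.mem p).src ≠ none) : p ∉ F ∧ m'.mem p = m.mem p := by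
  have : p ∉ F := fun hF => hp (h.lost p hZ hF).1
  exact ⟨this, h.same p hZ this⟩

theorem PQ0.ev {n S δ : ℕ} {A : ℕ → Word} {m m' : FState} {ins pn lo : ℕ} {Z : Set ℕ} {F : Finset ℕ}
    (h : PQ0 n S A m.mem ins pn lo) (e : EvF δ Z F m m') (hZ : ∀ p ∈ Z, p < 2 * n) :
    PQ0 n S A m'.mem ins pn lo := by
  have hp : ∀ g i, pcell n S g i ∉ Z := fun g i hz => by
    have := hZ _ hz; simp only [pcell] at this; omega
  refine ⟨h.leaf, h.occ, h.size, ?_, ?_, h.lol, h.sum⟩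
  · intro g hg i hi hs
    have := (e.src_ne (hp g i) hs).2
    rw [this] at hs ⊢
    exact h.min g hg i hi hs
  · intro g hg i hi hs
    have := (e.src_ne (hp g i) hs).2
    rw [this] at hs ⊢
    exact h.loc g hg i hi hs

theorem PQ.ev {n S δ : ℕ} {A : ℕ → Word} {m m' : FState} {ins pn lo : ℕ} {Z : Set ℕ} {F : Finset ℕ}
    (h : PQ n S A m.mem ins pn lo) (e : EvF δ Z F m m') (hZ : ∀ p ∈ Z, p < 2 * n) :
    PQ n S A m'.mem ins pn lo := ⟨h.toPQ0.ev e hZ, h.tree⟩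

/-- Memory agrees at the cells of the queue. -/
theorem PQ0.congr {n S : ℕ} {A A' mem mem' : ℕ → Word} {ins pn lo : ℕ}
    (h : PQ0 n S A mem ins pn lo) (hm : ∀ p, 2 * n ≤ p → mem' p = mem p)
    (hA : ∀ j, S ≤ j → nwin A' j = nwin A j ∧ nval A' j = nval A j)
    (hc : ∀ g, ncnt A' g = ncnt A g) : PQ0 n S A' mem' ins pn lo := by
  have hp : ∀ g i, mem' (pcell n S g i) = mem (pcell n S g i) := fun g i =>
    hm _ (by unfold pcell; omega)
  have hw : ∀ g, nwin A' (S + g) = nwin A (S + g) := fun g => (hA _ (by omega)).1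
  have hv : ∀ g, nval A' (S + g) = nval A (S + g) := fun g => (hA _ (by omega)).2
  have hz : ∀ g, gsz S A' g = gsz S A g := fun g => by simp [gsz, hc, hw]
  constructor
  · simpa [hw] using h.leaf
  · simpa [hw, hc] using h.occ
  · simpa [hz] using h.size
  · simpa [hp, hv, hc] using h.min
  · simpa [hp, hc] using h.loc
  · simpa [hw, hv] using h.lol
  · simpa [hz] using h.sum

/-- Groups are filled in turn, and `ins` counts all insertions ever made. So the group `ins % S` has
room for one more element, and extractions can only help. -/
theorem size_insert {S ins : ℕ} {f f' : ℕ → ℕ} (hS : 1 ≤ S)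
    (h : ∀ g < S, f g ≤ ins / S + if g < ins % S then 1 else 0)
    (h1 : f' (ins % S) = f (ins % S) + 1) (h2 : ∀ g, g ≠ ins % S → f' g = f g) :
    ∀ g < S, f' g ≤ (ins + 1) / S + if g < (ins + 1) % S then 1 else 0 := by
  have hm : ins % S < S := Nat.mod_lt _ hS
  have hd : (ins + 1) / S = ins / S ∧ (ins + 1) % S = ins % S + 1 ∧ ins % S + 1 < S ∨
      (ins + 1) / S = ins / S + 1 ∧ (ins + 1) % S = 0 ∧ ins % S + 1 = S := by
    have e := Nat.div_add_mod ins S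
    by_cases hlt : ins % S + 1 < S
    · left
      have := (Nat.div_mod_unique (b := S) (a := ins + 1) (c := ins % S + 1) (d := ins / S) hS).2 ⟨by omega, hlt⟩
      exact ⟨this.1, this.2, hlt⟩
    · right
      have := (Nat.div_mod_unique (b := S) (a := ins + 1) (c := 0) (d := ins / S + 1) hS).2
        ⟨by rw [mul_add]; omega, hS⟩
      exact ⟨this.1, this.2, by omega⟩
  intro g hg
  have hb := h g hg
  by_cases hgm : g = ins % S
  · subst hgm
    rw [h1]
    rw [if_neg (by omega)] at hb
    rcases hd with ⟨a, b, c⟩ | ⟨a, b, c⟩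
    · rw [a, b, if_pos (by omega)]; omega
    · rw [a]; omega
  · rw [h2 g hgm]
    rcases hd with ⟨a, b, c⟩ | ⟨a, b, c⟩
    · rw [a, b]; split_ifs at hb ⊢ <;> omega
    · rw [a]; split_ifs at hb <;> omega

theorem sum_insert {S g : ℕ} {f f' : ℕ → ℕ} (hg : g < S) (h1 : f' g = f g + 1)
    (h2 : ∀ x, x ≠ g → f' x = f x) :
    ∑ x ∈ Finset.range S, f' x = ∑ x ∈ Finset.range S, f x + 1 := by
  rw [← Finset.add_sum_erase _ _ (Finset.mem_range.2 hg),
    ← Finset.add_sum_erase _ f (Finset.mem_range.2 hg), h1]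
  have : ∑ x ∈ (Finset.range S).erase g, f' x = ∑ x ∈ (Finset.range S).erase g, f x :=
    Finset.sum_congr rfl fun x hx => h2 x (Finset.ne_of_mem_erase hx)
  omega

/-- Live locations: faulty words `Fr`, registers `R`, and the elements of the priority queue. -/
def pqL (n S : ℕ) (A : ℕ → Word) (Fr R : Set ℕ) : Set Loc
  | .f p => p ∈ Fr ∨ ∃ g < S, ∃ i < ncnt A g, p = pcell n S g i
  | .a x => ∃ g < S, nwin A (S + g) ≠ 0 ∧ x = 128 + 16 * (S + g) + 7
  | .g y => y ∈ R

theorem mem_pqL_f {n S : ℕ} {A : ℕ → Word} {Fr R : Set ℕ} {p : ℕ} : Loc.f p ∈ pqL n S A Fr R ↔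
    p ∈ Fr ∨ ∃ g < S, ∃ i < ncnt A g, p = pcell n S g i := Iff.rfl

theorem mem_pqL_a {n S : ℕ} {A : ℕ → Word} {Fr R : Set ℕ} {x : ℕ} : Loc.a x ∈ pqL n S A Fr R ↔
    ∃ g < S, nwin A (S + g) ≠ 0 ∧ x = 128 + 16 * (S + g) + 7 := Iff.rfl

theorem mem_pqL_g {n S : ℕ} {A : ℕ → Word} {Fr R : Set ℕ} {x : ℕ} : Loc.g x ∈ pqL n S A Fr R ↔
    x ∈ R := Iff.rfl

/-- Insert the word in register `62`. -/
def pqInsert : Cmd :=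
  (blk [.op .div 64 60 1, .op .mul 64 64 1, .op .sub 63 60 64, .op .add 65 1 63, .op .mul 111 65 5,
    .op .add 111 111 14, .op .add 112 111 4, .lds 113 111] ;;
  .cond (.eq 113 3) (blk [.op .add 114 63 4, .sts 111 114, .sts 112 62])
    (blk [.lds 115 112] ;; .cond (.lt 62 115) (blk [.sts 112 62, .mov 62 115]) .skip ;;
      blk [.op .mul 116 63 5, .op .add 116 116 15, .lds 117 116, .op .mul 118 117 1,
        .op .add 118 118 63, .op .add 118 118 16] ;;
      .store 118 62 ;; blk [.op .add 117 117 4, .sts 116 117])) ;;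
  blk [.op .add 60 60 4, .op .add 61 61 4] ;; treeUpdate

/-- A group without a minimum has no faulty words either, so the new word becomes its safe minimum.
-/
theorem PQ0.insert_leaf {n S : ℕ} {A A' mem : ℕ → Word} {ins pn lo g : ℕ} {w : Word} (hS : 1 ≤ S)
    (h : PQ0 n S A mem ins pn lo) (hg : g = ins % S) (h0 : nwin A (S + g) = 0)
    (hw : w.src ≠ none → lo ≤ w.val) (h1 : nwin A' (S + g) = g + 1) (h2 : nval A' (S + g) = w)
    (hA : ∀ j, j ≠ S + g → nwin A' j = nwin A j ∧ nval A' j = nval A j)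
    (hc : ∀ g, ncnt A' g = ncnt A g) : PQ0 n S A' mem (ins + 1) (pn + 1) lo := by
  have hgS : g < S := hg ▸ Nat.mod_lt _ hS
  have hc0 : ncnt A g = 0 := by
    by_contra hne; exact h.occ g hgS hne h0
  have z1 : gsz S A' g = gsz S A g + 1 := by simp [gsz, hc, h1, h0]
  have z2 : ∀ x, x ≠ g → gsz S A' x = gsz S A x := fun x hx => by
    simp [gsz, hc, (hA (S + x) (by omega)).1]
  constructor
  · intro x hx
    by_cases e : x = g
    · subst e; right; exact h1
    · rw [(hA (S + x) (by omega)).1]; exact h.leaf x hx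
  · intro x hx
    by_cases e : x = g
    · subst e; simp [h1]
    · rw [(hA (S + x) (by omega)).1, hc]; exact h.occ x hx
  · exact size_insert hS h.size (hg ▸ z1) (hg ▸ z2)
  · intro x hx i hi
    rw [hc] at hi
    by_cases e : x = g
    · subst e; omega
    · rw [(hA (S + x) (by omega)).2]; exact h.min x hx i hi
  · intro x hx i hi
    rw [hc] at hi
    exact h.loc x hx i hi
  · intro x hx
    by_cases e : x = g
    · subst e; intro _; rw [h2]; exact hw
    · rw [(hA (S + x) (by omega)).1, (hA (S + x) (by omega)).2]; exact h.lol x hx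
  · rw [sum_insert hgS z1 z2, h.sum]

/-- Of the new word and the old minimum, the smaller one `w1` stays in the safe leaf and `w2` is
appended to the faulty words of the group. -/
theorem PQ0.insert_cell {n S : ℕ} {A A' mem mem' : ℕ → Word} {ins pn lo g : ℕ} {w w1 w2 : Word}
    (hS : 1 ≤ S) (h : PQ0 n S A mem ins pn lo) (hg : g = ins % S) (h0 : nwin A (S + g) ≠ 0)
    (hw : w.src ≠ none → lo ≤ w.val)
    (hww : w1 = w ∧ w2 = nval A (S + g) ∨ w2 = w ∧ w1 = nval A (S + g)) (hle : w1.val ≤ w2.val)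
    (hnw : ∀ j, nwin A' j = nwin A j) (h2 : nval A' (S + g) = w1)
    (hA : ∀ j, j ≠ S + g → nval A' j = nval A j)
    (hc : ∀ x, x ≠ g → ncnt A' x = ncnt A x) (hcg : ncnt A' g = ncnt A g + 1)
    (hm : ∀ p, p ≠ pcell n S g (ncnt A g) → mem' p = mem p)
    (hm2 : mem' (pcell n S g (ncnt A g)) = w2) : PQ0 n S A' mem' (ins + 1) (pn + 1) lo := by
  have hgS : g < S := hg ▸ Nat.mod_lt _ hS
  have z1 : gsz S A' g = gsz S A g + 1 := by simp [gsz, hcg, hnw]; omega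
  have z2 : ∀ x, x ≠ g → gsz S A' x = gsz S A x := fun x hx => by simp [gsz, hc x hx, hnw]
  have hl : nval A (S + g) = w1 → w1.src ≠ none → lo ≤ w1.val := by
    intro e; rw [← e]; exact h.lol g hgS h0
  have hl' : nval A (S + g) = w2 → w2.src ≠ none → lo ≤ w2.val := by
    intro e; rw [← e]; exact h.lol g hgS h0
  have hle' : w1.val ≤ (nval A (S + g)).val := by
    rcases hww with ⟨a, b⟩ | ⟨a, b⟩
    · rw [← b]; exact hle
    · rw [b]
  have hmo : ∀ x < S, ∀ i, (x = g → i < ncnt A g) → mem' (pcell n S x i) = mem (pcell n S x i) := by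
    intro x hx i hi
    refine hm _ fun e => ?_
    obtain ⟨a, b⟩ := pcell_inj hx hgS e
    have := hi a
    omega
  constructor
  · simpa [hnw] using h.leaf
  · intro x hx
    rw [hnw]
    by_cases e : x = g
    · subst e; intro _; exact h0
    · rw [hc x e]; exact h.occ x hx
  · exact size_insert hS h.size (hg ▸ z1) (hg ▸ z2)
  · intro x hx i hi
    by_cases e : x = g
    · subst e
      rw [h2]
      by_cases hi' : i = ncnt A x
      · subst hi'; rw [hm2]; intro _; exact hle
      · rw [hmo x hx i (by omega)]
        intro hs
        exact hle'.trans (h.min x hx i (by omega) hs)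
    · rw [hc x e] at hi
      rw [hA (S + x) (by omega), hmo x hx i (by omega)]
      exact h.min x hx i hi
  · intro x hx i hi
    by_cases e : x = g
    · subst e
      by_cases hi' : i = ncnt A x
      · subst hi'; rw [hm2]
        rcases hww with ⟨a, b⟩ | ⟨a, b⟩
        · exact hl' b.symm
        · rw [a]; exact hw
      · rw [hmo x hx i (by omega)]
        exact h.loc x hx i (by omega)
    · rw [hc x e] at hi
      rw [hmo x hx i (by omega)]
      exact h.loc x hx i hi
  · intro x hx
    rw [hnw]
    by_cases e : x = g
    · subst e; rw [h2]; intro _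
      rcases hww with ⟨a, b⟩ | ⟨a, b⟩
      · rw [a]; exact hw
      · exact hl b.symm
    · rw [hA (S + x) (by omega)]; exact h.lol x hx
  · rw [sum_insert hgS z1 z2, h.sum]

theorem EvF.put {δ : ℕ} {Z : Set ℕ} {F : Finset ℕ} {m m' : FState} (h : EvF δ Z F m m') {x : ℕ}
    (hx : x ∈ Z) (w : Word) : EvF δ Z F m (m'.put x w) := by
  have hne : ∀ p, p ∉ Z → (m'.put x w).mem p = m'.mem p := fun p hp =>
    Function.update_of_ne (by rintro rfl; exact hp hx) _ _
  exact ⟨h.card, h.le, h.cor, fun p hp hF => by rw [hne p hp, h.same p hp hF],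
    fun p hp hF => by rw [hne p hp]; exact h.lost p hp hF⟩

theorem Good.swap {n : ℕ} {s s' : Loc → Option ℕ} {cor : Set ℕ} {live : Set Loc}
    (h : Good n s cor live) (y z : Loc) (hy : y ∈ live) (hz : z ∈ live) (h1 : s' y = s z)
    (h2 : s' z = s y) (hs : ∀ x ∈ live, x ≠ y → x ≠ z → s' x = s x) : Good n s' cor live := by
  have hmem : ∀ x ∈ live, Equiv.swap y z x ∈ live ∧ s' x = s (Equiv.swap y z x) := by
    intro x hx
    by_cases e1 : x = y
    · subst e1; simpa using ⟨hz, h1⟩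
    · by_cases e2 : x = z
      · subst e2; simpa using ⟨hy, h2⟩
      · rw [Equiv.swap_apply_of_ne_of_ne e1 e2]; exact ⟨hx, hs x hx e1 e2⟩
  exact h.map (Equiv.swap y z) subset_rfl (fun x hx => ⟨(hmem x hx).1, Or.inl (hmem x hx).2⟩)
    (fun x _ y _ e => (Equiv.swap _ _).injective e)
    (fun x hx => ⟨Equiv.swap y z x, (hmem x hx).1, by simp⟩)

theorem EvF.trans' {δ : ℕ} {Z : Set ℕ} {F F' : Finset ℕ} {m m' m'' : FState}
    (h : EvF δ Z F m m') (h' : EvF δ Z F' m' m'') : EvF δ Z (F ∪ F') m m'' := by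
  simpa using h.trans h'

theorem EvF.trans_ev' {δ : ℕ} {Z : Set ℕ} {F : Finset ℕ} {m m' m'' : FState}
    (h : EvF δ Z F m m') (h' : Ev δ m' m'') : ∃ F', EvF δ Z F' m m'' := by
  obtain ⟨F', -, h⟩ := h.trans_ev h'
  exact ⟨F', h⟩

theorem Consts.frame {P : Par} {n S : ℕ} {r r' A A' : ℕ → Word} {m m' : FState} {p : Cmd} {δ : ℕ}
    (h : Consts P n S r) (f : Frame δ p r A m r' A' m')
    (hp : ([0, 1, 3, 4, 5, 6, 7, 12, 13, 14, 15, 16].all fun x => !p.clob x) = true) :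
    Consts P n S r' := by
  refine h.congr fun x h1 h2 h3 h4 h5 h6 => f.1 x ?_
  simpa using List.all_eq_true.1 hp x (by simp; omega)

theorem ArrTree.leaf {S : ℕ} {A A' : ℕ → Word} (h : ArrTree S A A') {j : ℕ} (hj : S ≤ j) :
    nwin A' j = nwin A j ∧ nval A' j = nval A j :=
  ⟨congrArg _ (h _ fun i _ _ => by omega), h _ fun i _ _ => by omega⟩

theorem ArrTree.cnt {S : ℕ} {A A' : ℕ → Word} (h : ArrTree S A A') (g : ℕ) :
    ncnt A' g = ncnt A g := congrArg _ (h _ fun i _ _ => by omega)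

theorem Good.arrTree {n S : ℕ} {r r' A A' mem : ℕ → Word} {cor : Set ℕ} {Fr R : Set ℕ}
    (h : Good n (rd r A mem) cor (pqL n S A Fr R)) (hA : ArrTree S A A')
    (hr : ∀ x ∈ R, r' x = r x) : Good n (rd r' A' mem) cor (pqL n S A' Fr R) := by
  refine h.congr (fun x => ?_) (fun x hx => ?_)
  · cases x with
    | f p => simp only [mem_pqL_f, hA.cnt]
    | a x =>
      simp only [mem_pqL_a]
      simp only [fun g => (hA.leaf (Nat.le_add_right S g)).1]
    | g x => rfl
  · cases x with
    | f p => rfl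
    | a x =>
      obtain ⟨g, -, -, rfl⟩ := hx
      exact congrArg Word.src (hA.leaf (Nat.le_add_right S g)).2
    | g x => exact congrArg Word.src (hr x hx)

/-- What the other parts of the program know about a step of the priority queue. -/
def ArrHi (A A' : ℕ → Word) : Prop := ∀ x, (x % 16 < 6 → A' x = A x)

theorem ArrTree.hi {S : ℕ} {A A' : ℕ → Word} (h : ArrTree S A A') : ArrHi A A' :=
  fun x hx => h x fun i _ _ => by omega

/-- The condition at an inner node involves only the node and its two children, so a change of the
leaf `s` concerns its parent at most. -/
theorem tree_update_leaf {S s : ℕ} {A A' : ℕ → Word} (h : ∀ i, 1 ≤ i → i < S → TreeAt A i)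
    (hA : ∀ j, j ≠ s → nwin A' j = nwin A j ∧ nval A' j = nval A j) (hs : S ≤ s) (i : ℕ) (h1 : 1 ≤ i)
    (h2 : i < S) (ha : ¬ Anc i (s / 2)) : TreeAt A' i := by
  refine (h i h1 h2).congr fun j hj => ?_
  have : j ≠ s := by
    rintro rfl
    rcases hj with e | e | e
    · omega
    · exact ha ⟨0, by omega⟩
    · exact ha ⟨0, by omega⟩
  exact ⟨(hA j this).1, congrArg _ (hA j this).2⟩

/-- Besides the queue invariant, the keys are accounted for: the word in register `62` turns from a
live register into an element of the queue. Only words from `2 * n` on are written, which keeps runs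
and output apart. -/
theorem wp_pqInsert {P : Par} {n S : ℕ} (hP : P.Ok n S) {r A : ℕ → Word} {m : FState} {t : ℕ}
    {Q : Post} (hc : Consts P n S r) {l ins pn lo : ℕ} (hl : S ≤ 2 ^ l)
    (hpq : PQ n S A m.mem ins pn lo) (h60 : (r 60).val = ins) (h61 : (r 61).val = pn)
    (hins : ins ≤ 2 * P.δ) (hpn : pn ≤ ins) (hw : (r 62).src ≠ none → lo ≤ (r 62).val) {Fr : Set ℕ}
    (hFr : ∀ p ∈ Fr, p < 2 * n) (hG : Good n (rd r A m.mem) m.cor (pqL n S A Fr {62}))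
    (ht : t + 60 * l + 100 ≤ P.lim m.a)
    (hQ : ∀ r' A' m' t' F, Frame P.δ pqInsert r A m r' A' m' → EvF P.δ {p | 2 * n ≤ p} F m m' →
      PQ n S A' m'.mem (ins + 1) (pn + 1) lo → (r' 60).val = ins + 1 → (r' 61).val = pn + 1 →
      Good n (rd r' A' m'.mem) m'.cor (pqL n S A' Fr ∅) → ArrHi A A' →
      t' ≤ t + 60 * l + 100 → Q r' A' m' t') :
    wp P pqInsert Q r A m t := by
  suffices h : wp P pqInsert (fun r' A' m' t' => ∃ F, EvF P.δ {p | 2 * n ≤ p} F m m' ∧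
      PQ n S A' m'.mem (ins + 1) (pn + 1) lo ∧ (r' 60).val = ins + 1 ∧ (r' 61).val = pn + 1 ∧
      Good n (rd r' A' m'.mem) m'.cor (pqL n S A' Fr ∅) ∧ ArrHi A A' ∧
      t' ≤ t + 60 * l + 100) r A m t from
    wp_mono _ (wp_frame _ h) fun r' A' m' t' h => by
      obtain ⟨⟨F, h1, h2, h3, h4, h5, h6, h7⟩, hf⟩ := h
      exact hQ r' A' m' t' F hf h1 h2 h3 h4 h5 h6 h7
  have hM := hP.hM
  have hcap := hP.hcap
  have hS := hP.hS
  have hSδ := hP.hSδ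
  obtain ⟨g, hg⟩ : ∃ g, g = ins % S := ⟨_, rfl⟩
  have hgS : g < S := hg ▸ Nat.mod_lt _ hS
  have hdm : S * (ins / S) + g = ins := by rw [hg]; exact Nat.div_add_mod ins S
  have hq : ins / S * S ≤ ins := Nat.div_mul_le_self _ _
  have hcg : ncnt A g ≤ ins / S := by
    have h1 := hpq.size g hgS
    rw [if_neg (by omega)] at h1
    unfold gsz at h1
    omega
  have hcq : ncnt A g * S ≤ ins := (Nat.mul_le_mul_right _ hcg).trans hq
  have hcl : ncnt A g ≤ ins := (Nat.le_mul_of_pos_right _ hS).trans hcq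
  -- the part before the tree update
  suffices hmid : wp P (blk [.op .div 64 60 1, .op .mul 64 64 1, .op .sub 63 60 64, .op .add 65 1 63,
        .op .mul 111 65 5, .op .add 111 111 14, .op .add 112 111 4, .lds 113 111] ;;
      .cond (.eq 113 3) (blk [.op .add 114 63 4, .sts 111 114, .sts 112 62])
        (blk [.lds 115 112] ;; .cond (.lt 62 115) (blk [.sts 112 62, .mov 62 115]) .skip ;;
          blk [.op .mul 116 63 5, .op .add 116 116 15, .lds 117 116, .op .mul 118 117 1,
            .op .add 118 118 63, .op .add 118 118 16] ;;
          .store 118 62 ;; blk [.op .add 117 117 4, .sts 116 117]))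
      (fun r' A' m' t' => ∃ F, EvF P.δ {p | 2 * n ≤ p} F m m' ∧
        PQ0 n S A' m'.mem (ins + 1) (pn + 1) lo ∧
        (∀ i, 1 ≤ i → i < S → ¬ Anc i ((S + g) / 2) → TreeAt A' i) ∧ (r' 65).val = S + g ∧
        Good n (rd r' A' m'.mem) m'.cor (pqL n S A' Fr ∅) ∧ ArrHi A A' ∧ t' ≤ t + 60) r A m (t + 1) by
    refine wp_seq (by omega) (wp_mono _ (wp_frame _ hmid) ?_)
    rintro r1 A1 m1 t1 ⟨⟨F, ev, hp, hT, e65, hG1, hA1, ht1⟩, fr⟩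
    have hlim := P.lim_mono ev.a_le
    have e60 : (r1 60).val = ins := by rw [fr.1 60 (by decide), h60]
    have e61 : (r1 61).val = pn := by rw [fr.1 61 (by decide), h61]
    have hc1 := hc.frame fr (by decide)
    refine wp_blk_seq (by simp; omega) ?_
    simp only [wpB, Op.ok, Op.ev, e60, e61, hc1.c4, Function.update_of_ne, ne_eq, Nat.reduceEqDiff,
      not_false_eq_true]
    refine ⟨by omega, by omega, ?_⟩
    refine wp_treeUpdate hP (l := l) (hc1.congr fun x _ _ _ _ _ _ => by
      rw [Function.update_of_ne (by omega), Function.update_of_ne (by omega)]) hl hSδ ?_ ?_ ?_ ?_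
    · simp [e65]; omega
    · simpa [e65] using hT
    · simp; omega
    · rintro r2 A2 m2 t2 fr2 hT2 hA2 ht2
      have ev2 : Ev P.δ m1 m2 := fr2.2.2.1 (by decide)
      obtain ⟨F', ev'⟩ := ev.trans_ev' ev2
      obtain ⟨F2, ev2'⟩ := ev2
      refine ⟨F', ev', ⟨(hp.ev ev2' (by simp)).congr (fun _ _ => rfl) (fun j hj => hA2.leaf hj) hA2.cnt,
        hT2⟩, ?_, ?_, (hG1.ev ev2' (by simp)).arrTree hA2 (by simp), ?_, ?_⟩
      · rw [fr2.1 60 (by decide)]; simp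
      · rw [fr2.1 61 (by decide)]; simp
      · exact fun x hx => (hA2.hi x hx).trans (hA1 x hx)
      · simp at ht2; omega
  refine wp_hide fun Q' hQ' => ?_
  have i1 := hc.c1
  have i5 := hc.c5
  have i14 := hc.c14
  have i4 := hc.c4
  have hr63 : ins - ins / S * S = g := by have := mul_comm S (ins / S); omega
  refine wp_blk_seq (by simp; omega) ?_
  simp [wpB, Op.ok, Op.ev, h60, i1, i5, i14, i4, hr63]
  refine ⟨by omega, by omega, by omega, by omega, by omega, by omega, ?_⟩
  refine wp_abs fun r2 hr2 => ?_
  have f : ∀ y, y ∉ [63, 64, 65, 111, 112, 113] → r2 y = r y := by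
    intro y hy; simp at hy; simp [hr2, hy]
  have g111 : (r2 111).val = 128 + 16 * (S + g) + 6 := by simp [hr2]; omega
  have g112 : (r2 112).val = 128 + 16 * (S + g) + 7 := by simp [hr2]; omega
  have g65 : (r2 65).val = S + g := by simp [hr2]
  have g63 : (r2 63).val = g := by simp [hr2]
  have g113 : (r2 113).val = nwin A (S + g) := by
    simp [hr2, nwin, show (S + g) * 16 + 134 = 128 + 16 * (S + g) + 6 by omega]
  clear hr2
  have q3 : r2 3 = ⟨0, none⟩ := by rw [f 3 (by decide), hc.c3]
  have q4 : (r2 4).val = 1 := by rw [f 4 (by decide), i4]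
  have q62 : r2 62 = r 62 := f 62 (by decide)
  refine wp_cond (by omega) ?_ ?_
  · -- the group is empty
    intro h1
    simp only [Test.ev, q3, g113] at h1
    refine wp_blk _ (by simp; omega) ?_
    simp [wpB, Op.ok, Op.ev, g63, q4, g111, g112]
    refine ⟨by omega, by omega, by omega, ?_⟩
    refine hQ' _ _ _ _ ?_
    have b1 : ∀ B, B = update (update A (128 + 16 * (S + g) + 6) ⟨g + 1, none⟩)
        (128 + 16 * (S + g) + 7) (r2 62) → nwin B (S + g) = g + 1 ∧ nval B (S + g) = r 62 ∧
        (∀ j, j ≠ S + g → nwin B j = nwin A j ∧ nval B j = nval A j) ∧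
        (∀ x, ncnt B x = ncnt A x) ∧ ArrHi A B := by
      intro B hB
      refine ⟨by simp [hB, nwin], by simp [hB, nval, q62], fun j hj => ?_, fun x => ?_, fun x hx => ?_⟩
      · simp only [hB, nwin, nval]
        rw [Function.update_of_ne (by omega), Function.update_of_ne (by omega),
          Function.update_of_ne (by omega), Function.update_of_ne (by omega)]
        simp
      · simp only [hB, ncnt]
        rw [Function.update_of_ne (by omega), Function.update_of_ne (by omega)]
      · rw [hB, Function.update_of_ne (by omega), Function.update_of_ne (by omega)]
    obtain ⟨k1, k2, k3, k4, k5⟩ := b1 _ rfl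
    refine ⟨∅, EvF.refl _ _ _, PQ0.insert_leaf hS hpq.toPQ0 hg h1 hw k1 k2 k3 k4,
      tree_update_leaf hpq.tree k3 (by omega), by simpa using g65, ?_, k5, by omega⟩
    generalize update (update A (128 + 16 * (S + g) + 6) ⟨g + 1, none⟩)
        (128 + 16 * (S + g) + 7) (r2 62) = B at *
    refine hG.move (.g 62) (.a (128 + 16 * (S + g) + 7)) (by simp [mem_pqL_g]) ?_ ?_ ?_ ?_
    · rintro ⟨g', -, h2, h3⟩
      obtain rfl : g' = g := by omega
      exact h2 h1
    · intro x
      cases x with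
      | f p => simp [mem_pqL_f, k4]
      | a x =>
        simp only [mem_pqL_a, Loc.a.injEq, ne_eq, reduceCtorEq, not_false_eq_true, and_true]
        constructor
        · rintro ⟨g', h2, h3, h4⟩
          by_cases e : g' = g
          · left; rw [h4, e]
          · right; exact ⟨g', h2, by rwa [(k3 (S + g') (by omega)).1] at h3, h4⟩
        · rintro (rfl | ⟨g', h2, h3, h4⟩)
          · exact ⟨g, hgS, by omega, rfl⟩
          · by_cases e : g' = g
            · exact ⟨g, hgS, by omega, by rw [h4, e]⟩
            · exact ⟨g', h2, by rwa [(k3 (S + g') (by omega)).1], h4⟩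
      | g x => simp [mem_pqL_g]
    · exact congrArg Word.src k2
    · intro x hx hne
      cases x with
      | f p => rfl
      | a x =>
        obtain ⟨g', h2, h3, rfl⟩ := hx
        have : g' ≠ g := by rintro rfl; exact h3 h1
        exact congrArg Word.src (k3 (S + g') (by omega)).2
      | g x => exact absurd (congrArg Loc.g (show x = 62 from hx)) hne
  · -- the group has a minimum
    intro h1
    simp only [Test.ev, q3, g113] at h1
    refine wp_blk_seq (by simp; omega) ?_
    simp [wpB, g112]
    refine ⟨by omega, ?_⟩
    refine wp_abs fun r3 hr3 => ?_
    have f3 : ∀ y, y ≠ 115 → r3 y = r2 y := by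
      intro y hy; simp [hr3, hy]
    have g115 : r3 115 = nval A (S + g) := by simp [hr3, nval]
    clear hr3
    -- exchange the new word and the minimum if necessary
    refine wp_seq (by omega) ?_
    generalize hts : t + 1 + 18 + 1 + 4 + 1 = ts at *
    suffices hx : wp P (.cond (.lt 62 115) (blk [.sts 112 62, .mov 62 115]) .skip)
        (fun r' A' m' t' => (∀ y, y ≠ 62 → r' y = r3 y) ∧ m' = m ∧ t' ≤ t + 32 ∧
          (∀ x, x ≠ 128 + 16 * (S + g) + 7 → A' x = A x) ∧
          (nval A' (S + g) = r 62 ∧ r' 62 = nval A (S + g) ∨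
            r' 62 = r 62 ∧ nval A' (S + g) = nval A (S + g)) ∧
          (nval A' (S + g)).val ≤ (r' 62).val) r3 A m ts by
      refine wp_mono _ hx ?_
      rintro r4 A4 m4 t4 ⟨f4, rfl, ht4, hA4, hsw, hle⟩
      have p63 : (r4 63).val = g := by rw [f4 _ (by decide), f3 _ (by decide), g63]
      have p5 : (r4 5).val = 16 := by rw [f4 _ (by decide), f3 _ (by decide), f _ (by decide), i5]
      have p15 : (r4 15).val = 136 := by
        rw [f4 _ (by decide), f3 _ (by decide), f _ (by decide), hc.c15]
      have p1 : (r4 1).val = S := by rw [f4 _ (by decide), f3 _ (by decide), f _ (by decide), i1]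
      have p16 : (r4 16).val = 2 * n := by
        rw [f4 _ (by decide), f3 _ (by decide), f _ (by decide), hc.c16]
      have p4 : (r4 4).val = 1 := by rw [f4 _ (by decide), f3 _ (by decide), q4]
      have p65 : (r4 65).val = S + g := by rw [f4 _ (by decide), f3 _ (by decide), g65]
      have pc : (A4 (g * 16 + 136)).val = ncnt A g := by
        rw [hA4 _ (by omega)]
        simp [ncnt, show g * 16 + 136 = 128 + 16 * g + 8 by omega]
      refine wp_blk_seq (by simp; omega) ?_
      simp [wpB, Op.ok, Op.ev, p63, p5, p15, p1, p16, pc]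
      refine ⟨by omega, by omega, by omega, by omega, by omega, by omega, ?_⟩
      refine wp_seq (by omega) (wp_store (by omega) fun m5 ev5 => ?_)
      have hlim := P.lim_mono ev5.a_le
      refine wp_blk _ (by simp [FState.put]; omega) ?_
      simp [wpB, Op.ok, Op.ev, p4, pc]
      refine ⟨by omega, by omega, hQ' _ _ _ _ ?_⟩
      have hpc : ncnt A g * S + g + 2 * n = pcell n S g (ncnt A g) := by simp [pcell]; ring
      have h136 : g * 16 + 136 = 128 + 16 * g + 8 := by ring
      rw [hpc, h136]
      obtain ⟨B, hB⟩ : ∃ B, B = update A4 (128 + 16 * g + 8) ⟨ncnt A g + 1, none⟩ := ⟨_, rfl⟩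
      rw [← hB]
      have k1 : ∀ j, nwin B j = nwin A j := fun j => by
        simp only [hB, nwin]
        rw [Function.update_of_ne (by omega), hA4 _ (by omega)]
      have k2 : ∀ j, j ≠ S + g → nval B j = nval A j := fun j hj => by
        simp only [hB, nval]
        rw [Function.update_of_ne (by omega), hA4 _ (by omega)]
      have k3 : nval B (S + g) = nval A4 (S + g) := by
        simp only [hB, nval]
        rw [Function.update_of_ne (by omega)]
      have k4 : ∀ x, x ≠ g → ncnt B x = ncnt A x := fun j hj => by
        simp only [hB, ncnt]
        rw [Function.update_of_ne (by omega), hA4 _ (by omega)]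
      have k5 : ncnt B g = ncnt A g + 1 := by simp [hB, ncnt]
      have k6 : ArrHi A B := fun x hx => by
        rw [hB, Function.update_of_ne (by omega), hA4 _ (by omega)]
      obtain ⟨F5, ev5'⟩ := ev5
      have hpnew : ∀ g' < S, ∀ i' < ncnt A g', pcell n S g' i' ≠ pcell n S g (ncnt A g) := by
        intro g' h2 i' h3 h4
        obtain ⟨rfl, rfl⟩ := pcell_inj h2 hgS h4
        omega
      refine ⟨F5, (ev5'.mono (Set.empty_subset _)).put (by simp [pcell]; omega) _, ?_, ?_,
        by simpa using p65, ?_, k6, by omega⟩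
      · have hp5 := hpq.toPQ0.ev ev5' (by simp)
        refine hp5.insert_cell hS hg h1 hw (w1 := nval A4 (S + g)) (w2 := r4 62) ?_ hle k1 k3 k2 k4 k5
          (fun p hp => ?_) ?_
        · tauto
        · simp only [FState.put]; rw [Function.update_of_ne hp]
        · simp [FState.put]
      · refine tree_update_leaf (s := S + g) hpq.tree (fun j hj => ⟨k1 j, k2 j hj⟩) (by omega)
      · -- first the exchange, then the write
        have hG4 : Good n (rd r4 A4 m5.mem) m5.cor (pqL n S A Fr {62}) := by
          have hG' := hG.ev ev5' (by simp)
          rcases hsw with ⟨s1, s2⟩ | ⟨s1, s2⟩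
          · refine hG'.swap (.g 62) (.a (128 + 16 * (S + g) + 7)) rfl ⟨g, hgS, h1, rfl⟩
              (congrArg Word.src s2) (congrArg Word.src s1) fun x hx e1 e2 => ?_
            cases x with
            | f p => rfl
            | a x => exact congrArg Word.src (hA4 x (by simpa using e2))
            | g x => exact absurd (congrArg Loc.g (show x = 62 from hx)) e1
          · refine hG'.congr (fun _ => Iff.rfl) fun x hx => ?_
            cases x with
            | f p => rfl
            | a x =>
              by_cases e2 : x = 128 + 16 * (S + g) + 7
              · subst e2; exact congrArg Word.src s2
              · exact congrArg Word.src (hA4 x e2)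
            | g x => obtain rfl : x = 62 := hx; exact congrArg Word.src s1
        refine hG4.move (.g 62) (.f (pcell n S g (ncnt A g))) (by simp [mem_pqL_g]) ?_ ?_ ?_ ?_
        · rintro (h2 | ⟨g', h2, i', h3, h4⟩)
          · have := hFr _ h2; simp [pcell] at this; omega
          · exact hpnew g' h2 i' h3 h4.symm
        · intro x
          cases x with
          | f p =>
            simp only [mem_pqL_f, Loc.f.injEq, ne_eq, reduceCtorEq, not_false_eq_true, and_true]
            constructor
            · rintro (h2 | ⟨g', h2, i', h3, rfl⟩)
              · exact Or.inr (Or.inl h2)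
              · by_cases e : g' = g
                · subst e
                  by_cases e' : i' = ncnt A g'
                  · exact Or.inl (by rw [e'])
                  · exact Or.inr (Or.inr ⟨g', h2, i', by omega, rfl⟩)
                · exact Or.inr (Or.inr ⟨g', h2, i', by rwa [k4 g' e] at h3, rfl⟩)
            · rintro (rfl | h2 | ⟨g', h2, i', h3, rfl⟩)
              · exact Or.inr ⟨g, hgS, ncnt A g, by omega, rfl⟩
              · exact Or.inl h2
              · refine Or.inr ⟨g', h2, i', ?_, rfl⟩
                by_cases e : g' = g
                · subst e; omega
                · rwa [k4 g' e]
          | a x => simp [mem_pqL_a, k1]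
          | g x => simp [mem_pqL_g]
        · simp [rd, FState.put]
        · intro x hx hne
          cases x with
          | f p =>
            simp only [rd, FState.put]
            rw [Function.update_of_ne]
            rintro rfl
            rcases hx with h2 | ⟨g', h2, i', h3, h4⟩
            · have := hFr _ h2; simp [pcell] at this; omega
            · exact hpnew g' h2 i' h3 h4.symm
          | a x =>
            obtain ⟨g', h2, h3, rfl⟩ := hx
            simp only [rd, hB]
            rw [Function.update_of_ne (by omega)]
          | g x => exact absurd (congrArg Loc.g (show x = 62 from hx)) hne
    refine wp_cond (by omega) ?_ ?_
    · intro h2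
      simp only [Test.ev, g115, f3 62 (by decide), q62] at h2
      refine wp_blk _ (by simp; omega) ?_
      simp [wpB, f3 112 (by decide), g112, f3 62 (by decide), q62, g115, nval] at h2 ⊢
      refine ⟨by omega, ?_, by omega, ?_, by omega⟩
      · intro y hy; simp [hy]
      · intro y hy; simp [hy]
    · intro h2
      simp only [Test.ev, g115, f3 62 (by decide), q62] at h2
      refine wp_skip (by omega) ?_
      simp [f3 62 (by decide), q62]
      omega

/-! ### Extraction of the minimum. -/

/-- A nonempty inner node copies one of its children, so following the winner down the tree ends in
the leaf that provides it. The induction is on `2 * S - i`, which falls when passing to a child. -/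
theorem PQ.win {n S : ℕ} {A mem : ℕ → Word} {ins pn lo : ℕ} (h : PQ n S A mem ins pn lo) :
    ∀ d i, 1 ≤ i → i < 2 * S → 2 * S - i ≤ d → nwin A i ≠ 0 → ∃ g < S, nwin A i = g + 1 ∧
      nwin A (S + g) ≠ 0 ∧ (nval A i).val = (nval A (S + g)).val := by
  intro d
  induction d with
  | zero => intro i _ _ _; omega
  | succ d ih =>
    intro i h1 h2 h3 h4
    by_cases hi : i < S
    · rcases (h.tree i h1 hi).c with e | ⟨e, e'⟩ | ⟨e, e'⟩
      · exact absurd e h4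
      · rw [e, e']; rw [e] at h4; exact ih (2 * i) (by omega) (by omega) (by omega) h4
      · rw [e, e']; rw [e] at h4; exact ih (2 * i + 1) (by omega) (by omega) (by omega) h4
    · obtain ⟨g, rfl⟩ := Nat.exists_eq_add_of_le (Nat.le_of_not_lt hi)
      exact ⟨g, by omega, (h.leaf g (by omega)).resolve_left h4, h4, rfl⟩

/-- The minimum at a parent never exceeds that of a nonempty child; climb to the root. -/
theorem PQ.root_le {n S : ℕ} {A mem : ℕ → Word} {ins pn lo : ℕ} (h : PQ n S A mem ins pn lo) (i : ℕ)
    (h1 : 1 ≤ i) (h2 : i < 2 * S) (h3 : nwin A i ≠ 0) :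
    nwin A 1 ≠ 0 ∧ (nval A 1).val ≤ (nval A i).val := by
  induction i using Nat.strong_induction_on with
  | _ i ih =>
    by_cases hi : i = 1
    · subst hi; exact ⟨h3, le_rfl⟩
    · have ht := h.tree (i / 2) (by omega) (by omega)
      have hs : nwin A (i / 2) ≠ 0 ∧ (nval A (i / 2)).val ≤ (nval A i).val := by
        rcases Nat.mod_two_eq_zero_or_one i with e | e
        · have e' : 2 * (i / 2) = i := by omega
          have := ht.l
          rw [e'] at this
          exact this h3
        · have e' : 2 * (i / 2) + 1 = i := by omega
          have := ht.r
          rw [e'] at this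
          exact this h3
      obtain ⟨a, b⟩ := ih (i / 2) (by omega) (by omega) (by omega) hs.1
      exact ⟨a, b.trans hs.2⟩

theorem PQ.root_ne {n S : ℕ} {A mem : ℕ → Word} {ins pn lo : ℕ} (h : PQ n S A mem ins pn lo)
    (hS : 1 ≤ S) (hpn : pn ≠ 0) : nwin A 1 ≠ 0 := by
  have : ∃ g ∈ Finset.range S, gsz S A g ≠ 0 := by
    by_contra hne
    push Not at hne
    exact hpn (h.sum ▸ Finset.sum_eq_zero hne)
  obtain ⟨g, hg, hz⟩ := this
  rw [Finset.mem_range] at hg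
  refine (h.root_le (S + g) (by omega) (by omega) ?_).1
  intro h0
  by_cases hc : ncnt A g = 0
  · simp [gsz, h0, hc] at hz
  · exact h.occ g hg hc h0

/-- The lower bound may be raised up to the root of the tree. -/
theorem PQ.raise {n S : ℕ} {A mem : ℕ → Word} {ins pn lo lo' : ℕ} (h : PQ n S A mem ins pn lo)
    (hle : nwin A 1 ≠ 0 → lo' ≤ max lo (nval A 1).val) : PQ n S A mem ins pn lo' := by
  refine ⟨⟨h.leaf, h.occ, h.size, h.min, ?_, ?_, h.sum⟩, h.tree⟩
  · intro g hg i hi hs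
    have h1 := h.root_le (S + g) (by omega) (by omega) (h.occ g hg (by omega))
    exact (hle h1.1).trans (max_le (h.loc g hg i hi hs) (h1.2.trans (h.min g hg i hi hs)))
  · intro g hg hw hs
    have h1 := h.root_le (S + g) (by omega) (by omega) hw
    exact (hle h1.1).trans (max_le (h.lol g hg hw hs) h1.2)

theorem sum_remove {S g : ℕ} {f f' : ℕ → ℕ} (hg : g < S) (h1 : f' g = f g - 1) (h0 : f g ≠ 0)
    (h2 : ∀ x, x ≠ g → f' x = f x) :
    ∑ x ∈ Finset.range S, f' x = ∑ x ∈ Finset.range S, f x - 1 := by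
  have := sum_insert (f := f') (f' := f) hg (by omega) (fun x hx => (h2 x hx).symm)
  omega

theorem PQ0.pop_leaf {n S : ℕ} {A A' mem : ℕ → Word} {ins pn lo g : ℕ}
    (h : PQ0 n S A mem ins pn lo) (hgS : g < S) (h0 : nwin A (S + g) ≠ 0) (hc0 : ncnt A g = 0)
    (h1 : nwin A' (S + g) = 0) (hA : ∀ j, j ≠ S + g → nwin A' j = nwin A j)
    (hv : ∀ j, nval A' j = nval A j) (hc : ∀ g, ncnt A' g = ncnt A g) :
    PQ0 n S A' mem ins (pn - 1) lo := by
  have z0 : gsz S A g = 1 := by simp [gsz, hc0, h0]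
  have z1 : gsz S A' g = gsz S A g - 1 := by simp [gsz, hc, h1, hc0, h0]
  have z2 : ∀ x, x ≠ g → gsz S A' x = gsz S A x := fun x hx => by
    simp [gsz, hc, hA (S + x) (by omega)]
  constructor
  · intro x hx
    by_cases e : x = g
    · subst e; left; exact h1
    · rw [hA (S + x) (by omega)]; exact h.leaf x hx
  · intro x hx
    by_cases e : x = g
    · subst e; rw [hc]; omega
    · rw [hA (S + x) (by omega), hc]; exact h.occ x hx
  · intro x hx
    have := h.size x hx
    by_cases e : x = g
    · subst e; omega
    · rw [z2 x e]; exact this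
  · simpa [hc, hv] using h.min
  · simpa [hc] using h.loc
  · intro x hx
    by_cases e : x = g
    · subst e; intro h; exact absurd h1 h
    · rw [hA (S + x) (by omega), hv]; exact h.lol x hx
  · rw [sum_remove hgS z1 (by omega) z2, h.sum]

/-- The last faulty word of the group fills the hole at `b`, so the words in use remain an initial
segment. The new leaf has only to bound the faithful words of the group, as in `min`. -/
theorem PQ0.pop_cell {n S : ℕ} {A A' mem mem' : ℕ → Word} {ins pn lo g b : ℕ}
    (h : PQ0 n S A mem ins pn lo) (hgS : g < S) (hb : b < ncnt A g)
    (hmin : ∀ i < ncnt A g, (mem (pcell n S g i)).src ≠ none →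
      (nval A' (S + g)).val ≤ (mem (pcell n S g i)).val)
    (hlo : (nval A' (S + g)).src ≠ none → lo ≤ (nval A' (S + g)).val)
    (hnw : ∀ j, nwin A' j = nwin A j) (hA : ∀ j, j ≠ S + g → nval A' j = nval A j)
    (hc : ∀ x, x ≠ g → ncnt A' x = ncnt A x) (hcg : ncnt A' g = ncnt A g - 1)
    (hm : ∀ p, p ≠ pcell n S g b → p ≠ pcell n S g (ncnt A g - 1) → mem' p = mem p)
    (hm2 : b ≠ ncnt A g - 1 → mem' (pcell n S g b) = mem (pcell n S g (ncnt A g - 1))) :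
    PQ0 n S A' mem' ins (pn - 1) lo := by
  have h0 := h.occ g hgS (by omega)
  have z0 : gsz S A g ≠ 0 := by simp [gsz, h0]
  have z1 : gsz S A' g = gsz S A g - 1 := by simp [gsz, hcg, hnw, h0]; omega
  have z2 : ∀ x, x ≠ g → gsz S A' x = gsz S A x := fun x hx => by simp [gsz, hc x hx, hnw]
  have hcell : ∀ i < ncnt A' g, ∃ j < ncnt A g, mem' (pcell n S g i) = mem (pcell n S g j) := by
    intro i hi
    by_cases e : i = b
    · subst e; exact ⟨_, by omega, hm2 (by omega)⟩
    · refine ⟨i, by omega, hm _ (fun e' => e (pcell_inj hgS hgS e').2) fun e' => ?_⟩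
      have := (pcell_inj hgS hgS e').2
      omega
  have hother : ∀ x < S, x ≠ g → ∀ i, mem' (pcell n S x i) = mem (pcell n S x i) :=
    fun x hx e i => hm _ (fun e' => e (pcell_inj hx hgS e').1) fun e' => e (pcell_inj hx hgS e').1
  constructor
  · simpa [hnw] using h.leaf
  · intro x hx
    rw [hnw]
    by_cases e : x = g
    · subst e; intro _; exact h0
    · rw [hc x e]; exact h.occ x hx
  · intro x hx
    have := h.size x hx
    by_cases e : x = g
    · subst e; omega
    · rw [z2 x e]; exact this
  · intro x hx i hi
    by_cases e : x = g
    · subst e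
      obtain ⟨j, hj, e⟩ := hcell i hi
      rw [e]
      exact hmin j hj
    · rw [hc x e] at hi
      rw [hother x hx e, hA (S + x) (by omega)]
      exact h.min x hx i hi
  · intro x hx i hi
    by_cases e : x = g
    · subst e
      obtain ⟨j, hj, e⟩ := hcell i hi
      rw [e]
      exact h.loc x hx j hj
    · rw [hc x e] at hi
      rw [hother x hx e]
      exact h.loc x hx i hi
  · intro x hx
    by_cases e : x = g
    · subst e; intro _; exact hlo
    · rw [hnw, hA (S + x) (by omega)]; exact h.lol x hx
  · rw [sum_remove hgS z1 z0 z2, h.sum]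

/-- Find the minimum of a group: its address in register `118`, its value in register `119`. -/
def pqScan : Cmd :=
  .load 119 115 ;; blk [.op .add 115 115 1] ;;
  .loop (.lt 115 120) (.load 114 115 ;;
    .cond (.lt 114 119) (blk [.mov 119 114, .mov 118 115]) .skip ;; blk [.op .add 115 115 1])

/-- Remove the minimum, and put it into register `62`. -/
def pqPop : Cmd :=
  (blk [.set 111 150, .lds 112 111, .op .sub 63 112 4, .op .add 65 1 63, .op .mul 111 65 5,
    .op .add 111 111 14, .op .add 112 111 4, .lds 62 112, .op .mul 116 63 5, .op .add 116 116 15,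
    .lds 117 116] ;;
  .cond (.eq 117 3) (blk [.sts 111 3])
    (blk [.op .mul 120 117 1, .op .add 120 120 63, .op .add 120 120 16, .op .add 115 63 16,
      .mov 118 115] ;;
    pqScan ;;
    .load 114 118 ;; .cond (.eq 114 119) .skip (blk [.op .sub 114 119 3]) ;;
    blk [.op .sub 120 120 1] ;; .load 121 120 ;; .store 118 121 ;;
    blk [.sts 112 114, .op .sub 117 117 4, .sts 116 117])) ;;
  blk [.op .sub 61 61 4] ;; treeUpdate

theorem Ev.src_ne {δ : ℕ} {m m' : FState} (h : Ev δ m m') {p : ℕ}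
    (hp : (m'.mem p).src ≠ none) : m'.mem p = m.mem p := by
  obtain ⟨F, h⟩ := h
  exact (h.src_ne (by simp) hp).2

/-- The value found is kept in a register and bounds every word that is still faithful at the end.
The cell where it was found may be hit later; in that case it has no provenance any more. -/
theorem wp_pqScan {P : Par} {n S : ℕ} {r A : ℕ → Word} {m : FState} {t : ℕ}
    {Q : Post} {g c : ℕ} (h1 : (r 1).val = S) (h115 : (r 115).val = pcell n S g 0)
    (h118 : (r 118).val = pcell n S g 0) (h120 : (r 120).val = pcell n S g c) (hS : 1 ≤ S)
    (hc : 1 ≤ c) (hM : pcell n S g c < P.M) (ht : t + 20 * c + 20 ≤ P.lim m.a)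
    (hQ : ∀ r' A' m' t', Frame P.δ pqScan r A m r' A' m' →
      (∀ i < c, (m'.mem (pcell n S g i)).src ≠ none → (r' 119).val ≤ (m'.mem (pcell n S g i)).val) →
      (∃ b < c, (r' 118).val = pcell n S g b ∧
        ((m'.mem (pcell n S g b)).src ≠ none → (m'.mem (pcell n S g b)).val = (r' 119).val)) →
      t' ≤ t + 20 * c + 20 → Q r' A' m' t') :
    wp P pqScan Q r A m t := by
  suffices h : wp P pqScan (fun r' A' m' t' =>
      (∀ i < c, (m'.mem (pcell n S g i)).src ≠ none → (r' 119).val ≤ (m'.mem (pcell n S g i)).val) ∧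
      (∃ b < c, (r' 118).val = pcell n S g b ∧
        ((m'.mem (pcell n S g b)).src ≠ none → (m'.mem (pcell n S g b)).val = (r' 119).val)) ∧
      t' ≤ t + 20 * c + 20) r A m t from
    wp_mono _ (wp_frame _ h) fun r' A' m' t' h => hQ r' A' m' t' h.2 h.1.1 h.1.2.1 h.1.2.2
  have hstep : ∀ j, pcell n S g (j + 1) = pcell n S g j + S := fun j => by unfold pcell; ring
  have hmono : ∀ i j, i ≤ j → pcell n S g i ≤ pcell n S g j := fun i j h => by
    have := Nat.mul_le_mul_right S h
    unfold pcell; omega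
  have hm1 := hmono 1 c hc
  refine wp_seq (by omega) (wp_load (by omega) fun m1 ev1 => ?_)
  have hlim := P.lim_mono ev1.a_le
  refine wp_blk_seq (by simp; omega) ?_
  simp only [wpB, Op.ok, Op.ev, ne_eq, Nat.reduceEqDiff, not_false_eq_true, Function.update_of_ne,
    h115, h1, ← hstep]
  refine ⟨lt_of_le_of_lt hm1 hM, ?_⟩
  refine ⟨fun r' A' m' t' => ∃ j, 1 ≤ j ∧ j ≤ c ∧ (r' 1).val = S ∧ (r' 120).val = pcell n S g c ∧
      (r' 115).val = pcell n S g j ∧ P.lim m.a ≤ P.lim m'.a ∧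
      (∀ i < j, (m'.mem (pcell n S g i)).src ≠ none →
        (r' 119).val ≤ (m'.mem (pcell n S g i)).val) ∧
      (∃ b < j, (r' 118).val = pcell n S g b ∧
        ((m'.mem (pcell n S g b)).src ≠ none → (m'.mem (pcell n S g b)).val = (r' 119).val)) ∧
      t' + 20 * (c - j) ≤ t + 20 * c, ?_, ?_, ?_⟩
  · rintro r2 A2 m2 t2 m3 ⟨j, a1, a2, a3, a4, a5, a6, a7, ⟨b, a8, a9, a10⟩, a11⟩ ev
    refine ⟨j, a1, a2, a3, a4, a5, a6.trans (P.lim_mono ev.a_le), ?_, ⟨b, a8, a9, ?_⟩, a11⟩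
    · intro i hi hs
      have e := ev.src_ne hs; rw [e] at hs ⊢
      exact a7 i hi hs
    · intro hs
      have e := ev.src_ne hs; rw [e] at hs ⊢
      exact a10 hs
  · refine ⟨1, le_rfl, hc, ?_⟩
    simp [h1, h120, h118, hlim]
    omega
  · rintro r2 A2 m2 t2 ⟨j, a1, a2, a3, a4, a5, a6, a7, ⟨b, a8, a9, a10⟩, a11⟩
    refine ⟨by omega, ?_, ?_⟩
    · intro hlt
      simp only [Test.ev, a4, a5] at hlt
      have hj : j < c := by
        by_contra hne
        have := hmono c j (by omega)
        omega
      have hm2 := hmono (j + 1) c hj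
      refine wp_hide fun Q' hQ' => ?_
      refine wp_seq (by omega) (wp_load (by omega) fun m3 ev3 => ?_)
      have hlim3 := P.lim_mono ev3.a_le
      rw [a5]
      have b7 : ∀ i < j, (m3.mem (pcell n S g i)).src ≠ none →
          (r2 119).val ≤ (m3.mem (pcell n S g i)).val := by
        intro i hi hs
        have e := ev3.src_ne hs; rw [e] at hs ⊢
        exact a7 i hi hs
      have b10 : (m3.mem (pcell n S g b)).src ≠ none →
          (m3.mem (pcell n S g b)).val = (r2 119).val := by
        intro hs
        have e := ev3.src_ne hs; rw [e] at hs ⊢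
        exact a10 hs
      refine wp_seq (by omega) (wp_cond (by omega) ?_ ?_)
      · intro h
        simp [Test.ev] at h
        refine wp_blk _ (by simp; omega) ?_
        simp [wpB]
        refine wp_blk _ (by simp; omega) ?_
        simp [wpB, Op.ok, Op.ev, a3, a5, ← hstep]
        refine ⟨by omega, hQ' _ _ _ _ ⟨j + 1, by omega, hj, ?_⟩⟩
        simp [a3, a4, a6.trans hlim3]
        refine ⟨?_, ⟨j, by omega, a5, by simp⟩, by omega⟩
        intro i hi hs
        rcases Nat.lt_or_eq_of_le hi with hi | rfl
        · exact h.le.trans (b7 i hi (by simpa using hs))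
        · exact le_rfl
      · intro h
        simp [Test.ev] at h
        refine wp_skip (by omega) ?_
        refine wp_blk _ (by simp; omega) ?_
        simp [wpB, Op.ok, Op.ev, a3, a5, ← hstep]
        refine ⟨by omega, hQ' _ _ _ _ ⟨j + 1, by omega, hj, ?_⟩⟩
        simp [a3, a4, a6.trans hlim3]
        refine ⟨?_, ⟨b, by omega, a9, by simpa using b10⟩, by omega⟩
        intro i hi hs
        rcases Nat.lt_or_eq_of_le hi with hi | rfl
        · exact b7 i hi (by simpa using hs)
        · exact h
    · intro hlt
      simp only [Test.ev, a4, a5] at hlt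
      have hj : j = c := by
        by_contra hne
        have := hmono (j + 1) c (by omega)
        rw [hstep] at this
        omega
      subst hj
      exact ⟨a7, ⟨b, a8, a9, a10⟩, by omega⟩

/-- The choice of `K` makes the size of a group proportional to it. This is where the term `δ / S`
in the cost of an extraction comes from. -/
theorem Par.Ok.div_le {P : Par} {n S : ℕ} (hP : P.Ok n S) {ins : ℕ} (hins : ins ≤ 2 * P.δ) :
    ins / S ≤ 2 * P.K S := by
  have hS := hP.hS
  have h1 := Nat.div_add_mod P.δ S
  have h2 := Nat.mod_lt P.δ hS
  have h3 : S * (P.δ / S + 1) = S * (P.δ / S) + S := by ring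
  rw [Nat.div_le_iff_le_mul_add_pred hS]
  unfold Par.K
  have : 2 * (P.δ / S + 1) * S = 2 * (S * (P.δ / S + 1)) := by ring
  nlinarith

/-- The faulty words enter the invariant only through those with a provenance. -/
theorem PQ0.sub {n S : ℕ} {A mem mem' : ℕ → Word} {ins pn lo : ℕ}
    (h : PQ0 n S A mem ins pn lo) (hm : ∀ p, (mem' p).src ≠ none → mem' p = mem p) :
    PQ0 n S A mem' ins pn lo := by
  refine ⟨h.leaf, h.occ, h.size, ?_, ?_, h.lol, h.sum⟩
  · intro g hg i hi hs
    have e := hm _ hs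
    rw [e] at hs ⊢
    exact h.min g hg i hi hs
  · intro g hg i hi hs
    have e := hm _ hs
    rw [e] at hs ⊢
    exact h.loc g hg i hi hs

theorem Ev.src_or {δ : ℕ} {m m' : FState} (h : Ev δ m m') (p : ℕ) :
    (m'.mem p).src = (m.mem p).src ∨
      ((m'.mem p).src = none ∧ ∀ i, (m.mem p).src = some i → i ∈ m'.cor) := by
  obtain ⟨F, h⟩ := h
  by_cases hp : p ∈ F
  · exact Or.inr (h.lost p (by simp) hp)
  · exact Or.inl (by rw [h.same p (by simp) hp])

theorem Ev.cor {δ : ℕ} {m m' : FState} (h : Ev δ m m') : m.cor ⊆ m'.cor := by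
  obtain ⟨F, h⟩ := h
  exact h.cor

theorem Good.unused {n : ℕ} {s : Loc → Option ℕ} {cor : Set ℕ} {live : Set Loc}
    (h : Good n s cor live) {s' : Loc → Option ℕ} (hs : ∀ x ∈ live, s' x = s x) :
    Good n s' cor live := h.congr (fun _ => Iff.rfl) hs

/-- The extracted word comes from a safe leaf, so faults cannot touch it any more. The cost splits
into the path in the tree and the scan of at most `2 * P.K S` faulty words for a successor. -/
theorem wp_pqPop {P : Par} {n S : ℕ} (hP : P.Ok n S) {r A : ℕ → Word} {m : FState} {t : ℕ}
    {Q : Post} (hc : Consts P n S r) {l ins pn lo : ℕ} (hl : S ≤ 2 ^ l)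
    (hpq : PQ n S A m.mem ins pn lo) (h61 : (r 61).val = pn)
    (hins : ins ≤ 2 * P.δ) (hpn : pn ≠ 0) {Fr : Set ℕ}
    (hFr : ∀ p ∈ Fr, p < 2 * n) (hG : Good n (rd r A m.mem) m.cor (pqL n S A Fr ∅))
    (ht : t + 60 * l + 40 * P.K S + 150 ≤ P.lim m.a)
    (hQ : ∀ r' A' m' t' F, Frame P.δ pqPop r A m r' A' m' → EvF P.δ {p | 2 * n ≤ p} F m m' →
      PQ n S A' m'.mem ins (pn - 1) lo → (r' 61).val = pn - 1 →
      (r' 62).val = (nval A 1).val → ((r' 62).src ≠ none → lo ≤ (r' 62).val) →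
      Good n (rd r' A' m'.mem) m'.cor (pqL n S A' Fr {62}) → ArrHi A A' →
      t' ≤ t + 60 * l + 40 * P.K S + 150 → Q r' A' m' t') :
    wp P pqPop Q r A m t := by
  suffices h : wp P pqPop (fun r' A' m' t' => ∃ F, EvF P.δ {p | 2 * n ≤ p} F m m' ∧
      PQ n S A' m'.mem ins (pn - 1) lo ∧ (r' 61).val = pn - 1 ∧
      (r' 62).val = (nval A 1).val ∧ ((r' 62).src ≠ none → lo ≤ (r' 62).val) ∧
      Good n (rd r' A' m'.mem) m'.cor (pqL n S A' Fr {62}) ∧ ArrHi A A' ∧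
      t' ≤ t + 60 * l + 40 * P.K S + 150) r A m t from
    wp_mono _ (wp_frame _ h) fun r' A' m' t' h => by
      obtain ⟨⟨F, h1, h2, h3, h4, h5, h6, h7, h8⟩, hf⟩ := h
      exact hQ r' A' m' t' F hf h1 h2 h3 h4 h5 h6 h7 h8
  have hM := hP.hM
  have hcap := hP.hcap
  have hS := hP.hS
  have hSδ := hP.hSδ
  obtain ⟨g, hgS, hg1, hg2, hg3⟩ := hpq.win (2 * S) 1 le_rfl (by omega) (by omega)
    (hpq.root_ne hS hpn)
  have hgl : nwin A (S + g) = g + 1 := (hpq.leaf g hgS).resolve_left hg2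
  have hcK := hP.div_le hins
  have hcg : ncnt A g ≤ ins / S := by
    have h1 := hpq.size g hgS
    unfold gsz at h1
    rw [if_neg hg2] at h1
    split_ifs at h1 <;> omega
  have hcq : ncnt A g * S ≤ ins :=
    (Nat.mul_le_mul_right _ hcg).trans (Nat.div_mul_le_self _ _)
  have hcl : ncnt A g ≤ ins := (Nat.le_mul_of_pos_right _ hS).trans hcq
  have hpM : pcell n S g (ncnt A g) < P.M := by unfold pcell; omega
  have hlo := hpq.lol g hgS hg2
  -- the part before the tree update
  suffices hmid : wp P (blk [.set 111 150, .lds 112 111, .op .sub 63 112 4, .op .add 65 1 63,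
    .op .mul 111 65 5, .op .add 111 111 14, .op .add 112 111 4, .lds 62 112, .op .mul 116 63 5,
    .op .add 116 116 15, .lds 117 116] ;;
  .cond (.eq 117 3) (blk [.sts 111 3])
    (blk [.op .mul 120 117 1, .op .add 120 120 63, .op .add 120 120 16, .op .add 115 63 16,
      .mov 118 115] ;;
    pqScan ;;
    .load 114 118 ;; .cond (.eq 114 119) .skip (blk [.op .sub 114 119 3]) ;;
    blk [.op .sub 120 120 1] ;; .load 121 120 ;; .store 118 121 ;;
    blk [.sts 112 114, .op .sub 117 117 4, .sts 116 117]))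
      (fun r' A' m' t' => ∃ F, EvF P.δ {p | 2 * n ≤ p} F m m' ∧
        PQ0 n S A' m'.mem ins (pn - 1) lo ∧
        (∀ i, 1 ≤ i → i < S → ¬ Anc i ((S + g) / 2) → TreeAt A' i) ∧ (r' 65).val = S + g ∧
        r' 62 = nval A (S + g) ∧
        Good n (rd r' A' m'.mem) m'.cor (pqL n S A' Fr {62}) ∧ ArrHi A A' ∧
        t' ≤ t + 40 * P.K S + 120) r A m (t + 1) by
    refine wp_seq (by omega) (wp_mono _ (wp_frame _ hmid) ?_)
    rintro r1 A1 m1 t1 ⟨⟨F, ev, hp, hT, e65, e62, hG1, hA1, ht1⟩, fr⟩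
    have hlim := P.lim_mono ev.a_le
    have e61 : (r1 61).val = pn := by rw [fr.1 61 (by decide), h61]
    have hc1 := hc.frame fr (by decide)
    refine wp_blk_seq (by simp; omega) ?_
    simp only [wpB, Op.ok, Op.ev, e61, hc1.c4, ne_eq, true_and]
    refine wp_treeUpdate hP (l := l) (hc1.congr fun x _ _ _ _ _ _ => by
      rw [Function.update_of_ne (by omega)]) hl hSδ ?_ ?_ ?_ ?_
    · simp [e65]; omega
    · simpa [e65] using hT
    · simp; omega
    · rintro r2 A2 m2 t2 fr2 hT2 hA2 ht2
      have ev2 : Ev P.δ m1 m2 := fr2.2.2.1 (by decide)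
      obtain ⟨F', ev'⟩ := ev.trans_ev' ev2
      obtain ⟨F2, ev2'⟩ := ev2
      have q62 : r2 62 = r1 62 := by rw [fr2.1 62 (by decide)]; simp
      refine ⟨F', ev', ⟨(hp.ev ev2' (by simp)).congr (fun _ _ => rfl) (fun j hj => hA2.leaf hj) hA2.cnt,
        hT2⟩, ?_, ?_, ?_, (hG1.ev ev2' (by simp)).arrTree hA2 (by simpa using q62), ?_, ?_⟩
      · rw [fr2.1 61 (by decide)]; simp
      · rw [q62, e62, hg3]
      · rw [q62, e62]; exact hlo
      · exact fun x hx => (hA2.hi x hx).trans (hA1 x hx)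
      · simp at ht2; omega
  refine wp_hide fun Q' hQ' => ?_
  have i1 := hc.c1
  have i5 := hc.c5
  have i14 := hc.c14
  have i15 := hc.c15
  have i4 := hc.c4
  have hroot : (A 150).val = g + 1 := by rw [← hg1]; rfl
  refine wp_blk_seq (by simp; omega) ?_
  simp [wpB, Op.ok, Op.ev, i1, i5, i14, i15, i4, hroot]
  refine ⟨by omega, by omega, by omega, by omega, by omega, by omega, by omega, by omega, by omega,
    by omega, ?_⟩
  refine wp_abs fun r2 hr2 => ?_
  have f : ∀ y, y ∉ [62, 63, 65, 111, 112, 116, 117] → r2 y = r y := by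
    intro y hy; simp at hy; simp [hr2, hy]
  have g111 : (r2 111).val = 128 + 16 * (S + g) + 6 := by simp [hr2]; omega
  have g112 : (r2 112).val = 128 + 16 * (S + g) + 7 := by simp [hr2]; omega
  have g65 : (r2 65).val = S + g := by simp [hr2]
  have g63 : (r2 63).val = g := by simp [hr2]
  have g62 : r2 62 = nval A (S + g) := by
    simp [hr2, nval, show (S + g) * 16 + 134 + 1 = 128 + 16 * (S + g) + 7 by omega]
  have g116 : (r2 116).val = 128 + 16 * g + 8 := by simp [hr2]; omega
  have g117 : (r2 117).val = ncnt A g := by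
    simp [hr2, ncnt, show g * 16 + 136 = 128 + 16 * g + 8 by omega]
  clear hr2
  have q3 : r2 3 = ⟨0, none⟩ := by rw [f 3 (by decide), hc.c3]
  have q4 : (r2 4).val = 1 := by rw [f 4 (by decide), i4]
  have q1 : (r2 1).val = S := by rw [f 1 (by decide), i1]
  have q16 : (r2 16).val = 2 * n := by rw [f 16 (by decide), hc.c16]
  have hG2 : Good n (rd r2 A m.mem) m.cor (pqL n S A Fr ∅) :=
    hG.unused fun x hx => by cases x <;> first | rfl | exact absurd hx (by simp [mem_pqL_g])
  -- take the minimum out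
  have hG3 : ∀ B r3, (∀ x, x ≠ 128 + 16 * (S + g) + 6 → B x = A x) → nwin B (S + g) = 0 →
      ncnt A g = 0 → r3 62 = nval A (S + g) →
      Good n (rd r3 B m.mem) m.cor (pqL n S B Fr {62}) := by
    intro B r3 hB hB0 hc0 h62
    have hB1 : ∀ j, j ≠ S + g → nwin B j = nwin A j := fun j hj =>
      congrArg Word.val (hB _ (by omega))
    have hB2 : ∀ j, ncnt B j = ncnt A j := fun j => congrArg Word.val (hB _ (by omega))
    refine hG2.move (.a (128 + 16 * (S + g) + 7)) (.g 62) ⟨g, hgS, hg2, rfl⟩ (by simp [mem_pqL_g])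
      ?_ (congrArg Word.src h62) ?_
    · intro x
      cases x with
      | f p => simp [mem_pqL_f, hB2]
      | a x =>
        simp only [mem_pqL_a, reduceCtorEq, false_or, Loc.a.injEq, ne_eq]
        constructor
        · rintro ⟨g', h2, h3, h4⟩
          have e : g' ≠ g := by rintro rfl; exact h3 hB0
          exact ⟨⟨g', h2, by rwa [hB1 _ (by omega)] at h3, h4⟩, by omega⟩
        · rintro ⟨⟨g', h2, h3, h4⟩, h5⟩
          have e : g' ≠ g := by rintro rfl; exact h5 h4
          exact ⟨g', h2, by rwa [hB1 _ (by omega)], h4⟩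
      | g x => simp [mem_pqL_g]
    · intro x hx hne
      cases x with
      | f p => rfl
      | a x =>
        obtain ⟨g', h2, h3, rfl⟩ := hx
        exact congrArg Word.src (hB _ (by omega))
      | g x => exact absurd hx (by simp [mem_pqL_g])
  refine wp_cond (by omega) ?_ ?_
  · -- the group becomes empty
    intro h1
    simp only [Test.ev, q3, g117] at h1
    refine wp_blk _ (by simp; omega) ?_
    simp only [wpB, g111, q3]
    refine ⟨by omega, ?_⟩
    refine hQ' _ _ _ _ ?_
    have b1 : ∀ B, B = update A (128 + 16 * (S + g) + 6) ⟨0, none⟩ → nwin B (S + g) = 0 ∧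
        (∀ x, x ≠ 128 + 16 * (S + g) + 6 → B x = A x) := by
      intro B hB
      exact ⟨by simp [hB, nwin], fun x hx => by simp [hB, hx]⟩
    obtain ⟨k1, k2⟩ := b1 _ rfl
    generalize update A (128 + 16 * (S + g) + 6) ⟨0, none⟩ = B at *
    have k3 : ∀ j, j ≠ S + g → nwin B j = nwin A j := fun j hj =>
      congrArg Word.val (k2 _ (by omega))
    have k4 : ∀ j, nval B j = nval A j := fun j => k2 _ (by omega)
    exact ⟨∅, EvF.refl _ _ _, PQ0.pop_leaf hpq.toPQ0 hgS hg2 h1 k1 k3 k4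
      (fun j => congrArg Word.val (k2 _ (by omega))),
      tree_update_leaf hpq.tree (fun j hj => ⟨k3 j hj, k4 j⟩) (by omega), g65, g62,
      hG3 _ _ k2 k1 h1 g62, fun x hx => k2 x (by omega), by simp; omega⟩
  · intro h1
    simp only [Test.ev, q3, g117] at h1
    refine wp_blk_seq (by simp; omega) ?_
    have hpc : ncnt A g * S + g + 2 * n = pcell n S g (ncnt A g) := by simp [pcell]; ring
    have hp0 : g + 2 * n = pcell n S g 0 := by simp [pcell]; ring
    simp [wpB, Op.ok, Op.ev, q1, g63, q16, g117]
    rw [hpc, hp0]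
    refine ⟨by omega, by omega, by omega, by omega, ?_⟩
    refine wp_abs fun r3 hr3 => ?_
    have f3 : ∀ y, y ∉ [120, 115, 118] → r3 y = r2 y := by
      intro y hy; simp at hy; simp [hr3, hy]
    have g120 : (r3 120).val = pcell n S g (ncnt A g) := by simp [hr3]
    have g115 : (r3 115).val = pcell n S g 0 := by simp [hr3]
    have g118 : (r3 118).val = pcell n S g 0 := by simp [hr3]
    clear hr3
    refine wp_seq (by omega) (wp_pqScan (g := g) (c := ncnt A g)
      (by rw [f3 1 (by decide), q1]) g115 g118 g120 hS (by omega) hpM (by omega) ?_)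
    rintro r4 A4 m4 t4 fr4 hmin ⟨b, hb, e118, hbv⟩ ht4
    obtain rfl : A4 = A := fr4.2.1 (by decide)
    have ev4 : Ev P.δ m m4 := fr4.2.2.1 (by decide)
    have hlim4 := P.lim_mono ev4.a_le
    have k : ∀ y, y ∉ [114, 115, 118, 119, 120] → r4 y = r2 y := fun y hy => by
      rw [fr4.1 y (by simp at hy; simp [pqScan, Cmd.clob, blk, Ins.toCmd]; omega), f3 y (by simp at hy ⊢; omega)]
    have e120 : (r4 120).val = pcell n S g (ncnt A4 g) := by rw [fr4.1 120 (by decide), g120]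
    -- read the minimum again
    refine wp_seq (by omega) (wp_load (by omega) fun m5 ev5 => ?_)
    have hlim5 := P.lim_mono ev5.a_le
    have ev45 := ev4.trans ev5
    rw [e118]
    suffices hst : wp P (.cond (.eq 114 119) .skip (blk [.op .sub 114 119 3]))
        (fun r' A' m' t' => (∀ y, y ≠ 114 → r' y = r4 y) ∧ A' = A4 ∧ m' = m5 ∧ t' ≤ t4 + 8 ∧
          (r' 114).val = (r4 119).val ∧ (r' 114).src = (m5.mem (pcell n S g b)).src)
        (update r4 114 (m5.mem (pcell n S g b))) A4 m5 (t4 + 1 + 1 + 1) by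
      refine wp_seq (by omega) (wp_mono _ hst ?_)
      rintro r5 A5 m5 t5 ⟨f5, rfl, rfl, ht5, hv1, hv2⟩
      have p : ∀ y, y ∉ [114, 115, 118, 119, 120] → r5 y = r2 y := fun y hy => by
        rw [f5 y (by simp at hy; omega), k y hy]
      have p120 : (r5 120).val = pcell n S g (ncnt A5 g) := by rw [f5 120 (by decide), e120]
      have p1 : (r5 1).val = S := by rw [p 1 (by decide), q1]
      have p118 : (r5 118).val = pcell n S g b := by rw [f5 118 (by decide), e118]
      have hlast : pcell n S g (ncnt A5 g) - S = pcell n S g (ncnt A5 g - 1) := by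
        obtain ⟨c, hc⟩ := Nat.exists_eq_succ_of_ne_zero h1
        rw [hc]; simp [pcell, Nat.succ_mul]; omega
      refine wp_blk_seq (by simp; omega) ?_
      simp [wpB, Op.ok, Op.ev, p120, p1, hlast]
      refine wp_seq (by omega) (wp_load (by omega) fun m6 ev6 => ?_)
      have hlim6 := P.lim_mono ev6.a_le
      simp only [Function.update_self]
      refine wp_seq (by omega) (wp_store (by omega) fun m7 ev7 => ?_)
      have hlim7 := P.lim_mono ev7.a_le
      simp [p118]
      refine wp_blk _ (by simp [FState.put]; omega) ?_
      simp [wpB, Op.ok, Op.ev, p 112 (by decide), g112, p 117 (by decide), g117, p 116 (by decide),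
        g116, p 4 (by decide), q4]
      refine ⟨by omega, by omega, hQ' _ _ _ _ ?_⟩
      obtain ⟨B, hB⟩ : ∃ B, B = update (update A5 (128 + 16 * (S + g) + 7) (r5 114))
        (128 + 16 * g + 8) ⟨ncnt A5 g - 1, none⟩ := ⟨_, rfl⟩
      rw [← hB]
      have k1 : ∀ j, nwin B j = nwin A5 j := fun j => by
        simp only [hB, nwin]
        rw [Function.update_of_ne (by omega), Function.update_of_ne (by omega)]
      have k2 : ∀ j, j ≠ S + g → nval B j = nval A5 j := fun j hj => by
        simp only [hB, nval]
        rw [Function.update_of_ne (by omega), Function.update_of_ne (by omega)]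
      have k3 : nval B (S + g) = r5 114 := by
        simp only [hB, nval]
        rw [Function.update_of_ne (by omega), Function.update_self]
      have k4 : ∀ x, x ≠ g → ncnt B x = ncnt A5 x := fun j hj => by
        simp only [hB, ncnt]
        rw [Function.update_of_ne (by omega), Function.update_of_ne (by omega)]
      have k5 : ncnt B g = ncnt A5 g - 1 := by simp [hB, ncnt]
      have k6 : ArrHi A5 B := fun x hx => by
        rw [hB, Function.update_of_ne (by omega), Function.update_of_ne (by omega)]
      have ev46 := ev45.trans ev6
      have ev47 := ev46.trans ev7
      -- The last word is read before the final store, the other ones count at the time of the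
      -- store. The mixed memory makes the replacement look instantaneous.
      have hmix : ∀ p, (if p = pcell n S g (ncnt A5 g - 1) then m6.mem p else m7.mem p).src ≠ none →
          (if p = pcell n S g (ncnt A5 g - 1) then m6.mem p else m7.mem p) = m.mem p ∧
          (if p = pcell n S g (ncnt A5 g - 1) then m6.mem p else m7.mem p) = m4.mem p := by
        intro p hp
        split_ifs at hp ⊢
        · exact ⟨ev46.src_ne hp, (ev5.trans ev6).src_ne hp⟩
        · exact ⟨ev47.src_ne hp, ((ev5.trans ev6).trans ev7).src_ne hp⟩
      obtain ⟨Fa, ev'⟩ := ev47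
      refine ⟨Fa, (ev'.mono (Set.empty_subset _)).put (by simp [pcell]; omega) _, ?_, ?_,
        by simp [p 65 (by decide), g65], by simp [p 62 (by decide), g62], ?_, k6, by omega⟩
      · refine (hpq.toPQ0.sub fun p hp => (hmix p hp).1).pop_cell hgS hb ?_ ?_ k1 k2 k4 k5
          (mem' := (m7.put (pcell n S g b) (m6.mem (pcell n S g (ncnt A5 g - 1)))).mem) ?_ ?_
        · intro i hi hs
          have e := (hmix _ hs).2
          rw [e] at hs ⊢
          rw [k3, hv1]
          exact hmin i hi hs
        · rw [k3, hv2, hv1]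
          intro hs
          have h5 := ev5.src_ne hs
          rw [h5] at hs
          rw [← hbv hs, ← h5]
          rw [← h5] at hs
          have e := ev45.src_ne hs
          rw [e] at hs ⊢
          exact hpq.loc g hgS b hb hs
        · intro p hp hp'
          simp only [FState.put]
          rw [Function.update_of_ne hp, if_neg hp']
        · intro hne
          simp [FState.put]
      · exact tree_update_leaf hpq.tree (fun j hj => ⟨k1 j, k2 j hj⟩) (by omega)
      · obtain ⟨last, hlastd⟩ : ∃ last, last = pcell n S g (ncnt A5 g - 1) := ⟨_, rfl⟩
        have hnl : Loc.f last ∉ pqL n S B Fr {62} := by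
          rw [hlastd]
          rintro (h | ⟨g', h2, i', h3, h4⟩)
          · have := hFr _ h; simp [pcell] at this; omega
          · obtain ⟨rfl, rfl⟩ := pcell_inj hgS h2 h4
            omega
        have hbn : pcell n S g b ∉ Fr := fun h => by
          have := hFr _ h; simp [pcell] at this; omega
        have hlm : Loc.f last ∈ pqL n S A5 Fr ∅ := by
          rw [hlastd]; exact Or.inr ⟨g, hgS, ncnt A5 g - 1, by omega, rfl⟩
        have hbm : Loc.f (pcell n S g b) ∈ pqL n S A5 Fr ∅ := Or.inr ⟨g, hgS, b, hb, rfl⟩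
        rw [← hlastd]
        -- The contents move along a chain: last cell to cell `b`, cell `b` to the leaf, leaf to
        -- register `62`. If `b` is the last cell, the chain is shorter by one.
        refine hG2.map (fun x => if x = .g 62 then .a (128 + 16 * (S + g) + 7) else
            if x = .a (128 + 16 * (S + g) + 7) then .f (pcell n S g b) else
            if x = .f (pcell n S g b) then .f last else x) ev'.cor ?_ ?_ ?_
        · intro x hx
          by_cases e1 : x = .g 62
          · subst e1
            simp only [if_true]
            exact ⟨⟨g, hgS, hg2, rfl⟩, Or.inl (by simp [rd, p 62 (by decide), g62, nval])⟩
          rw [if_neg e1]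
          by_cases e2 : x = .a (128 + 16 * (S + g) + 7)
          · subst e2
            simp only [if_true]
            refine ⟨hbm, ?_⟩
            have : (B (128 + 16 * (S + g) + 7)).src = (m5.mem (pcell n S g b)).src := by
              rw [← hv2, ← k3]; rfl
            simp only [rd, this]
            exact (ev45.src_or _).imp id fun h => ⟨h.1, fun i hi =>
              (ev6.trans ev7).cor (h.2 i hi)⟩
          rw [if_neg e2]
          by_cases e3 : x = .f (pcell n S g b)
          · subst e3
            simp only [if_true]
            refine ⟨hlm, ?_⟩
            simp only [rd, FState.put, Function.update_self]
            exact (ev46.src_or _).imp id fun h => ⟨h.1, fun i hi => ev7.cor (h.2 i hi)⟩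
          rw [if_neg e3]
          cases x with
          | f q =>
            refine ⟨?_, ?_⟩
            · rcases hx with h | ⟨g', h2, i', h3, h4⟩
              · exact Or.inl h
              · refine Or.inr ⟨g', h2, i', ?_, h4⟩
                by_cases e : g' = g
                · subst e; omega
                · rwa [k4 g' e] at h3
            · simp only [rd, FState.put]
              rw [Function.update_of_ne (by simpa using e3)]
              exact Ev.src_or ⟨Fa, ev'⟩ _
          | a x =>
            obtain ⟨g', h2, h3, rfl⟩ := hx
            refine ⟨⟨g', h2, by rwa [k1] at h3, rfl⟩, Or.inl ?_⟩
            exact congrArg Word.src (k2 (S + g') (by simp at e2; omega))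
          | g x => exact absurd (congrArg Loc.g (show x = 62 from hx)) e1
        · intro x hx y hy hxy
          grind
        · intro y hy
          cases y with
          | f q =>
            by_cases e : q = pcell n S g b
            · exact ⟨.a (128 + 16 * (S + g) + 7), ⟨g, hgS, by rwa [k1], rfl⟩, by simp [e]⟩
            · by_cases e' : q = last
              · refine ⟨.f (pcell n S g b), Or.inr ⟨g, hgS, b, ?_, rfl⟩, by simp [e']⟩
                rw [k5]
                by_contra hlt
                exact e (by rw [e', hlastd]; congr 1; omega)
              · refine ⟨.f q, ?_, by simp [e]⟩
                rcases hy with h | ⟨g', h2, i', h3, h4⟩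
                · exact Or.inl h
                · refine Or.inr ⟨g', h2, i', ?_, h4⟩
                  by_cases e : g' = g
                  · subst e
                    have : i' ≠ ncnt A5 g' - 1 := by rintro rfl; exact e' (h4.trans hlastd.symm)
                    omega
                  · rwa [k4 g' e]
          | a x =>
            by_cases e : x = 128 + 16 * (S + g) + 7
            · exact ⟨.g 62, rfl, by simp [e]⟩
            · obtain ⟨g', h2, h3, h4⟩ := hy
              exact ⟨.a x, ⟨g', h2, by rwa [k1], h4⟩, by simp [e]⟩
          | g x => exact absurd hy (by simp [mem_pqL_g])
    refine wp_cond (by omega) ?_ ?_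
    · intro h2
      simp [Test.ev] at h2
      refine wp_skip (by omega) ?_
      simp +contextual [h2]
    · intro h2
      simp [Test.ev] at h2
      refine wp_blk _ (by simp; omega) ?_
      simp +contextual [wpB, Op.ok, Op.ev, k 3 (by decide), q3]
      -- If the word had kept its provenance, it would be unchanged since the scan, and the second
      -- reading would agree with the first. So dropping the provenance by subtracting zero loses
      -- nothing.
      by_contra hne
      exact h2 ((ev5.src_ne (Ne.symm hne)) ▸ hbv ((ev5.src_ne (Ne.symm hne)) ▸ (Ne.symm hne)))

/-! ### Runs with verified blocks. -/

/-- A sorted run that is being merged: verified blocks `kf ≤ k < kl`, where block `k` occupies the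
addresses from `S k` to `E k` and separates at the value `C k`, and unverified words from `u` to
`h`. -/
structure Run where
  b : ℕ
  kf : ℕ
  kl : ℕ
  u : ℕ
  h : ℕ
  S : ℕ → ℕ
  E : ℕ → ℕ
  C : ℕ → ℕ

def Run.Blk (R : Run) (k p : ℕ) : Prop := (R.kf ≤ k ∧ k < R.kl) ∧ R.S k ≤ p ∧ p < R.E k

def Run.Zone (R : Run) (p : ℕ) : Prop := R.u ≤ p ∧ p < R.h

def Run.Cell (R : Run) (p : ℕ) : Prop := (∃ k, R.Blk k p) ∨ R.Zone p

def Run.size (R : Run) : ℕ := ∑ k ∈ Finset.Ico R.kf R.kl, (R.E k - R.S k) + (R.h - R.u)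

/-- The geometry of a run. -/
structure Run.Geo (R : Run) (K S w : ℕ) : Prop where
  kle : R.kf ≤ R.kl
  klS : R.kl ≤ R.kf + S + 1
  se : ∀ k, R.kf ≤ k → k < R.kl → R.b ≤ R.S k ∧ R.S k ≤ R.E k ∧ R.E k ≤ R.u ∧
    R.E k ≤ R.S k + min K w
  next : ∀ k, R.kf ≤ k → k + 1 < R.kl → R.E k ≤ R.S (k + 1)
  bu : R.b ≤ R.u
  uh : R.u ≤ R.h
  hw : R.h ≤ R.b + w
  full : R.u < R.h → ∀ k, R.kf < k → k < R.kl → R.E k = R.S k + K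

/-- What is known about the words that were not hit by a fault since they were written. -/
structure Run.Val (R : Run) (mem : ℕ → Word) (bad : Finset ℕ) (lo : ℕ) : Prop where
  sorted : ∀ p q, R.Cell p → R.Cell q → p < q → p ∉ bad → q ∉ bad → (mem p).val ≤ (mem q).val
  up : ∀ k p, R.Blk k p → p ∉ bad → (mem p).val ≤ R.C k
  low : ∀ k p, R.kf ≤ k → R.Blk (k + 1) p → p ∉ bad → R.C k ≤ (mem p).val
  mono : ∀ k, R.kf ≤ k → k + 1 < R.kl → R.C k ≤ R.C (k + 1)
  ge : ∀ p, R.Cell p → p ∉ bad → lo ≤ (mem p).val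
  geC : ∀ k, R.kf ≤ k → k < R.kl → lo ≤ R.C k

theorem Run.Geo.le {R : Run} {K S w : ℕ} (h : R.Geo K S w) {k j : ℕ} (hk : R.kf ≤ k) (hkj : k < j)
    (hj : j < R.kl) : R.E k ≤ R.S j := by
  induction j, hkj using Nat.le_induction with
  | base => exact h.next k hk hj
  | succ j hkj ih =>
    have h1 := ih (by omega)
    have h2 := (h.se j (by omega) (by omega)).2.1
    have h3 := h.next j (by omega) hj
    omega

theorem Run.Val.mono_le {R : Run} {mem : ℕ → Word} {bad : Finset ℕ} {lo : ℕ}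
    (h : R.Val mem bad lo) {k j : ℕ} (hk : R.kf ≤ k) (hkj : k ≤ j) (hj : j < R.kl) :
    R.C k ≤ R.C j := by
  induction j, hkj using Nat.le_induction with
  | base => exact le_rfl
  | succ j hkj ih => exact (ih (by omega)).trans (h.mono j (by omega) hj)

/-- Words of a run that were moved in an order-preserving way. -/
theorem Run.Val.reloc {R R' : Run} {mem mem' : ℕ → Word} {bad bad' : Finset ℕ} {lo : ℕ}
    (h : R.Val mem bad lo) (φ : ℕ → ℕ) (hkf : R.kf ≤ R'.kf) (hkl : R'.kl ≤ R.kl)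
    (hC : ∀ k, R'.kf ≤ k → k < R'.kl → R'.C k = R.C k)
    (hblk : ∀ k p, R'.Blk k p → R.Blk k (φ p)) (hz : ∀ p, R'.Zone p → R.Cell (φ p))
    (hφ : ∀ p q, R'.Cell p → R'.Cell q → p < q → φ p < φ q)
    (hm : ∀ p, R'.Cell p → p ∉ bad' → φ p ∉ bad ∧ mem' p = mem (φ p)) : R'.Val mem' bad' lo := by
  have hcell : ∀ p, R'.Cell p → R.Cell (φ p) := by
    rintro p (⟨k, hk⟩ | hp)
    · exact Or.inl ⟨k, hblk k p hk⟩
    · exact hz p hp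
  constructor
  · intro p q hp hq hpq hpb hqb
    obtain ⟨a1, a2⟩ := hm p hp hpb
    obtain ⟨b1, b2⟩ := hm q hq hqb
    rw [a2, b2]
    exact h.sorted _ _ (hcell p hp) (hcell q hq) (hφ p q hp hq hpq) a1 b1
  · intro k p hp hpb
    obtain ⟨a1, a2⟩ := hm p (Or.inl ⟨k, hp⟩) hpb
    rw [a2, hC k hp.1.1 hp.1.2]
    exact h.up k _ (hblk k p hp) a1
  · intro k p hk hp hpb
    obtain ⟨a1, a2⟩ := hm p (Or.inl ⟨k + 1, hp⟩) hpb
    rw [a2, hC k hk (by have := hp.1.2; omega)]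
    exact h.low k _ (by omega) (hblk _ p hp) a1
  · intro k hk hk'
    rw [hC k hk (by omega), hC (k + 1) (by omega) hk']
    exact h.mono k (by omega) (by omega)
  · intro p hp hpb
    obtain ⟨a1, a2⟩ := hm p hp hpb
    rw [a2]
    exact h.ge _ (hcell p hp) a1
  · intro k hk hk'
    rw [hC k hk hk']
    exact h.geC k (by omega) (by omega)

theorem Run.Val.sub {R : Run} {mem mem' : ℕ → Word} {bad bad' : Finset ℕ} {lo : ℕ}
    (h : R.Val mem bad lo) (hm : ∀ p, R.Cell p → p ∉ bad' → p ∉ bad ∧ mem' p = mem p) :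
    R.Val mem' bad' lo :=
  h.reloc id le_rfl le_rfl (fun _ _ _ => rfl) (fun _ _ h => h) (fun _ h => Or.inr h)
    (fun _ _ _ _ h => h) hm

/-- If all slots of the table are in use, there are too many verified words for all of them to be
corrupted. -/
theorem Run.Val.cover {R : Run} {mem : ℕ → Word} {bad : Finset ℕ} {lo S w δ z : ℕ}
    (h : R.Val mem bad lo) (hg : R.Geo (δ / S + 1) S w) (hS : 1 ≤ S) (hb : bad.card ≤ δ)
    (hkl : R.kl = R.kf + S + 1) (hz : R.Zone z) (hzb : z ∉ bad) : R.C R.kf ≤ (mem z).val := by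
  -- The `S` blocks behind the front have more words than there can be faults; the block length is
  -- chosen for this.
  have hK : δ < S * (δ / S + 1) := by
    have h1 := Nat.div_add_mod δ S
    have h2 := Nat.mod_lt δ hS
    rw [mul_add]; omega
  set K := δ / S + 1 with hKd
  have hfull := hg.full (lt_of_le_of_lt hz.1 hz.2)
  -- Lists all words of the blocks `kf + 1, …, kf + S`, each of which is full as unverified words
  -- remain.
  let f : ℕ × ℕ → ℕ := fun x => R.S (R.kf + 1 + x.1) + x.2
  have hf : ∀ x ∈ Finset.range S ×ˢ Finset.range K, R.Blk (R.kf + 1 + x.1) (f x) := by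
    rintro ⟨j, i⟩ hx
    simp only [Finset.mem_product, Finset.mem_range] at hx
    refine ⟨⟨by omega, by omega⟩, by simp [f], ?_⟩
    rw [hfull _ (by omega) (by omega)]
    simp [f, hx.2]
  have hinj : Set.InjOn f (Finset.range S ×ˢ Finset.range K : Finset (ℕ × ℕ)) := by
    rintro ⟨j, i⟩ hx ⟨j', i'⟩ hx' e
    have h1 := hf _ hx
    have h2 := hf _ hx'
    rw [e] at h1
    have hj : j = j' := by
      simp only [Run.Blk] at h1 h2
      rcases lt_trichotomy j j' with hlt | rfl | hlt
      · have := hg.le (k := R.kf + 1 + j) (j := R.kf + 1 + j') (by omega) (by omega) (by omega)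
        omega
      · rfl
      · have := hg.le (k := R.kf + 1 + j') (j := R.kf + 1 + j) (by omega) (by omega) (by omega)
        omega
    subst hj
    simp only [f] at e
    simp; omega
  have hcard := Finset.card_image_of_injOn hinj
  rw [Finset.card_product, Finset.card_range, Finset.card_range] at hcard
  obtain ⟨q, hq, hqb⟩ := Finset.exists_mem_notMem_of_card_lt_card (s := bad) (t := (Finset.range S ×ˢ
    Finset.range K).image f) (by omega)
  obtain ⟨x, hx, rfl⟩ := Finset.mem_image.1 hq
  have hblk := hf x hx
  -- The chain from the first separator up to the block before that of the good word, on to the good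
  -- word itself, and by sortedness to `z`.
  have h1 : R.C R.kf ≤ R.C (R.kf + x.1) := h.mono_le le_rfl (by omega) (by have := hblk.1.2; omega)
  have h2 := h.low (R.kf + x.1) (f x) (by omega)
    (by rw [show R.kf + x.1 + 1 = R.kf + 1 + x.1 by omega]; exact hblk) hqb
  have h3 := (hg.se _ hblk.1.1 hblk.1.2).2.2.1
  have h4 := hblk.2.2
  have h5 := hz.1
  have h6 := h.sorted _ z (Or.inl ⟨_, hblk⟩) (Or.inr hz) (by omega) hqb hzb
  omega

/-! ### Hit addresses and live words under a move. -/

/-- The address from which the word at `p` was moved. -/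
def og (s d c p : ℕ) : ℕ := if d - c ≤ p ∧ p < d then p + s - d else p

/-- The corrupted words after a move. -/
def sbad (bad : Finset ℕ) (s d c : ℕ) : Finset ℕ :=
  (bad.filter fun p => ¬ (s - c ≤ p ∧ p < s) ∧ ¬ (d - c ≤ p ∧ p < d)) ∪
    (bad.filter fun p => s - c ≤ p ∧ p < s).image fun p => p + d - s

/-- Addresses in the source are renamed, those overwritten in the destination are dropped, and the
others remain. -/
theorem sbad_card (bad : Finset ℕ) (s d c : ℕ) : (sbad bad s d c).card ≤ bad.card := by
  have h1 := Finset.card_union_le (bad.filter fun p => ¬ (s - c ≤ p ∧ p < s) ∧ ¬ (d - c ≤ p ∧ p < d))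
    ((bad.filter fun p => s - c ≤ p ∧ p < s).image fun p => p + d - s)
  have h2 := Finset.card_image_le (s := bad.filter fun p => s - c ≤ p ∧ p < s)
    (f := fun p => p + d - s)
  have h3 : (bad.filter fun p => ¬ (s - c ≤ p ∧ p < s) ∧ ¬ (d - c ≤ p ∧ p < d)).card ≤
      (bad.filter fun p => ¬ (s - c ≤ p ∧ p < s)).card :=
    Finset.card_le_card fun p hp => by simp only [Finset.mem_filter] at hp ⊢; exact ⟨hp.1, hp.2.1⟩
  have h4 := Finset.card_filter_add_card_filter_not (s := bad) (fun p => s - c ≤ p ∧ p < s)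
  unfold sbad
  omega

theorem mem_sbad {bad : Finset ℕ} {s d c p : ℕ} (hs : c ≤ s) (hd : c ≤ d) (hp : p ∉ deadZone s d c) :
    p ∈ sbad bad s d c ↔ og s d c p ∈ bad := by
  simp only [deadZone, Set.mem_ofPred_eq] at hp
  simp only [sbad, og, Finset.mem_union, Finset.mem_filter, Finset.mem_image]
  by_cases h : d - c ≤ p ∧ p < d
  · rw [if_pos h]
    constructor
    · rintro (⟨-, -, h'⟩ | ⟨q, ⟨h1, h2⟩, rfl⟩)
      · exact absurd h h'
      · rwa [show q + d - s + s - d = q by omega]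
    · intro hb
      exact Or.inr ⟨p + s - d, ⟨hb, by omega⟩, by omega⟩
  · rw [if_neg h]
    constructor
    · rintro (⟨h', -⟩ | ⟨q, ⟨h1, h2⟩, rfl⟩)
      · exact h'
      · exact absurd (by omega) h
    · intro hb
      exact Or.inl ⟨hb, by omega, h⟩

theorem moved_mem {m : FState} {s d c p : ℕ} : (m.moved s d c).mem p = m.mem (og s d c p) := by
  simp only [FState.moved, og]
  split_ifs <;> rfl

theorem EvF.moved_good {δ s d c : ℕ} {F : Finset ℕ} {m m' : FState} (bad : Finset ℕ)
    (ev : EvF δ (deadZone s d c) F (m.moved s d c) m') (hs : c ≤ s) (hd : c ≤ d) {p : ℕ}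
    (hp : p ∉ deadZone s d c) (hb : p ∉ sbad bad s d c ∪ F) :
    og s d c p ∉ bad ∧ m'.mem p = m.mem (og s d c p) := by
  rw [Finset.mem_union, not_or, mem_sbad hs hd hp] at hb
  exact ⟨hb.1, by rw [ev.same p hp hb.2, moved_mem]⟩

theorem EvF.moved_src {δ s d c : ℕ} {F : Finset ℕ} {m m' : FState} (bad : Finset ℕ)
    (ev : EvF δ (deadZone s d c) F (m.moved s d c) m') (hs : c ≤ s) (hd : c ≤ d) {p : ℕ}
    (hp : p ∉ deadZone s d c) (hsrc : (m'.mem p).src ≠ none)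
    (hc : (m.mem (og s d c p)).src ≠ none → og s d c p ∉ bad) : p ∉ sbad bad s d c ∪ F := by
  obtain ⟨h1, h2⟩ := ev.src_ne hp hsrc
  rw [h2, moved_mem] at hsrc
  rw [Finset.mem_union, not_or, mem_sbad hs hd hp]
  exact ⟨hc hsrc, h1⟩

/-- The relocation is `og`. It is injective off the vacated cells; by `hdead` no live word is
overwritten, so it also reaches every live word. The queue lies above `2 * n` and is not affected.
-/
theorem Good.moved {n S s d c : ℕ} {r A : ℕ → Word} {m : FState} {cor : Set ℕ} {Fr Fr' R : Set ℕ}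
    (h : Good n (rd r A m.mem) cor (pqL n S A Fr R)) (hs : c ≤ s) (hd : c ≤ d)
    (hsn : s ≤ 2 * n) (hdn : d ≤ 2 * n) (hFr : ∀ p ∈ Fr, p < 2 * n)
    (hFr' : ∀ p, p ∈ Fr' ↔ p ∉ deadZone s d c ∧ og s d c p ∈ Fr)
    (hdead : ∀ p, d - c ≤ p → p < d → ¬ (s - c ≤ p ∧ p < s) → p ∉ Fr) :
    Good n (rd r A (m.moved s d c).mem) cor (pqL n S A Fr' R) := by
  have hcell : ∀ g i, og s d c (pcell n S g i) = pcell n S g i := fun g i => by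
    unfold og pcell; rw [if_neg (by omega)]
  have hno : ∀ g i, pcell n S g i ∉ Fr := fun g i hp => by
    have := hFr _ hp; unfold pcell at this; omega
  have hog : ∀ p, og s d c p ∈ Fr → p < 2 * n := fun p hp => by
    have := hFr _ hp
    unfold og at this
    split_ifs at this <;> omega
  have hinj : ∀ p q, p ∉ deadZone s d c → q ∉ deadZone s d c → og s d c p = og s d c q → p = q := by
    intro p q hp hq
    simp only [deadZone, Set.mem_ofPred_eq] at hp hq
    unfold og
    split_ifs <;> omega
  have hcd : ∀ g i, pcell n S g i ∉ deadZone s d c := fun g i => by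
    simp only [deadZone, Set.mem_ofPred_eq]; unfold pcell; omega
  have hmd : ∀ p, Loc.f p ∈ pqL n S A Fr' R → p ∉ deadZone s d c := by
    rintro p (hp | ⟨g, -, i, -, rfl⟩)
    · exact ((hFr' p).1 hp).1
    · exact hcd g i
  refine h.map (fun x => match x with | .f p => .f (og s d c p) | y => y) subset_rfl ?_ ?_ ?_
  · intro x hx
    cases x with
    | f p =>
      refine ⟨?_, Or.inl (by simp only [rd, moved_mem])⟩
      rcases hx with hx | ⟨g, h1, i, h2, rfl⟩
      · exact Or.inl ((hFr' p).1 hx).2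
      · exact Or.inr ⟨g, h1, i, h2, hcell g i⟩
    | a x => exact ⟨hx, Or.inl rfl⟩
    | g x => exact ⟨hx, Or.inl rfl⟩
  · intro x hx y hy e
    cases x <;> cases y <;> simp only [Loc.f.injEq, reduceCtorEq] at e ⊢ <;> try exact e
    exact hinj _ _ (hmd _ hx) (hmd _ hy) e
  · intro y hy
    cases y with
    | f p =>
      rcases hy with hy | ⟨g, h1, i, h2, rfl⟩
      · by_cases hsrc : s - c ≤ p ∧ p < s
        · refine ⟨.f (p + d - s), Or.inl ((hFr' _).2 ⟨?_, ?_⟩), ?_⟩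
          · simp only [deadZone, Set.mem_ofPred_eq]; omega
          · unfold og; rw [if_pos (by omega), show p + d - s + s - d = p by omega]; exact hy
          · simp only [og]; rw [if_pos (by omega), show p + d - s + s - d = p by omega]
        · have hnd : ¬ (d - c ≤ p ∧ p < d) := fun hd' => hdead p hd'.1 hd'.2 hsrc hy
          refine ⟨.f p, Or.inl ((hFr' _).2 ⟨?_, ?_⟩), ?_⟩
          · simp only [deadZone, Set.mem_ofPred_eq]; omega
          · unfold og; rw [if_neg hnd]; exact hy
          · simp only [og]; rw [if_neg hnd]
      · exact ⟨.f (pcell n S g i), Or.inr ⟨g, h1, i, h2, rfl⟩, by simp only [hcell]⟩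
    | a x => exact ⟨.a x, hy, rfl⟩
    | g x => exact ⟨.g x, hy, rfl⟩

/-! ### The state of a merge and the emission of words. -/

/-- Parameters of a merge of two runs of length at most `w` in the words `plo ≤ p < phi`. -/
structure Ctx where
  P : Par
  n : ℕ
  S : ℕ
  l : ℕ
  plo : ℕ
  phi : ℕ
  w : ℕ
  Bh : ℕ
  Rest : ℕ
  Rel : ℕ → ℕ → Prop

def Ctx.K (c : Ctx) : ℕ := c.P.K c.S

/-- The credit of an element of the priority queue. -/
def Ctx.cp (c : Ctx) : ℕ := 5000 * c.K + 200 * c.l + 5000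

/-- `Bh` is what a single insertion may spend. `hM` leaves room for block indices, which are never
reset during a merge. -/
structure Ctx.Ok (c : Ctx) : Prop where
  ok : c.P.Ok c.n c.S
  hl : c.S ≤ 2 ^ c.l
  hB : c.P.B = 2 * c.Bh
  hBh : 30000 * c.K + 1000 * c.l + 30000 ≤ c.Bh
  hplo : c.plo ≤ c.phi
  hphi : c.phi ≤ c.n
  hw : 1 ≤ c.w
  hM : 4 * c.n + c.n * (2 * c.P.δ) + 10 ≤ c.P.M

/-- Faulty words that hold keys during a merge, apart from those of the priority queue. -/
def liveF (c : Ctx) (X Y : Run) (o : ℕ) : Set ℕ :=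
  {p | (p < c.n ∧ ¬ (c.plo ≤ p ∧ p < c.phi)) ∨ X.Cell p ∨ Y.Cell p ∨ (c.n ≤ p ∧ p < o)}

def noReg : ℕ → Word := fun _ => ⟨0, none⟩

/-- The state of a merge. The output occupies the words `n ≤ p < o`, it is bounded by `ot`, and the
remaining keys are at least `lo`. -/
structure Core (c : Ctx) (A : ℕ → Word) (m : FState) (bad : Finset ℕ) (X Y : Run)
    (lo o ot ins pn : ℕ) : Prop where
  pq : PQ c.n c.S A m.mem ins pn lo
  gx : X.Geo c.K c.S c.w
  gy : Y.Geo c.K c.S c.w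
  vx : X.Val m.mem bad lo
  vy : Y.Val m.mem bad lo
  xin : c.plo ≤ X.b ∧ X.h ≤ c.phi
  yin : c.plo ≤ Y.b ∧ Y.h ≤ c.phi
  sep : X.h ≤ Y.b ∨ Y.h ≤ X.b
  good : Good c.n (rd noReg A m.mem) m.cor (pqL c.n c.S A (liveF c X Y o) ∅)
  clean : ∀ p ∈ liveF c X Y o, (m.mem p).src ≠ none → p ∉ bad
  outer : ∀ p q, p < q → q < c.n → ¬ (c.plo ≤ p ∧ p < c.phi) → ¬ (c.plo ≤ q ∧ q < c.phi) →
    c.Rel p q → p ∉ bad → q ∉ bad → (m.mem p).val ≤ (m.mem q).val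
  osort : ∀ p q, c.n ≤ p → p < q → q < o → p ∉ bad → q ∉ bad → (m.mem p).val ≤ (m.mem q).val
  obd : ∀ p, c.n ≤ p → p < o → p ∉ bad → (m.mem p).val ≤ ot
  no : c.n ≤ o
  cnt : X.size + Y.size + pn + (o - c.n) = c.phi - c.plo
  card : 2 * bad.card + ins ≤ 2 * m.a
  ale : m.a ≤ c.P.δ
  pnle : pn ≤ ins

theorem Run.Geo.cell {R : Run} {K S w p : ℕ} (h : R.Geo K S w) (hp : R.Cell p) : R.b ≤ p ∧ p < R.h := by
  rcases hp with ⟨k, hk, h1, h2⟩ | ⟨h1, h2⟩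
  · obtain ⟨a, b, c, -⟩ := h.se k hk.1 hk.2
    have := h.uh
    omega
  · have := h.bu
    omega

theorem Core.xcell {c : Ctx} {A m bad X Y lo o ot ins pn} (h : Core c A m bad X Y lo o ot ins pn)
    {p : ℕ} (hp : X.Cell p) : c.plo ≤ p ∧ p < c.phi := by
  have h1 := h.gx.cell hp
  have h2 := h.xin
  omega

theorem liveF_swap (c : Ctx) (X Y : Run) (o : ℕ) : liveF c X Y o = liveF c Y X o := by
  ext p
  simp only [liveF, Set.mem_ofPred_eq]
  tauto

theorem Core.swap {c : Ctx} {A m bad X Y lo o ot ins pn} (h : Core c A m bad X Y lo o ot ins pn) :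
    Core c A m bad Y X lo o ot ins pn :=
  ⟨h.pq, h.gy, h.gx, h.vy, h.vx, h.yin, h.xin, h.sep.symm, liveF_swap c X Y o ▸ h.good,
    liveF_swap c X Y o ▸ h.clean, h.outer, h.osort, h.obd, h.no, by have := h.cnt; omega, h.card, h.ale,
    h.pnle⟩

theorem Core.o_le {c : Ctx} {A m bad X Y lo o ot ins pn} (h : Core c A m bad X Y lo o ot ins pn)
    (hc : c.Ok) : o ≤ 2 * c.n := by
  have h1 := h.cnt
  have h2 := hc.hphi
  have h3 := h.no
  omega

theorem Core.live_lt {c : Ctx} {A m bad X Y lo o ot ins pn} (h : Core c A m bad X Y lo o ot ins pn)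
    (hc : c.Ok) {p : ℕ} (hp : p ∈ liveF c X Y o) : p < o := by
  have h2 := hc.hphi
  have h3 := h.no
  rcases hp with h1 | h1 | h1 | h1
  · omega
  · have := h.xcell h1; omega
  · have := h.swap.xcell h1; omega
  · omega

theorem Core.ins_le {c : Ctx} {A m bad X Y lo o ot ins pn} (h : Core c A m bad X Y lo o ot ins pn) :
    ins ≤ 2 * c.P.δ := by
  have h1 := h.card
  have h2 := h.ale
  omega

/-- Faults, and writes to unused words. -/
theorem Core.step {c : Ctx} {A m bad X Y lo o ot ins pn} (h : Core c A m bad X Y lo o ot ins pn)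
    (hc : c.Ok) {m' : FState} {Z : Set ℕ} {F bad' : Finset ℕ} (ev : EvF c.P.δ Z F m m')
    (hZ : ∀ p ∈ Z, o ≤ p ∧ p < 2 * c.n) (hb : ∀ p ∉ Z, (p ∈ bad' ↔ p ∈ bad ∨ p ∈ F))
    (hcard : bad'.card ≤ bad.card + F.card) : Core c A m' bad' X Y lo o ot ins pn := by
  have hsub : ∀ p, p < o → p ∉ bad' → p ∉ bad ∧ m'.mem p = m.mem p := by
    intro p hp hpb
    have hz : p ∉ Z := fun hz => by have := hZ p hz; omega
    rw [hb p hz, not_or] at hpb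
    exact ⟨hpb.1, ev.same p hz hpb.2⟩
  have hno := h.no
  have hphi := hc.hphi
  have hxc : ∀ p, X.Cell p → p < o := fun p hp => by have := h.xcell hp; omega
  have hyc : ∀ p, Y.Cell p → p < o := fun p hp => by have := h.swap.xcell hp; omega
  refine ⟨h.pq.ev ev fun p hp => (hZ p hp).2, h.gx, h.gy, h.vx.sub fun p hp => hsub p (hxc p hp),
    h.vy.sub fun p hp => hsub p (hyc p hp), h.xin, h.yin, h.sep, ?_, ?_, ?_, ?_, ?_, h.no, h.cnt, ?_,
    ev.le h.ale, h.pnle⟩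
  · refine h.good.ev ev ?_
    rintro p (hp | ⟨g, -, i, -, rfl⟩) hz
    · have := h.live_lt hc hp; have := hZ p hz; omega
    · have := hZ _ hz; unfold pcell at this; omega
  · intro p hp hs
    have hpo := h.live_lt hc hp
    have hz : p ∉ Z := fun hz => by have := hZ p hz; omega
    obtain ⟨h1, h2⟩ := ev.src_ne hz hs
    rw [h2] at hs
    rw [hb p hz, not_or]
    exact ⟨h.clean p hp hs, h1⟩
  · intro p q hpq hq h1 h2 h3 hp' hq'
    obtain ⟨a1, a2⟩ := hsub p (by omega) hp'
    obtain ⟨b1, b2⟩ := hsub q (by omega) hq'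
    rw [a2, b2]
    exact h.outer p q hpq hq h1 h2 h3 a1 b1
  · intro p q h1 hpq hq hp' hq'
    obtain ⟨a1, a2⟩ := hsub p (by omega) hp'
    obtain ⟨b1, b2⟩ := hsub q (by omega) hq'
    rw [a2, b2]
    exact h.osort p q h1 hpq hq a1 b1
  · intro p h1 h2 hp'
    obtain ⟨a1, a2⟩ := hsub p (by omega) hp'
    rw [a2]
    exact h.obd p h1 h2 a1
  · have := ev.card; have := h.card; omega

theorem Core.ev {c : Ctx} {A m bad X Y lo o ot ins pn} (h : Core c A m bad X Y lo o ot ins pn)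
    (hc : c.Ok) {m' : FState} {F : Finset ℕ} (ev : EvF c.P.δ ∅ F m m') :
    Core c A m' (bad ∪ F) X Y lo o ot ins pn :=
  h.step hc ev (by simp) (by simp) (Finset.card_union_le _ _)

/-- Drop the words of the first block below `i`. -/
def Run.cut (R : Run) (i : ℕ) : Run := { R with S := update R.S R.kf i }

theorem Run.cut_blk {R : Run} {i k p : ℕ} (hk : R.kf < R.kl → R.S R.kf ≤ i) :
    (R.cut i).Blk k p ↔ R.Blk k p ∧ (k = R.kf → i ≤ p) := by
  simp only [Run.Blk, Run.cut]
  by_cases e : k = R.kf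
  · subst e
    simp
    constructor
    · rintro ⟨h1, h2, h3⟩; have := hk h1; exact ⟨⟨h1, by omega, h3⟩, h2⟩
    · rintro ⟨⟨h1, -, h3⟩, h2⟩; exact ⟨h1, h2, h3⟩
  · simp [e]

theorem Run.cut_size {R : Run} {i : ℕ} (h : R.kf < R.kl) (h1 : R.S R.kf ≤ i) (h2 : i ≤ R.E R.kf) :
    (R.cut i).size + (i - R.S R.kf) = R.size := by
  simp only [Run.size, Run.cut]
  rw [Finset.sum_eq_sum_Ico_succ_bot h, Finset.sum_eq_sum_Ico_succ_bot h]
  have : ∑ k ∈ Finset.Ico (R.kf + 1) R.kl, (R.E k - update R.S R.kf i k) =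
      ∑ k ∈ Finset.Ico (R.kf + 1) R.kl, (R.E k - R.S k) := by
    refine Finset.sum_congr rfl fun k hk => ?_
    rw [Finset.mem_Ico] at hk
    rw [Function.update_of_ne (by omega)]
  simp [this]
  omega

theorem Run.Geo.cut {R : Run} {K S w i : ℕ} (hg : R.Geo K S w) (h1 : R.kf < R.kl → R.S R.kf ≤ i)
    (h2 : R.kf < R.kl → i ≤ R.E R.kf) : (R.cut i).Geo K S w := by
  have hs : ∀ k, k ≠ R.kf → (R.cut i).S k = R.S k := fun k hk => Function.update_of_ne hk _ _
  refine ⟨hg.kle, hg.klS, ?_, ?_, hg.bu, hg.uh, hg.hw, ?_⟩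
  · intro k h3 h4
    change R.kf ≤ k at h3
    change k < R.kl at h4
    obtain ⟨a, b, c, d⟩ := hg.se k h3 h4
    by_cases e : k = R.kf
    · subst e
      have h5 : (R.cut i).S R.kf = i := Function.update_self _ _ _
      rw [h5]
      have := h1 h4
      have := h2 h4
      change R.b ≤ i ∧ i ≤ R.E R.kf ∧ R.E R.kf ≤ R.u ∧ R.E R.kf ≤ _
      omega
    · rw [hs k e]; exact ⟨a, b, c, d⟩
  · intro k h3 h4
    rw [hs (k + 1) (by change R.kf ≤ k at h3; omega)]
    exact hg.next k h3 h4
  · intro h3 k h4 h5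
    rw [hs k (by change R.kf < k at h4; omega)]
    exact hg.full h3 k h4 h5

theorem Run.Val.cut {R : Run} {mem : ℕ → Word} {bad : Finset ℕ} {lo i : ℕ}
    (hv : R.Val mem bad lo) (h1 : R.kf < R.kl → R.S R.kf ≤ i) : (R.cut i).Val mem bad lo :=
  hv.reloc id le_rfl le_rfl (fun _ _ _ => rfl) (fun _ _ h => ((cut_blk h1).1 h).1)
    (fun _ h => Or.inr h) (fun _ _ _ _ h => h) (fun _ _ h => ⟨h, rfl⟩)

theorem Run.cut_cell {R : Run} {K S w i p : ℕ} (hg : R.Geo K S w) (hk : R.kf < R.kl)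
    (h1 : R.S R.kf ≤ i) (h2 : i ≤ R.E R.kf) :
    (R.cut i).Cell p ↔ R.Cell p ∧ ¬ (R.S R.kf ≤ p ∧ p < i) := by
  have hu := (hg.se R.kf le_rfl hk).2.2.1
  have hz : (R.cut i).Zone p ↔ R.Zone p := Iff.rfl
  simp only [Run.Cell, cut_blk (fun _ => h1), hz]
  constructor
  · rintro (⟨k, h3, h4⟩ | h3)
    · refine ⟨Or.inl ⟨k, h3⟩, fun h5 => ?_⟩
      by_cases e : k = R.kf
      · have := h4 e; omega
      · have := hg.le (k := R.kf) (j := k) le_rfl (by have := h3.1.1; omega) h3.1.2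
        have := h3.2.1
        omega
    · exact ⟨Or.inr h3, fun h5 => by have := h3.1; omega⟩
  · rintro ⟨⟨k, h3⟩ | h3, h4⟩
    · refine Or.inl ⟨k, h3, fun e => ?_⟩
      subst e
      have := h3.2.1
      omega
    · exact Or.inr h3

/-- Write the value in register `111` to the address in register `112`, if possible by copying the
word at the address in register `110`. -/
def emit : Cmd :=
  .load 113 110 ;; .cond (.eq 113 111) .skip (blk [.op .sub 113 111 3]) ;; .store 112 113

/-- The key at `y` was copied or lost. -/
def SrcOr (w w' : Word) (cor' : Set ℕ) : Prop :=
  w'.src = w.src ∨ (w'.src = none ∧ ∀ i, w.src = some i → i ∈ cor')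

/-- The value `v` was decided on earlier, and it must be written even if the cell has changed since.
If the cell still holds `v`, it is moved with its provenance. Otherwise it has been hit or was not
faithful, and `v` is written without provenance, as the result of subtracting zero. -/
theorem wp_emit {P : Par} {r A : ℕ → Word} {m : FState} {t : ℕ} {Q : Post} {p q v : ℕ}
    (h3 : (r 3).val = 0) (h110 : (r 110).val = p) (h111 : (r 111).val = v)
    (h112 : (r 112).val = q) (hv : (m.mem p).src ≠ none → (m.mem p).val = v)
    (ht : t + 12 ≤ P.lim m.a)
    (hQ : ∀ r' A' m' t' F, Frame P.δ emit r A m r' A' m' → EvF P.δ {q} F m m' → q ∉ F →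
      (m'.mem q).val = v → SrcOr (m.mem p) (m'.mem q) m'.cor → t' ≤ t + 12 → Q r' A' m' t') :
    wp P emit Q r A m t := by
  suffices h : wp P emit (fun r' A' m' t' => ∃ F, EvF P.δ {q} F m m' ∧ q ∉ F ∧
      (m'.mem q).val = v ∧ SrcOr (m.mem p) (m'.mem q) m'.cor ∧ t' ≤ t + 12) r A m t from
    wp_mono _ (wp_frame _ h) fun r' A' m' t' h => by
      obtain ⟨⟨F, h1, h2, h3, h4, h5⟩, hf⟩ := h
      exact hQ r' A' m' t' F hf h1 h2 h3 h4 h5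
  refine wp_hide fun Q' hQ' => ?_
  refine wp_seq (by omega) (wp_load (by omega) fun m1 ev1 => ?_)
  have hlim1 := P.lim_mono ev1.a_le
  rw [h110]
  have key : ∀ w : Word, w.val = v → w.src = (m1.mem p).src → ∀ r' t', (r' 112).val = q →
      r' 113 = w → t' ≤ t + 10 → wp P (.store 112 113) Q' r' A m1 t' := by
    intro w hw1 hw2 r' t' e1 e2 ht'
    refine wp_store (by omega) fun m2 ev2 => hQ' _ _ _ _ ?_
    rw [e1, e2]
    obtain ⟨F, ev⟩ := ev1.trans ev2
    have ev' := (ev.mono (Set.empty_subset {q})).put (Set.mem_singleton q) w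
    refine ⟨F.erase q, ⟨?_, ev'.le, ev'.cor, ?_, ?_⟩, by simp, by simp [FState.put, hw1], ?_, by omega⟩
    · have h1 := ev'.card
      have h2 := Finset.card_le_card (Finset.erase_subset q F)
      omega
    · intro x hx hxF
      exact ev'.same x hx (by simp at hx hxF; tauto)
    · intro x hx hxF
      exact ev'.lost x hx (Finset.mem_of_mem_erase hxF)
    · simp only [SrcOr, FState.put, Function.update_self, hw2]
      exact (ev1.src_or p).imp id fun h => ⟨h.1, fun i hi => ev2.cor (h.2 i hi)⟩
  refine wp_seq (by omega) (wp_cond (by omega) ?_ ?_)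
  · intro h
    simp [Test.ev, h111] at h
    exact wp_skip (by omega) (key _ h rfl _ _ (by simp [h112]) (by simp) (by omega))
  · intro h
    simp [Test.ev, h111] at h
    refine wp_blk _ (by simp; omega) ?_
    simp [wpB, Op.ok, Op.ev, h3, h111]
    -- A word with a provenance would be unchanged and equal to `v`, so the missing provenance
    -- agrees with that of the cell.
    refine key ⟨v, none⟩ rfl ?_ _ _ (by simp [h112]) (by simp) (by omega)
    by_contra hne
    have e := ev1.src_ne (Ne.symm hne)
    rw [e] at h hne
    exact h (hv (Ne.symm hne))

theorem Core.disj {c : Ctx} {A m bad X Y lo o ot ins pn} (h : Core c A m bad X Y lo o ot ins pn)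
    {p : ℕ} (hp : X.Cell p) : ¬ Y.Cell p := by
  intro hq
  have h1 := h.gx.cell hp
  have h2 := h.gy.cell hq
  have h3 := h.sep
  omega

theorem EvF.srcOr {δ : ℕ} {Z : Set ℕ} {F : Finset ℕ} {m m' : FState} (h : EvF δ Z F m m') {p : ℕ}
    (hp : p ∉ Z) : SrcOr (m.mem p) (m'.mem p) m'.cor := by
  by_cases hF : p ∈ F
  · exact Or.inr (h.lost p hp hF)
  · exact Or.inl (by rw [h.same p hp hF])

/-- A bad address is a fault not yet charged, so it covers two more insertions. -/
theorem Core.a_pos {c : Ctx} {A m bad X Y lo o ot ins pn} (h : Core c A m bad X Y lo o ot ins pn)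
    {p : ℕ} (hp : p ∈ bad) : ins + 2 ≤ 2 * m.a := by
  have h1 := h.card
  have h2 : 0 < bad.card := Finset.card_pos.2 ⟨p, hp⟩
  omega

/-- The first remaining word of a run is written to the output. -/
theorem Core.emit_cell {c : Ctx} {A m bad X Y lo o ot ins pn}
    (h : Core c A m bad X Y lo o ot ins pn) (hc : c.Ok) (hk : X.kf < X.kl)
    (hi : X.S X.kf < X.E X.kf) {m' : FState} {F : Finset ℕ} {v : ℕ} (ev : EvF c.P.δ {o} F m m')
    (hv : (m'.mem o).val = v) (hsrc : SrcOr (m.mem (X.S X.kf)) (m'.mem o) m'.cor)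
    (hout : ∀ p, c.n ≤ p → p < o → p ∉ bad → (m.mem p).val ≤ v) (hvo : v ≤ ot) :
    Core c A m' ((bad ∪ F).erase o) (X.cut (X.S X.kf + 1)) Y lo (o + 1) ot ins pn := by
  obtain ⟨i, hi'⟩ : ∃ i, i = X.S X.kf := ⟨_, rfl⟩
  rw [← hi'] at hi hsrc ⊢
  have hcell : ∀ p, (X.cut (i + 1)).Cell p ↔ X.Cell p ∧ p ≠ i := fun p => by
    rw [Run.cut_cell h.gx hk (by omega) (by omega)]
    exact and_congr_right fun _ => by omega
  have hXi : X.Cell i := Or.inl ⟨X.kf, ⟨le_rfl, hk⟩, by omega, hi⟩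
  have hin := h.xcell hXi
  have hphi := hc.hphi
  have hno := h.no
  have hsz : 1 ≤ X.size := by
    have := Run.cut_size (i := i + 1) hk (by omega) hi
    omega
  have ho : o < 2 * c.n := by have := h.cnt; omega
  have hs := h.step hc (bad' := (bad ∪ F).erase o) ev (by rintro p rfl; omega)
    (fun p hp => by simp at hp; simp [hp])
    ((Finset.card_le_card (Finset.erase_subset _ _)).trans (Finset.card_union_le _ _))
  have hob : ∀ p, c.n ≤ p → p < o → p ∉ (bad ∪ F).erase o → (m'.mem p).val ≤ v := by
    intro p h1 h2 h3
    have hpo : p ≠ o := by omega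
    simp [hpo] at h3
    rw [ev.same p (by simpa using hpo) h3.2]
    exact hout p h1 h2 h3.1
  have hlive : ∀ p, p ∈ liveF c (X.cut (i + 1)) Y (o + 1) ↔ p = o ∨ (p ∈ liveF c X Y o ∧ p ≠ i) := by
    intro p
    have hYi : p = i → ¬ Y.Cell p := by rintro rfl; exact h.disj hXi
    simp only [liveF, Set.mem_ofPred_eq, hcell]
    by_cases e : p = o
    · subst e; simp; right; right; right; omega
    · by_cases e' : p = i
      · subst e'; simp [hYi rfl, e]; omega
      · have : p < o + 1 ↔ p < o := by omega
        simp [e, e', this]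
  refine ⟨hs.pq, h.gx.cut (by omega) (by omega), h.gy, hs.vx.cut (by omega), hs.vy, h.xin, h.yin, h.sep,
    ?_, ?_, hs.outer, ?_, ?_, by omega, ?_, hs.card, hs.ale, h.pnle⟩
  · refine h.good.map (fun x => if x = .f o then .f i else x) ev.cor ?_ ?_ ?_
    · intro x hx
      by_cases e : x = .f o
      · subst e
        simp only [if_true]
        exact ⟨Or.inl (Or.inr (Or.inl hXi)), hsrc⟩
      · rw [if_neg e]
        cases x with
        | f p =>
          have hpo : p ≠ o := by simpa using e
          refine ⟨?_, ev.srcOr (by simpa using hpo)⟩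
          rcases hx with hx | hx
          · exact Or.inl (((hlive p).1 hx).resolve_left hpo).1
          · exact Or.inr hx
        | a x => exact ⟨hx, Or.inl rfl⟩
        | g x => exact ⟨hx, Or.inl rfl⟩
    · have hni : Loc.f i ∉ pqL c.n c.S A (liveF c (X.cut (i + 1)) Y (o + 1)) ∅ := by
        rintro (hx | ⟨g, -, j, -, e⟩)
        · rcases (hlive i).1 hx with e | e
          · omega
          · exact e.2 rfl
        · unfold pcell at e; omega
      intro x hx y hy e
      by_cases e1 : x = .f o <;> by_cases e2 : y = .f o
      · rw [e1, e2]
      · simp only [e1, e2, if_true, if_false] at e; exact absurd (e ▸ hy) hni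
      · simp only [e1, e2, if_true, if_false] at e; exact absurd (e ▸ hx) hni
      · simpa [e1, e2] using e
    · intro y hy
      by_cases e : y = .f i
      · exact ⟨.f o, Or.inl ((hlive o).2 (Or.inl rfl)), by simp [e]⟩
      · refine ⟨y, ?_, ?_⟩
        · cases y with
          | f p =>
            rcases hy with hy | hy
            · exact Or.inl ((hlive p).2 (Or.inr ⟨hy, by simpa using e⟩))
            · exact Or.inr hy
          | a x => exact hy
          | g x => exact hy
        · rw [if_neg]
          rintro rfl
          rcases hy with hy | ⟨g, -, j, -, e⟩
          · have := h.live_lt hc hy; omega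
          · unfold pcell at e; omega
  · intro p hp hsr
    rcases (hlive p).1 hp with rfl | ⟨h1, -⟩
    · simp
    · exact hs.clean p h1 hsr
  · intro p q h1 hpq hq hpb hqb
    by_cases e : q = o
    · subst e; rw [hv]; exact hob p h1 hpq hpb
    · exact hs.osort p q h1 hpq (by omega) hpb hqb
  · intro p h1 h2 hpb
    by_cases e : p = o
    · subst e; rw [hv]; exact hvo
    · exact hs.obd p h1 (by omega) hpb
  · have h1 := Run.cut_size (i := i + 1) hk (by omega) hi
    have h2 := h.cnt
    omega

/-- An element that was taken from the priority queue is written to the output. -/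
theorem Core.emit_pop {c : Ctx} {A m bad X Y lo o ot ins pn}
    (h : Core c A m bad X Y lo o ot ins pn) (hc : c.Ok) (hpn : pn ≠ 0) {r A' : ℕ → Word}
    {m1 : FState} {F : Finset ℕ} {w : Word} (ev : EvF c.P.δ {p | 2 * c.n ≤ p} F m m1)
    (hpq : PQ c.n c.S A' m1.mem ins (pn - 1) lo)
    (hg : Good c.n (rd r A' m1.mem) m1.cor (pqL c.n c.S A' (liveF c X Y o) {62}))
    (hw : w.src = (r 62).src) (hwv : w.val = ot) :
    Core c A' (m1.put o w) ((bad ∪ F).erase o) X Y lo (o + 1) ot ins (pn - 1) := by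
  have hphi := hc.hphi
  have hno := h.no
  have ho : o < 2 * c.n := by have := h.cnt; omega
  have ev' : EvF c.P.δ {p | o ≤ p} F m (m1.put o w) :=
    (ev.mono fun p (hp : 2 * c.n ≤ p) => show o ≤ p by omega).put (show o ≤ o from le_rfl) w
  have hlt : ∀ p ∈ liveF c X Y o, p < o := fun p => h.live_lt hc
  have hsub : ∀ p, p < o → p ∉ (bad ∪ F).erase o → p ∉ bad ∧ (m1.put o w).mem p = m.mem p := by
    intro p hp hpb
    have hpo : p ≠ o := by omega
    simp [hpo] at hpb
    exact ⟨hpb.1, ev'.same p (by simp; omega) hpb.2⟩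
  have hlive : ∀ p, p ∈ liveF c X Y (o + 1) ↔ p = o ∨ p ∈ liveF c X Y o := by
    intro p
    simp only [liveF, Set.mem_ofPred_eq]
    by_cases e : p = o
    · subst e; simp; right; right; right; omega
    · have : p < o + 1 ↔ p < o := by omega
      simp [e, this]
  have hxo : ∀ p, X.Cell p → p < o := fun p hp => hlt p (Or.inr (Or.inl hp))
  have hyo : ∀ p, Y.Cell p → p < o := fun p hp => hlt p (Or.inr (Or.inr (Or.inl hp)))
  refine ⟨?_, h.gx, h.gy, h.vx.sub fun p hp => hsub p (hxo p hp),
    h.vy.sub fun p hp => hsub p (hyo p hp), h.xin, h.yin, h.sep, ?_, ?_, ?_, ?_, ?_, by omega, ?_, ?_,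
    ev'.le h.ale, by have := h.pnle; omega⟩
  · refine ⟨hpq.toPQ0.congr (fun p hp => ?_) (fun _ _ => ⟨rfl, rfl⟩) fun _ => rfl, hpq.tree⟩
    exact Function.update_of_ne (by omega) _ _
  · have hfo : Loc.f o ∉ pqL c.n c.S A' (liveF c X Y o) {62} := by
      rintro (hx | ⟨g, -, j, -, e⟩)
      · have := hlt _ hx; omega
      · unfold pcell at e; omega
    refine hg.move (.g 62) (.f o) rfl hfo ?_ (by simp [rd, FState.put, hw]) ?_
    · intro x
      cases x with
      | f p =>
        simp only [mem_pqL_f, hlive, Loc.f.injEq, ne_eq, reduceCtorEq, not_false_eq_true, and_true]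
        tauto
      | a x => simp [mem_pqL_a]
      | g x => simp [mem_pqL_g]
    · intro x hx hne
      cases x with
      | f p =>
        refine congrArg Word.src (Function.update_of_ne ?_ _ _)
        rintro rfl
        exact hfo hx
      | a x => rfl
      | g x => exact absurd (congrArg Loc.g (show x = 62 from hx)) hne
  · intro p hp hsr
    rcases (hlive p).1 hp with rfl | h1
    · simp
    · have hpo := hlt p h1
      obtain ⟨a1, a2⟩ := ev'.src_ne (p := p) (by simp; omega) hsr
      rw [a2] at hsr
      have := h.clean p h1 hsr
      simp [this, a1]
  · intro p q hpq hq h1 h2 h3 hp' hq'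
    obtain ⟨a1, a2⟩ := hsub p (by omega) hp'
    obtain ⟨b1, b2⟩ := hsub q (by omega) hq'
    rw [a2, b2]
    exact h.outer p q hpq hq h1 h2 h3 a1 b1
  · intro p q h1 hpq hq hp' hq'
    obtain ⟨a1, a2⟩ := hsub p (by omega) hp'
    rw [a2]
    by_cases e : q = o
    · subst e
      simp only [FState.put, Function.update_self, hwv]
      exact h.obd p h1 hpq a1
    · obtain ⟨b1, b2⟩ := hsub q (by omega) hq'
      rw [b2]
      exact h.osort p q h1 hpq (by omega) a1 b1
  · intro p h1 h2 hp'
    by_cases e : p = o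
    · subst e; simp [FState.put, hwv]
    · obtain ⟨a1, a2⟩ := hsub p (by omega) hp'
      rw [a2]
      exact h.obd p h1 (by omega) a1
  · have := h.cnt; omega
  · have h1 := ev'.card
    have h2 := h.card
    have h3 := Finset.card_le_card (Finset.erase_subset o (bad ∪ F))
    have h4 := Finset.card_union_le bad F
    omega

/-! ### Removal of two words that are out of order. -/

/-- Move the words at `r 91` and the next address to the priority queue, and close the gap with the
preceding words down to `r 90`. -/
def remove : Cmd :=
  .load 62 91 ;; pqInsert ;; blk [.op .add 111 91 4] ;; .load 62 111 ;; pqInsert ;;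
    blk [.mov 92 91, .op .add 93 91 12, .op .sub 94 91 90] ;; moveDown

theorem Good.load {n S p : ℕ} {r A mem : ℕ → Word} {cor : Set ℕ} {Fr : Set ℕ}
    (h : Good n (rd r A mem) cor (pqL n S A Fr ∅)) (hp : p ∈ Fr) (hFr : ∀ p ∈ Fr, p < 2 * n)
    {r' : ℕ → Word} (hr : r' 62 = mem p) :
    Good n (rd r' A mem) cor (pqL n S A (Fr \ {p}) {62}) := by
  refine h.move (.f p) (.g 62) (Or.inl hp) (by simp [mem_pqL_g]) ?_ (by simp [rd, hr]) ?_
  · intro x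
    cases x with
    | f q =>
      simp only [mem_pqL_f, reduceCtorEq, false_or, Set.mem_sdiff, Set.mem_singleton_iff, ne_eq,
        Loc.f.injEq]
      constructor
      · rintro (⟨h1, h2⟩ | ⟨g, h1, i, h2, h3⟩)
        · exact ⟨Or.inl h1, h2⟩
        · refine ⟨Or.inr ⟨g, h1, i, h2, h3⟩, ?_⟩
          rintro rfl
          have := hFr _ hp
          unfold pcell at h3
          omega
      · rintro ⟨h1 | h1, h2⟩
        · exact Or.inl ⟨h1, h2⟩
        · exact Or.inr h1
    | a x => simp [mem_pqL_a]
    | g x => simp [mem_pqL_g]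
  · intro x hx hne
    cases x with
    | f q => rfl
    | a x => rfl
    | g x => exact absurd hx (by simp [mem_pqL_g])

/-- `X'` arises from `X` by removing the words at `a` and `a + 1`, where the preceding words down to
`s` are moved by two. -/
structure Run.Removed (c : Ctx) (X X' : Run) (s a : ℕ) : Prop where
  sa : s ≤ a
  cells : ∀ p, s ≤ p → p < a + 2 → X.Cell p
  geo : X'.Geo c.K c.S c.w
  b : X'.b = X.b
  h : X'.h = X.h
  size : X'.size + 2 = X.size
  kf : X.kf ≤ X'.kf
  kl : X'.kl ≤ X.kl
  C : ∀ k, X'.kf ≤ k → k < X'.kl → X'.C k = X.C k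
  blk : ∀ k p, X'.Blk k p → X.Blk k (og a (a + 2) (a - s) p)
  zone : ∀ p, X'.Zone p → X.Cell (og a (a + 2) (a - s) p)
  cell : ∀ p, X'.Cell p ↔ X.Cell p ∧ p ≠ s ∧ p ≠ s + 1

/-- Since one of the two words is bad, `bad` loses an element while `ins` grows by two, and the
fault balance is kept. The words from `s` to `a` move up by two, so that the hole appears at the
lower end `s`, where it can be cut off. -/
theorem wp_remove {c : Ctx} (hc : c.Ok) {r A : ℕ → Word} {m : FState} {t : ℕ} {Q : Post}
    (hk : Consts c.P c.n c.S r) {bad : Finset ℕ} {X X' Y : Run} {lo o ot ins pn s a : ℕ}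
    (h : Core c A m bad X Y lo o ot ins pn) (h60 : (r 60).val = ins) (h61 : (r 61).val = pn)
    (h90 : (r 90).val = s) (h91 : (r 91).val = a) (hr : X.Removed c X' s a)
    (hbad : a ∈ bad ∨ a + 1 ∈ bad) (ht : t + 120 * c.l + 20 * (a - s) + 260 ≤ c.P.lim m.a)
    (hQ : ∀ r' A' m' t' bad', Frame c.P.δ remove r A m r' A' m' →
      Core c A' m' bad' X' Y lo o ot (ins + 2) (pn + 2) → (r' 60).val = ins + 2 →
      (r' 61).val = pn + 2 → ArrHi A A' → t' ≤ t + 120 * c.l + 20 * (a - s) + 260 → Q r' A' m' t') :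
    wp c.P remove Q r A m t := by
  suffices hh : wp c.P remove (fun r' A' m' t' => ∃ bad',
      Core c A' m' bad' X' Y lo o ot (ins + 2) (pn + 2) ∧ (r' 60).val = ins + 2 ∧
      (r' 61).val = pn + 2 ∧ ArrHi A A' ∧ t' ≤ t + 120 * c.l + 20 * (a - s) + 260) r A m t from
    wp_mono _ (wp_frame _ hh) fun r' A' m' t' h => by
      obtain ⟨⟨F, h1, h2, h3, h4, h5⟩, hf⟩ := h
      exact hQ r' A' m' t' F hf h1 h2 h3 h4 h5
  have hP := hc.ok
  have hM := hP.hM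
  have hphi := hc.hphi
  have hno := h.no
  have hol := h.o_le hc
  -- The bad word guarantees that the insertions stay within the capacity of the queue.
  have hins2 : ins + 2 ≤ 2 * c.P.δ := by
    have h1 : ins + 2 ≤ 2 * m.a := by rcases hbad with hb | hb <;> exact h.a_pos hb
    have := h.ale
    omega
  have hpn := h.pnle
  have hXa : X.Cell a := hr.cells a hr.sa (by omega)
  have hXa1 : X.Cell (a + 1) := hr.cells (a + 1) (by have := hr.sa; omega) (by omega)
  have hain := h.xcell hXa
  have ha1in := h.xcell hXa1
  have hsa := hr.sa
  have hlt : ∀ p ∈ liveF c X Y o, p < 2 * c.n := fun p hp => by have := h.live_lt hc hp; omega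
  have hla : a ∈ liveF c X Y o := Or.inr (Or.inl hXa)
  have hla1 : a + 1 ∈ liveF c X Y o := Or.inr (Or.inl hXa1)
  refine wp_hide fun Q' hQ' => ?_
  refine wp_seq (by omega) (wp_load (by omega) fun m1 ⟨F1, ev1⟩ => ?_)
  have hlim1 := c.P.lim_mono ev1.a_le
  rw [h91]
  have hge : ∀ p, X.Cell p → (m.mem p).src ≠ none → lo ≤ (m.mem p).val := fun p hp hs =>
    h.vx.ge p hp (h.clean p (Or.inr (Or.inl hp)) hs)
  have hg1 := (h.good.ev ev1 (by simp)).load (p := a) hla hlt (r' := update r 62 (m1.mem a)) (by simp)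
  refine wp_seq (by omega) (wp_pqInsert hP (l := c.l) (ins := ins) (pn := pn) (lo := lo)
    (hk.congr fun x _ _ _ _ _ _ => Function.update_of_ne (by omega) _ _)
    hc.hl (h.pq.ev ev1 (by simp)) (by simp [h60]) (by simp [h61]) (by omega) hpn ?_
    (fun p hp => hlt p hp.1) hg1 (by omega) ?_)
  · simp only [Function.update_self]
    intro hs
    have e := Ev.src_ne ⟨F1, ev1⟩ hs
    rw [e] at hs ⊢
    exact hge a hXa hs
  intro r2 A2 m2 t2 F2 fr2 ev2 hpq2 e60 e61 hg2 hA2 ht2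
  have hlim2 := c.P.lim_mono ev2.a_le
  have hk2 : Consts c.P c.n c.S r2 :=
    (hk.congr fun x _ _ _ _ _ _ => Function.update_of_ne (by omega) _ _).frame fr2 (by decide)
  have e91 : (r2 91).val = a := by rw [fr2.1 91 (by decide)]; simp [h91]
  have e90 : (r2 90).val = s := by rw [fr2.1 90 (by decide)]; simp [h90]
  refine wp_blk_seq (by simp; omega) ?_
  simp [wpB, Op.ok, Op.ev, e91, hk2.c4]
  refine ⟨by omega, ?_⟩
  refine wp_seq (by omega) (wp_load (by omega) fun m3 ⟨F3, ev3⟩ => ?_)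
  have hlim3 := c.P.lim_mono ev3.a_le
  simp only [Function.update_self]
  have hgd : Good c.n (rd noReg A2 m2.mem) m2.cor
      (pqL c.n c.S A2 (liveF c X Y o \ {a}) ∅) := hg2.unused fun x hx => by
    cases x <;> first | rfl | exact absurd hx (by simp [mem_pqL_g])
  have ev12 := ((ev1.mono (Set.empty_subset {p | 2 * c.n ≤ p})).trans' ev2).trans'
    (ev3.mono (Set.empty_subset _))
  obtain ⟨r3, hr3⟩ : ∃ r3, r3 = update (update r2 111 ⟨a + 1, none⟩) 62 (m3.mem (a + 1)) := ⟨_, rfl⟩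
  rw [← hr3]
  have hg3 := (hgd.ev ev3 (by simp)).load (p := a + 1) (r' := r3) ⟨hla1, by simp⟩
    (fun p hp => hlt p hp.1) (by simp [hr3])
  have hk3 : Consts c.P c.n c.S r3 := hk2.congr fun x _ _ _ _ _ _ => by
    rw [hr3, Function.update_of_ne (by omega), Function.update_of_ne (by omega)]
  refine wp_seq (by omega) (wp_pqInsert hP (l := c.l) (ins := ins + 1) (pn := pn + 1) (lo := lo)
    hk3 hc.hl (hpq2.ev ev3 (by simp)) (by simp [hr3, e60]) (by simp [hr3, e61]) (by omega) (by omega) ?_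
    (fun p hp => hlt p hp.1.1) hg3 (by omega) ?_)
  · simp only [hr3, Function.update_self]
    intro hs
    have e := (ev12.src_ne (p := a + 1) (by simp; omega) hs).2
    rw [e] at hs ⊢
    exact hge (a + 1) hXa1 hs
  intro r4 A4 m4 t4 F4 fr4 ev4 hpq4 f60 f61 hg4 hA4 ht4
  have hlim4 := c.P.lim_mono ev4.a_le
  have hk4 := hk3.frame fr4 (by decide)
  have f91 : (r4 91).val = a := by rw [fr4.1 91 (by decide), hr3]; simp [e91]
  have f90 : (r4 90).val = s := by rw [fr4.1 90 (by decide), hr3]; simp [e90]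
  refine wp_blk_seq (by simp; omega) ?_
  simp [wpB, Op.ok, Op.ev, f91, f90, hk4.c12]
  refine ⟨by omega, ?_⟩
  refine wp_moveDown (s := a) (d := a + 2) (c := a - s) (by simp [hk4.c3]) (by simp [hk4.c4])
    (by simp [f91]) (by simp) (by simp) (by omega) (by omega) (by omega) (by omega) ?_
  intro r5 A5 m5 t5 F5 fr5 ev5 _ ht5
  obtain rfl : A5 = A4 := fr5.2.1 (by decide)
  have ev14 := ev12.trans' ev4
  generalize hF : F1 ∪ F2 ∪ F3 ∪ F4 = F at *
  set Z := deadZone a (a + 2) (a - s) with hZ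
  have hZm : ∀ p, p ∈ Z → X.Cell p ∧ (p = s ∨ p = s + 1) := fun p hp => by
    simp only [hZ, deadZone, Set.mem_ofPred_eq] at hp
    exact ⟨hr.cells p (by omega) (by omega), by omega⟩
  -- live words are not in the dead zone
  have hnotX : ∀ p, p ∈ liveF c X' Y o → X.Cell p → p ≠ s ∧ p ≠ s + 1 := by
    intro p hp hX
    have hin := h.xcell hX
    rcases hp with h1 | h1 | h1 | h1
    · omega
    · exact ((hr.cell p).1 h1).2
    · exact absurd h1 (h.disj hX)
    · omega
  have hnZ : ∀ p ∈ liveF c X' Y o, p ∉ Z := fun p hp hz => by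
    obtain ⟨h1, h2⟩ := hZm p hz
    have := hnotX p hp h1
    omega
  have hogs : ∀ p, p ≠ s → p ≠ s + 1 → og a (a + 2) (a - s) p ≠ a ∧ og a (a + 2) (a - s) p ≠ a + 1 := by
    intro p h1 h2
    unfold og
    split_ifs <;> omega
  have hogid : ∀ p, ¬ X.Cell p → og a (a + 2) (a - s) p = p := by
    intro p hp
    unfold og
    rw [if_neg]
    intro h1
    exact hp (hr.cells p (by omega) (by omega))
  have hog2 : ∀ p, og a (a + 2) (a - s) p = p ∨ (s + 2 ≤ p ∧ p < a + 2 ∧ og a (a + 2) (a - s) p = p - 2) := by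
    intro p
    unfold og
    split_ifs <;> omega
  have hlive : ∀ p, p ∈ liveF c X' Y o → p ≠ s → p ≠ s + 1 → og a (a + 2) (a - s) p ∈ liveF c X Y o := by
    intro p hp h1 h2
    rcases hog2 p with e | ⟨h3, h4, e⟩
    · rw [e]
      rcases hp with hp | hp | hp | hp
      · exact Or.inl hp
      · exact Or.inr (Or.inl ((hr.cell p).1 hp).1)
      · exact Or.inr (Or.inr (Or.inl hp))
      · exact Or.inr (Or.inr (Or.inr hp))
    · rw [e]
      exact Or.inr (Or.inl (hr.cells _ (by omega) (by omega)))
  have hss : ∀ p ∈ liveF c X' Y o, p ≠ s ∧ p ≠ s + 1 := fun p hp => by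
    by_cases hX : X.Cell p
    · exact hnotX p hp hX
    · exact ⟨fun e => hX (hr.cells p (by omega) (by omega)), fun e => hX (hr.cells p (by omega) (by omega))⟩
  -- Both addresses are vacated, so they are dropped before the remaining ones are renamed by the
  -- move.
  obtain ⟨bad1, hb1⟩ : ∃ b, b = ((bad ∪ F).erase a).erase (a + 1) := ⟨_, rfl⟩
  have hbm : ∀ p, p ≠ a → p ≠ a + 1 → (p ∈ bad1 ↔ p ∈ bad ∨ p ∈ F) := fun p h1 h2 => by
    simp [hb1, h1, h2]
  have hb1c : bad1.card + 1 ≤ bad.card + F.card := by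
    have h1 := Finset.card_union_le bad F
    have h2 : bad1.card < (bad ∪ F).card := by
      refine Finset.card_lt_card ⟨fun x hx => ?_, fun hx => ?_⟩
      · rw [hb1] at hx; exact Finset.mem_of_mem_erase (Finset.mem_of_mem_erase hx)
      · rcases hbad with hb | hb
        · have := hx (Finset.mem_union_left F hb); simp [hb1] at this
        · have := hx (Finset.mem_union_left F hb); simp [hb1] at this
    omega
  have hmv : ∀ p ∈ liveF c X' Y o, p ∉ sbad bad1 a (a + 2) (a - s) ∪ F5 →
      og a (a + 2) (a - s) p ∉ bad ∧ m5.mem p = m.mem (og a (a + 2) (a - s) p) := by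
    intro p hp hpb
    obtain ⟨h1, h2⟩ := ev5.moved_good bad1 (by omega) (by omega) (hnZ p hp) hpb
    obtain ⟨h3, h4⟩ := hss p hp
    obtain ⟨h5, h6⟩ := hogs p h3 h4
    rw [hbm _ h5 h6, not_or] at h1
    have h7 := hlt _ (hlive p hp h3 h4)
    exact ⟨h1.1, by rw [h2, ev14.same _ (by simp; omega) h1.2]⟩
  have hXl : ∀ p, X'.Cell p → p ∈ liveF c X' Y o := fun p hp => Or.inr (Or.inl hp)
  have hYl : ∀ p, Y.Cell p → p ∈ liveF c X' Y o := fun p hp => Or.inr (Or.inr (Or.inl hp))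
  have hin := h.xin
  refine hQ' _ _ _ _ ⟨sbad bad1 a (a + 2) (a - s) ∪ F5, ?_, ?_, ?_, ?_, by omega⟩
  · refine ⟨?_, hr.geo, h.gy, ?_, ?_, ?_, h.yin, ?_, ?_, ?_, ?_, ?_, ?_, h.no, ?_, ?_, ?_, by omega⟩
    · have hpq5 : PQ c.n c.S A5 (m4.moved a (a + 2) (a - s)).mem (ins + 1 + 1) (pn + 1 + 1) lo := by
        refine ⟨hpq4.toPQ0.congr (fun p hp => ?_) (fun _ _ => ⟨rfl, rfl⟩) fun _ => rfl, hpq4.tree⟩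
        rw [moved_mem]
        unfold og
        rw [if_neg (by omega)]
      exact hpq5.ev ev5 fun p hp => by have := h.xcell (hZm p hp).1; omega
    · refine h.vx.reloc (og a (a + 2) (a - s)) hr.kf hr.kl hr.C hr.blk hr.zone ?_
        fun p hp => hmv p (hXl p hp)
      intro p q hp hq hpq
      have h1 := ((hr.cell p).1 hp).2
      have h2 := ((hr.cell q).1 hq).2
      unfold og
      split_ifs <;> omega
    · refine h.vy.sub fun p hp hpb => ?_
      have := hmv p (hYl p hp) hpb
      rwa [hogid p fun hX => h.disj hX hp] at this
    · rw [hr.b, hr.h]; exact hin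
    · rw [hr.b, hr.h]; exact h.sep
    · have hg4' : Good c.n (rd noReg A5 m4.mem) m4.cor
          (pqL c.n c.S A5 ((liveF c X Y o \ {a}) \ {a + 1}) ∅) := hg4.unused fun x hx => by
        cases x <;> first | rfl | exact absurd hx (by simp [mem_pqL_g])
      have hg5 := hg4'.moved (s := a) (d := a + 2) (c := a - s) (Fr' := liveF c X' Y o) (by omega)
        (by omega) (by omega) (by omega) (fun p hp => hlt p hp.1.1) ?_ ?_
      · refine hg5.ev ev5 fun p hp => ?_
        rcases hp with hp | ⟨g, -, j, -, rfl⟩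
        · exact hnZ p hp
        · intro hz
          have := h.xcell (hZm _ hz).1
          unfold pcell at this
          omega
      · intro p
        simp only [Set.mem_sdiff, Set.mem_singleton_iff]
        constructor
        · intro hp
          obtain ⟨h3, h4⟩ := hss p hp
          exact ⟨hnZ p hp, ⟨hlive p hp h3 h4, (hogs p h3 h4).1⟩, (hogs p h3 h4).2⟩
        · rintro ⟨h1, ⟨h2, h3⟩, h4⟩
          rcases hog2 p with e | ⟨h5, h6, e⟩
          · rw [e] at h2 h3 h4
            rcases h2 with h2 | h2 | h2 | h2
            · exact Or.inl h2
            · refine hXl p ((hr.cell p).2 ⟨h2, ?_⟩)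
              simp only [deadZone, Set.mem_ofPred_eq] at h1
              unfold og at e
              split_ifs at e <;> omega
            · exact hYl p h2
            · exact Or.inr (Or.inr (Or.inr h2))
          · exact hXl p ((hr.cell p).2 ⟨hr.cells p (by omega) (by omega), by omega, by omega⟩)
      · intro p h1 h2 h3 h4
        simp only [Set.mem_sdiff, Set.mem_singleton_iff] at h4
        omega
    · intro p hp hs
      refine ev5.moved_src bad1 (by omega) (by omega) (hnZ p hp) hs fun hs4 => ?_
      obtain ⟨h3, h4⟩ := hss p hp
      obtain ⟨h5, h6⟩ := hogs p h3 h4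
      have h7 := hlive p hp h3 h4
      have h8 := hlt _ h7
      obtain ⟨h9, h10⟩ := ev14.src_ne (by simp; omega) hs4
      rw [h10] at hs4
      rw [hbm _ h5 h6, not_or]
      exact ⟨h.clean _ h7 hs4, h9⟩
    · intro p q hpq hq h1 h2 h3 hp' hq'
      obtain ⟨a1, a2⟩ := hmv p (Or.inl ⟨by omega, h1⟩) hp'
      obtain ⟨b1, b2⟩ := hmv q (Or.inl ⟨by omega, h2⟩) hq'
      rw [hogid p fun hX => h1 (h.xcell hX)] at a1 a2
      rw [hogid q fun hX => h2 (h.xcell hX)] at b1 b2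
      rw [a2, b2]
      exact h.outer p q hpq hq h1 h2 h3 a1 b1
    · intro p q h1 hpq hq hp' hq'
      obtain ⟨a1, a2⟩ := hmv p (Or.inr (Or.inr (Or.inr ⟨h1, by omega⟩))) hp'
      obtain ⟨b1, b2⟩ := hmv q (Or.inr (Or.inr (Or.inr ⟨by omega, hq⟩))) hq'
      rw [hogid p fun hX => by have := h.xcell hX; omega] at a1 a2
      rw [hogid q fun hX => by have := h.xcell hX; omega] at b1 b2
      rw [a2, b2]
      exact h.osort p q h1 hpq hq a1 b1
    · intro p h1 h2 hp'
      obtain ⟨a1, a2⟩ := hmv p (Or.inr (Or.inr (Or.inr ⟨h1, h2⟩))) hp'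
      rw [hogid p fun hX => by have := h.xcell hX; omega] at a1 a2
      rw [a2]
      exact h.obd p h1 h2 a1
    · have := h.cnt; have := hr.size; omega
    · have h1 := Finset.card_union_le (sbad bad1 a (a + 2) (a - s)) F5
      have h2 := sbad_card bad1 a (a + 2) (a - s)
      have h3 := ev5.card
      have h4 := ev14.card
      have h5 := h.card
      simp only [FState.moved] at h3
      omega
    · exact ev5.le (ev14.le h.ale)
  · rw [fr5.1 60 (by decide)]; simp [f60]
  · rw [fr5.1 61 (by decide)]; simp [f61]
  · exact fun x hx => (hA4 x hx).trans (hA2 x hx)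

/-! ### Registers and block tables of a merge. -/

/-- The safe address of the record of block `k`. -/
def slotA (S k tf : ℕ) : ℕ := 128 + 16 * (k % (S + 1)) + tf

/-- The registers and the table of a run. -/
structure RunReg (S b : ℕ) (r A : ℕ → Word) (R : Run) : Prop where
  kf : (r b).val = R.kf
  kl : (r (b + 1)).val = R.kl
  u : (r (b + 2)).val = R.u
  h : (r (b + 3)).val = R.h
  tab : ∀ k, R.kf ≤ k → k < R.kl → (A (slotA S k (r (b + 4)).val)).val = R.S k ∧
    (A (slotA S k (r (b + 4)).val + 1)).val = R.E k ∧ (A (slotA S k (r (b + 4)).val + 2)).val = R.C k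

/-- The registers of a merge. -/
structure Mach (c : Ctx) (r A : ℕ → Word) (X Y : Run) (lo o ins pn : ℕ) : Prop where
  k : Consts c.P c.n c.S r
  x : RunReg c.S 20 r A X
  y : RunReg c.S 40 r A Y
  tf : (r 24).val = 0 ∧ (r 44).val = 3 ∨ (r 24).val = 3 ∧ (r 44).val = 0
  lo : (r 8).val = lo
  o : (r 9).val = o
  oend : (r 10).val = c.n + (c.phi - c.plo)
  ins : (r 60).val = ins
  pn : (r 61).val = pn

/-- The registers that belong to the state of a merge. -/
def keepRegs : List ℕ := [0, 1, 3, 4, 5, 6, 7, 8, 9, 10, 12, 13, 14, 15, 16, 20, 21, 22, 23, 24, 40, 41,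
  42, 43, 44, 60, 61]

theorem RunReg.congr {S b : ℕ} {r r' A A' : ℕ → Word} {R : Run} (h : RunReg S b r A R)
    (h0 : r' b = r b) (h1 : r' (b + 1) = r (b + 1)) (h2 : r' (b + 2) = r (b + 2))
    (h3 : r' (b + 3) = r (b + 3)) (h4 : r' (b + 4) = r (b + 4)) (ht : (r (b + 4)).val ≤ 3)
    (hA : ArrHi A A') : RunReg S b r' A' R where
  kf := by rw [h0, h.kf]
  kl := by rw [h1, h.kl]
  u := by rw [h2, h.u]
  h := by rw [h3, h.h]
  tab := fun k hk hk' => by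
    rw [h4, hA _ (by unfold slotA; omega), hA _ (by unfold slotA; omega), hA _ (by unfold slotA; omega)]
    exact h.tab k hk hk'

theorem Mach.congr {c : Ctx} {r r' A A' : ℕ → Word} {X Y : Run} {lo o ins pn : ℕ}
    (h : Mach c r A X Y lo o ins pn) (hr : ∀ x ∈ keepRegs, r' x = r x) (hA : ArrHi A A') :
    Mach c r' A' X Y lo o ins pn where
  k := h.k.congr fun x h1 h2 h3 h4 h5 h6 => hr x (by simp [keepRegs]; omega)
  x := h.x.congr (hr _ (by decide)) (hr _ (by decide)) (hr _ (by decide)) (hr _ (by decide))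
    (hr _ (by decide)) (by have := h.tf; simp; omega) hA
  y := h.y.congr (hr _ (by decide)) (hr _ (by decide)) (hr _ (by decide)) (hr _ (by decide))
    (hr _ (by decide)) (by have := h.tf; simp; omega) hA
  tf := by rw [hr 24 (by decide), hr 44 (by decide)]; exact h.tf
  lo := by rw [hr 8 (by decide), h.lo]
  o := by rw [hr 9 (by decide), h.o]
  oend := by rw [hr 10 (by decide), h.oend]
  ins := by rw [hr 60 (by decide), h.ins]
  pn := by rw [hr 61 (by decide), h.pn]

theorem ArrHi.refl (A : ℕ → Word) : ArrHi A A := fun _ _ => rfl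

/-- The address of the record of block `r 110` of the first run. -/
def slotC : Cmd :=
  blk [.op .div 111 110 7, .op .mul 111 111 7, .op .sub 111 110 111, .op .mul 111 111 5,
    .op .add 111 111 13, .op .add 111 111 24]

theorem wp_slotC {P : Par} {n S : ℕ} (hP : P.Ok n S) {r A : ℕ → Word} {m : FState} {t : ℕ} {Q : Post}
    (hc : Consts P n S r) {k tf : ℕ} (hk : (r 110).val = k) (htf : (r 24).val = tf) (htf3 : tf ≤ 3)
    (hkM : k < P.M) (ht : t + 13 ≤ P.lim m.a)
    (hQ : ∀ r', (∀ y, y ≠ 111 → r' y = r y) → (r' 111).val = slotA S k tf → Q r' A m (t + 13)) :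
    wp P slotC Q r A m t := by
  have hM := hP.hM
  have hS := hP.hSδ
  have h1 := Nat.div_add_mod k (S + 1)
  have h2 : k % (S + 1) < S + 1 := Nat.mod_lt k (Nat.succ_pos S)
  have h3 : k - k / (S + 1) * (S + 1) = k % (S + 1) := by
    rw [mul_comm] at h1; omega
  have h4 : k / (S + 1) * (S + 1) ≤ k := Nat.div_mul_le_self _ _
  have h7 := hc.c7
  have h5 := hc.c5
  have h13 := hc.c13
  refine wp_blk _ (by simp; omega) ?_
  simp [wpB, Op.ok, Op.ev, hk, htf, h7, h5, h13, h3]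
  refine ⟨by omega, by omega, by omega, by omega, ?_⟩
  refine hQ _ (fun y hy => by simp [hy]) ?_
  simp [slotA]
  ring

/-! ### Verification of further blocks. -/

/-- Check that the words from `r 80` to `r 81`, where smaller values are replaced by `r 83`, are in
order, and not smaller than `r 82`. -/
def scan : Cmd :=
  .loop (.lt 80 81) (.load 84 80 ;; .cond (.lt 84 83) (blk [.mov 84 83]) .skip ;;
    .cond (.lt 84 82) (blk [.set 75 1, .mov 81 3]) (blk [.mov 82 84, .op .add 80 80 4]))

/-- The value `v` is that of the word before `j`, unless `j` is the first address. -/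
def Link (mem : ℕ → Word) (bad : Finset ℕ) (u cl j v : ℕ) : Prop :=
  (j = u ∧ v ≤ cl) ∨ (u < j ∧ (j - 1 ∉ bad → (mem (j - 1)).val = v))

theorem EvF.val {δ : ℕ} {F : Finset ℕ} {m m' : FState} (h : EvF δ ∅ F m m') {bad : Finset ℕ} {p : ℕ}
    (hp : p ∉ bad ∪ F) : p ∉ bad ∧ m'.mem p = m.mem p := by
  rw [Finset.mem_union, not_or] at hp
  exact ⟨hp.1, h.same p (by simp) hp.2⟩

theorem Link.ev {δ : ℕ} {F : Finset ℕ} {m m' : FState} {bad : Finset ℕ} {u cl j v : ℕ}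
    (h : Link m.mem bad u cl j v) (e : EvF δ ∅ F m m') : Link m'.mem (bad ∪ F) u cl j v := by
  refine h.imp id fun h => ⟨h.1, fun hb => ?_⟩
  obtain ⟨h1, h2⟩ := e.val hb
  rw [h2]
  exact h.2 h1

/-- Good words are at least `cl`, so raising a value to `cl` alters bad words only. A failure must
exhibit two neighbouring words in memory: `Link` says that the value in register `82` stems from the
preceding word, or does not exceed `cl` and so cannot cause a failure. Setting the end register `81`
to zero leaves the loop. -/
theorem wp_scan {P : Par} {r A : ℕ → Word} {m : FState} {t : ℕ} {Q : Post} {p0 pe u0 v0 cl : ℕ}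
    {bad : Finset ℕ} (h3 : (r 3).val = 0) (h4 : (r 4).val = 1) (h80 : (r 80).val = p0)
    (h81 : (r 81).val = pe) (h82 : (r 82).val = v0) (h83 : (r 83).val = cl) (h75 : (r 75).val = 0)
    (hp : p0 ≤ pe) (hL : Link m.mem bad u0 cl p0 v0)
    (hcl : ∀ p, p0 ≤ p → p < pe → p ∉ bad → cl ≤ (m.mem p).val) (hM : pe + 1 < P.M)
    (ht : t + 25 * (pe - p0) + 25 ≤ P.lim m.a)
    (hQ : ∀ r' A' m' t' F, Frame P.δ scan r A m r' A' m' → EvF P.δ ∅ F m m' →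
      ((r' 75).val = 0 ∧ v0 ≤ (r' 82).val ∧
        (∀ p, p0 ≤ p → p < pe → p ∉ bad ∪ F → v0 ≤ (m'.mem p).val ∧ (m'.mem p).val ≤ (r' 82).val) ∧
        Link m'.mem (bad ∪ F) u0 cl pe (r' 82).val) ∨
      ((r' 75).val = 1 ∧ ∃ j, (r' 80).val = j ∧ p0 ≤ j ∧ j < pe ∧ u0 < j ∧
        (j - 1 ∉ bad ∪ F → j ∉ bad ∪ F → (m'.mem j).val < (m'.mem (j - 1)).val)) →
      t' ≤ t + 25 * (pe - p0) + 25 → Q r' A' m' t') :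
    wp P scan Q r A m t := by
  suffices h : wp P scan (fun r' A' m' t' => ∃ F, EvF P.δ ∅ F m m' ∧
      (((r' 75).val = 0 ∧ v0 ≤ (r' 82).val ∧
        (∀ p, p0 ≤ p → p < pe → p ∉ bad ∪ F → v0 ≤ (m'.mem p).val ∧ (m'.mem p).val ≤ (r' 82).val) ∧
        Link m'.mem (bad ∪ F) u0 cl pe (r' 82).val) ∨
      ((r' 75).val = 1 ∧ ∃ j, (r' 80).val = j ∧ p0 ≤ j ∧ j < pe ∧ u0 < j ∧
        (j - 1 ∉ bad ∪ F → j ∉ bad ∪ F → (m'.mem j).val < (m'.mem (j - 1)).val))) ∧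
      t' ≤ t + 25 * (pe - p0) + 25) r A m t from
    wp_mono _ (wp_frame _ h) fun r' A' m' t' h => by
      obtain ⟨⟨F, h1, h2, h3⟩, hf⟩ := h
      exact hQ r' A' m' t' F hf h1 h2 h3
  refine ⟨fun r' A' m' t' => ∃ F j, EvF P.δ ∅ F m m' ∧ (r' 3).val = 0 ∧ (r' 4).val = 1 ∧
      (r' 83).val = cl ∧ (r' 80).val = j ∧ p0 ≤ j ∧
      (((r' 81).val = pe ∧ (r' 75).val = 0 ∧ j ≤ pe ∧ v0 ≤ (r' 82).val ∧
        (∀ p, p0 ≤ p → p < j → p ∉ bad ∪ F → v0 ≤ (m'.mem p).val ∧ (m'.mem p).val ≤ (r' 82).val) ∧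
        Link m'.mem (bad ∪ F) u0 cl j (r' 82).val ∧ t' + 25 * (pe - j) ≤ t + 25 * (pe - p0)) ∨
      ((r' 81).val = 0 ∧ (r' 75).val = 1 ∧ j < pe ∧ u0 < j ∧
        (j - 1 ∉ bad ∪ F → j ∉ bad ∪ F → (m'.mem j).val < (m'.mem (j - 1)).val) ∧
        t' ≤ t + 25 * (pe - p0))), ?_, ?_, ?_⟩
  · rintro r1 A1 m1 t1 m2 ⟨F, j, ev, a1, a2, a3, a4, a5, h⟩ ⟨F', ev'⟩
    refine ⟨F ∪ F', j, by simpa using ev.trans ev', a1, a2, a3, a4, a5, ?_⟩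
    rw [← Finset.union_assoc]
    rcases h with ⟨b1, b2, b3, b4, b5, b6, b7⟩ | ⟨b1, b2, b3, b4, b5, b6⟩
    · refine Or.inl ⟨b1, b2, b3, b4, fun p hp1 hp2 hpb => ?_, b6.ev ev', b7⟩
      obtain ⟨c1, c2⟩ := ev'.val hpb
      rw [c2]
      exact b5 p hp1 hp2 c1
    · refine Or.inr ⟨b1, b2, b3, b4, fun hb1 hb2 => ?_, b6⟩
      obtain ⟨c1, c2⟩ := ev'.val hb1
      obtain ⟨d1, d2⟩ := ev'.val hb2
      rw [c2, d2]
      exact b5 c1 d1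
  · exact ⟨∅, p0, EvF.refl _ _ _, h3, h4, h83, h80, le_rfl, Or.inl ⟨h81, h75, hp, h82.ge,
      fun p h1 h2 => by omega, by simpa [h82] using hL, by omega⟩⟩
  · rintro r1 A1 m1 t1 ⟨F, j, ev, a1, a2, a3, a4, a5, h⟩
    have hlim := P.lim_mono ev.a_le
    refine ⟨by rcases h with ⟨b1, b2, b3, b4, b5, b6, b7⟩ | ⟨b1, b2, b3, b4, b5, b6⟩ <;> omega, ?_, ?_⟩
    · intro hlt
      simp only [Test.ev, a4] at hlt
      rcases h with ⟨b1, b2, b3, b4, b5, b6, b7⟩ | ⟨b1, b2, b3, b4, b5, b6⟩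
      swap
      · omega
      have hj : j < pe := by omega
      refine wp_hide fun Q' hQ' => ?_
      refine wp_seq (by omega) (wp_load (by omega) fun m2 ⟨F2, ev2⟩ => ?_)
      have hlim2 := P.lim_mono ev2.a_le
      rw [a4]
      have ev02 : EvF P.δ ∅ (F ∪ F2) m m2 := by simpa using ev.trans ev2
      have c5 : ∀ p, p0 ≤ p → p < j → p ∉ bad ∪ (F ∪ F2) →
          v0 ≤ (m2.mem p).val ∧ (m2.mem p).val ≤ (r1 82).val := fun p hp1 hp2 hpb => by
        rw [← Finset.union_assoc] at hpb
        obtain ⟨c1, c2⟩ := ev2.val hpb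
        rw [c2]
        exact b5 p hp1 hp2 c1
      have c6 := b6.ev ev2
      rw [Finset.union_assoc] at c6
      have hclj : j ∉ bad ∪ (F ∪ F2) → cl ≤ (m2.mem j).val := fun hjb => by
        obtain ⟨c1, c2⟩ := ev02.val hjb
        rw [c2]
        exact hcl j a5 hj c1
      suffices hs : ∀ r2 t2, (∀ y, y ≠ 84 → r2 y = r1 y) → (r2 84).val = max cl (m2.mem j).val →
          t2 ≤ t1 + 10 → wp P (.cond (.lt 84 82) (blk [.set 75 1, .mov 81 3])
            (blk [.mov 82 84, .op .add 80 80 4])) Q' r2 A1 m2 t2 by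
        refine wp_seq (by omega) (wp_cond (by omega) ?_ ?_)
        · intro h
          simp [Test.ev, a3] at h
          refine wp_blk _ (by simp; omega) ?_
          simp [wpB]
          refine hs _ _ (fun y hy => by simp [hy]) ?_ (by omega)
          simp [a3]
          omega
        · intro h
          simp [Test.ev, a3] at h
          refine wp_skip (by omega) ?_
          refine hs _ _ (fun y hy => by simp [hy]) ?_ (by omega)
          simp
          omega
      intro r2 t2 f2 e84 ht2
      have e82 : r2 82 = r1 82 := f2 _ (by decide)
      refine wp_cond (by omega) ?_ ?_
      · intro h
        simp only [Test.ev, e84, e82] at h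
        refine wp_blk _ (by simp; omega) ?_
        simp [wpB]
        refine ⟨by omega, hQ' _ _ _ _ ⟨F ∪ F2, j, ev02, ?_⟩⟩
        simp [f2, a1, a2, a3, a4, a5]
        rcases c6 with ⟨h1, h2⟩ | ⟨h1, h2⟩
        · omega
        · refine ⟨hj, h1, fun hb1 hb2 hb3 hb4 hb5 hb6 => ?_, by omega⟩
          have h5 := h2 (by simp [hb1, hb2, hb3])
          have h6 := hclj (by simp [hb4, hb5, hb6])
          omega
      · intro h
        simp only [Test.ev, e84, e82] at h
        refine wp_blk _ (by simp; omega) ?_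
        simp [wpB, Op.ok, Op.ev, f2, a2, a4]
        refine ⟨by omega, hQ' _ _ _ _ ⟨F ∪ F2, j + 1, ev02, ?_⟩⟩
        simp only [ne_eq, Nat.reduceEqDiff, not_false_eq_true, Function.update_of_ne,
          Function.update_self, f2, e84]
        refine ⟨a1, a2, a3, trivial, by omega, Or.inl ⟨b1, b2, hj, by omega, fun p hp1 hp2 hpb => ?_,
          Or.inr ⟨?_, fun hb => ?_⟩, by omega⟩⟩
        · by_cases e : p = j
          · subst e
            have := hclj hpb
            omega
          · have := c5 p hp1 (by omega) hpb
            omega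
        · rcases b6 with h | h <;> omega
        · rw [show j + 1 - 1 = j by omega] at hb ⊢
          have := hclj hb
          omega
    · intro hlt
      simp only [Test.ev, a4] at hlt
      rcases h with ⟨b1, b2, b3, b4, b5, b6, b7⟩ | ⟨b1, b2, b3, b4, b5, b6⟩
      · obtain rfl : j = pe := by omega
        exact ⟨F, ev, Or.inl ⟨b2, b4, b5, b6⟩, by omega⟩
      · exact ⟨F, ev, Or.inr ⟨b2, j, a4, a5, b3, b4, b5⟩, by omega⟩

/-- Move words of the first run. -/
theorem Core.moved {c : Ctx} {A m bad X Y lo o ot ins pn} (h : Core c A m bad X Y lo o ot ins pn)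
    (hc : c.Ok) {X' : Run} {s d e : ℕ} {F : Finset ℕ} {m' : FState} (hs : e ≤ s) (hd : e ≤ d)
    (hsn : s ≤ 2 * c.n) (hdn : d ≤ c.n)
    (ev : EvF c.P.δ (deadZone s d e) F (m.moved s d e) m')
    (hsrc : ∀ p, s - e ≤ p → p < s → X.Cell p)
    (hdead : ∀ p, d - e ≤ p → p < d → ¬ (s - e ≤ p ∧ p < s) → p ∉ liveF c X Y o)
    (hcell : ∀ p, X'.Cell p ↔ p ∉ deadZone s d e ∧ X.Cell (og s d e p))
    (hgeo : X'.Geo c.K c.S c.w) (hb : X'.b = X.b) (hh : X'.h = X.h) (hsize : X'.size = X.size)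
    (hv : ∀ bad' mem', (∀ p, X'.Cell p → p ∉ bad' → og s d e p ∉ bad ∧
      mem' p = m.mem (og s d e p)) → X'.Val mem' bad' lo) :
    Core c A m' (sbad bad s d e ∪ F) X' Y lo o ot ins pn := by
  have hphi := hc.hphi
  have hno := h.no
  have hol := h.o_le hc
  have hlt : ∀ p ∈ liveF c X Y o, p < 2 * c.n := fun p hp => by have := h.live_lt hc hp; omega
  have hdst : ∀ p, d - e ≤ p → p < d → X'.Cell p := fun p h1 h2 => (hcell p).2 ⟨by
    simp only [deadZone, Set.mem_ofPred_eq]; omega, by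
    unfold og; rw [if_pos ⟨h1, h2⟩]; exact hsrc _ (by omega) (by omega)⟩
  have hin : ∀ p, X'.Cell p → c.plo ≤ p ∧ p < c.phi ∧ ¬ Y.Cell p := fun p hp => by
    have h1 := hgeo.cell hp
    have h2 := h.xin
    rw [hb, hh] at h1
    refine ⟨by omega, by omega, fun hY => ?_⟩
    have h3 := h.gy.cell hY
    have h4 := h.sep
    omega
  have hogid : ∀ p, ¬ X'.Cell p → og s d e p = p := fun p hp => by
    unfold og
    rw [if_neg]
    rintro ⟨h1, h2⟩
    exact hp (hdst p h1 h2)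
  have hdz : ∀ p, ¬ X.Cell p → p ∉ deadZone s d e := fun p hp hz => by
    simp only [deadZone, Set.mem_ofPred_eq] at hz
    exact hp (hsrc p (by omega) (by omega))
  have hnX : ∀ p, (p < c.n ∧ ¬ (c.plo ≤ p ∧ p < c.phi)) ∨ Y.Cell p ∨ (c.n ≤ p ∧ p < o) →
      ¬ X.Cell p ∧ ¬ X'.Cell p := by
    intro p hp
    constructor
    · intro hX
      have h1 := h.xcell hX
      have h2 := h.disj hX
      have := hc.hphi
      rcases hp with hp | hp | hp
      · omega
      · exact h2 hp
      · omega
    · intro hX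
      obtain ⟨h1, h2, h3⟩ := hin p hX
      rcases hp with hp | hp | hp
      · omega
      · exact h3 hp
      · omega
  have hlive : ∀ p, p ∈ liveF c X' Y o ↔ p ∉ deadZone s d e ∧ og s d e p ∈ liveF c X Y o := by
    intro p
    by_cases hX' : X'.Cell p
    · exact ⟨fun _ => ⟨((hcell p).1 hX').1, Or.inr (Or.inl ((hcell p).1 hX').2)⟩,
        fun _ => Or.inr (Or.inl hX')⟩
    · have e1 := hogid p hX'
      rw [e1]
      constructor
      · intro hp
        have hp' : (p < c.n ∧ ¬ (c.plo ≤ p ∧ p < c.phi)) ∨ Y.Cell p ∨ (c.n ≤ p ∧ p < o) := by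
          rcases hp with hp | hp | hp | hp
          · exact Or.inl hp
          · exact absurd hp hX'
          · exact Or.inr (Or.inl hp)
          · exact Or.inr (Or.inr hp)
        refine ⟨hdz p (hnX p hp').1, ?_⟩
        rcases hp' with hp' | hp' | hp'
        · exact Or.inl hp'
        · exact Or.inr (Or.inr (Or.inl hp'))
        · exact Or.inr (Or.inr (Or.inr hp'))
      · rintro ⟨h1, hp | hp | hp | hp⟩
        · exact Or.inl hp
        · exact absurd ((hcell p).2 ⟨h1, by rwa [e1]⟩) hX'
        · exact Or.inr (Or.inr (Or.inl hp))
        · exact Or.inr (Or.inr (Or.inr hp))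
  have hmv : ∀ p, p ∈ liveF c X' Y o → p ∉ sbad bad s d e ∪ F →
      og s d e p ∉ bad ∧ m'.mem p = m.mem (og s d e p) := fun p hp hpb =>
    ev.moved_good bad hs hd ((hlive p).1 hp).1 hpb
  have hid : ∀ p, (p < c.n ∧ ¬ (c.plo ≤ p ∧ p < c.phi)) ∨ Y.Cell p ∨ (c.n ≤ p ∧ p < o) →
      p ∉ sbad bad s d e ∪ F → p ∉ bad ∧ m'.mem p = m.mem p := by
    intro p hp hpb
    have h1 := hmv p (by
      rcases hp with hp' | hp' | hp'
      · exact Or.inl hp'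
      · exact Or.inr (Or.inr (Or.inl hp'))
      · exact Or.inr (Or.inr (Or.inr hp'))) hpb
    rwa [hogid p (hnX p hp).2] at h1
  refine ⟨?_, hgeo, h.gy, hv _ _ fun p hp => hmv p (Or.inr (Or.inl hp)),
    h.vy.sub fun p hp => hid p (Or.inr (Or.inl hp)), by rw [hb, hh]; exact h.xin, h.yin,
    by rw [hb, hh]; exact h.sep, ?_, ?_, ?_, ?_, ?_, h.no, by rw [hsize]; exact h.cnt, ?_,
    ev.le h.ale, h.pnle⟩
  · have hpq5 : PQ c.n c.S A (m.moved s d e).mem ins pn lo := by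
      refine ⟨h.pq.toPQ0.congr (fun p hp => ?_) (fun _ _ => ⟨rfl, rfl⟩) fun _ => rfl, h.pq.tree⟩
      rw [moved_mem]
      unfold og
      rw [if_neg (by omega)]
    refine hpq5.ev ev fun p hp => ?_
    simp only [deadZone, Set.mem_ofPred_eq] at hp
    omega
  · refine (h.good.moved hs hd hsn (by omega) hlt hlive hdead).ev ev fun p hp => ?_
    rcases hp with hp | ⟨g, -, j, -, rfl⟩
    · exact ((hlive p).1 hp).1
    · simp only [deadZone, Set.mem_ofPred_eq]; unfold pcell; omega
  · intro p hp hsr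
    exact ev.moved_src bad hs hd ((hlive p).1 hp).1 hsr fun h1 => h.clean _ ((hlive p).1 hp).2 h1
  · intro p q hpq hq h1 h2 h3 hp' hq'
    obtain ⟨a1, a2⟩ := hid p (Or.inl ⟨by omega, h1⟩) hp'
    obtain ⟨b1, b2⟩ := hid q (Or.inl ⟨by omega, h2⟩) hq'
    rw [a2, b2]
    exact h.outer p q hpq hq h1 h2 h3 a1 b1
  · intro p q h1 hpq hq hp' hq'
    obtain ⟨a1, a2⟩ := hid p (Or.inr (Or.inr ⟨h1, by omega⟩)) hp'
    obtain ⟨b1, b2⟩ := hid q (Or.inr (Or.inr ⟨by omega, hq⟩)) hq'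
    rw [a2, b2]
    exact h.osort p q h1 hpq hq a1 b1
  · intro p h1 h2 hp'
    obtain ⟨a1, a2⟩ := hid p (Or.inr (Or.inr ⟨h1, h2⟩)) hp'
    rw [a2]
    exact h.obd p h1 h2 a1
  · have h1 := Finset.card_union_le (sbad bad s d e) F
    have h2 := sbad_card bad s d e
    have h3 := ev.card
    have h4 := h.card
    simp only [FState.moved] at h3
    omega

/-- Return the last block to the unverified words. -/
def Run.popLast (R : Run) : Run :=
  { R with kl := R.kl - 1, u := R.u - (R.E (R.kl - 1) - R.S (R.kl - 1)) }

theorem Run.size_pop {R : Run} {K S w : ℕ} (hg : R.Geo K S w) (hk : R.kf < R.kl) :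
    R.popLast.size = R.size := by
  obtain ⟨j, hj⟩ : ∃ j, R.kl = j + 1 := ⟨R.kl - 1, by omega⟩
  obtain ⟨h1, h2, h3, -⟩ := hg.se j (by omega) (by omega)
  have hu := hg.uh
  simp only [Run.size, Run.popLast, hj, Nat.add_sub_cancel]
  rw [Finset.sum_Ico_succ_top (by omega)]
  omega

theorem Run.Geo.popLast {R : Run} {K S w : ℕ} (hg : R.Geo K S w) (hk : R.kf < R.kl)
    (hz : R.u < R.h) : R.popLast.Geo K S w := by
  obtain ⟨j, hj⟩ : ∃ j, R.kl = j + 1 := ⟨R.kl - 1, by omega⟩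
  obtain ⟨h1, h2, h3, -⟩ := hg.se j (by omega) (by omega)
  have e1 : R.popLast.kl = j := by simp [Run.popLast, hj]
  have e2 : R.popLast.u = R.u - (R.E j - R.S j) := by simp [Run.popLast, hj]
  have hu := hg.uh
  have hkS := hg.klS
  refine ⟨by rw [e1]; change R.kf ≤ j; omega, by rw [e1]; change j ≤ R.kf + S + 1; omega, ?_, ?_,
    by rw [e2]; change R.b ≤ _; omega, by rw [e2]; change _ ≤ R.h; omega, hg.hw, ?_⟩
  · intro k hk1 hk2
    rw [e1] at hk2
    change R.kf ≤ k at hk1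
    obtain ⟨a1, a2, a3, a4⟩ := hg.se k hk1 (by omega)
    have := hg.le hk1 hk2 (by omega)
    rw [e2]
    change R.b ≤ R.S k ∧ R.S k ≤ R.E k ∧ R.E k ≤ _ ∧ R.E k ≤ R.S k + _
    omega
  · intro k hk1 hk2
    rw [e1] at hk2
    exact hg.next k hk1 (by omega)
  · intro _ k hk1 hk2
    rw [e1] at hk2
    exact hg.full hz k hk1 (by omega)

/-- The division into blocks enters only through geometry and separators; everything else speaks of
the set of cells. -/
theorem Core.reshape {c : Ctx} {A m bad X Y lo o ot ins pn} (h : Core c A m bad X Y lo o ot ins pn)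
    {X' : Run} (hcell : ∀ p, X'.Cell p ↔ X.Cell p) (hb : X'.b = X.b) (hh : X'.h = X.h)
    (hsize : X'.size = X.size) (hg : X'.Geo c.K c.S c.w) (hv : X'.Val m.mem bad lo) :
    Core c A m bad X' Y lo o ot ins pn := by
  have hl : liveF c X' Y o = liveF c X Y o := by
    ext p
    simp only [liveF, Set.mem_ofPred_eq, hcell]
  exact ⟨h.pq, hg, h.gy, hv, h.vy, by rw [hb, hh]; exact h.xin, h.yin, by rw [hb, hh]; exact h.sep,
    hl ▸ h.good, hl ▸ h.clean, h.outer, h.osort, h.obd, h.no, by rw [hsize]; exact h.cnt, h.card, h.ale,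
    h.pnle⟩

theorem Core.arr {c : Ctx} {A A' m bad X Y lo o ot ins pn} (h : Core c A m bad X Y lo o ot ins pn)
    (hA : ∀ x, 6 ≤ x % 16 → A' x = A x) : Core c A' m bad X Y lo o ot ins pn := by
  have hw : ∀ i, nwin A' i = nwin A i := fun i => by unfold nwin; rw [hA _ (by omega)]
  have hv : ∀ i, nval A' i = nval A i := fun i => by unfold nval; rw [hA _ (by omega)]
  have hn : ∀ i, ncnt A' i = ncnt A i := fun i => by unfold ncnt; rw [hA _ (by omega)]
  refine ⟨⟨h.pq.toPQ0.congr (fun _ _ => rfl) (fun j _ => ⟨hw j, hv j⟩) hn, fun i h1 h2 =>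
    (h.pq.tree i h1 h2).congr fun j _ => ⟨hw j, by rw [hv]⟩⟩, h.gx, h.gy, h.vx, h.vy, h.xin, h.yin, h.sep,
    ?_, h.clean, h.outer, h.osort, h.obd, h.no, h.cnt, h.card, h.ale, h.pnle⟩
  refine h.good.congr ?_ ?_
  · intro x
    cases x with
    | f p => simp only [mem_pqL_f, hn]
    | a p => simp only [mem_pqL_a, hw]
    | g p => simp only [mem_pqL_g]
  · intro x hx
    cases x with
    | f p => rfl
    | a p =>
      obtain ⟨g, -, -, rfl⟩ := mem_pqL_a.1 hx
      simp only [rd]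
      rw [hA _ (by omega)]
    | g p => rfl

theorem Run.Val.popLast {R : Run} {K S w lo : ℕ} {mem mem' : ℕ → Word} {bad bad' : Finset ℕ}
    (hv : R.Val mem bad lo) (hg : R.Geo K S w) (hk : R.kf < R.kl)
    (hm : ∀ p, R.popLast.Cell p → p ∉ bad' → og (R.E (R.kl - 1)) R.u (R.E (R.kl - 1) - R.S (R.kl - 1)) p
      ∉ bad ∧ mem' p = mem (og (R.E (R.kl - 1)) R.u (R.E (R.kl - 1) - R.S (R.kl - 1)) p)) :
    R.popLast.Val mem' bad' lo := by
  obtain ⟨h1, h2, h3, -⟩ := hg.se (R.kl - 1) (by omega) (by omega)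
  have hblk : ∀ k p, R.popLast.Blk k p → p < R.S (R.kl - 1) := by
    rintro k p ⟨⟨h4, h5⟩, -, h6⟩
    simp only [Run.popLast] at h4 h5 h6
    have := hg.le (k := k) (j := R.kl - 1) h4 h5 (by omega)
    omega
  refine hv.reloc (og (R.E (R.kl - 1)) R.u (R.E (R.kl - 1) - R.S (R.kl - 1))) le_rfl (Nat.sub_le _ _)
    (fun _ _ _ => rfl) ?_ ?_ ?_ hm
  · intro k p hp
    have h4 := hblk k p hp
    unfold og
    rw [if_neg (by omega)]
    exact ⟨⟨hp.1.1, by have := hp.1.2; simp only [Run.popLast] at this; omega⟩, hp.2⟩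
  · rintro p ⟨h4, h5⟩
    simp only [Run.popLast] at h4 h5
    unfold og
    split_ifs with h6
    · exact Or.inl ⟨R.kl - 1, ⟨by omega, by omega⟩, by omega, by omega⟩
    · exact Or.inr ⟨by omega, h5⟩
  · intro p q hp hq hpq
    have hc : ∀ x, R.popLast.Cell x → x < R.S (R.kl - 1) ∨ R.u - (R.E (R.kl - 1) - R.S (R.kl - 1)) ≤ x := by
      rintro x (⟨k, hx⟩ | hx)
      · exact Or.inl (hblk k x hx)
      · exact Or.inr hx.1
    have h4 := hc p hp
    have h5 := hc q hq
    unfold og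
    split_ifs <;> omega

theorem Run.popLast_cell {R : Run} {K S w p : ℕ} (hg : R.Geo K S w) (hk : R.kf < R.kl) :
    R.popLast.Cell p ↔ p ∉ deadZone (R.E (R.kl - 1)) R.u (R.E (R.kl - 1) - R.S (R.kl - 1)) ∧
      R.Cell (og (R.E (R.kl - 1)) R.u (R.E (R.kl - 1) - R.S (R.kl - 1)) p) := by
  obtain ⟨h1, h2, h3, -⟩ := hg.se (R.kl - 1) (by omega) (by omega)
  have hu := hg.uh
  have hle : ∀ k, R.kf ≤ k → k < R.kl - 1 → R.E k ≤ R.S (R.kl - 1) := fun k h4 h5 =>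
    hg.le h4 h5 (by omega)
  simp only [deadZone, Set.mem_ofPred_eq]
  constructor
  · rintro (⟨k, ⟨h4, h5⟩, h6, h7⟩ | ⟨h4, h5⟩)
    · simp only [Run.popLast] at h4 h5 h6 h7
      have := hle k h4 h5
      refine ⟨by omega, ?_⟩
      unfold og
      rw [if_neg (by omega)]
      exact Or.inl ⟨k, ⟨h4, by omega⟩, h6, h7⟩
    · simp only [Run.popLast] at h4 h5
      refine ⟨by omega, ?_⟩
      unfold og
      split_ifs with h6
      · exact Or.inl ⟨R.kl - 1, ⟨by omega, by omega⟩, by omega, by omega⟩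
      · exact Or.inr ⟨by omega, h5⟩
  · rintro ⟨h4, h5⟩
    unfold og at h5
    split_ifs at h5 with h6
    · exact Or.inr ⟨h6.1, by change p < R.h; omega⟩
    · rcases h5 with ⟨k, ⟨h7, h8⟩, h9, h10⟩ | ⟨h7, h8⟩
      · by_cases e : k = R.kl - 1
        · subst e
          exact absurd (by omega) h4
        · exact Or.inl ⟨k, ⟨h7, by change k < R.kl - 1; omega⟩, h9, h10⟩
      · exact Or.inr ⟨by change R.u - _ ≤ p; omega, h8⟩

/-- The words between `R.u` and `mid` follow the last block, which may be appended after them. -/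
structure Run.Open (R : Run) (K S w mid : ℕ) : Prop where
  klS : R.kl + 2 ≤ R.kf + S + 1
  um : R.u ≤ mid
  mh : mid < R.h
  len : mid ≤ R.u + min K w
  full : R.kf < R.kl → mid = R.u + K

/-- A lower bound of the unverified words. -/
def Run.lower (R : Run) (lo : ℕ) : ℕ := if R.kf < R.kl then R.C (R.kl - 1) else lo

/-- Append two blocks. -/
def Run.push (R : Run) (mid e c1 c2 : ℕ) : Run :=
  { R with
    kl := R.kl + 2
    u := e
    S := update (update R.S R.kl R.u) (R.kl + 1) mid
    E := update (update R.E R.kl mid) (R.kl + 1) e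
    C := update (update R.C R.kl c1) (R.kl + 1) c2 }

theorem Run.push_old {R : Run} {mid e c1 c2 k : ℕ} (h : k < R.kl) :
    (R.push mid e c1 c2).S k = R.S k ∧ (R.push mid e c1 c2).E k = R.E k ∧
      (R.push mid e c1 c2).C k = R.C k := by
  have h1 : k ≠ R.kl := by omega
  have h2 : k ≠ R.kl + 1 := by omega
  simp [push, h1, h2]

theorem Run.push_fst {R : Run} {mid e c1 c2 : ℕ} :
    (R.push mid e c1 c2).S R.kl = R.u ∧ (R.push mid e c1 c2).E R.kl = mid ∧
      (R.push mid e c1 c2).C R.kl = c1 := by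
  simp [push]

theorem Run.push_snd {R : Run} {mid e c1 c2 : ℕ} :
    (R.push mid e c1 c2).S (R.kl + 1) = mid ∧ (R.push mid e c1 c2).E (R.kl + 1) = e ∧
      (R.push mid e c1 c2).C (R.kl + 1) = c2 := by
  simp [push]

/-- Two blocks are appended at once. The first is the block that was taken back; unless it is the
front block, it has exactly `K` words. The second is full unless it exhausts the run. -/
theorem Run.Geo.push {R : Run} {K S w mid e c1 c2 : ℕ} (hg : R.Geo K S w) (ho : R.Open K S w mid)
    (he : e = min (mid + K) R.h) : (R.push mid e c1 c2).Geo K S w := by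
  obtain ⟨a1, a2, a3, a4, a5⟩ := ho
  have hbu := hg.bu
  have hw := hg.hw
  have hkl := hg.kle
  have cases3 : ∀ k, k < R.kl + 2 → k < R.kl ∨ k = R.kl ∨ k = R.kl + 1 := by omega
  refine ⟨by change R.kf ≤ R.kl + 2; omega, a1, ?_, ?_, by change R.b ≤ e; omega,
    by change e ≤ R.h; omega, hg.hw, ?_⟩
  · intro k h1 h2
    change R.kf ≤ k at h1
    change R.b ≤ _ ∧ _ ∧ _ ≤ e ∧ _
    rcases cases3 k h2 with h | rfl | rfl
    · obtain ⟨b1, b2, b3⟩ := push_old (mid := mid) (e := e) (c1 := c1) (c2 := c2) h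
      have := hg.se k h1 h
      rw [b1, b2]
      omega
    · obtain ⟨b1, b2, b3⟩ := push_fst (R := R) (mid := mid) (e := e) (c1 := c1) (c2 := c2)
      rw [b1, b2]; omega
    · obtain ⟨b1, b2, b3⟩ := push_snd (R := R) (mid := mid) (e := e) (c1 := c1) (c2 := c2)
      rw [b1, b2]; omega
  · intro k h1 h2
    change R.kf ≤ k at h1
    change k + 1 < R.kl + 2 at h2
    rcases cases3 (k + 1) h2 with h | h | h
    · rw [(push_old (show k < R.kl by omega)).2.1, (push_old h).1]
      exact hg.next k h1 h
    · rw [(push_old (show k < R.kl by omega)).2.1, h, push_fst.1]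
      exact (hg.se k h1 (by omega)).2.2.1
    · obtain rfl : k = R.kl := by omega
      rw [push_fst.2.1, push_snd.1]
  · intro h1 k h2 h3
    change e < R.h at h1
    change R.kf < k at h2
    rcases cases3 k h3 with h | rfl | rfl
    · rw [(push_old h).1, (push_old h).2.1]
      exact hg.full (by omega) k h2 h
    · rw [push_fst.1, push_fst.2.1]; exact a5 h2
    · rw [push_snd.1, push_snd.2.1]; omega

theorem Run.push_cell {R : Run} {K S w mid e c1 c2 p : ℕ} (hg : R.Geo K S w) (ho : R.Open K S w mid)
    (he : e = min (mid + K) R.h) : (R.push mid e c1 c2).Cell p ↔ R.Cell p := by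
  obtain ⟨a1, a2, a3, a4, a5⟩ := ho
  have hkl := hg.kle
  constructor
  · rintro (⟨k, ⟨h1, h2⟩, h3, h4⟩ | h)
    · change R.kf ≤ k at h1
      rcases (show k < R.kl ∨ k = R.kl ∨ k = R.kl + 1 by change k < R.kl + 2 at h2; omega) with h | rfl | rfl
      · rw [(push_old h).1] at h3
        rw [(push_old h).2.1] at h4
        exact Or.inl ⟨k, ⟨h1, h⟩, h3, h4⟩
      · rw [push_fst.1] at h3
        rw [push_fst.2.1] at h4
        exact Or.inr ⟨h3, by omega⟩
      · rw [push_snd.1] at h3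
        rw [push_snd.2.1] at h4
        exact Or.inr ⟨by omega, by omega⟩
    · obtain ⟨h1, h2⟩ := h
      change e ≤ p at h1
      exact Or.inr ⟨by omega, h2⟩
  · rintro (⟨k, ⟨h1, h2⟩, h3, h4⟩ | ⟨h1, h2⟩)
    · refine Or.inl ⟨k, ⟨h1, by change k < R.kl + 2; omega⟩, ?_, ?_⟩
      · rw [(push_old h2).1]; exact h3
      · rw [(push_old h2).2.1]; exact h4
    · by_cases h3 : p < mid
      · refine Or.inl ⟨R.kl, ⟨hkl, by change R.kl < R.kl + 2; omega⟩, ?_, ?_⟩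
        · rw [push_fst.1]; exact h1
        · rw [push_fst.2.1]; exact h3
      · by_cases h4 : p < e
        · refine Or.inl ⟨R.kl + 1, ⟨by change R.kf ≤ R.kl + 1; omega, by change R.kl + 1 < R.kl + 2; omega⟩, ?_, ?_⟩
          · rw [push_snd.1]; omega
          · rw [push_snd.2.1]; exact h4
        · exact Or.inr ⟨by change e ≤ p; omega, h2⟩

theorem Run.push_size {R : Run} {K S w mid e c1 c2 : ℕ} (hg : R.Geo K S w) (ho : R.Open K S w mid)
    (he : e = min (mid + K) R.h) : (R.push mid e c1 c2).size = R.size := by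
  obtain ⟨a1, a2, a3, a4, a5⟩ := ho
  have hkl := hg.kle
  simp only [Run.size]
  change ∑ k ∈ Finset.Ico R.kf (R.kl + 1 + 1), _ + (R.h - e) = _
  rw [Finset.sum_Ico_succ_top (by omega), Finset.sum_Ico_succ_top hkl, push_fst.1, push_fst.2.1, push_snd.1,
    push_snd.2.1]
  have : ∑ k ∈ Finset.Ico R.kf R.kl, ((R.push mid e c1 c2).E k - (R.push mid e c1 c2).S k) =
      ∑ k ∈ Finset.Ico R.kf R.kl, (R.E k - R.S k) := by
    refine Finset.sum_congr rfl fun k hk => ?_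
    rw [Finset.mem_Ico] at hk
    rw [(push_old hk.2).1, (push_old hk.2).2.1]
  rw [this]
  omega

/-- The cells are the same, so their order is inherited. New are only the two separators and the
bounds that they give, which the scans have established. -/
theorem Run.Val.push {R : Run} {K S w mid e c1 c2 lo : ℕ} {mem : ℕ → Word} {bad : Finset ℕ}
    (hv : R.Val mem bad lo) (hg : R.Geo K S w) (ho : R.Open K S w mid)
    (he : e = min (mid + K) R.h) (h1 : R.lower lo ≤ c1) (h2 : c1 ≤ c2)
    (hl : ∀ p, R.u ≤ p → p < mid → p ∉ bad → R.lower lo ≤ (mem p).val ∧ (mem p).val ≤ c1)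
    (hr : ∀ p, mid ≤ p → p < e → p ∉ bad → c1 ≤ (mem p).val ∧ (mem p).val ≤ c2) :
    (R.push mid e c1 c2).Val mem bad lo := by
  have hcell := fun p => push_cell (p := p) (c1 := c1) (c2 := c2) hg ho he
  have hlo : lo ≤ R.lower lo := by
    unfold lower
    split_ifs with h
    · exact hv.geC _ (by omega) (by omega)
    · exact le_rfl
  have cases3 : ∀ k, k < R.kl + 2 → k < R.kl ∨ k = R.kl ∨ k = R.kl + 1 := by omega
  have hblk : ∀ k p, (R.push mid e c1 c2).Blk k p → R.Blk k p ∨ (k = R.kl ∧ R.u ≤ p ∧ p < mid) ∨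
      (k = R.kl + 1 ∧ mid ≤ p ∧ p < e) := by
    rintro k p ⟨⟨h3, h4⟩, h5, h6⟩
    rcases cases3 k h4 with h | rfl | rfl
    · rw [(push_old h).1] at h5
      rw [(push_old h).2.1] at h6
      exact Or.inl ⟨⟨h3, h⟩, h5, h6⟩
    · rw [push_fst.1] at h5
      rw [push_fst.2.1] at h6
      exact Or.inr (Or.inl ⟨rfl, h5, h6⟩)
    · rw [push_snd.1] at h5
      rw [push_snd.2.1] at h6
      exact Or.inr (Or.inr ⟨rfl, h5, h6⟩)
  constructor
  · intro p q hp hq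
    exact hv.sorted p q ((hcell p).1 hp) ((hcell q).1 hq)
  · intro k p hp hpb
    rcases hblk k p hp with h | ⟨rfl, h3, h4⟩ | ⟨rfl, h3, h4⟩
    · rw [(push_old h.1.2).2.2]; exact hv.up k p h hpb
    · rw [push_fst.2.2]; exact (hl p h3 h4 hpb).2
    · rw [push_snd.2.2]; exact (hr p h3 h4 hpb).2
  · intro k p hk hp hpb
    change R.kf ≤ k at hk
    rcases hblk (k + 1) p hp with h | ⟨e1, h3, h4⟩ | ⟨e1, h3, h4⟩
    · rw [(push_old (show k < R.kl by have := h.1.2; omega)).2.2]; exact hv.low k p hk h hpb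
    · rw [(push_old (show k < R.kl by omega)).2.2]
      have := (hl p h3 h4 hpb).1
      rw [lower, if_pos (by omega), ← e1] at this
      exact this
    · obtain rfl : k = R.kl := by omega
      rw [push_fst.2.2]; exact (hr p h3 h4 hpb).1
  · intro k hk hk'
    change R.kf ≤ k at hk
    change k + 1 < R.kl + 2 at hk'
    rcases cases3 (k + 1) hk' with h | h | h
    · rw [(push_old h).2.2, (push_old (show k < R.kl by omega)).2.2]; exact hv.mono k hk h
    · rw [(push_old (show k < R.kl by omega)).2.2, h, push_fst.2.2]
      rw [lower, if_pos (by omega), ← h] at h1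
      exact h1
    · obtain rfl : k = R.kl := by omega
      rw [push_fst.2.2, push_snd.2.2]; exact h2
  · intro p hp
    exact hv.ge p ((hcell p).1 hp)
  · intro k hk hk'
    change R.kf ≤ k at hk
    rcases cases3 k hk' with h | rfl | rfl
    · rw [(push_old h).2.2]; exact hv.geC k hk h
    · rw [push_fst.2.2]; omega
    · rw [push_snd.2.2]; omega

/-- Two unverified words that are out of order can be removed. -/
theorem Run.removed_zone {c : Ctx} {R : Run} {a : ℕ} (hg : R.Geo c.K c.S c.w) (h1 : R.u ≤ a)
    (h2 : a + 2 ≤ R.h) : R.Removed c { R with u := R.u + 2 } R.u a := by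
  have hse := hg.se
  have hbu := hg.bu
  refine ⟨h1, fun p h3 h4 => Or.inr ⟨h3, by omega⟩, ⟨hg.kle, hg.klS, fun k h3 h4 => ?_, hg.next,
    by change R.b ≤ R.u + 2; omega, by change R.u + 2 ≤ R.h; omega, hg.hw,
    fun h3 k h4 h5 => hg.full (by change R.u + 2 < R.h at h3; omega) k h4 h5⟩, rfl, rfl, ?_, le_rfl, le_rfl,
    fun _ _ _ => rfl, ?_, ?_, ?_⟩
  · have := hse k h3 h4
    change _ ∧ _ ∧ R.E k ≤ R.u + 2 ∧ _
    exact ⟨this.1, this.2.1, by omega, this.2.2.2⟩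
  · simp only [Run.size]
    omega
  · intro k p hp
    have h3 := hse k hp.1.1 hp.1.2
    have h4 := hp.2.2
    change p < R.E k at h4
    unfold og
    rw [if_neg (by omega)]
    exact hp
  · rintro p ⟨h3, h4⟩
    change R.u + 2 ≤ p at h3
    change p < R.h at h4
    unfold og
    refine Or.inr ?_
    split_ifs
    · exact ⟨by omega, by omega⟩
    · exact ⟨by omega, h4⟩
  · intro p
    constructor
    · rintro (⟨k, hp⟩ | ⟨h3, h4⟩)
      · have h3 := hse k hp.1.1 hp.1.2
        have h4 := hp.2.2
        change p < R.E k at h4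
        exact ⟨Or.inl ⟨k, hp⟩, by omega, by omega⟩
      · change R.u + 2 ≤ p at h3
        exact ⟨Or.inr ⟨by omega, h4⟩, by omega, by omega⟩
    · rintro ⟨⟨k, hp⟩ | ⟨h3, h4⟩, h5, h6⟩
      · exact Or.inl ⟨k, hp⟩
      · exact Or.inr ⟨by change R.u + 2 ≤ p; omega, h4⟩

theorem Mach.setX {c : Ctx} {r r' A A' : ℕ → Word} {X X' Y : Run} {lo o ins pn lo' o' ins' pn' : ℕ}
    (h : Mach c r A X Y lo o ins pn)
    (hr : ∀ x ∈ keepRegs, x ∉ [8, 9, 20, 21, 22, 60, 61] → r' x = r x)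
    (hA : ∀ k j, j < 3 → A' (slotA c.S k (r 44).val + j) = A (slotA c.S k (r 44).val + j))
    (hx : RunReg c.S 20 r' A' X') (h8 : (r' 8).val = lo') (h9 : (r' 9).val = o')
    (h60 : (r' 60).val = ins') (h61 : (r' 61).val = pn') : Mach c r' A' X' Y lo' o' ins' pn' where
  k := h.k.congr fun x h1 h2 h3 h4 h5 h6 => hr x (by
    simp only [keepRegs, List.mem_cons, List.not_mem_nil, or_false]; omega) (by simp; omega)
  x := hx
  y := by
    refine ⟨by rw [hr _ (by decide) (by decide)]; exact h.y.kf,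
      by rw [hr _ (by decide) (by decide)]; exact h.y.kl,
      by rw [hr _ (by decide) (by decide)]; exact h.y.u,
      by rw [hr _ (by decide) (by decide)]; exact h.y.h, fun k h1 h2 => ?_⟩
    rw [hr (40 + 4) (by decide) (by decide)]
    rw [← Nat.add_zero (slotA _ _ _)]
    simp only [show 40 + 4 = 44 by rfl]
    rw [hA k 0 (by omega), add_assoc, add_assoc, hA k (0 + 1) (by omega), hA k (0 + 2) (by omega)]
    exact h.y.tab k h1 h2
  tf := by rw [hr 24 (by decide) (by decide), hr 44 (by decide) (by decide)]; exact h.tf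
  lo := h8
  o := h9
  oend := by rw [hr 10 (by decide) (by decide), h.oend]
  ins := h60
  pn := h61

theorem Mach.tf3 {c : Ctx} {r A : ℕ → Word} {X Y : Run} {lo o ins pn : ℕ}
    (h : Mach c r A X Y lo o ins pn) : (r 24).val ≤ 3 ∧ (r 44).val ≤ 3 := by
  have := h.tf; omega

theorem slotA_lt {S k tf : ℕ} (htf : tf ≤ 3) : slotA S k tf + 3 ≤ 128 + 16 * S + 6 ∧ 128 ≤ slotA S k tf := by
  have h2 : k % (S + 1) < S + 1 := Nat.mod_lt k (Nat.succ_pos S)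
  unfold slotA
  omega

/-- Take back the last block of the first run; its words are moved next to the unverified ones. -/
def extPop : Cmd :=
  blk [.mov 86 22] ;;
  .cond (.lt 20 21) (
    blk [.op .sub 21 21 4, .mov 110 21] ;; slotC ;;
    blk [.lds 112 111, .op .add 111 111 4, .lds 92 111, .op .sub 94 92 112, .mov 93 22] ;; moveDown ;;
    blk [.mov 22 93]) .skip

/-- The last block has to be read again. Its separator is a value from the past, so a smaller word
after it would not exhibit a pair of neighbouring words that are now out of order. Moving its words
next to the unverified ones also closes the gap left by removals. -/
theorem wp_extPop {c : Ctx} (hc : c.Ok) {r A : ℕ → Word} {m : FState} {t : ℕ} {Q : Post}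
    {X Y : Run} {lo o ot ins pn : ℕ} {bad : Finset ℕ} (hm : Mach c r A X Y lo o ins pn)
    (h : Core c A m bad X Y lo o ot ins pn) (hz : X.u < X.h) (hS : X.kl < X.kf + c.S + 1)
    (hkM : X.kl < c.P.M) (ht : t + 20 * min c.K c.w + 60 ≤ c.P.lim m.a)
    (hQ : ∀ r' m' t' bad' X1, Frame c.P.δ extPop r A m r' A m' → Mach c r' A X1 Y lo o ins pn →
      Core c A m' bad' X1 Y lo o ot ins pn → X1.Open c.K c.S c.w X.u → (r' 86).val = X.u →
      (∀ p, X1.u ≤ p → p < X.u → p ∉ bad' → X1.lower lo ≤ (m'.mem p).val) →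
      X1.h = X.h → X1.kf = X.kf → (X1.kl = X.kl ∧ X1.u = X.u ∨ X1.kl + 1 = X.kl) →
      t' ≤ t + 20 * min c.K c.w + 60 → Q r' A m' t') :
    wp c.P extPop Q r A m t := by
  suffices hh : wp c.P extPop (fun r' A' m' t' => A' = A ∧ ∃ bad' X1, Mach c r' A X1 Y lo o ins pn ∧
      Core c A m' bad' X1 Y lo o ot ins pn ∧ X1.Open c.K c.S c.w X.u ∧ (r' 86).val = X.u ∧
      (∀ p, X1.u ≤ p → p < X.u → p ∉ bad' → X1.lower lo ≤ (m'.mem p).val) ∧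
      X1.h = X.h ∧ X1.kf = X.kf ∧ (X1.kl = X.kl ∧ X1.u = X.u ∨ X1.kl + 1 = X.kl) ∧
      t' ≤ t + 20 * min c.K c.w + 60) r A m t from
    wp_mono _ (wp_frame _ hh) fun r' A' m' t' h => by
      obtain ⟨⟨rfl, F, X1, h1, h2, h3, h4, h5, h6, h7, h8, h9⟩, hf⟩ := h
      exact hQ r' m' t' F X1 hf h1 h2 h3 h4 h5 h6 h7 h8 h9
  have hP := hc.ok
  have hM := hP.hM
  have hcap := hP.hcap
  have hkle := h.gx.kle
  have hphi := hc.hphi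
  have hin := h.xin
  have h20 := hm.x.kf
  have h21 := hm.x.kl
  have h22 := hm.x.u
  have hSS := hP.hS
  have hSd := hP.hSδ
  simp only [Nat.reduceAdd] at h21 h22
  refine wp_hide fun Q' hQ' => ?_
  refine wp_blk_seq (by simp; omega) ?_
  simp [wpB]
  refine wp_cond (by omega) ?_ ?_
  · intro hlt
    simp [Test.ev, h20, h21] at hlt
    obtain ⟨j, hj⟩ : ∃ j, X.kl = j + 1 := ⟨X.kl - 1, by omega⟩
    obtain ⟨g1, g2, g3, g4⟩ := h.gx.se j (by omega) (by omega)
    have hgp := h.gx.popLast hlt hz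
    have hej : X.kl - 1 = j := by omega
    refine wp_blk_seq (by simp; omega) ?_
    simp [wpB, Op.ok, Op.ev, hm.k.c4, h21, hej]
    have htf := hm.tf3
    refine wp_seq (by omega) (wp_slotC hP (k := j) (tf := (r 24).val)
      (hm.k.congr fun x _ _ _ _ _ _ => by
        rw [Function.update_of_ne (by omega), Function.update_of_ne (by omega),
          Function.update_of_ne (by omega)])
      (by simp) (by simp) htf.1 (by omega) (by omega) ?_)
    intro r1 f1 e111
    have hsl := slotA_lt (S := c.S) (k := j) htf.1
    have htab := hm.x.tab j (by omega) (by omega)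
    simp only [Nat.reduceAdd] at htab
    refine wp_blk_seq (by simp; omega) ?_
    simp [wpB, Op.ok, Op.ev, e111, f1, hm.k.c4, htab]
    refine ⟨by omega, by omega, by omega, ?_⟩
    refine wp_seq (by omega) (wp_moveDown (s := X.E j) (d := X.u) (c := X.E j - X.S j) (by simp [f1, hm.k.c3])
      (by simp [f1, hm.k.c4]) (by simp [htab]) (by simp [h22]) (by simp) (by omega) (by omega)
      (by omega) (by omega) ?_)
    intro r2 A2 m2 t2 F fr2 ev2 e93 ht2
    obtain rfl : A2 = A := fr2.2.1 (by decide)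
    have hlim := c.P.lim_mono fr2.2.2.2
    have hmv : ∀ p, p ∉ deadZone (X.E j) X.u (X.E j - X.S j) →
        p ∉ sbad bad (X.E j) X.u (X.E j - X.S j) ∪ F →
        og (X.E j) X.u (X.E j - X.S j) p ∉ bad ∧ m2.mem p = m.mem (og (X.E j) X.u (X.E j - X.S j) p) :=
      fun p h1 h2 => ev2.moved_good bad (by omega) (by omega) h1 h2
    refine wp_blk _ (by simp; omega) ?_
    simp [wpB]
    have hcore := h.moved hc (X' := X.popLast) (s := X.E j) (d := X.u) (e := X.E j - X.S j) (by omega)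
      (by omega) (by omega) (by omega) ev2
      (fun p h1 h2 => Or.inl ⟨j, ⟨by omega, by omega⟩, by omega, h2⟩) ?_ ?_ hgp rfl rfl
      (Run.size_pop h.gx hlt) ?_
    · refine hQ' _ _ _ _ ⟨rfl, _, X.popLast, ?_, hcore, ?_, ?_, ?_, rfl, rfl, Or.inr ?_, by omega⟩
      · refine hm.setX ?_ (fun _ _ _ => rfl) ?_ ?_ ?_ ?_ ?_
        · intro x hx hx'
          have hx2 : x ∉ [20, 21, 22, 86, 92, 93, 94, 95, 110, 111, 112] := by
            revert hx' hx; revert x; decide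
          simp only [List.mem_cons, List.not_mem_nil, or_false, not_or] at hx2
          rw [Function.update_of_ne hx2.2.2.1, fr2.1 x (by
            have : x ∈ keepRegs → x ∉ [8, 9, 20, 21, 22, 60, 61] → moveDown.clob x = false := by
              revert x; decide
            exact this hx hx')]
          simp [hx2, f1]
        · refine ⟨?_, ?_, ?_, ?_, ?_⟩
          · simp [fr2.1 20 (by decide), f1, h20, Run.popLast]
          · simp [fr2.1 21 (by decide), f1, Run.popLast, hej]
          · simp [e93, Run.popLast, hej]
          · simpa [fr2.1 23 (by decide), f1, Run.popLast] using hm.x.h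
          · intro k hk1 hk2
            have := hm.x.tab k hk1 (by simp only [Run.popLast] at hk2; omega)
            simp [fr2.1 24 (by decide), f1]
            exact this
        · simp [fr2.1 8 (by decide), f1, hm.lo]
        · simp [fr2.1 9 (by decide), f1, hm.o]
        · simp [fr2.1 60 (by decide), f1, hm.ins]
        · simp [fr2.1 61 (by decide), f1, hm.pn]
      · have e1 : X.popLast.u = X.u - (X.E j - X.S j) := by simp [Run.popLast, hej]
        refine ⟨by change X.kl - 1 + 2 ≤ X.kf + _ + 1; omega, by omega, hz, by omega, fun h1 => ?_⟩
        have := h.gx.full hz j (by change X.kf < X.kl - 1 at h1; omega) (by omega)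
        omega
      · simp [fr2.1 86 (by decide), f1, h22]
      · intro p h1 h2 h3
        have e1 : X.popLast.u = X.u - (X.E j - X.S j) := by simp [Run.popLast, hej]
        obtain ⟨b1, b2⟩ := hmv p (by simp only [deadZone, Set.mem_ofPred_eq]; omega) h3
        rw [b2]
        unfold og at b1 ⊢
        rw [if_pos (by omega)] at b1 ⊢
        have hb : X.Blk j (p + X.E j - X.u) := ⟨⟨by omega, by omega⟩, by omega, by omega⟩
        unfold Run.lower
        split_ifs with h4
        · change X.kf < X.kl - 1 at h4
          obtain ⟨i, rfl⟩ : ∃ i, j = i + 1 := ⟨j - 1, by omega⟩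
          have := h.vx.low i _ (by omega) hb b1
          change X.C (X.kl - 1 - 1) ≤ _
          rwa [hej, Nat.add_sub_cancel]
        · exact h.vx.ge _ (Or.inl ⟨j, hb⟩) b1
      · simp [Run.popLast]; omega
    · intro p h1 h2 h3 h4
      have hXp : ¬ X.Cell p := by
        rintro (⟨k, ⟨h5, h6⟩, h7, h8⟩ | h5)
        · by_cases e : k = j
          · subst e; omega
          · have := h.gx.le (k := k) (j := j) h5 (by omega) (by omega)
            omega
        · have := h5.1; omega
      have h7 : ¬ Y.Cell p := fun hY => by
        have h8 := h.gy.cell hY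
        have h9 := h.sep
        have h10 := h.gx.cell (p := X.u) (Or.inr ⟨le_rfl, hz⟩)
        omega
      rcases h4 with h5 | h5 | h5 | h5
      · omega
      · exact hXp h5
      · exact h7 h5
      · omega
    · intro p
      have := Run.popLast_cell (p := p) h.gx hlt
      rwa [hej] at this
    · intro bad' mem' hb
      refine h.vx.popLast h.gx hlt ?_
      rw [hej]
      exact hb
  · intro hlt
    simp [Test.ev, h20, h21] at hlt
    refine wp_skip (by omega) (hQ' _ _ _ _ ⟨rfl, bad, X, ?_, h, ?_, ?_, ?_, rfl, rfl, Or.inl ⟨rfl, rfl⟩, by omega⟩)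
    · refine hm.congr (fun x hx => Function.update_of_ne ?_ _ _) (ArrHi.refl _)
      revert hx; revert x; decide
    · refine ⟨by omega, le_rfl, hz, by omega, fun h1 => by omega⟩
    · simp [h22]
    · intro p h1 h2; omega

/-- Determine the bounds for the next two blocks. -/
def extBounds : Cmd :=
  .cond (.lt 20 21) (blk [.op .sub 110 21 4] ;; slotC ;; blk [.op .add 111 111 12, .lds 89 111])
    (blk [.mov 89 8]) ;;
  blk [.op .add 87 86 6] ;; .cond (.lt 23 87) (blk [.mov 87 23]) .skip

theorem wp_extBounds {c : Ctx} (hc : c.Ok) {r A : ℕ → Word} {m : FState} {t : ℕ} {Q : Post}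
    {X Y : Run} {lo o ins pn mid : ℕ} (hm : Mach c r A X Y lo o ins pn) (h86 : (r 86).val = mid)
    (hmid : mid < c.n) (hkM : X.kl < c.P.M) (ht : t + 60 ≤ c.P.lim m.a)
    (hQ : ∀ r' t', (∀ x, x ∉ [87, 89, 110, 111] → r' x = r x) → (r' 89).val = X.lower lo →
      (r' 87).val = min (mid + c.K) X.h → t' ≤ t + 60 → Q r' A m t') :
    wp c.P extBounds Q r A m t := by
  have hP := hc.ok
  have hM := hP.hM
  have hcap := hP.hcap
  have hSS := hP.hS
  have hSd := hP.hSδ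
  have hK : c.K ≤ c.P.δ + 1 := Nat.add_le_add_right (Nat.div_le_self _ _) 1
  have h20 := hm.x.kf
  have h21 := hm.x.kl
  have h23 := hm.x.h
  have h6 : (r 6).val = c.K := hm.k.c6
  simp only [Nat.reduceAdd] at h21 h23
  refine wp_hide fun Q' hQ' => ?_
  have key : ∀ r1 t1, (∀ x, x ∉ [89, 110, 111] → r1 x = r x) → (r1 89).val = X.lower lo →
      t1 ≤ t + 40 → wp c.P (blk [.op .add 87 86 6] ;; .cond (.lt 23 87) (blk [.mov 87 23]) .skip) Q'
        r1 A m t1 := by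
    intro r1 t1 f1 e89 ht1
    refine wp_blk_seq (by simp; omega) ?_
    simp [wpB, Op.ok, Op.ev, f1, h86, h6]
    refine ⟨by omega, wp_cond (by omega) ?_ ?_⟩
    · intro h
      simp [Test.ev, f1, h23] at h
      refine wp_blk _ (by simp; omega) ?_
      simp [wpB]
      refine hQ' _ _ _ _ (hQ _ _ (fun x hx => ?_) (by simp [e89]) (by simp [f1, h23]; omega) (by omega))
      simp only [List.mem_cons, List.not_mem_nil, or_false, not_or] at hx
      simp [hx, f1]
    · intro h
      simp [Test.ev, f1, h23] at h
      refine wp_skip (by omega) ?_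
      refine hQ' _ _ _ _ (hQ _ _ (fun x hx => ?_) (by simp [e89]) (by simp; omega) (by omega))
      simp only [List.mem_cons, List.not_mem_nil, or_false, not_or] at hx
      simp [hx, f1]
  refine wp_seq (by omega) (wp_cond (by omega) ?_ ?_)
  · intro hlt
    simp [Test.ev, h20, h21] at hlt
    refine wp_blk_seq (by simp; omega) ?_
    simp [wpB, Op.ok, Op.ev, h21, hm.k.c4]
    have htf := hm.tf3
    refine wp_seq (by omega) (wp_slotC hP (k := X.kl - 1) (tf := (r 24).val)
      (hm.k.congr fun x _ _ _ _ _ _ => Function.update_of_ne (by omega) _ _) (by simp) (by simp) htf.1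
      (by omega) (by omega) ?_)
    intro r1 f1 e111
    have hsl := slotA_lt (S := c.S) (k := X.kl - 1) htf.1
    have htab := hm.x.tab (X.kl - 1) (by omega) (by omega)
    simp only [Nat.reduceAdd] at htab
    refine wp_blk _ (by simp; omega) ?_
    simp [wpB, Op.ok, Op.ev, e111, f1, hm.k.c12]
    refine ⟨by omega, by omega, key _ _ (fun x hx => ?_) ?_ (by omega)⟩
    · simp only [List.mem_cons, List.not_mem_nil, or_false, not_or] at hx
      simp [hx, f1]
    · simp [htab, Run.lower, hlt]
  · intro hlt
    simp [Test.ev, h20, h21] at hlt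
    refine wp_blk _ (by simp; omega) ?_
    simp [wpB]
    refine key _ _ (fun x hx => ?_) ?_ (by omega)
    · simp only [List.mem_cons, List.not_mem_nil, or_false, not_or] at hx
      simp [hx]
    · have : ¬ X.kf < X.kl := by omega
      simp [hm.lo, Run.lower, this]

/-- Check the order of the words of the next two blocks. -/
def verify : Cmd :=
  blk [.mov 80 22, .mov 81 86, .mov 82 89, .mov 83 89, .mov 75 3] ;; scan ;;
  .cond (.eq 75 3) (blk [.mov 88 82, .mov 80 86, .mov 81 87, .mov 83 8] ;; scan) .skip

/-- The lower bound `lw` applies to the first block only. The second scan falls back to `lo`, so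
that the first word of the second block is compared with its true predecessor and a failure at the
border is an adjacent pair as well. -/
theorem wp_verify {P : Par} {r A : ℕ → Word} {m : FState} {t : ℕ} {Q : Post} {u mid e lw lo : ℕ}
    {bad : Finset ℕ} (h3 : r 3 = ⟨0, none⟩) (h4 : (r 4).val = 1) (h22 : (r 22).val = u)
    (h86 : (r 86).val = mid) (h87 : (r 87).val = e) (h89 : (r 89).val = lw) (h8 : (r 8).val = lo)
    (hum : u ≤ mid) (hme : mid ≤ e) (hlw : u < mid ∨ lw = lo)
    (hl : ∀ p, u ≤ p → p < mid → p ∉ bad → lw ≤ (m.mem p).val)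
    (hr : ∀ p, mid ≤ p → p < e → p ∉ bad → lo ≤ (m.mem p).val) (hM : e + 1 < P.M)
    (ht : t + 25 * (e - u) + 100 ≤ P.lim m.a)
    (hQ : ∀ r' m' t' F, Frame P.δ verify r A m r' A m' → EvF P.δ ∅ F m m' →
      ((r' 75).val = 0 ∧ lw ≤ (r' 88).val ∧ (r' 88).val ≤ (r' 82).val ∧
        (∀ p, u ≤ p → p < mid → p ∉ bad ∪ F → lw ≤ (m'.mem p).val ∧ (m'.mem p).val ≤ (r' 88).val) ∧
        (∀ p, mid ≤ p → p < e → p ∉ bad ∪ F →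
          (r' 88).val ≤ (m'.mem p).val ∧ (m'.mem p).val ≤ (r' 82).val)) ∨
      ((r' 75).val = 1 ∧ ∃ j, (r' 80).val = j ∧ u < j ∧ j < e ∧
        (j - 1 ∉ bad ∪ F → j ∉ bad ∪ F → (m'.mem j).val < (m'.mem (j - 1)).val)) →
      t' ≤ t + 25 * (e - u) + 100 → Q r' A m' t') :
    wp P verify Q r A m t := by
  suffices hh : wp P verify (fun r' A' m' t' => ∃ F, EvF P.δ ∅ F m m' ∧
      (((r' 75).val = 0 ∧ lw ≤ (r' 88).val ∧ (r' 88).val ≤ (r' 82).val ∧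
        (∀ p, u ≤ p → p < mid → p ∉ bad ∪ F → lw ≤ (m'.mem p).val ∧ (m'.mem p).val ≤ (r' 88).val) ∧
        (∀ p, mid ≤ p → p < e → p ∉ bad ∪ F →
          (r' 88).val ≤ (m'.mem p).val ∧ (m'.mem p).val ≤ (r' 82).val)) ∨
      ((r' 75).val = 1 ∧ ∃ j, (r' 80).val = j ∧ u < j ∧ j < e ∧
        (j - 1 ∉ bad ∪ F → j ∉ bad ∪ F → (m'.mem j).val < (m'.mem (j - 1)).val))) ∧
      t' ≤ t + 25 * (e - u) + 100) r A m t from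
    wp_mono _ (wp_frame _ hh) fun r' A' m' t' h => by
      obtain ⟨⟨F, h1, h2, h3⟩, hf⟩ := h
      obtain rfl := hf.2.1 (by decide)
      exact hQ r' m' t' F hf h1 h2 h3
  refine wp_hide fun Q' hQ' => ?_
  refine wp_blk_seq (by simp; omega) ?_
  simp [wpB]
  refine wp_seq (by omega) (wp_scan (p0 := u) (pe := mid) (u0 := u) (v0 := lw) (cl := lw) (bad := bad)
    (by simp [h3]) (by simp [h4]) (by simp [h22]) (by simp [h86]) (by simp [h89]) (by simp [h89])
    (by simp [h3]) hum (Or.inl ⟨rfl, le_rfl⟩) hl (by omega) (by omega) ?_)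
  intro r1 A1 m1 t1 F1 fr1 ev1 hres ht1
  have hlim1 := P.lim_mono ev1.a_le
  have e3 : r1 3 = ⟨0, none⟩ := by rw [fr1.1 3 (by decide)]; simp [h3]
  rcases hres with ⟨e75, b1, b2, b3⟩ | ⟨e75, j, e80, b1, b2, b3, b4⟩
  swap
  · refine wp_cond (by omega) (fun h => ?_) fun _ => wp_skip (by omega) (hQ' _ _ _ _
      ⟨F1, ev1, Or.inr ⟨e75, j, e80, b3, by omega, b4⟩, by omega⟩)
    simp [Test.ev, e3, e75] at h
  refine wp_cond (by omega) ?_ fun h => ?_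
  swap
  · simp [Test.ev, e3, e75] at h
  intro _
  refine wp_blk_seq (by simp; omega) ?_
  simp [wpB]
  -- If the first block is empty, there is no predecessor, but then `lw = lo` and the bound is
  -- harmless.
  have hL : Link m1.mem (bad ∪ F1) u lo mid (r1 82).val := by
    rcases b3 with ⟨h1, h2⟩ | h1
    · refine Or.inl ⟨h1, ?_⟩
      rcases hlw with h | h
      · omega
      · omega
    · exact Or.inr h1
  have f : ∀ x ∈ [4, 8, 22, 86, 87, 89], r1 x = r x := by
    intro x hx
    rw [fr1.1 x (by revert hx; revert x; decide)]
    simp only [List.mem_cons, List.not_mem_nil, or_false] at hx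
    rcases hx with rfl | rfl | rfl | rfl | rfl | rfl <;> simp
  refine wp_scan (p0 := mid) (pe := e) (u0 := u) (v0 := (r1 82).val) (cl := lo) (bad := bad ∪ F1)
    (by simp [e3]) (by simp [f, h4]) (by simp [f, h86]) (by simp [f, h87]) (by simp) (by simp [f, h8])
    (by simp [e75]) hme hL ?_ (by omega) (by omega) ?_
  · intro p h1 h2 hp
    obtain ⟨c1, c2⟩ := ev1.val hp
    rw [c2]
    exact hr p h1 h2 c1
  intro r2 A2 m2 t2 F2 fr2 ev2 hres2 ht2
  have ev12 : EvF P.δ ∅ (F1 ∪ F2) m m2 := by simpa using ev1.trans ev2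
  have e88 : (r2 88) = r1 82 := by rw [fr2.1 88 (by decide)]; simp
  refine hQ' _ _ _ _ ⟨F1 ∪ F2, ev12, ?_, by omega⟩
  rw [← Finset.union_assoc, e88]
  rcases hres2 with ⟨g75, d1, d2, d3⟩ | ⟨g75, j, e80, d1, d2, d3, d4⟩
  · refine Or.inl ⟨g75, b1, d1, fun p h1 h2 hp => ?_, d2⟩
    obtain ⟨c1, c2⟩ := ev2.val hp
    rw [c2]
    exact b2 p h1 h2 c1
  · exact Or.inr ⟨g75, j, e80, d3, d2, d4⟩

/-- Append two blocks to the table of the first run. -/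
def extPush : Cmd :=
  blk [.mov 110 21] ;; slotC ;;
  blk [.sts 111 22, .op .add 111 111 4, .sts 111 86, .op .add 111 111 4, .sts 111 88,
    .op .add 110 110 4] ;; slotC ;;
  blk [.sts 111 86, .op .add 111 111 4, .sts 111 87, .op .add 111 111 4, .sts 111 82,
    .op .add 21 21 12, .mov 22 87]

/-- At most `S + 1` consecutive blocks are in the table, so their indices differ modulo `S + 1`. -/
theorem slotA_ne {S k k' tf : ℕ} (h1 : k < k') (h2 : k' ≤ k + S) :
    slotA S k tf + 16 ≤ slotA S k' tf ∨ slotA S k' tf + 16 ≤ slotA S k tf := by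
  have h : k % (S + 1) ≠ k' % (S + 1) := fun e => by
    have h3 : (S + 1) ∣ k' - k := (Nat.modEq_iff_dvd' (by omega)).1 e
    have := Nat.le_of_dvd (by omega) h3
    omega
  unfold slotA
  omega

theorem wp_extPush {c : Ctx} (hc : c.Ok) {r A : ℕ → Word} {m : FState} {t : ℕ} {Q : Post}
    {X Y : Run} {lo o ins pn mid e c1 c2 : ℕ} (hm : Mach c r A X Y lo o ins pn)
    (h86 : (r 86).val = mid) (h87 : (r 87).val = e) (h88 : (r 88).val = c1) (h82 : (r 82).val = c2)
    (hS : X.kl + 2 ≤ X.kf + c.S + 1) (hkM : X.kl + 2 < c.P.M) (ht : t + 80 ≤ c.P.lim m.a)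
    (hQ : ∀ r' A' t', Mach c r' A' (X.push mid e c1 c2) Y lo o ins pn →
      (∀ x, 6 ≤ x % 16 → A' x = A x) → t' ≤ t + 80 → Q r' A' m t') :
    wp c.P extPush Q r A m t := by
  have hP := hc.ok
  have hM := hP.hM
  have hcap := hP.hcap
  have hSS := hP.hS
  have hSd := hP.hSδ
  have htf := hm.tf3
  have htf' := hm.tf
  have h21 := hm.x.kl
  have h22 := hm.x.u
  simp only [Nat.reduceAdd] at h21 h22
  obtain ⟨tf, htfe⟩ : ∃ tf, tf = (r 24).val := ⟨_, rfl⟩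
  obtain ⟨a0, ha0⟩ : ∃ a, a = slotA c.S X.kl tf := ⟨_, rfl⟩
  obtain ⟨a1, ha1⟩ : ∃ a, a = slotA c.S (X.kl + 1) tf := ⟨_, rfl⟩
  have hl0 := slotA_lt (S := c.S) (k := X.kl) htf.1
  have hl1 := slotA_lt (S := c.S) (k := X.kl + 1) htf.1
  rw [← htfe, ← ha0] at hl0
  rw [← htfe, ← ha1] at hl1
  have hm0 : a0 % 16 = tf := by rw [ha0]; unfold slotA; omega
  have hm1 : a1 % 16 = tf := by rw [ha1]; unfold slotA; omega
  have h01 := slotA_ne (S := c.S) (k := X.kl) (k' := X.kl + 1) (tf := tf) (by omega) (by omega)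
  rw [← ha0, ← ha1] at h01
  refine wp_hide fun Q' hQ' => ?_
  refine wp_blk_seq (by simp; omega) ?_
  simp [wpB]
  refine wp_seq (by omega) (wp_slotC hP (k := X.kl) (tf := tf)
    (hm.k.congr fun x _ _ _ _ _ _ => Function.update_of_ne (by omega) _ _) (by simp [h21]) (by simp [htfe])
    (by omega) (by omega) (by omega) ?_)
  intro r1 f1 e111
  rw [← ha0] at e111
  refine wp_blk_seq (by simp; omega) ?_
  simp [wpB, Op.ok, Op.ev, e111, f1, hm.k.c4, h21]
  refine ⟨by omega, by omega, by omega, by omega, by omega, by omega, ?_⟩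
  refine wp_abs fun r2 hr2 => ?_
  refine wp_seq (by omega) (wp_slotC hP (k := X.kl + 1) (tf := tf)
    (hm.k.congr fun x _ _ _ _ _ _ => by
      have h1 : x ≠ 111 := by omega
      have h2 : x ≠ 110 := by omega
      simp [hr2, f1, h1, h2])
    (by simp [hr2]) (by simp [hr2, f1, htfe]) (by omega) (by omega) (by omega) ?_)
  intro r3 f3 g111
  rw [← ha1] at g111
  refine wp_blk _ (by simp; omega) ?_
  simp [wpB, Op.ok, Op.ev, g111, f3, hr2, f1, hm.k.c4, hm.k.c12, h21]
  refine ⟨by omega, by omega, by omega, by omega, by omega, by omega, ?_⟩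
  refine hQ' _ _ _ _ (hQ _ _ _ ?_ ?_ (by omega))
  · have hold : ∀ x (w0 w1 w2 w3 w4 w5 : Word), x + 3 ≤ a0 + 3 ∧ x < a0 ∨ a0 + 3 ≤ x → x < a1 ∨ a1 + 3 ≤ x →
        update (update (update (update (update (update A a0 w0) (a0 + 1) w1) (a0 + 1 + 1) w2) a1 w3)
          (a1 + 1) w4) (a1 + 1 + 1) w5 x = A x := by
      intro x w0 w1 w2 w3 w4 w5 h1 h2
      rw [Function.update_of_ne (by omega), Function.update_of_ne (by omega), Function.update_of_ne (by omega),
        Function.update_of_ne (by omega), Function.update_of_ne (by omega), Function.update_of_ne (by omega)]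
    refine hm.setX ?_ ?_ ?_ ?_ ?_ ?_ ?_
    · intro x hx hx'
      have hx2 : x ∉ [21, 22, 110, 111] := by revert hx' hx; revert x; decide
      simp only [List.mem_cons, List.not_mem_nil, or_false, not_or] at hx2
      simp [hx2, f3, hr2, f1]
    · intro k j hj
      have : slotA c.S k (r 44).val % 16 = (r 44).val := by unfold slotA; omega
      refine hold _ _ _ _ _ _ _ ?_ ?_ <;> omega
    · refine ⟨?_, ?_, ?_, ?_, ?_⟩
      · simpa [f3, hr2, f1, Run.push] using hm.x.kf
      · simp [Run.push]
      · simp [h87, Run.push]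
      · simpa [f3, hr2, f1, Run.push] using hm.x.h
      · intro k hk1 hk2
        have e24 : ∀ w1 w2 w3 : Word, (update (update (update r3 111 w1) 21 w2) 22 w3 (20 + 4)).val = tf := by
          intros; simp [f3, hr2, f1, htfe]
        change k < X.kl + 2 at hk2
        change X.kf ≤ k at hk1
        rw [e24]
        rcases (show k < X.kl ∨ k = X.kl ∨ k = X.kl + 1 by omega) with h | rfl | rfl
        · have n0 := slotA_ne (S := c.S) (k := k) (k' := X.kl) (tf := tf) (by omega) (by omega)
          have n1 := slotA_ne (S := c.S) (k := k) (k' := X.kl + 1) (tf := tf) (by omega) (by omega)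
          rw [← ha0] at n0
          rw [← ha1] at n1
          obtain ⟨b1, b2, b3⟩ := Run.push_old (mid := mid) (e := e) (c1 := c1) (c2 := c2) h
          rw [b1, b2, b3, hold _ _ _ _ _ _ _ (by omega) (by omega),
            hold _ _ _ _ _ _ _ (by omega) (by omega), hold _ _ _ _ _ _ _ (by omega) (by omega), htfe]
          exact hm.x.tab k hk1 h
        · obtain ⟨b1, b2, b3⟩ := Run.push_fst (R := X) (mid := mid) (e := e) (c1 := c1) (c2 := c2)
          rw [b1, b2, b3, ← ha0]
          refine ⟨?_, ?_, ?_⟩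
          · rw [Function.update_of_ne (by omega), Function.update_of_ne (by omega),
              Function.update_of_ne (by omega), Function.update_of_ne (by omega),
              Function.update_of_ne (by omega), Function.update_self, h22]
          · rw [Function.update_of_ne (by omega), Function.update_of_ne (by omega),
              Function.update_of_ne (by omega), Function.update_of_ne (by omega), Function.update_self, h86]
          · rw [Function.update_of_ne (by omega), Function.update_of_ne (by omega),
              Function.update_of_ne (by omega), Function.update_self, h88]
        · obtain ⟨b1, b2, b3⟩ := Run.push_snd (R := X) (mid := mid) (e := e) (c1 := c1) (c2 := c2)
          rw [b1, b2, b3, ← ha1]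
          refine ⟨?_, ?_, ?_⟩
          · rw [Function.update_of_ne (by omega), Function.update_of_ne (by omega),
              Function.update_self, h86]
          · rw [Function.update_of_ne (by omega), Function.update_self, h87]
          · rw [Function.update_self, h82]
    · simp [f3, hr2, f1, hm.lo]
    · simp [f3, hr2, f1, hm.o]
    · simp [f3, hr2, f1, hm.ins]
    · simp [f3, hr2, f1, hm.pn]
  · intro x hx
    rw [Function.update_of_ne (by omega), Function.update_of_ne (by omega), Function.update_of_ne (by omega),
        Function.update_of_ne (by omega), Function.update_of_ne (by omega), Function.update_of_ne (by omega)]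

/-! ### Time credit, and the cost of an extension. -/

/-- The maximal length of a block. -/
def Ctx.bb (c : Ctx) : ℕ := min c.K c.w

/-- The credit of a run. -/
def Run.pot (R : Run) (c : Ctx) : ℕ :=
  8000 * (R.h - R.u) + 2000 * c.bb * (R.kl - R.kf) + if R.u < R.h then 8000 * c.bb else 0

/-- The invariant of a merge. -/
structure Inv (c : Ctx) (r A : ℕ → Word) (m : FState) (T : ℕ) (X Y : Run) (lo o : ℕ) (bad : Finset ℕ)
    (ins pn : ℕ) : Prop where
  mach : Mach c r A X Y lo o ins pn
  core : Core c A m bad X Y lo o lo ins pn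
  kx : X.kl + 2 * (X.h - X.u) ≤ 2 * c.n + c.n * ins
  ky : Y.kl + 2 * (Y.h - Y.u) ≤ 2 * c.n + c.n * ins
  time : T + X.pot c + Y.pot c + c.cp * pn + c.Rest ≤ c.P.A0 + c.Bh * ins

theorem Ctx.bb_pos (c : Ctx) (hc : c.Ok) : 1 ≤ c.bb := by
  have := hc.hw
  have : 1 ≤ c.K := Nat.succ_pos _
  unfold bb; omega

/-- The program pays in insertions, the limit grows with faults; `ins ≤ 2 * a` and `B = 2 * Bh`
connect the two. -/
theorem Core.lim_ge {c : Ctx} (hc : c.Ok) {A m bad X Y lo o ot ins pn}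
    (h : Core c A m bad X Y lo o ot ins pn) : c.P.A0 + c.Bh * ins ≤ c.P.lim m.a := by
  have h1 := h.card
  have h2 := hc.hB
  have h3 : c.Bh * ins ≤ c.Bh * (2 * m.a) := Nat.mul_le_mul_left _ (by omega)
  unfold Par.lim
  rw [h2]
  calc _ ≤ c.P.A0 + c.Bh * (2 * m.a) := by omega
    _ = _ := by ring

/-- As soon as a bad word is known to exist, the price of the next two insertions can be spent, even
before they take place. -/
theorem Core.lim_bad {c : Ctx} (hc : c.Ok) {A m bad X Y lo o ot ins pn}
    (h : Core c A m bad X Y lo o ot ins pn) {p : ℕ} (hp : p ∈ bad) :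
    c.P.A0 + c.Bh * ins + 2 * c.Bh ≤ c.P.lim m.a := by
  have h1 := h.a_pos hp
  have h2 := hc.hB
  have h3 : c.Bh * (ins + 2) ≤ c.Bh * (2 * m.a) := Nat.mul_le_mul_left _ (by omega)
  unfold Par.lim
  rw [h2]
  calc _ = c.P.A0 + c.Bh * (ins + 2) := by ring
    _ ≤ c.P.A0 + c.Bh * (2 * m.a) := by omega
    _ = _ := by ring

/-- A successful extension raises the index by at most two and verifies at least one word. A failed
one returns at most `n` words but raises `ins` by two. This is the reason for `kx` and `ky` in
`Inv`. -/
theorem Core.index_lt {c : Ctx} (hc : c.Ok) {A m bad X Y lo o ot ins pn k}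
    (h : Core c A m bad X Y lo o ot ins pn) (hk : k ≤ 2 * c.n + c.n * ins) : k + 10 ≤ c.P.M := by
  have h1 := h.ins_le
  have h2 := hc.hM
  have h3 : c.n * ins ≤ c.n * (2 * c.P.δ) := Nat.mul_le_mul_left _ h1
  omega

/-- Verify the next words of the first run. -/
def ext : Cmd :=
  extPop ;; extBounds ;; verify ;;
  .cond (.eq 75 3) extPush (blk [.mov 90 22, .op .sub 91 80 4] ;; remove ;; blk [.op .add 22 22 12])

theorem Inv.congr {c : Ctx} {r r' A : ℕ → Word} {m : FState} {T : ℕ} {X Y : Run} {lo o : ℕ}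
    {bad : Finset ℕ} {ins pn : ℕ} (h : Inv c r A m T X Y lo o bad ins pn)
    (hr : ∀ x ∈ keepRegs, r' x = r x) : Inv c r' A m T X Y lo o bad ins pn :=
  ⟨h.mach.congr hr (ArrHi.refl _), h.core, h.kx, h.ky, h.time⟩

/-- A success pays from the words newly verified; a failure has found a bad word and pays from its
fault. The slack of `100` covers the overhead of the surrounding loop. -/
theorem wp_ext {c : Ctx} (hc : c.Ok) {r A : ℕ → Word} {m : FState} {t T : ℕ} {Q : Post}
    {X Y : Run} {lo o ins pn : ℕ} {bad : Finset ℕ} (h : Inv c r A m T X Y lo o bad ins pn)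
    (hT : t ≤ T + 100) (hz : X.u < X.h) (hS : X.kl < X.kf + c.S + 1)
    (hQ : ∀ r' A' m' t' X' bad' ins' pn', Frame c.P.δ ext r A m r' A' m' →
      Inv c r' A' m' (t' + 100) X' Y lo o bad' ins' pn' → Q r' A' m' t') :
    wp c.P ext Q r A m t := by
  suffices hh : wp c.P ext (fun r' A' m' t' => ∃ X' bad' ins' pn',
      Inv c r' A' m' (t' + 100) X' Y lo o bad' ins' pn') r A m t from
    wp_mono _ (wp_frame _ hh) fun r' A' m' t' h => by
      obtain ⟨⟨X', b, i, p, h⟩, hf⟩ := h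
      exact hQ r' A' m' t' X' b i p hf h
  obtain ⟨hm, hcore, hkx, hky, htime⟩ := h
  have hP := hc.ok
  have hMM := hc.hM
  have hphi := hc.hphi
  have hbb := c.bb_pos hc
  have hkM := hcore.index_lt hc (show X.kl ≤ 2 * c.n + c.n * ins by omega)
  have hlim0 := hcore.lim_ge hc
  have hin := hcore.xin
  have hkle := hcore.gx.kle
  have hpot : X.pot c = 8000 * (X.h - X.u) + 2000 * c.bb * (X.kl - X.kf) + 8000 * c.bb := by
    unfold Run.pot; rw [if_pos hz]
  refine wp_hide fun Q' hQ' => ?_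
  refine wp_seq (by omega) (wp_extPop hc hm hcore hz hS (by omega) (by unfold Ctx.bb at *; omega) ?_)
  intro r1 m1 t1 bad1 X1 fr1 hm1 hcore1 hopen e86 hlow eh ekf ekl ht1
  have hlim1 := c.P.lim_mono fr1.2.2.2
  change t1 ≤ _ + 20 * c.bb + 60 at ht1
  have hkM1 : X1.kl ≤ X.kl := by omega
  obtain ⟨o1, o2, o3, o4, o5⟩ := hopen
  have hopen : X1.Open c.K c.S c.w X.u := ⟨o1, o2, o3, o4, o5⟩
  change X.u ≤ X1.u + c.bb at o4
  have hbK : c.bb ≤ c.K := Nat.min_le_left _ _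
  have hw1 := hcore1.gx.hw
  have hbu1 := hcore1.gx.bu
  have hbw : c.bb = min c.K c.w := rfl
  refine wp_seq (by omega) (wp_extBounds hc hm1 e86 (by omega) (by omega) (by omega) ?_)
  intro r2 t2 f2 e89 e87 ht2
  rw [eh] at e87
  obtain ⟨e, he⟩ : ∃ e, e = min (X.u + c.K) X.h := ⟨_, rfl⟩
  rw [← he] at e87
  have hebb : e - X.u ≤ c.bb := by omega
  have hk3 : (r2 3) = ⟨0, none⟩ := by rw [f2 3 (by decide)]; exact hm1.k.c3
  have hk4 : (r2 4).val = 1 := by rw [f2 4 (by decide)]; exact hm1.k.c4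
  have hm2 : Mach c r2 A X1 Y lo o ins pn := hm1.congr (fun x hx => f2 x (by
    revert hx; revert x; decide)) (ArrHi.refl _)
  have h1K : 1 ≤ c.K := Nat.succ_pos _
  refine wp_seq (by omega) (wp_verify (u := X1.u) (mid := X.u) (e := e) (lw := X1.lower lo) (lo := lo)
    (bad := bad1) hk3 hk4 hm2.x.u (by rw [f2 86 (by decide)]; exact e86) e87 e89 hm2.lo o2 (by omega) ?_ hlow
    ?_ (by omega) (by omega) ?_)
  · by_cases hlt : X1.kf < X1.kl
    · have := o5 hlt; omega
    · exact Or.inr (if_neg hlt)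
  · intro p h1 h2 hp
    exact hcore1.vx.ge p (Or.inr ⟨by omega, by omega⟩) hp
  intro r3 m3 t3 F3 fr3 ev3 hres ht3
  have hcore3 := hcore1.ev hc ev3
  have hlim3 := c.P.lim_mono ev3.a_le
  have hm3 : Mach c r3 A X1 Y lo o ins pn := hm2.congr (fun x hx => fr3.1 x (by
    revert hx; revert x; decide)) (ArrHi.refl _)
  have e3 := hm3.k.c3
  have epot1 : 2000 * c.bb * (X1.kl - X1.kf) ≤ 2000 * c.bb * (X.kl - X.kf) :=
    Nat.mul_le_mul_left _ (by omega)
  rcases hres with ⟨e75, b1, b2, b3, b4⟩ | ⟨e75, j, e80, b1, b2, b3⟩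
  · refine wp_cond (by omega) (fun _ => ?_) (fun h => ?_)
    swap
    · simp [Test.ev, e3, e75] at h
    refine wp_extPush hc hm3 (mid := X.u) (e := e) (c1 := (r3 88).val) (c2 := (r3 82).val)
      (by rw [fr3.1 86 (by decide), f2 86 (by decide)]; exact e86)
      (by rw [fr3.1 87 (by decide)]; exact e87) rfl rfl o1 (by omega) (by omega) ?_
    intro r4 A4 t4 hm4 hA4 ht4
    have he' : e = min (X.u + c.K) X1.h := by rw [eh]; exact he
    have hcore4 := (hcore3.reshape (X' := X1.push X.u e (r3 88).val (r3 82).val)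
      (fun p => Run.push_cell hcore3.gx hopen he') rfl rfl (Run.push_size hcore3.gx hopen he')
      (hcore3.gx.push hopen he') (hcore3.vx.push hcore3.gx hopen he' b1 b2 b3 b4)).arr hA4
    refine hQ' _ _ _ _ ⟨_, _, ins, pn, hm4, hcore4, ?_, hky, ?_⟩
    · change X1.kl + 2 + 2 * (X1.h - e) ≤ _
      omega
    · have hp4 : (X1.push X.u e (r3 88).val (r3 82).val).pot c = 8000 * (X1.h - e) +
          2000 * c.bb * (X1.kl + 2 - X1.kf) + if e < X1.h then 8000 * c.bb else 0 := rfl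
      -- The table has grown by at most two blocks. If words remain unverified, the new block has `K
      -- ≥ bb` words, whose credit covers this and the scans; otherwise the last summand of the
      -- potential is released.
      have hx1 : 2000 * c.bb * (X1.kl + 2 - X1.kf) ≤ 2000 * c.bb * (X.kl - X.kf) + 4000 * c.bb := by
        calc _ ≤ 2000 * c.bb * (X.kl - X.kf + 2) := Nat.mul_le_mul_left _ (by omega)
          _ = _ := by ring
      rw [hp4]
      split_ifs with h5
      · omega
      · omega
  · refine wp_cond (by omega) (fun h => ?_) (fun _ => ?_)
    · simp [Test.ev, e3, e75] at h
    have h80 := e80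
    -- Good words of a run are in order, so a descent cannot consist of two good words.
    have hbad : j - 1 ∈ bad1 ∪ F3 ∨ j - 1 + 1 ∈ bad1 ∪ F3 := by
      rw [show j - 1 + 1 = j by omega]
      by_contra hcon
      rw [not_or] at hcon
      have h1 := b3 hcon.1 hcon.2
      have h2 := hcore3.vx.sorted (j - 1) j (Or.inr ⟨by omega, by omega⟩) (Or.inr ⟨by omega, by omega⟩)
        (by omega) hcon.1 hcon.2
      omega
    have hlimb : c.P.A0 + c.Bh * ins + 2 * c.Bh ≤ c.P.lim m3.a := by
      rcases hbad with hb | hb <;> exact hcore3.lim_bad hc hb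
    have hBh := hc.hBh
    refine wp_blk_seq (by simp; omega) ?_
    simp [wpB, Op.ok, Op.ev, e80, hm3.k.c4]
    have hrem := Run.removed_zone (c := c) (R := X1) (a := j - 1) hcore3.gx (by omega) (by omega)
    have h22 := hm3.x.u
    simp only [Nat.reduceAdd] at h22
    refine wp_seq (by omega) (wp_remove hc (hm3.k.congr fun x _ _ _ _ _ _ => by
        rw [Function.update_of_ne (by omega), Function.update_of_ne (by omega)]) hcore3 (by simp [hm3.ins])
      (by simp [hm3.pn]) (by simp [h22]) (by simp) hrem hbad (by omega) ?_)
    intro r4 A4 m4 t4 bad4 fr4 hcore4 e60 e61 hA4 ht4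
    have hlim4 := c.P.lim_mono fr4.2.2.2
    have f4 : ∀ x ∈ keepRegs, x ∉ [60, 61] → r4 x = r3 x := by
      intro x hx hx'
      have h1 : x ∉ [60, 61] → x ∈ keepRegs → remove.clob x = false ∧ x ≠ 90 ∧ x ≠ 91 := by
        revert x; decide
      obtain ⟨h2, h3, h4⟩ := h1 hx' hx
      rw [fr4.1 x h2, Function.update_of_ne h4, Function.update_of_ne h3]
    refine wp_blk _ (by simp; omega) ?_
    simp [wpB, Op.ok, Op.ev, f4 22 (by decide) (by decide), f4 12 (by decide) (by decide), hm3.k.c12, h22]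
    refine ⟨by omega, hQ' _ _ _ _ ⟨_, bad4, ins + 2, pn + 2, ?_, hcore4, ?_, ?_, ?_⟩⟩
    · refine hm3.setX ?_ ?_ ?_ ?_ ?_ ?_ ?_
      · intro x hx hx'
        have h1 : x ∉ [8, 9, 20, 21, 22, 60, 61] → x ∈ keepRegs → x ≠ 22 ∧ x ∉ [60, 61] := by
          revert x; decide
        obtain ⟨h2, h3⟩ := h1 hx' hx
        rw [Function.update_of_ne h2, f4 x hx h3]
      · intro k j hj
        have := hm3.tf
        refine hA4 _ ?_
        unfold slotA; omega
      · refine ⟨?_, ?_, ?_, ?_, ?_⟩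
        · simpa [f4 20 (by decide) (by decide)] using hm3.x.kf
        · simpa [f4 21 (by decide) (by decide)] using hm3.x.kl
        · simp
        · simpa [f4 23 (by decide) (by decide)] using hm3.x.h
        · intro k hk1 hk2
          have h24 : ∀ w, update r4 22 w (20 + 4) = r3 24 := by
            intro w; simp [f4 24 (by decide) (by decide)]
          have := hm3.x.tab k hk1 hk2
          have htf := hm3.tf
          rw [h24, hA4 _ (by unfold slotA; omega), hA4 _ (by unfold slotA; omega),
            hA4 _ (by unfold slotA; omega)]
          exact this
      · simp [f4 8 (by decide) (by decide), hm3.lo]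
      · simp [f4 9 (by decide) (by decide), hm3.o]
      · simp [e60]
      · simp [e61]
    · change X1.kl + 2 * (X1.h - (X1.u + 2)) ≤ _
      rw [mul_add]
      have : X.u ≤ c.n := by omega
      omega
    · rw [mul_add]; omega
    · have hp4 : ({ X1 with u := X1.u + 2 } : Run).pot c = 8000 * (X1.h - (X1.u + 2)) +
          2000 * c.bb * (X1.kl - X1.kf) + if X1.u + 2 < X1.h then 8000 * c.bb else 0 := rfl
      have h5 : (if X1.u + 2 < X1.h then 8000 * c.bb else 0) ≤ 8000 * c.bb := by split_ifs <;> omega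
      have h6 : c.cp = 5000 * c.K + 200 * c.l + 5000 := rfl
      have h7 : c.Bh * (ins + 2) = c.Bh * ins + 2 * c.Bh := by ring
      have h8 : c.cp * (pn + 2) = c.cp * pn + 2 * c.cp := by ring
      rw [hp4, h7, h8]
      omega

/-! ### Exchange of the two runs. -/

/-- Exchange the registers of the two runs. -/
def swapRegs : Cmd :=
  blk ([0, 1, 2, 3, 4, 5, 6, 7, 8, 9, 10].flatMap fun i =>
    [.mov 110 (20 + i), .mov (20 + i) (40 + i), .mov (40 + i) 110])

/-- The permutation of registers that exchanges the two runs. -/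
def swapIdx (x : ℕ) : ℕ :=
  if 20 ≤ x ∧ x ≤ 30 then x + 20 else if 40 ≤ x ∧ x ≤ 50 then x - 20 else x

theorem wp_swapRegs {P : Par} {r A : ℕ → Word} {m : FState} {t : ℕ} {Q : Post}
    (ht : t + 67 ≤ P.lim m.a) (hQ : ∀ r', (∀ x, x ≠ 110 → r' x = r (swapIdx x)) → Q r' A m (t + 67)) :
    wp P swapRegs Q r A m t := by
  refine wp_blk _ (by simp; omega) ?_
  simp [wpB]
  refine hQ _ fun x hx => ?_
  by_cases h : x ∈ [20, 21, 22, 23, 24, 25, 26, 27, 28, 29, 30, 40, 41, 42, 43, 44, 45, 46, 47, 48, 49, 50]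
  · simp only [List.mem_cons, List.not_mem_nil, or_false] at h
    rcases h with rfl | rfl | rfl | rfl | rfl | rfl | rfl | rfl | rfl | rfl | rfl | rfl | rfl | rfl | rfl | rfl |
      rfl | rfl | rfl | rfl | rfl | rfl <;> simp [swapIdx]
  · simp only [List.mem_cons, List.not_mem_nil, or_false, not_or] at h
    have e : swapIdx x = x := by unfold swapIdx; rw [if_neg (by omega), if_neg (by omega)]
    simp [h, hx, e]

/-- The tables stay in place: registers `24` and `44` hold the offset of each table within the
records, and they are exchanged along with the others. -/
theorem Mach.swap {c : Ctx} {r r' A : ℕ → Word} {X Y : Run} {lo o ins pn : ℕ}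
    (h : Mach c r A X Y lo o ins pn) (hr : ∀ x ∈ keepRegs, r' x = r (swapIdx x)) :
    Mach c r' A Y X lo o ins pn where
  k := h.k.congr fun x h1 h2 h3 h4 h5 h6 => by
    rw [hr x (by simp only [keepRegs, List.mem_cons, List.not_mem_nil, or_false]; omega)]
    unfold swapIdx
    rw [if_neg (by omega), if_neg (by omega)]
  x := ⟨by rw [hr _ (by decide)]; exact h.y.kf, by rw [hr _ (by decide)]; exact h.y.kl,
    by rw [hr _ (by decide)]; exact h.y.u, by rw [hr _ (by decide)]; exact h.y.h,
    by rw [hr _ (by decide)]; exact h.y.tab⟩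
  y := ⟨by rw [hr _ (by decide)]; exact h.x.kf, by rw [hr _ (by decide)]; exact h.x.kl,
    by rw [hr _ (by decide)]; exact h.x.u, by rw [hr _ (by decide)]; exact h.x.h,
    by rw [hr _ (by decide)]; exact h.x.tab⟩
  tf := by
    rw [hr _ (by decide), hr _ (by decide)]
    exact h.tf.symm.imp (fun h => ⟨h.2, h.1⟩) fun h => ⟨h.2, h.1⟩
  lo := by rw [hr _ (by decide)]; exact h.lo
  o := by rw [hr _ (by decide)]; exact h.o
  oend := by rw [hr _ (by decide)]; exact h.oend
  ins := by rw [hr _ (by decide)]; exact h.ins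
  pn := by rw [hr _ (by decide)]; exact h.pn

theorem Inv.swap {c : Ctx} {r r' A : ℕ → Word} {m : FState} {T : ℕ} {X Y : Run} {lo o : ℕ}
    {bad : Finset ℕ} {ins pn : ℕ} (h : Inv c r A m T X Y lo o bad ins pn)
    (hr : ∀ x ∈ keepRegs, r' x = r (swapIdx x)) : Inv c r' A m T Y X lo o bad ins pn :=
  ⟨h.mach.swap hr, h.core.swap, h.ky, h.kx, by have := h.time; omega⟩

/-! ### Reading the front blocks and the output bound. -/

/-- The first and the last address of the front block. -/
def Run.fs (R : Run) : ℕ := if R.kf < R.kl then R.S R.kf else 0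

def Run.fe (R : Run) : ℕ := if R.kf < R.kl then R.E R.kf else 0

/-- The registers that describe the progress in the front block of a run. The words below `i` have
been read, those below `ci` were written to the output, `w` is the value of the word at `i`. -/
structure Front (c : Ctx) (b : ℕ) (r mem : ℕ → Word) (bad : Finset ℕ) (R : Run)
    (lo th oo i ci w : ℕ) : Prop where
  r_fs : (r (b + 5)).val = R.fs
  r_fe : (r (b + 6)).val = R.fe
  r_fc : R.kf < R.kl → (r (b + 7)).val = R.C R.kf
  r_i : (r (b + 8)).val = i
  r_ci : (r (b + 9)).val = ci
  r_w : (r (b + 10)).val = w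
  le : R.fs ≤ ci ∧ ci ≤ i ∧ i ≤ R.fe
  bd : i < R.fe → lo ≤ w ∧ w ≤ R.C R.kf
  hd : i < R.fe → i ∉ bad → (mem i).val = w
  out : i < R.fe → ∀ p, c.n ≤ p → p < oo → p ∉ bad → (mem p).val ≤ w
  skip : ci = i ∨ (∀ p, ci ≤ p → p < i → p ∉ bad → th < (mem p).val) ∧ (i < R.fe → th < w) ∧
    th < R.C R.kf

theorem Front.congr {c : Ctx} {b b' : ℕ} {r r' mem : ℕ → Word} {bad : Finset ℕ} {R : Run}
    {lo th oo i ci w : ℕ} (h : Front c b r mem bad R lo th oo i ci w)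
    (hr : ∀ j, 5 ≤ j → j ≤ 10 → r' (b' + j) = r (b + j)) : Front c b' r' mem bad R lo th oo i ci w where
  r_fs := by rw [hr 5 (by omega) (by omega)]; exact h.r_fs
  r_fe := by rw [hr 6 (by omega) (by omega)]; exact h.r_fe
  r_fc := by rw [hr 7 (by omega) (by omega)]; exact h.r_fc
  r_i := by rw [hr 8 (by omega) (by omega)]; exact h.r_i
  r_ci := by rw [hr 9 (by omega) (by omega)]; exact h.r_ci
  r_w := by rw [hr 10 (by omega) (by omega)]; exact h.r_w
  le := h.le
  bd := h.bd
  hd := h.hd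
  out := h.out
  skip := h.skip

theorem Front.sub {c : Ctx} {b : ℕ} {r mem mem' : ℕ → Word} {bad bad' : Finset ℕ} {R : Run}
    {lo th oo oo' i ci w : ℕ} (h : Front c b r mem bad R lo th oo i ci w) (hn : R.fe ≤ c.n)
    (hm : ∀ p, p < c.n → p ∉ bad' → p ∉ bad ∧ mem' p = mem p)
    (ho : i < R.fe → ∀ p, c.n ≤ p → p < oo' → p ∉ bad' → (mem' p).val ≤ w) :
    Front c b r mem' bad' R lo th oo' i ci w := by
  obtain ⟨a1, a2, a3, a4, a5, a6, a7, a8, a9, a10, a11⟩ := h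
  refine ⟨a1, a2, a3, a4, a5, a6, a7, a8, fun h1 h2 => ?_, ho, a11.imp id fun h => ⟨fun p h1 h2 h3 => ?_, h.2⟩⟩
  · obtain ⟨h3, h4⟩ := hm i (by omega) h2
    rw [h4]; exact a9 h1 h3
  · obtain ⟨h4, h5⟩ := hm p (by omega) h3
    rw [h5]; exact h.1 p h1 h2 h4

theorem Front.ev {c : Ctx} {b : ℕ} {r : ℕ → Word} {m m' : FState} {bad F : Finset ℕ} {R : Run}
    {lo th oo i ci w : ℕ} (h : Front c b r m.mem bad R lo th oo i ci w) (hn : R.fe ≤ c.n)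
    (e : EvF c.P.δ ∅ F m m') : Front c b r m'.mem (bad ∪ F) R lo th oo i ci w :=
  h.sub hn (fun _ _ hp => e.val hp) fun h1 p h2 h3 h4 => by
    obtain ⟨h5, h6⟩ := e.val h4
    rw [h6]; exact h.out h1 p h2 h3 h5

theorem Core.fe_le {c : Ctx} (hc : c.Ok) {A m bad X Y lo o ot ins pn}
    (h : Core c A m bad X Y lo o ot ins pn) : X.fe ≤ c.n ∧ X.fs ≤ X.fe ∧ X.fe ≤ X.fs + c.bb ∧
      (X.kf < X.kl → c.plo ≤ X.fs) := by
  have h1 := h.xin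
  have h2 := hc.hphi
  unfold Run.fe Run.fs
  split_ifs with h3
  · obtain ⟨a1, a2, a3, a4⟩ := h.gx.se X.kf le_rfl h3
    have := h.gx.uh
    unfold Ctx.bb
    omega
  · omega

theorem Run.fe_lt {R : Run} {i : ℕ} (h : i < R.fe) :
    R.kf < R.kl ∧ R.fs = R.S R.kf ∧ R.fe = R.E R.kf := by
  unfold Run.fs Run.fe at *
  split_ifs at h ⊢ with h3
  · exact ⟨h3, rfl, rfl⟩
  · omega

/-- Load the word at `r 28`, and restrict its value to the range from `r 8` to `r 27`. -/
def clampLoad : Cmd :=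
  .load 114 28 ;; .cond (.lt 114 8) (blk [.mov 114 8]) .skip ;; .cond (.lt 27 114) (blk [.mov 114 27]) .skip

/-- Good words of the front block lie in this range already. For bad ones the restriction keeps the
output above `lo`, and it ensures that a block whose separator does not exceed the bound is written
completely. -/
theorem wp_clampLoad {P : Par} {r A : ℕ → Word} {m : FState} {t : ℕ} {Q : Post} {i lo fc : ℕ}
    (h28 : (r 28).val = i) (h8 : (r 8).val = lo) (h27 : (r 27).val = fc) (ht : t + 14 ≤ P.lim m.a)
    (hQ : ∀ r' m' t' F, (∀ x, x ≠ 114 → r' x = r x) → EvF P.δ ∅ F m m' →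
      (r' 114).val = min fc (max lo (m'.mem i).val) → t' ≤ t + 14 → Q r' A m' t') :
    wp P clampLoad Q r A m t := by
  refine wp_hide fun Q' hQ' => ?_
  refine wp_seq (by omega) (wp_load (by omega) fun m1 ⟨F, ev⟩ => ?_)
  have hlim := P.lim_mono ev.a_le
  rw [h28]
  have key : ∀ r1 t1, (∀ x, x ≠ 114 → r1 x = r x) → (r1 114).val = max lo (m1.mem i).val → t1 ≤ t + 8 →
      wp P (.cond (.lt 27 114) (blk [.mov 114 27]) .skip) Q' r1 A m1 t1 := by
    intro r1 t1 f1 e1 ht1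
    refine wp_cond (by omega) (fun h => ?_) fun h => ?_
    · simp [Test.ev, f1, h27, e1] at h
      refine wp_blk _ (by simp; omega) ?_
      simp [wpB]
      exact hQ' _ _ _ _ (hQ _ _ _ F (fun x hx => by simp [hx, f1]) ev (by simp [f1, h27]; omega) (by omega))
    · simp only [Test.ev, f1, h27, e1, ne_eq, Nat.reduceEqDiff, not_false_eq_true] at h
      exact wp_skip (by omega) (hQ' _ _ _ _ (hQ _ _ _ F f1 ev (by omega) (by omega)))
  refine wp_seq (by omega) (wp_cond (by omega) (fun h => ?_) fun h => ?_)
  · simp [Test.ev, h8] at h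
    refine wp_blk _ (by simp; omega) ?_
    simp [wpB]
    exact key _ _ (fun x hx => by simp [hx]) (by simp [h8]; omega) (by omega)
  · simp [Test.ev, h8] at h
    exact wp_skip (by omega) (key _ _ (fun x hx => by simp [hx]) (by simp; omega) (by omega))

/-- Start to read the front block of the first run. -/
def loadFront : Cmd :=
  .cond (.lt 20 21) (blk [.mov 110 20] ;; slotC ;; blk [.lds 25 111, .op .add 111 111 4, .lds 26 111,
    .op .add 111 111 4, .lds 27 111]) (blk [.mov 25 3, .mov 26 3, .mov 27 3]) ;;
  blk [.mov 28 25, .mov 29 25] ;; .cond (.lt 28 26) (clampLoad ;; blk [.mov 30 114]) .skip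

/-- Nothing has been read or written yet, so the result holds for every bound `th`; the bound is
fixed only after both fronts are loaded. -/
theorem wp_loadFront {c : Ctx} (hc : c.Ok) {r A : ℕ → Word} {m : FState} {t : ℕ} {Q : Post}
    {X Y : Run} {lo o ins pn : ℕ} {bad : Finset ℕ} (hm : Mach c r A X Y lo o ins pn)
    (h : Core c A m bad X Y lo o lo ins pn) (hkM : X.kl < c.P.M) (ht : t + 70 ≤ c.P.lim m.a)
    (hQ : ∀ r' m' t' F w, (∀ x, x ∉ [25, 26, 27, 28, 29, 30, 110, 111, 114] → r' x = r x) →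
      EvF c.P.δ ∅ F m m' → (∀ th, Front c 20 r' m'.mem (bad ∪ F) X lo th o X.fs X.fs w) →
      t' ≤ t + 70 → Q r' A m' t') :
    wp c.P loadFront Q r A m t := by
  have hP := hc.ok
  have hM := hP.hM
  have hcap := hP.hcap
  have hSS := hP.hS
  have hSd := hP.hSδ
  have h20 := hm.x.kf
  have h21 := hm.x.kl
  simp only [Nat.reduceAdd] at h21
  have hfe := h.fe_le hc
  refine wp_hide fun Q' hQ' => ?_
  have key : ∀ r1 t1, (∀ x, x ∉ [25, 26, 27, 110, 111] → r1 x = r x) → (r1 25).val = X.fs →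
      (r1 26).val = X.fe → (X.kf < X.kl → (r1 27).val = X.C X.kf) → t1 ≤ t + 40 →
      wp c.P (blk [.mov 28 25, .mov 29 25] ;; .cond (.lt 28 26) (clampLoad ;; blk [.mov 30 114]) .skip)
        Q' r1 A m t1 := by
    intro r1 t1 f1 e25 e26 e27 ht1
    refine wp_blk_seq (by simp; omega) ?_
    simp [wpB]
    refine wp_cond (by omega) (fun hlt => ?_) fun hlt => ?_
    · simp [Test.ev, e25, e26] at hlt
      obtain ⟨g1, g2, g3⟩ := Run.fe_lt hlt
      refine wp_seq (by omega) (wp_clampLoad (i := X.fs) (lo := lo) (fc := X.C X.kf) (by simp [e25])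
        (by simp [f1, hm.lo]) (by simp [e27 g1]) (by omega) ?_)
      intro r2 m2 t2 F f2 ev e114 ht2
      have hlim := c.P.lim_mono ev.a_le
      refine wp_blk _ (by simp; omega) ?_
      simp [wpB]
      have hcell : X.Cell X.fs := Or.inl ⟨X.kf, ⟨le_rfl, g1⟩, by omega, by omega⟩
      have hblk : X.Blk X.kf X.fs := ⟨⟨le_rfl, g1⟩, by omega, by omega⟩
      have hloC := h.vx.geC X.kf le_rfl g1
      refine hQ' _ _ _ _ (hQ _ _ _ F (r2 114).val (fun x hx => ?_) ev (fun th => ⟨?_, ?_, ?_, ?_, ?_, ?_, ?_, ?_, ?_, ?_, Or.inl rfl⟩) (by omega))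
      · simp only [List.mem_cons, List.not_mem_nil, or_false, not_or] at hx
        simp [hx, f2, f1]
      · simp [f2, e25]
      · simp [f2, e26]
      · simpa [f2] using e27
      · simp [f2, e25]
      · simp [f2, e25]
      · simp
      · exact ⟨le_rfl, le_rfl, hfe.2.1⟩
      · intro _; omega
      · intro _ hp
        obtain ⟨b1, b2⟩ := ev.val hp
        have c1 := h.vx.ge _ hcell b1
        have c2 := h.vx.up _ _ hblk b1
        rw [b2] at e114 ⊢
        omega
      · intro _ p h1 h2 h3
        obtain ⟨b1, b2⟩ := ev.val h3
        have := h.obd p h1 h2 b1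
        rw [b2]
        omega
    · simp [Test.ev, e25, e26] at hlt
      refine wp_skip (by omega) (hQ' _ _ _ _ (hQ _ _ _ ∅ (r 30).val (fun x hx => ?_) (EvF.refl _ _ _) (fun th => ⟨?_, ?_, ?_, ?_, ?_, ?_, ?_, ?_, ?_, ?_, Or.inl rfl⟩) (by omega)))
      · simp only [List.mem_cons, List.not_mem_nil, or_false, not_or] at hx
        simp [hx, f1]
      · simp [e25]
      · simp [e26]
      · simpa using e27
      · simp [e25]
      · simp [e25]
      · simp [f1]
      · exact ⟨le_rfl, le_rfl, hfe.2.1⟩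
      all_goals intro h5; omega
  refine wp_seq (by omega) (wp_cond (by omega) (fun hlt => ?_) fun hlt => ?_)
  · simp [Test.ev, h20, h21] at hlt
    refine wp_blk_seq (by simp; omega) ?_
    simp [wpB]
    have htf := hm.tf3
    refine wp_seq (by omega) (wp_slotC hP (k := X.kf) (tf := (r 24).val)
      (hm.k.congr fun x _ _ _ _ _ _ => Function.update_of_ne (by omega) _ _) (by simp [h20]) (by simp) htf.1
      (by omega) (by omega) ?_)
    intro r1 f1 e111
    have hsl := slotA_lt (S := c.S) (k := X.kf) htf.1
    have htab := hm.x.tab X.kf le_rfl hlt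
    simp only [Nat.reduceAdd] at htab
    refine wp_blk _ (by simp; omega) ?_
    simp [wpB, Op.ok, Op.ev, e111, f1, hm.k.c4]
    refine ⟨by omega, by omega, by omega, by omega, by omega, key _ _ (fun x hx => ?_) ?_ ?_ ?_ (by omega)⟩
    · simp only [List.mem_cons, List.not_mem_nil, or_false, not_or] at hx
      simp [hx, f1]
    · simp [htab, Run.fs, hlt]
    · simp [htab, Run.fe, hlt]
    · intro _; simp [add_assoc, htab]
  · simp [Test.ev, h20, h21] at hlt
    have hn : ¬ X.kf < X.kl := by omega
    refine wp_blk _ (by simp; omega) ?_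
    simp [wpB, hm.k.c3]
    refine key _ _ (fun x hx => ?_) ?_ ?_ ?_ (by omega)
    · simp only [List.mem_cons, List.not_mem_nil, or_false, not_or] at hx
      simp [hx]
    · simp [Run.fs, hn]
    · simp [Run.fe, hn]
    · exact fun h => absurd h hn

theorem PQ.root_zero {n S : ℕ} {A mem : ℕ → Word} {ins lo : ℕ} (h : PQ n S A mem ins 0 lo)
    (hS : 1 ≤ S) : nwin A 1 = 0 := by
  by_contra hne
  obtain ⟨g, hg, -, h1, -⟩ := h.win (2 * S) 1 le_rfl (by omega) (by omega) hne
  have h2 := h.sum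
  rw [Finset.sum_eq_zero_iff] at h2
  have := h2 g (Finset.mem_range.2 hg)
  simp [gsz, h1] at this

/-- Determine the bound up to which words can be written to the output. -/
def bound : Cmd :=
  blk [.mov 70 3, .mov 71 3] ;;
  .cond (.lt 20 21) (blk [.mov 70 27, .mov 71 4]) .skip ;;
  .cond (.lt 40 41) (.cond (.eq 71 3) (blk [.mov 70 47, .mov 71 4])
    (.cond (.lt 47 70) (blk [.mov 70 47]) .skip)) .skip ;;
  .cond (.lt 3 61) (blk [.set 111 151, .lds 72 111] ;;
    .cond (.eq 71 3) (blk [.mov 70 72, .mov 71 12])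
      (.cond (.lt 72 70) (blk [.mov 70 72, .mov 71 12]) .skip)) .skip ;;
  .cond (.lt 70 8) (blk [.mov 70 8]) .skip

/-- What the bound `th` satisfies; `q` says whether it was provided by the priority queue. -/
structure Bound (A : ℕ → Word) (X Y : Run) (lo pn th : ℕ) (q : Prop) : Prop where
  lo_le : lo ≤ th
  x : X.kf < X.kl → th = lo ∨ th ≤ X.C X.kf
  y : Y.kf < Y.kl → th = lo ∨ th ≤ Y.C Y.kf
  pq : pn ≠ 0 → th ≤ max lo (nval A 1).val
  pop : q → pn ≠ 0 ∧ (nval A 1).val ≤ th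
  run : ¬ q → (X.kf < X.kl ∧ X.C X.kf ≤ th) ∨ (Y.kf < Y.kl ∧ Y.C Y.kf ≤ th)

/-- Register `71` remembers which source provided the minimum: `1` for a run, `2` for the queue.
This decides afterwards which credit pays for the phase. The final comparison with `lo` keeps the
bounds of successive phases nondecreasing. -/
theorem wp_bound {P : Par} {r A : ℕ → Word} {m : FState} {t : ℕ} {Q : Post} {X Y : Run} {lo pn : ℕ}
    (h3 : r 3 = ⟨0, none⟩) (h4 : (r 4).val = 1) (h12 : (r 12).val = 2) (hM : 1000 ≤ P.M)
    (hcap : 152 ≤ P.cap) (h20 : (r 20).val = X.kf) (h21 : (r 21).val = X.kl)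
    (h27 : X.kf < X.kl → (r 27).val = X.C X.kf) (h40 : (r 40).val = Y.kf) (h41 : (r 41).val = Y.kl)
    (h47 : Y.kf < Y.kl → (r 47).val = Y.C Y.kf) (h8 : (r 8).val = lo) (h61 : (r 61).val = pn)
    (hne : X.kf < X.kl ∨ Y.kf < Y.kl ∨ pn ≠ 0) (ht : t + 60 ≤ P.lim m.a)
    (hQ : ∀ r' t' th, (∀ x, x ∉ [70, 71, 72, 111] → r' x = r x) → (r' 70).val = th →
      Bound A X Y lo pn th ((r' 71).val = 2) → t' ≤ t + 60 → Q r' A m t') :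
    wp P bound Q r A m t := by
  refine wp_hide fun Q' hQ' => ?_
  refine wp_blk_seq (by simp; omega) ?_
  simp [wpB, h3]
  have last : ∀ r1 t1, (∀ x, x ∉ [70, 71, 72, 111] → r1 x = r x) →
      (X.kf < X.kl → (r1 70).val ≤ X.C X.kf) → (Y.kf < Y.kl → (r1 70).val ≤ Y.C Y.kf) →
      (pn ≠ 0 → (r1 70).val ≤ (nval A 1).val) →
      ((r1 71).val = 2 → pn ≠ 0 ∧ (nval A 1).val ≤ (r1 70).val) →
      ((r1 71).val ≠ 2 → (X.kf < X.kl ∧ X.C X.kf ≤ (r1 70).val) ∨ (Y.kf < Y.kl ∧ Y.C Y.kf ≤ (r1 70).val)) →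
      t1 ≤ t + 50 → wp P (.cond (.lt 70 8) (blk [.mov 70 8]) .skip) Q' r1 A m t1 := by
    intro r1 t1 f1 b1 b2 b3 b4 b5 ht1
    refine wp_cond (by omega) (fun h => ?_) fun h => ?_
    · simp [Test.ev, f1, h8] at h
      refine wp_blk _ (by simp; omega) ?_
      simp [wpB]
      refine hQ' _ _ _ _ (hQ _ _ lo (fun x hx => ?_) (by simp [f1, h8]) ?_ (by omega))
      · simp only [List.mem_cons, List.not_mem_nil, or_false, not_or] at hx
        simp [hx, f1]
      · simp only [ne_eq, Nat.reduceEqDiff, not_false_eq_true, Function.update_of_ne]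
        exact ⟨le_rfl, fun _ => Or.inl rfl, fun _ => Or.inl rfl, fun _ => le_max_left _ _,
          fun h5 => ⟨(b4 h5).1, by have := (b4 h5).2; omega⟩,
          fun h5 => (b5 h5).imp (fun h => ⟨h.1, by omega⟩) fun h => ⟨h.1, by omega⟩⟩
    · simp [Test.ev, f1, h8] at h
      exact wp_skip (by omega) (hQ' _ _ _ _ (hQ _ _ _ f1 rfl ⟨h, fun h => Or.inr (b1 h), fun h => Or.inr (b2 h),
        fun h => le_max_of_le_right (b3 h), b4, b5⟩ (by omega)))
  have third : ∀ r1 t1, (∀ x, x ∉ [70, 71] → r1 x = r x) →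
      (X.kf < X.kl → (r1 70).val ≤ X.C X.kf) → (Y.kf < Y.kl → (r1 70).val ≤ Y.C Y.kf) →
      ((r1 71).val = 0 ∧ ¬ X.kf < X.kl ∧ ¬ Y.kf < Y.kl ∨ (r1 71).val = 1 ∧
      ((X.kf < X.kl ∧ X.C X.kf ≤ (r1 70).val) ∨ (Y.kf < Y.kl ∧ Y.C Y.kf ≤ (r1 70).val))) →
      t1 ≤ t + 28 → wp P (.cond (.lt 3 61) (blk [.set 111 151, .lds 72 111] ;;
        .cond (.eq 71 3) (blk [.mov 70 72, .mov 71 12])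
          (.cond (.lt 72 70) (blk [.mov 70 72, .mov 71 12]) .skip)) .skip ;;
      .cond (.lt 70 8) (blk [.mov 70 8]) .skip) Q' r1 A m t1 := by
    intro r1 t1 f1 b1 b2 b3 ht1
    have ep : (A 151) = nval A 1 := rfl
    refine wp_seq (by omega) (wp_cond (by omega) (fun h => ?_) fun h => ?_)
    · simp [Test.ev, f1, h61, h3] at h
      refine wp_blk_seq (by simp; omega) ?_
      simp [wpB]
      refine ⟨by omega, by omega, wp_cond (by omega) (fun h5 => ?_) fun h5 => ?_⟩
      · simp [Test.ev, f1, h3] at h5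
        have hx : ¬ X.kf < X.kl ∧ ¬ Y.kf < Y.kl := by
          rcases b3 with b | b
          · exact b.2
          · omega
        refine wp_blk _ (by simp; omega) ?_
        simp [wpB]
        refine last _ _ (fun x hx => ?_) (fun h => absurd h hx.1) (fun h => absurd h hx.2) (fun _ => by simp [ep])
          (fun _ => ⟨by omega, by simp [ep]⟩) (fun h6 => by simp [f1, h12] at h6) (by omega)
        simp only [List.mem_cons, List.not_mem_nil, or_false, not_or] at hx
        simp [hx, f1]
      · simp [Test.ev, f1, h3] at h5
        have hx : (r1 71).val = 1 ∧
          ((X.kf < X.kl ∧ X.C X.kf ≤ (r1 70).val) ∨ (Y.kf < Y.kl ∧ Y.C Y.kf ≤ (r1 70).val)) := by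
          rcases b3 with b | b
          · omega
          · exact b
        refine wp_cond (by omega) (fun h6 => ?_) fun h6 => ?_
        · simp [Test.ev, ep] at h6
          refine wp_blk _ (by simp; omega) ?_
          simp [wpB]
          refine last _ _ (fun x hx => ?_) (fun h => ?_) (fun h => ?_) (fun _ => by simp [ep])
            (fun _ => ⟨by omega, by simp [ep]⟩) (fun h6 => by simp [f1, h12] at h6) (by omega)
          · simp only [List.mem_cons, List.not_mem_nil, or_false, not_or] at hx
            simp [hx, f1]
          · have := b1 h; simp [ep]; omega
          · have := b2 h; simp [ep]; omega
        · simp [Test.ev, ep] at h6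
          refine wp_skip (by omega) (last _ _ (fun x hx => ?_) (by simpa using b1) (by simpa using b2)
            (fun _ => by simpa using h6) (fun h7 => by simp [hx.1] at h7) (fun _ => by simpa using hx.2) (by omega))
          simp only [List.mem_cons, List.not_mem_nil, or_false, not_or] at hx
          simp [hx, f1]
    · simp [Test.ev, f1, h61, h3] at h
      refine wp_skip (by omega) (last _ _ (fun x hx => ?_) b1 b2 (fun h5 => by omega) (fun h5 => by omega)
        (fun _ => ?_) (by omega))
      · simp only [List.mem_cons, List.not_mem_nil, or_false, not_or] at hx
        simp [hx, f1]
      · rcases b3 with b | b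
        · omega
        · exact b.2
  have second : ∀ r1 t1, (∀ x, x ∉ [70, 71] → r1 x = r x) →
      ((r1 71).val = 0 ∧ ¬ X.kf < X.kl ∨ (r1 71).val = 1 ∧ X.kf < X.kl ∧ (r1 70).val = X.C X.kf) →
      t1 ≤ t + 15 → wp P (.cond (.lt 40 41) (.cond (.eq 71 3) (blk [.mov 70 47, .mov 71 4])
        (.cond (.lt 47 70) (blk [.mov 70 47]) .skip)) .skip ;; .cond (.lt 3 61) (blk [.set 111 151, .lds 72 111] ;;
        .cond (.eq 71 3) (blk [.mov 70 72, .mov 71 12])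
          (.cond (.lt 72 70) (blk [.mov 70 72, .mov 71 12]) .skip)) .skip ;;
      .cond (.lt 70 8) (blk [.mov 70 8]) .skip) Q' r1 A m t1 := by
    intro r1 t1 f1 b1 ht1
    refine wp_seq (by omega) (wp_cond (by omega) (fun h => ?_) fun h => ?_)
    · simp [Test.ev, f1, h40, h41] at h
      have e47 := h47 h
      refine wp_cond (by omega) (fun h5 => ?_) fun h5 => ?_
      · simp [Test.ev, f1, h3] at h5
        have hx : ¬ X.kf < X.kl := by omega
        refine wp_blk _ (by simp; omega) ?_
        simp [wpB]
        refine third _ _ (fun x hx => ?_) (fun h => absurd h hx) (fun _ => by simp [f1, e47])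
          (Or.inr ⟨by simp [f1, h4], Or.inr ⟨h, by simp [f1, e47]⟩⟩) (by omega)
        simp only [List.mem_cons, List.not_mem_nil, or_false, not_or] at hx
        simp [hx, f1]
      · simp [Test.ev, f1, h3] at h5
        have hx : (r1 71).val = 1 ∧ X.kf < X.kl ∧ (r1 70).val = X.C X.kf := by omega
        refine wp_cond (by omega) (fun h6 => ?_) fun h6 => ?_
        · simp [Test.ev, f1, e47, hx.2.2] at h6
          refine wp_blk _ (by simp; omega) ?_
          simp [wpB]
          refine third _ _ (fun x hx => ?_) (fun _ => by simp [f1, e47]; omega) (fun _ => by simp [f1, e47])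
            (Or.inr ⟨by simp [hx.1], Or.inr ⟨h, by simp [f1, e47]⟩⟩) (by omega)
          simp only [List.mem_cons, List.not_mem_nil, or_false, not_or] at hx
          simp [hx, f1]
        · simp [Test.ev, f1, e47, hx.2.2] at h6
          exact wp_skip (by omega) (third _ _ f1 (fun _ => by omega) (fun _ => by omega)
            (Or.inr ⟨hx.1, Or.inl ⟨hx.2.1, by omega⟩⟩) (by omega))
    · simp [Test.ev, f1, h40, h41] at h
      refine wp_skip (by omega) (third _ _ f1 (fun h => ?_) (fun h => by omega) ?_ (by omega))
      · rcases b1 with b | b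
        · omega
        · omega
      · rcases b1 with b | b
        · exact Or.inl ⟨b.1, b.2, by omega⟩
        · exact Or.inr ⟨b.1, Or.inl ⟨b.2.1, by omega⟩⟩
  refine wp_seq (by omega) (wp_cond (by omega) (fun h => ?_) fun h => ?_)
  · simp [Test.ev, h20, h21] at h
    refine wp_blk _ (by simp; omega) ?_
    simp [wpB]
    refine second _ _ (fun x hx => ?_) (Or.inr ⟨by simp [h4], h, by simp [h27 h]⟩) (by omega)
    simp only [List.mem_cons, List.not_mem_nil, or_false, not_or] at hx
    simp [hx]
  · simp [Test.ev, h20, h21] at h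
    refine wp_skip (by omega) (second _ _ (fun x hx => ?_) (Or.inl ⟨by simp, by omega⟩) (by omega))
    simp only [List.mem_cons, List.not_mem_nil, or_false, not_or] at hx
    simp [hx]

/-! ### Merging the front blocks tentatively. -/

/-- The state while the front blocks are merged; the words from `o` to `oo` are tentative output. -/
structure Merging (c : Ctx) (r A : ℕ → Word) (m : FState) (X Y : Run) (lo o : ℕ) (bad : Finset ℕ)
    (ins pn th oo i ci w i' ci' w' : ℕ) : Prop where
  mach : Mach c r A X Y lo o ins pn
  core : Core c A m bad X Y lo o lo ins pn
  tent : Core c A m bad (X.cut ci) (Y.cut ci') lo oo th ins pn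
  fx : Front c 20 r m.mem bad X lo th oo i ci w
  fy : Front c 40 r m.mem bad Y lo th oo i' ci' w'
  r_th : (r 70).val = th
  r_oo : (r 73).val = oo
  r_rem : (r 74).val = (X.fe - i) + (Y.fe - i')
  r_ok : (r 75).val = 0
  le : o ≤ oo

theorem Merging.swap {c r r' A m X Y lo o bad ins pn th oo i ci w i' ci' w'}
    (h : Merging c r A m X Y lo o bad ins pn th oo i ci w i' ci' w')
    (hr : ∀ x, x ≠ 110 → r' x = r (swapIdx x)) :
    Merging c r' A m Y X lo o bad ins pn th oo i' ci' w' i ci w := by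
  refine ⟨h.mach.swap fun x hx => hr x (by revert hx; revert x; decide), h.core.swap, h.tent.swap,
    h.fy.congr fun j h1 h2 => ?_, h.fx.congr fun j h1 h2 => ?_, ?_, ?_, ?_, ?_, h.le⟩
  · rw [hr _ (by omega)]; congr 1; unfold swapIdx; rw [if_pos (by omega)]; omega
  · rw [hr _ (by omega)]; congr 1; unfold swapIdx; rw [if_neg (by omega), if_pos (by omega)]; omega
  · rw [hr _ (by omega)]; exact h.r_th
  · rw [hr _ (by omega)]; exact h.r_oo
  · rw [hr _ (by omega)]; have := h.r_rem; simp only [swapIdx]; norm_num; omega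
  · rw [hr _ (by omega)]; exact h.r_ok

theorem Merging.ev {c r A m X Y lo o bad ins pn th oo i ci w i' ci' w'} (hc : c.Ok)
    (h : Merging c r A m X Y lo o bad ins pn th oo i ci w i' ci' w') {m' : FState} {F : Finset ℕ}
    (e : EvF c.P.δ ∅ F m m') :
    Merging c r A m' X Y lo o (bad ∪ F) ins pn th oo i ci w i' ci' w' :=
  ⟨h.mach, h.core.ev hc e, h.tent.ev hc e, h.fx.ev (h.core.fe_le hc).1 e, h.fy.ev (h.core.swap.fe_le hc).1 e,
    h.r_th, h.r_oo, h.r_rem, h.r_ok, h.le⟩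

/-- Make the run with the smaller head the first run. -/
def choose : Cmd :=
  .cond (.lt 48 46) (.cond (.lt 28 26) (.cond (.lt 50 30) swapRegs .skip) swapRegs) .skip

theorem wp_choose {c : Ctx} {r A : ℕ → Word} {m : FState} {t : ℕ} {Q : Post}
    {X Y lo o bad ins pn th oo i ci w i' ci' w'}
    (h : Merging c r A m X Y lo o bad ins pn th oo i ci w i' ci' w') (h0 : (r 74).val ≠ 0)
    (ht : t + 75 ≤ c.P.lim m.a)
    (hQ : ∀ r' t' X' Y' i ci w i' ci' w', (X' = X ∧ Y' = Y ∨ X' = Y ∧ Y' = X) →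
      Merging c r' A m X' Y' lo o bad ins pn th oo i ci w i' ci' w' → (r' 74) = r 74 → i < X'.fe →
      (i' < Y'.fe → w ≤ w') → t' ≤ t + 75 → Q r' A m t') :
    wp c.P choose Q r A m t := by
  have e46 := h.fy.r_fe
  have e48 := h.fy.r_i
  have e50 := h.fy.r_w
  have e26 := h.fx.r_fe
  have e28 := h.fx.r_i
  have e30 := h.fx.r_w
  have hx := h.fx.le
  have hy := h.fy.le
  have hrem := h.r_rem
  simp only [Nat.reduceAdd] at e46 e48 e50 e26 e28 e30
  refine wp_cond (by omega) (fun h1 => ?_) fun h1 => ?_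
  · simp only [Test.ev, e46, e48] at h1
    refine wp_cond (by omega) (fun h2 => ?_) fun h2 => ?_
    · simp only [Test.ev, e26, e28] at h2
      refine wp_cond (by omega) (fun h3 => ?_) fun h3 => ?_
      · simp only [Test.ev, e50, e30] at h3
        refine wp_swapRegs (by omega) fun r' hr => ?_
        exact hQ _ _ _ _ _ _ _ _ _ _ (Or.inr ⟨rfl, rfl⟩) (h.swap hr) (hr 74 (by omega)) h1
          (fun _ => by omega) (by omega)
      · simp only [Test.ev, e50, e30] at h3
        exact wp_skip (by omega) (hQ _ _ _ _ _ _ _ _ _ _ (Or.inl ⟨rfl, rfl⟩) h rfl h2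
          (fun _ => by omega) (by omega))
    · simp only [Test.ev, e26, e28] at h2
      refine wp_swapRegs (by omega) fun r' hr => ?_
      exact hQ _ _ _ _ _ _ _ _ _ _ (Or.inr ⟨rfl, rfl⟩) (h.swap hr) (hr 74 (by omega)) h1
        (fun _ => by omega) (by omega)
  · simp only [Test.ev, e46, e48] at h1
    exact wp_skip (by omega) (hQ _ _ _ _ _ _ _ _ _ _ (Or.inl ⟨rfl, rfl⟩) h rfl (by omega)
      (fun _ => by omega) (by omega))

/-- The state after the head of the first run was processed, before the next head is loaded. -/
structure Half (c : Ctx) (r A : ℕ → Word) (m : FState) (X Y : Run) (lo o : ℕ) (bad : Finset ℕ)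
    (ins pn th oo i ci w i' ci' w' : ℕ) : Prop where
  mach : Mach c r A X Y lo o ins pn
  core : Core c A m bad X Y lo o lo ins pn
  tent : Core c A m bad (X.cut ci) (Y.cut ci') lo oo th ins pn
  fy : Front c 40 r m.mem bad Y lo th oo i' ci' w'
  r_th : (r 70).val = th
  r_oo : (r 73).val = oo
  r_rem : (r 74).val = (X.fe - (i + 1)) + (Y.fe - i')
  r_ok : (r 75).val = 0
  le : o ≤ oo
  r_fs : (r 25).val = X.fs
  r_fe : (r 26).val = X.fe
  r_fc : (r 27).val = X.C X.kf
  r_i : (r 28).val = i + 1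
  r_ci : (r 29).val = ci
  r_w : (r 30).val = w
  li : X.fs ≤ i ∧ i < X.fe ∧ X.fs ≤ ci ∧ ci ≤ i + 1
  bd : lo ≤ w ∧ w ≤ X.C X.kf
  hd : i ∉ bad → (m.mem i).val = w
  out : ∀ p, c.n ≤ p → p < oo → p ∉ bad → (m.mem p).val ≤ w
  skip : ci = i + 1 ∨ (∀ p, ci ≤ p → p < i + 1 → p ∉ bad → th < (m.mem p).val) ∧ th < w ∧
    th < X.C X.kf

theorem Run.cut_cut (R : Run) (i j : ℕ) : (R.cut i).cut j = R.cut j := by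
  simp [Run.cut]

/-- Write the head of the first run to the output, if it does not exceed the bound. -/
def emitHead : Cmd :=
  .cond (.lt 70 30) .skip (blk [.mov 110 28, .mov 111 30, .mov 112 73] ;; emit ;;
    blk [.op .add 73 73 4, .op .add 29 28 4]) ;;
  blk [.op .add 28 28 4, .op .sub 74 74 4]

/-- Heads above the bound are passed over but still read. The head written is the smaller one, so
the output stays below the heads of both runs. -/
theorem wp_emitHead {c : Ctx} (hc : c.Ok) {r A : ℕ → Word} {m : FState} {t : ℕ} {Q : Post}
    {X Y lo o bad ins pn th oo i ci w i' ci' w'}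
    (h : Merging c r A m X Y lo o bad ins pn th oo i ci w i' ci' w') (hi : i < X.fe)
    (hww : i' < Y.fe → w ≤ w') (ht : t + 40 ≤ c.P.lim m.a)
    (hQ : ∀ r' m' t' bad' oo' ci1, Half c r' A m' X Y lo o bad' ins pn th oo' i ci1 w i' ci' w' →
      (r' 74).val = (r 74).val - 1 → m.a ≤ m'.a →
      t' ≤ t + 40 → Q r' A m' t') :
    wp c.P emitHead Q r A m t := by
  have e26 := h.fx.r_fe
  have e28 := h.fx.r_i
  have e29 := h.fx.r_ci
  have e30 := h.fx.r_w
  have hx := h.fx.le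
  have hrem := h.r_rem
  simp only [Nat.reduceAdd] at e26 e28 e29 e30
  have hfe := h.core.fe_le hc
  obtain ⟨g1, g2, g3⟩ := Run.fe_lt hi
  have hP := hc.ok
  have hM := hP.hM
  have hno := h.core.no
  have hle := h.le
  have hol := h.tent.o_le hc
  have hc4 := h.mach.k.c4
  have hout := h.fx.out hi
  refine wp_hide fun Q' hQ' => ?_
  refine wp_seq (by omega) (wp_cond (by omega) (fun h1 => ?_) fun h1 => ?_)
  · simp only [Test.ev, h.r_th, e30] at h1
    refine wp_skip (by omega) (wp_blk _ (by simp; omega) ?_)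
    simp [wpB, Op.ok, Op.ev, e28, hc4]
    refine ⟨by omega, hQ' _ _ _ _ (hQ _ _ _ bad oo ci ⟨?_, h.core, h.tent, ?_, ?_, ?_, ?_, ?_, h.le, ?_, ?_, ?_,
      ?_, ?_, ?_, by omega, h.fx.bd hi, h.fx.hd hi, hout, Or.inr ⟨fun p h2 h3 h4 => ?_, h1,
        h1.trans_le (h.fx.bd hi).2⟩⟩ (by simp) le_rfl (by omega))⟩
    · refine h.mach.congr (fun x hx => ?_) (ArrHi.refl _)
      have : x ≠ 28 ∧ x ≠ 74 := by revert hx; revert x; decide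
      simp [this]
    · exact h.fy.congr fun j h1 h2 => by
        have : 40 + j ≠ 28 ∧ 40 + j ≠ 74 := by omega
        simp [this]
    · simp [h.r_th]
    · simp [h.r_oo]
    · simp; omega
    · simp [h.r_ok]
    · simpa using h.fx.r_fs
    · simp [e26]
    · simpa using h.fx.r_fc g1
    · simp
    · simp [e29]
    · simp [e30]
    · by_cases e : p = i
      · subst e; rw [h.fx.hd hi h4]; exact h1
      · rcases h.fx.skip with h5 | h5
        · omega
        · exact h5.1 p h2 (by omega) h4
  · simp only [Test.ev, h.r_th, e30, not_lt] at h1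
    -- Once a head has been passed over, all later heads of its block exceed the bound. A head
    -- within the bound shows that none was passed over.
    have hci : ci = i := by
      rcases h.fx.skip with h5 | h5
      · exact h5
      · have := h5.2.1 hi; omega
    subst hci
    refine wp_blk_seq (by simp; omega) ?_
    simp [wpB]
    have hblk : X.Blk X.kf ci := ⟨⟨le_rfl, g1⟩, by omega, by omega⟩
    have hS : (X.cut ci).S (X.cut ci).kf = ci := Function.update_self _ _ _
    refine wp_seq (by omega) (wp_emit (p := ci) (q := oo) (v := w) (by simp [h.mach.k.c3]) (by simp [e28])
      (by simp [e30]) (by simp [h.r_oo]) (fun hs => ?_) (by omega) ?_)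
    · exact h.fx.hd hi (h.core.clean ci (Or.inr (Or.inl (Or.inl ⟨_, hblk⟩))) hs)
    intro r1 A1 m1 t1 F fr1 ev1 hqF hval hsrc ht1
    obtain rfl := fr1.2.1 (by decide)
    have hlim := c.P.lim_mono fr1.2.2.2
    have ht1' := h.tent.emit_cell hc g1 (by rw [hS]; change ci < X.E X.kf; omega) ev1 hval (by rw [hS]; exact hsrc)
      hout h1
    rw [hS, Run.cut_cut] at ht1'
    have hol1 := ht1'.o_le hc
    have f : ∀ x, x ∉ [110, 111, 112, 113] → r1 x = r x := by
      intro x hx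
      simp only [List.mem_cons, List.not_mem_nil, or_false, not_or] at hx
      rw [fr1.1 x]
      · simp [hx]
      · simp [emit, blk, Ins.toCmd, Cmd.clob]; omega
    have hcore := h.core.step hc (bad' := (bad ∪ F).erase oo) ev1 (by rintro p rfl; omega)
      (fun p hp => by simp at hp; simp [hp])
      ((Finset.card_le_card (Finset.erase_subset _ _)).trans (Finset.card_union_le _ _))
    have hsub : ∀ p, p ≠ oo → p ∉ (bad ∪ F).erase oo → p ∉ bad ∧ m1.mem p = m.mem p := by
      intro p h2 h3
      simp [h2] at h3
      exact ⟨h3.1, ev1.same p (by simpa using h2) h3.2⟩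
    refine wp_blk _ (by simp; omega) (by
      simp [wpB, Op.ok, Op.ev, f, e28, h.r_oo, hc4]
      refine ⟨by omega, by omega, ?_⟩
      refine wp_blk _ (by simp; omega) ?_
      simp [wpB, Op.ok, Op.ev, f, e28, hc4]
      refine ⟨by omega, hQ' _ _ _ _ (hQ _ _ _ ((bad ∪ F).erase oo) (oo + 1) (ci + 1) ⟨?_, hcore, ht1', ?_, ?_, ?_, ?_, ?_, by omega, ?_, ?_, ?_,
        ?_, ?_, ?_, by omega, h.fx.bd hi, ?_, ?_, Or.inl rfl⟩ (by simp) ev1.a_le (by omega))⟩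
      · refine h.mach.congr (fun x hx => ?_) (ArrHi.refl _)
        have : x ≠ 28 ∧ x ≠ 74 ∧ x ≠ 73 ∧ x ≠ 29 ∧ x ∉ [110, 111, 112, 113] := by revert hx; revert x; decide
        simp [this, f]
      · refine (h.fy.sub (mem' := m1.mem) (bad' := (bad ∪ F).erase oo) (oo' := oo + 1)
          (h.core.swap.fe_le hc).1 (fun p hp => hsub p (by omega)) ?_).congr ?_
        · intro h2 p h3 h4 h5
          by_cases e : p = oo
          · subst e; rw [hval]; exact hww h2
          · obtain ⟨h6, h7⟩ := hsub p e h5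
            rw [h7]; exact h.fy.out h2 p h3 (by omega) h6
        · intro j h1 h2
          have : 40 + j ≠ 28 ∧ 40 + j ≠ 74 ∧ 40 + j ≠ 73 ∧ 40 + j ≠ 29 := by omega
          simp only [this.1, this.2.1, this.2.2.1, this.2.2.2, ne_eq, not_false_eq_true, Function.update_of_ne]
          exact f _ (by simp; omega)
      · simp [f, h.r_th]
      · simp
      · simp; omega
      · simp [f, h.r_ok]
      · simpa [f] using h.fx.r_fs
      · simp [f, e26]
      · simpa [f] using h.fx.r_fc g1
      · simp
      · simp
      · simp [f, e30]
      · intro hb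
        obtain ⟨h6, h7⟩ := hsub ci (by omega) hb
        rw [h7]; exact h.fx.hd hi h6
      · intro p h3 h4 h5
        by_cases e : p = oo
        · subst e; rw [hval]
        · obtain ⟨h6, h7⟩ := hsub p e h5
          rw [h7]; exact hout p h3 (by omega) h6)

/-- Two words of the front block of the first run are out of order. -/
structure Failed (c : Ctx) (r A : ℕ → Word) (m : FState) (X Y : Run) (lo o : ℕ) (bad : Finset ℕ)
    (ins pn a : ℕ) : Prop where
  mach : Mach c r A X Y lo o ins pn
  core : Core c A m bad X Y lo o lo ins pn
  r_fs : (r 25).val = X.fs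
  r_i : (r 28).val = a + 1
  r_rem : (r 74).val = 0
  r_fail : (r 75).val = 1
  le : X.fs ≤ a
  lt : a + 1 < X.fe
  bad : a ∈ bad ∨ a + 1 ∈ bad

/-- Load the next head of the first run. -/
def nextHead : Cmd :=
  .cond (.lt 28 26) (clampLoad ;; .cond (.lt 114 30) (blk [.set 75 1, .mov 74 3]) (blk [.mov 30 114])) .skip

/-- Comparing each head with its predecessor in the same block catches every descent, and keeps the
heads nondecreasing. This also carries the information that the words passed over exceed the bound.
-/
theorem wp_nextHead {c : Ctx} (hc : c.Ok) {r A : ℕ → Word} {m : FState} {t : ℕ} {Q : Post}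
    {X Y lo o bad ins pn th oo i ci w i' ci' w'}
    (h : Half c r A m X Y lo o bad ins pn th oo i ci w i' ci' w') (ht : t + 30 ≤ c.P.lim m.a)
    (hQ : ∀ r' m' t' bad', m.a ≤ m'.a →
      (∃ w, Merging c r' A m' X Y lo o bad' ins pn th oo (i + 1) ci w i' ci' w') ∧ (r' 74).val = (r 74).val ∨
      Failed c r' A m' X Y lo o bad' ins pn i → t' ≤ t + 30 → Q r' A m' t') :
    wp c.P nextHead Q r A m t := by
  have hP := hc.ok
  have hM := hP.hM
  have hli := h.li
  have hfe := h.core.fe_le hc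
  obtain ⟨g1, g2, g3⟩ := Run.fe_lt hli.2.1
  refine wp_hide fun Q' hQ' => ?_
  refine wp_cond (by omega) (fun h1 => ?_) fun h1 => ?_
  · simp only [Test.ev, h.r_fe, h.r_i] at h1
    refine wp_seq (by omega) (wp_clampLoad (i := i + 1) (lo := lo) (fc := X.C X.kf) h.r_i h.mach.lo h.r_fc
      (by omega) ?_)
    intro r1 m1 t1 F f1 ev e114 ht1
    have hlim := c.P.lim_mono ev.a_le
    have hcore := h.core.ev hc ev
    have hloC := hcore.vx.geC X.kf le_rfl g1
    have hb0 : X.Blk X.kf i := ⟨⟨le_rfl, g1⟩, by omega, by omega⟩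
    have hb1 : X.Blk X.kf (i + 1) := ⟨⟨le_rfl, g1⟩, by omega, by omega⟩
    have hmach : ∀ r2 : ℕ → Word, (∀ x ∈ keepRegs, r2 x = r1 x) → Mach c r2 A X Y lo o ins pn := fun r2 hr2 =>
      h.mach.congr (fun x hx => by
        rw [hr2 x hx, f1 x (by revert hx; revert x; decide)]) (ArrHi.refl _)
    have hval : i + 1 ∉ bad ∪ F → (m1.mem (i + 1)).val = (r1 114).val := by
      intro hp
      have c1 := hcore.vx.ge _ (Or.inl ⟨_, hb1⟩) hp
      have c2 := hcore.vx.up _ _ hb1 hp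
      omega
    have hval0 : i ∉ bad ∪ F → (m1.mem i).val = w := fun hp => by
      obtain ⟨h2, h3⟩ := ev.val hp
      rw [h3]; exact h.hd h2
    refine wp_cond (by omega) (fun h2 => ?_) fun h2 => ?_
    · simp [Test.ev, f1, h.r_w] at h2
      refine wp_blk _ (by simp; omega) ?_
      simp [wpB]
      refine ⟨by omega, hQ' _ _ _ _ (hQ _ _ _ (bad ∪ F) ev.a_le (Or.inr ⟨?_, hcore, ?_, ?_, ?_, ?_, hli.1, h1, ?_⟩) (by omega))⟩
      · refine hmach _ fun x hx => ?_
        have : x ≠ 75 ∧ x ≠ 74 := by revert hx; revert x; decide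
        simp [this]
      · simp [f1, h.r_fs]
      · simp [f1, h.r_i]
      · simp [f1, h.mach.k.c3]
      · simp
      -- For good words the restricted values are the true ones, so a descent among the heads would
      -- contradict the order of the run.
      · by_contra hcon
        rw [not_or] at hcon
        have h3 := hval0 hcon.1
        have h4 := hval hcon.2
        have h5 := hcore.vx.sorted i (i + 1) (Or.inl ⟨_, hb0⟩) (Or.inl ⟨_, hb1⟩) (by omega) hcon.1 hcon.2
        omega
    · simp [Test.ev, f1, h.r_w] at h2
      refine wp_blk _ (by simp; omega) ?_
      simp [wpB]
      refine hQ' _ _ _ _ (hQ _ _ _ (bad ∪ F) ev.a_le (Or.inl ⟨⟨(r1 114).val, ⟨?_, hcore, h.tent.ev hc ev,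
        ⟨?_, ?_, ?_, ?_, ?_, ?_, by omega, ?_, ?_, ?_, ?_⟩, ?_, ?_, ?_, ?_, ?_, h.le⟩⟩, by simp [f1]⟩) (by omega))
      · refine hmach _ fun x hx => ?_
        have : x ≠ 30 := by revert hx; revert x; decide
        simp [this]
      · simp [f1, h.r_fs]
      · simp [f1, h.r_fe]
      · simp [f1, h.r_fc]
      · simp [f1, h.r_i]
      · simp [f1, h.r_ci]
      · simp
      · intro _; omega
      · intro _; exact hval
      · intro _ p h3 h4 h5
        obtain ⟨h6, h7⟩ := ev.val h5
        have := h.out p h3 h4 h6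
        rw [h7]; omega
      · refine h.skip.imp id fun h3 => ⟨fun p h4 h5 h6 => ?_, fun _ => by omega, h3.2.2⟩
        obtain ⟨h7, h8⟩ := ev.val h6
        rw [h8]; exact h3.1 p h4 h5 h7
      · refine (h.fy.ev (h.core.swap.fe_le hc).1 ev).congr fun j h3 h4 => ?_
        have h5 : 40 + j ≠ 30 := by omega
        have h6 : 40 + j ≠ 114 := by omega
        simp [h5, h6, f1]
      · simp [f1, h.r_th]
      · simp [f1, h.r_oo]
      · simp [f1, h.r_rem]
      · simp [f1, h.r_ok]
  · simp only [Test.ev, h.r_fe, h.r_i] at h1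
    refine wp_skip (by omega) (hQ' _ _ _ _ (hQ _ _ _ bad le_rfl (Or.inl ⟨⟨w, ⟨h.mach, h.core, h.tent,
      ⟨h.r_fs, h.r_fe, fun _ => h.r_fc, h.r_i, h.r_ci, h.r_w, by omega, fun _ => by omega, fun _ => by omega,
        fun _ => by omega, ?_⟩, h.fy, h.r_th, h.r_oo, h.r_rem, h.r_ok, h.le⟩⟩, rfl⟩) (by omega)))
    exact h.skip.imp id fun h3 => ⟨h3.1, fun _ => h3.2.1, h3.2.2⟩

/-- Merge the front blocks. -/
def mergeLoop : Cmd := .loop (.lt 3 74) (choose ;; emitHead ;; nextHead)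

/-- Both blocks are read to the end, beyond the bound as well: a bad word above the bound may be
followed by good words below it, and only complete reading excludes this. Register `74` counts the
unread words and is set to zero on failure. -/
theorem wp_mergeLoop {c : Ctx} (hc : c.Ok) {r A : ℕ → Word} {m : FState} {t : ℕ} {Q : Post}
    {X Y lo o bad ins pn th oo i ci w i' ci' w'}
    (h : Merging c r A m X Y lo o bad ins pn th oo i ci w i' ci' w')
    (ht : t + 150 * (r 74).val + 5 ≤ c.P.lim m.a)
    (hQ : ∀ r' m' t' X' Y' bad', Frame c.P.δ mergeLoop r A m r' A m' →
      (X' = X ∧ Y' = Y ∨ X' = Y ∧ Y' = X) →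
      (∃ oo ci w ci' w', Merging c r' A m' X' Y' lo o bad' ins pn th oo X'.fe ci w Y'.fe ci' w') ∨
      (∃ a, Failed c r' A m' X' Y' lo o bad' ins pn a) → t' ≤ t + 150 * (r 74).val + 5 → Q r' A m' t') :
    wp c.P mergeLoop Q r A m t := by
  suffices hh : wp c.P mergeLoop (fun r' A' m' t' => A' = A ∧ ∃ X' Y' bad',
      (X' = X ∧ Y' = Y ∨ X' = Y ∧ Y' = X) ∧
      ((∃ oo ci w ci' w', Merging c r' A m' X' Y' lo o bad' ins pn th oo X'.fe ci w Y'.fe ci' w') ∨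
      (∃ a, Failed c r' A m' X' Y' lo o bad' ins pn a)) ∧ t' ≤ t + 150 * (r 74).val + 5) r A m t from
    wp_mono _ (wp_frame _ hh) fun r' A' m' t' h => by
      obtain ⟨⟨rfl, X', Y', b, h1, h2, h3⟩, hf⟩ := h
      exact hQ r' m' t' X' Y' b hf h1 h2 h3
  refine ⟨fun r' A' m' t' => A' = A ∧ ∃ X' Y' bad', (X' = X ∧ Y' = Y ∨ X' = Y ∧ Y' = X) ∧
    m.a ≤ m'.a ∧ t' + 150 * (r' 74).val ≤ t + 150 * (r 74).val ∧
    ((∃ oo i ci w i' ci' w', Merging c r' A m' X' Y' lo o bad' ins pn th oo i ci w i' ci' w') ∨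
      (∃ a, Failed c r' A m' X' Y' lo o bad' ins pn a)), ?_, ?_, ?_⟩
  · rintro r1 A1 m1 t1 m2 ⟨rfl, X', Y', b, h1, h2, h3, h4⟩ ⟨F, ev⟩
    refine ⟨rfl, X', Y', b ∪ F, h1, h2.trans ev.a_le, h3, ?_⟩
    rcases h4 with ⟨oo, i, ci, w, i', ci', w', h4⟩ | ⟨a, h4⟩
    · exact Or.inl ⟨_, _, _, _, _, _, _, h4.ev hc ev⟩
    · exact Or.inr ⟨a, h4.mach, h4.core.ev hc ev, h4.r_fs, h4.r_i, h4.r_rem, h4.r_fail, h4.le, h4.lt,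
        h4.bad.imp (fun h => Finset.mem_union_left _ h) fun h => Finset.mem_union_left _ h⟩
  · exact ⟨rfl, X, Y, bad, Or.inl ⟨rfl, rfl⟩, le_rfl, le_rfl, Or.inl ⟨_, _, _, _, _, _, _, h⟩⟩
  · rintro r1 A1 m1 t1 ⟨rfl, X', Y', b, h1, h2, h3, h4⟩
    have hlim := c.P.lim_mono h2
    refine ⟨by omega, fun hlt => ?_, fun hlt => ?_⟩
    · rcases h4 with ⟨oo, i, ci, w, i', ci', w', h4⟩ | ⟨a, h4⟩
      swap
      · simp only [Test.ev, h4.r_rem] at hlt; omega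
      simp only [Test.ev, h4.mach.k.c3] at hlt
      refine wp_hide fun Q' hQ' => ?_
      refine wp_seq (by omega) (wp_choose h4 (by omega) (by omega) ?_)
      intro r2 t2 X2 Y2 i2 ci2 w2 i2' ci2' w2' hXY h5 e74 hi hw ht2
      refine wp_seq (by omega) (wp_emitHead hc h5 hi hw (by omega) ?_)
      intro r3 m3 t3 b3 oo3 ci3 h6 f74 ha3 ht3
      have hlim3 := c.P.lim_mono ha3
      rw [e74] at f74
      refine wp_nextHead hc h6 (by omega) ?_
      intro r4 m4 t4 b4 ha4 h7 ht4
      refine hQ' _ _ _ _ ⟨rfl, X2, Y2, b4, ?_, by omega, ?_, ?_⟩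
      · rcases h1 with ⟨rfl, rfl⟩ | ⟨rfl, rfl⟩ <;> rcases hXY with ⟨rfl, rfl⟩ | ⟨rfl, rfl⟩ <;> simp
      · rcases h7 with ⟨-, h8⟩ | h8
        · omega
        · have := h8.r_rem; omega
      · rcases h7 with ⟨⟨w, h8⟩, -⟩ | h8
        · exact Or.inl ⟨_, _, _, _, _, _, _, h8⟩
        · exact Or.inr ⟨_, h8⟩
    · refine ⟨rfl, X', Y', b, h1, ?_, by omega⟩
      rcases h4 with ⟨oo, i, ci, w, i', ci', w', h4⟩ | h4
      · simp only [Test.ev, h4.mach.k.c3] at hlt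
        have h5 := h4.r_rem
        have h6 := h4.fx.le
        have h7 := h4.fy.le
        obtain rfl : i = X'.fe := by omega
        obtain rfl : i' = Y'.fe := by omega
        exact Or.inl ⟨_, _, _, _, _, h4⟩
      · exact Or.inr h4

/-! ### Committing or discarding a phase. -/

/-- Two words of the front block that are out of order can be removed. -/
theorem Run.removed_front {c : Ctx} {R : Run} {a : ℕ} (hg : R.Geo c.K c.S c.w) (hk : R.kf < R.kl)
    (h1 : R.S R.kf ≤ a) (h2 : a + 2 ≤ R.E R.kf) : R.Removed c (R.cut (R.S R.kf + 2)) (R.S R.kf) a := by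
  have hse := hg.se R.kf le_rfl hk
  have hb : ∀ k p, R.Blk k p → k ≠ R.kf → R.E R.kf ≤ p := fun k p hp hne => by
    have := hg.le (k := R.kf) (j := k) le_rfl (by have := hp.1.1; omega) hp.1.2
    have := hp.2.1
    omega
  refine ⟨h1, fun p h3 h4 => Or.inl ⟨R.kf, ⟨le_rfl, hk⟩, h3, by omega⟩, hg.cut (by omega) (by omega), rfl, rfl,
    ?_, le_rfl, le_rfl, fun _ _ _ => rfl, ?_, ?_, ?_⟩
  · have := Run.cut_size (R := R) (i := R.S R.kf + 2) hk (by omega) (by omega)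
    omega
  · intro k p hp
    obtain ⟨h3, h4⟩ := (Run.cut_blk (by omega)).1 hp
    by_cases e : k = R.kf
    · subst e
      have h5 := h4 rfl
      have h6 := h3.2.2
      unfold og
      refine ⟨h3.1, ?_⟩
      split_ifs <;> omega
    · have := hb k p h3 e
      unfold og
      rw [if_neg (by omega)]
      exact h3
  · rintro p ⟨h3, h4⟩
    change R.u ≤ p at h3
    unfold og
    rw [if_neg (by omega)]
    exact Or.inr ⟨h3, h4⟩
  · intro p
    rw [Run.cut_cell hg hk (by omega) (by omega)]
    exact and_congr_right fun _ => by omega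

/-- The run after the words of the front block below `i` were written to the output. -/
def Run.done (R : Run) (i : ℕ) : Run :=
  if R.kf < R.kl then if i = R.E R.kf then { R with kf := R.kf + 1 } else R.cut i else R

/-- A front block whose words are all written has become empty and leaves the table, without any
change to the set of cells. -/
theorem Core.doneX {c : Ctx} {A m bad} {X Y : Run} {lo o ot ins pn i}
    (h : Core c A m bad (X.cut i) Y lo o ot ins pn) (hg : X.Geo c.K c.S c.w) (h1 : X.fs ≤ i) (h2 : i ≤ X.fe) :
    Core c A m bad (X.done i) Y lo o ot ins pn := by
  unfold Run.done
  by_cases hk : X.kf < X.kl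
  · rw [if_pos hk]
    simp only [Run.fs, Run.fe, if_pos hk] at h1 h2
    by_cases hi : i = X.E X.kf
    · rw [if_pos hi]
      have hblk : ∀ k p, ({ X with kf := X.kf + 1 } : Run).Blk k p ↔ (X.cut i).Blk k p := by
        intro k p
        rw [Run.cut_blk (by omega)]
        constructor
        · rintro ⟨⟨h3, h4⟩, h5⟩
          change X.kf + 1 ≤ k at h3
          exact ⟨⟨⟨by omega, h4⟩, h5⟩, fun e => by omega⟩
        · rintro ⟨⟨⟨h3, h4⟩, h5, h6⟩, h7⟩
          have : k ≠ X.kf := by rintro rfl; have := h7 rfl; omega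
          exact ⟨⟨by change X.kf + 1 ≤ k; omega, h4⟩, h5, h6⟩
      have hz : ∀ p, ({ X with kf := X.kf + 1 } : Run).Zone p ↔ (X.cut i).Zone p := fun p => Iff.rfl
      refine h.reshape (fun p => ?_) rfl rfl ?_ ?_ ?_
      · simp only [Run.Cell, hblk, hz]
      · have h3 := Run.cut_size (R := X) (i := i) hk h1 h2
        have h4 : X.size = (X.E X.kf - X.S X.kf) + ({ X with kf := X.kf + 1 } : Run).size := by
          simp only [Run.size]
          rw [Finset.sum_eq_sum_Ico_succ_bot hk]
          omega
        omega
      · refine ⟨hk, by have := hg.klS; change X.kl ≤ X.kf + 1 + _ + 1; omega, fun k h3 h4 => hg.se k ?_ h4,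
          fun k h3 h4 => hg.next k ?_ h4, hg.bu, hg.uh, hg.hw, fun h3 k h4 h5 => hg.full h3 k ?_ h5⟩
        · change X.kf + 1 ≤ k at h3; omega
        · change X.kf + 1 ≤ k at h3; omega
        · change X.kf + 1 < k at h4; omega
      · exact h.vx.reloc id (Nat.le_succ _) le_rfl (fun _ _ _ => rfl) (fun k p hp => (hblk k p).1 hp)
          (fun p hp => Or.inr hp) (fun _ _ _ _ h => h) (fun _ _ h => ⟨h, rfl⟩)
    · rwa [if_neg hi]
  · rw [if_neg hk]
    have hb : ∀ k p, X.Blk k p ↔ (X.cut i).Blk k p := fun k p =>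
      ⟨fun h3 => absurd h3.1 (by omega), fun h3 => absurd h3.1 (by
        change ¬ (X.kf ≤ k ∧ k < X.kl); omega)⟩
    have hz : ∀ p, X.Zone p ↔ (X.cut i).Zone p := fun p => Iff.rfl
    have hc : ∀ p, X.Cell p ↔ (X.cut i).Cell p := fun p => by simp only [Run.Cell, hb, hz]
    refine h.reshape hc rfl rfl ?_ hg ?_
    · simp only [Run.size, Run.cut]
      rw [Finset.Ico_eq_empty (by omega)]
      rfl
    · exact h.vx.reloc id le_rfl le_rfl (fun _ _ _ => rfl) (fun k p hp => (hb k p).1 hp)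
          (fun p hp => Or.inr hp) (fun _ _ _ _ h => h) (fun _ _ h => ⟨h, rfl⟩)

theorem Run.done_fields (R : Run) (i : ℕ) : (R.done i).kl = R.kl ∧ (R.done i).u = R.u ∧
    (R.done i).h = R.h ∧ R.kf ≤ (R.done i).kf := by
  unfold done
  split_ifs <;> simp [cut]

theorem Run.done_blk {R : Run} {i k p : ℕ} (h : (R.done i).Blk k p) (h1 : R.fs ≤ i) :
    R.Blk k p ∧ (k = R.kf → i ≤ p ∧ p < R.fe) := by
  unfold done at h
  split_ifs at h with h2 h3
  · obtain ⟨⟨h4, h5⟩, h6⟩ := h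
    change R.kf + 1 ≤ k at h4
    exact ⟨⟨⟨by omega, h5⟩, h6⟩, fun e => by omega⟩
  · simp only [fs, fe, if_pos h2] at h1 ⊢
    obtain ⟨h4, h5⟩ := (cut_blk (by omega)).1 h
    exact ⟨h4, fun e => ⟨h5 e, by have := h4.2.2; rwa [e] at this⟩⟩
  · exact absurd h.1 (by omega)

/-- The good words left are of three kinds: in the front block they were read and exceed `th`; in
later blocks they are at least the first separator; unverified ones are at least that separator by
the counting argument. -/
theorem Run.Val.raise {R : Run} {mem : ℕ → Word} {bad : Finset ℕ} {lo S w δ i th : ℕ}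
    (hd : (R.done i).Val mem bad lo) (h : R.Val mem bad lo) (hg : R.Geo (δ / S + 1) S w) (hS : 1 ≤ S)
    (hb : bad.card ≤ δ) (hn : R.kl = R.kf + S + 1 ∨ R.u = R.h) (h1 : R.fs ≤ i)
    (hth : R.kf < R.kl → th = lo ∨ th ≤ R.C R.kf)
    (hs : ∀ p, i ≤ p → p < R.fe → p ∉ bad → th < (mem p).val) : (R.done i).Val mem bad th := by
  obtain ⟨e1, e2, e3, e4⟩ := R.done_fields i
  have eC : (R.done i).C = R.C := by unfold done; split_ifs <;> rfl
  by_cases hk : R.kf < R.kl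
  · rcases hth hk with rfl | hth
    · exact hd
    refine ⟨hd.sorted, hd.up, hd.low, hd.mono, ?_, ?_⟩
    · rintro p (⟨k, hp⟩ | ⟨h3, h4⟩) hpb
      · obtain ⟨h3, h4⟩ := done_blk hp h1
        by_cases e : k = R.kf
        · exact (hs p (h4 e).1 (h4 e).2 hpb).le
        · obtain ⟨j, rfl⟩ : ∃ j, k = j + 1 := ⟨k - 1, by have := h3.1.1; omega⟩
          have h5 := h.low j p (by have := h3.1.1; omega) h3 hpb
          have h6 := h.mono_le (k := R.kf) (j := j) le_rfl (by have := h3.1.1; omega) (by have := h3.1.2; omega)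
          omega
      · rw [e2] at h3
        rw [e3] at h4
        -- An unverified word exists, so all slots are in use. The original table is needed here,
        -- not the one shortened by the phase.
        have := h.cover hg hS hb (hn.resolve_right (by omega)) ⟨h3, h4⟩ hpb
        omega
    · intro k h3 h4
      rw [eC]
      have := h.mono_le (k := R.kf) (j := k) le_rfl (by omega) (by omega)
      omega
  · have hkl := hg.kle
    refine ⟨hd.sorted, hd.up, hd.low, hd.mono, ?_, fun k h3 h4 => by omega⟩
    rintro p (⟨k, hp⟩ | ⟨h3, h4⟩) hpb
    · exact absurd (done_blk hp h1).1.1 (by omega)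
    · omega

/-- Using up the front block releases the credit that a phase lives on. -/
theorem Run.done_pot (R : Run) (c : Ctx) (i : ℕ) : (R.done i).pot c ≤ R.pot c ∧
    (R.kf < R.kl → i = R.fe → (R.done i).pot c + 2000 * c.bb = R.pot c) := by
  unfold done
  by_cases hk : R.kf < R.kl
  · rw [if_pos hk]
    have e : ({ R with kf := R.kf + 1 } : Run).pot c + 2000 * c.bb = R.pot c := by
      simp only [pot]
      have : R.kl - R.kf = R.kl - (R.kf + 1) + 1 := by omega
      rw [this]
      ring
    split_ifs with h
    · exact ⟨by omega, fun _ _ => e⟩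
    · refine ⟨le_rfl, fun _ h' => absurd h' ?_⟩
      simpa [fe, hk] using h
  · rw [if_neg hk]
    exact ⟨le_rfl, fun h => absurd h hk⟩

/-- Set the start of the front block of the first run to `r 29`. -/
def setFront : Cmd := blk [.mov 110 20] ;; slotC ;; blk [.sts 111 29]

theorem wp_setFront {c : Ctx} (hc : c.Ok) {r A : ℕ → Word} {m : FState} {t : ℕ} {Q : Post}
    {X Y : Run} {lo o ins pn i : ℕ} (hm : Mach c r A X Y lo o ins pn) (hk : X.kf < X.kl)
    (hkS : X.kl ≤ X.kf + c.S + 1) (hkM : X.kl < c.P.M) (h29 : (r 29).val = i) (ht : t + 25 ≤ c.P.lim m.a)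
    (hQ : ∀ r' A' t', Mach c r' A' (X.cut i) Y lo o ins pn → (∀ x, x ≠ 110 → x ≠ 111 → r' x = r x) →
      (∀ x, 6 ≤ x % 16 → A' x = A x) → t' ≤ t + 25 → Q r' A' m t') :
    wp c.P setFront Q r A m t := by
  have hP := hc.ok
  have hcap := hP.hcap
  have hSS := hP.hS
  have htf := hm.tf3
  have htf' := hm.tf
  obtain ⟨tf, htfe⟩ : ∃ tf, tf = (r 24).val := ⟨_, rfl⟩
  obtain ⟨a0, ha0⟩ : ∃ a, a = slotA c.S X.kf tf := ⟨_, rfl⟩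
  have hl0 := slotA_lt (S := c.S) (k := X.kf) htf.1
  rw [← htfe, ← ha0] at hl0
  have hm0 : a0 % 16 = tf := by rw [ha0]; unfold slotA; omega
  refine wp_blk_seq (by simp; omega) ?_
  simp [wpB]
  refine wp_seq (by omega) (wp_slotC hP (k := X.kf) (tf := tf)
    (hm.k.congr fun x _ _ _ _ _ _ => Function.update_of_ne (by omega) _ _) (by simp [hm.x.kf])
    (by simp [htfe]) (by omega) (by omega) (by omega) ?_)
  intro r1 f1 e111
  rw [← ha0] at e111
  refine wp_blk _ (by simp; omega) ?_
  simp [wpB, e111, f1]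
  refine ⟨by omega, hQ _ _ _ ?_ (fun x h1 h2 => by simp [f1, h1, h2]) ?_ (by omega)⟩
  · refine hm.setX (fun x hx hx' => ?_) ?_ ?_ ?_ ?_ ?_ ?_
    · have : x ≠ 110 ∧ x ≠ 111 := by clear hx'; revert hx; revert x; decide
      simp [this, f1]
    · intro k j hj
      have : slotA c.S k (r 44).val % 16 = (r 44).val := by unfold slotA; omega
      exact Function.update_of_ne (by omega) _ _
    · refine ⟨?_, ?_, ?_, ?_, ?_⟩
      · simpa [f1, Run.cut] using hm.x.kf
      · simpa [f1, Run.cut] using hm.x.kl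
      · simpa [f1, Run.cut] using hm.x.u
      · simpa [f1, Run.cut] using hm.x.h
      · intro k hk1 hk2
        change X.kf ≤ k at hk1
        change k < X.kl at hk2
        have e24 : (r1 (20 + 4)).val = tf := by simp [f1, htfe]
        have htab := hm.x.tab k hk1 hk2
        simp only [Nat.reduceAdd, ← htfe] at htab
        rw [e24]
        by_cases e : k = X.kf
        · subst e
          rw [← ha0] at htab ⊢
          refine ⟨?_, ?_, ?_⟩
          · simp [h29, Run.cut]
          · rw [Function.update_of_ne (by omega)]; exact htab.2.1
          · rw [Function.update_of_ne (by omega)]; exact htab.2.2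
        · have n0 := slotA_ne (S := c.S) (k := X.kf) (k' := k) (tf := tf) (by omega) (by omega)
          rw [← ha0] at n0
          have e5 : (X.cut i).S k = X.S k := Function.update_of_ne e _ _
          rw [Function.update_of_ne (by omega), Function.update_of_ne (by omega),
            Function.update_of_ne (by omega), e5]
          exact htab
    · simp [f1, hm.lo]
    · simp [f1, hm.o]
    · simp [f1, hm.ins]
    · simp [f1, hm.pn]
  · intro x hx
    exact Function.update_of_ne (by omega) _ _

/-- Remove the words from the first run that were written to the output. -/
def commit : Cmd :=
  .cond (.lt 20 21) (.cond (.eq 29 26) (blk [.op .add 20 20 4]) setFront) .skip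

theorem wp_commit {c : Ctx} (hc : c.Ok) {r A : ℕ → Word} {m : FState} {t : ℕ} {Q : Post}
    {X Y : Run} {lo o ins pn i : ℕ} (hm : Mach c r A X Y lo o ins pn)
    (hkS : X.kl ≤ X.kf + c.S + 1) (hkM : X.kl < c.P.M) (h29 : (r 29).val = i) (h26 : (r 26).val = X.fe)
    (ht : t + 30 ≤ c.P.lim m.a)
    (hQ : ∀ r' A' t', Mach c r' A' (X.done i) Y lo o ins pn →
      (∀ x, x ≠ 20 → x ≠ 110 → x ≠ 111 → r' x = r x) →
      (∀ x, 6 ≤ x % 16 → A' x = A x) → t' ≤ t + 30 → Q r' A' m t') :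
    wp c.P commit Q r A m t := by
  have h20 := hm.x.kf
  have h21 := hm.x.kl
  simp only [Nat.reduceAdd] at h21
  refine wp_cond (by omega) (fun hk => ?_) fun hk => ?_
  · simp only [Test.ev, h20, h21] at hk
    refine wp_cond (by omega) (fun hi => ?_) fun hi => ?_
    · simp only [Test.ev, h29, h26] at hi
      have hd : X.done i = { X with kf := X.kf + 1 } := by
        unfold Run.done
        rw [if_pos hk, if_pos (by rw [hi, Run.fe, if_pos hk])]
      refine wp_blk _ (by simp; omega) ?_
      simp [wpB, Op.ok, Op.ev, h20, hm.k.c4]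
      refine ⟨by omega, hQ _ _ _ ?_ (fun x h1 _ _ => by simp [h1]) (fun _ _ => rfl) (by omega)⟩
      rw [hd]
      refine hm.setX (fun x hx hx' => ?_) (fun _ _ _ => rfl) ⟨?_, ?_, ?_, ?_, fun k h1 h2 => ?_⟩ ?_ ?_ ?_ ?_
      · have : x ≠ 20 := by rintro rfl; simp at hx'
        simp [this]
      · simp
      · simpa using hm.x.kl
      · simpa using hm.x.u
      · simpa using hm.x.h
      · have h3 := hm.x.tab k (by change X.kf + 1 ≤ k at h1; omega) h2
        simpa using h3
      · simp [hm.lo]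
      · simp [hm.o]
      · simp [hm.ins]
      · simp [hm.pn]
    · simp only [Test.ev, h29, h26] at hi
      have hd : X.done i = X.cut i := by
        unfold Run.done
        rw [if_pos hk, if_neg (by rw [Run.fe, if_pos hk] at hi; exact hi)]
      refine wp_setFront hc hm hk hkS hkM h29 (by omega) ?_
      intro r' A' t' h1 h2 h3 h4
      exact hQ _ _ _ (by rw [hd]; exact h1) (fun x _ => h2 x) h3 (by omega)
  · simp only [Test.ev, h20, h21] at hk
    have hd : X.done i = X := by unfold Run.done; rw [if_neg hk]
    exact wp_skip (by omega) (hQ _ _ _ (by rw [hd]; exact hm) (fun _ _ _ _ => rfl) (fun _ _ => rfl) (by omega))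

/-- Prepare a merge of the front blocks. -/
def phasePre : Cmd :=
  loadFront ;; swapRegs ;; loadFront ;; bound ;;
  blk [.mov 73 9, .mov 75 3, .op .sub 74 26 25, .op .sub 111 46 45, .op .add 74 74 111]

theorem Run.cut_fs {R : Run} : R.cut R.fs = R ∨ ¬ R.kf < R.kl := by
  by_cases h : R.kf < R.kl
  · left
    simp only [fs, if_pos h, cut, Function.update_eq_self]
  · exact Or.inr h

theorem Core.cutX {c : Ctx} {A m bad} {X Y : Run} {lo o ot ins pn}
    (h : Core c A m bad X Y lo o ot ins pn) : Core c A m bad (X.cut X.fs) Y lo o ot ins pn := by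
  rcases X.cut_fs with e | hk
  · rwa [e]
  · have hb : ∀ k p, (X.cut X.fs).Blk k p ↔ X.Blk k p := fun k p =>
      ⟨fun h3 => absurd h3.1 (by change ¬ (X.kf ≤ k ∧ k < X.kl); omega), fun h3 => absurd h3.1 (by omega)⟩
    have hz : ∀ p, (X.cut X.fs).Zone p ↔ X.Zone p := fun p => Iff.rfl
    refine h.reshape (fun p => by simp only [Run.Cell, hb, hz]) rfl rfl ?_ (h.gx.cut (fun h => absurd h hk)
      fun h => absurd h hk) (h.vx.cut fun h => absurd h hk)
    simp only [Run.size, Run.cut]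
    rw [Finset.Ico_eq_empty (by omega)]
    rfl

theorem Core.bound {c : Ctx} {A m bad X Y lo o ot ot' ins pn}
    (h : Core c A m bad X Y lo o ot ins pn) (hle : ot ≤ ot') : Core c A m bad X Y lo o ot' ins pn :=
  { h with obd := fun p h1 h2 h3 => (h.obd p h1 h2 h3).trans hle }

theorem wp_phasePre {c : Ctx} (hc : c.Ok) {r A : ℕ → Word} {m : FState} {t : ℕ} {Q : Post}
    {X Y : Run} {lo o ins pn : ℕ} {bad : Finset ℕ} (hm : Mach c r A X Y lo o ins pn)
    (h : Core c A m bad X Y lo o lo ins pn) (hxM : X.kl < c.P.M) (hyM : Y.kl < c.P.M)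
    (hne : X.kf < X.kl ∨ Y.kf < Y.kl ∨ pn ≠ 0) (ht : t + 300 ≤ c.P.lim m.a)
    (hQ : ∀ r' m' t' bad' th w w', m.a ≤ m'.a →
      Merging c r' A m' Y X lo o bad' ins pn th o Y.fs Y.fs w' X.fs X.fs w →
      Bound A Y X lo pn th ((r' 71).val = 2) → t' ≤ t + 300 → Q r' A m' t') :
    wp c.P phasePre Q r A m t := by
  have hP := hc.ok
  have hM := hP.hM
  have hcap := hP.hcap
  have hSS := hP.hS
  refine wp_hide fun Q' hQ' => ?_
  refine wp_seq (by omega) (wp_loadFront hc hm h hxM (by omega) ?_)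
  intro r1 m1 t1 F1 w f1 ev1 hfx ht1
  have hlim1 := c.P.lim_mono ev1.a_le
  have hm1 : Mach c r1 A X Y lo o ins pn := hm.congr (fun x hx => f1 x (by
    revert hx; revert x; decide)) (ArrHi.refl _)
  have hc1 := h.ev hc ev1
  refine wp_seq (by omega) (wp_swapRegs (by omega) fun r2 f2 => ?_)
  have hm2 : Mach c r2 A Y X lo o ins pn := hm1.swap fun x hx => f2 x (by
    revert hx; revert x; decide)
  refine wp_seq (by omega) (wp_loadFront hc hm2 hc1.swap hyM (by omega) ?_)
  intro r3 m3 t3 F3 w' f3 ev3 hfy ht3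
  have hlim3 := c.P.lim_mono ev3.a_le
  have hm3 : Mach c r3 A Y X lo o ins pn := hm2.congr (fun x hx => f3 x (by
    revert hx; revert x; decide)) (ArrHi.refl _)
  have hc3 := hc1.swap.ev hc ev3
  have e4x : ∀ j, 5 ≤ j → j ≤ 10 → r3 (40 + j) = r1 (20 + j) := by
    intro j h1 h2
    rw [f3 _ (by simp only [List.mem_cons, List.not_mem_nil, or_false]; omega), f2 _ (by omega)]
    congr 1
    unfold swapIdx
    rw [if_neg (by omega), if_pos (by omega)]
    omega
  have hfx3 : ∀ th, Front c 40 r3 m3.mem (bad ∪ F1 ∪ F3) X lo th o X.fs X.fs w := fun th =>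
    ((hfx th).ev (hc1.fe_le hc).1 ev3).congr e4x
  refine wp_seq (by omega) (wp_bound (X := Y) (Y := X) (lo := lo) (pn := pn) hm3.k.c3 hm3.k.c4 hm3.k.c12
    (by omega) (by omega) hm3.x.kf hm3.x.kl (hfy 0).r_fc hm3.y.kf hm3.y.kl (hfx3 0).r_fc hm3.lo hm3.pn
    (by tauto) (by omega) ?_)
  intro r4 t4 th f4 e70 hb ht4
  have hfe := hc3.fe_le hc
  have hfe' := hc3.swap.fe_le hc
  have e25 := (hfy 0).r_fs
  have e26 := (hfy 0).r_fe
  have e45 := (hfx3 0).r_fs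
  have e46 := (hfx3 0).r_fe
  simp only [Nat.reduceAdd] at e25 e26 e45 e46
  refine wp_blk _ (by simp; omega) ?_
  simp [wpB, Op.ok, Op.ev, f4, e25, e26, e45, e46]
  refine ⟨by omega, hQ' _ _ _ _ (hQ _ _ _ (bad ∪ F1 ∪ F3) th w w' (ev1.a_le.trans ev3.a_le)
    ⟨?_, hc3, ?_, ?_, ?_, ?_, ?_, ?_, ?_, le_rfl⟩ ?_ (by omega))⟩
  · refine hm3.congr (fun x hx => ?_) (ArrHi.refl _)
    have h1 : x ∈ keepRegs → x ≠ 73 ∧ x ≠ 75 ∧ x ≠ 74 ∧ x ≠ 111 ∧ x ∉ [70, 71, 72, 111] := by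
      revert x; decide
    have h2 := h1 hx
    simp [h2, f4]
  · exact (hc3.cutX.swap.cutX.swap).bound hb.lo_le
  · refine (hfy th).congr fun j h1 h2 => ?_
    have : 20 + j ≠ 73 ∧ 20 + j ≠ 75 ∧ 20 + j ≠ 74 ∧ 20 + j ≠ 111 := by omega
    simp only [this, ne_eq, not_false_eq_true, Function.update_of_ne]
    exact f4 _ (by simp; omega)
  · refine (hfx3 th).congr fun j h1 h2 => ?_
    have : 40 + j ≠ 73 ∧ 40 + j ≠ 75 ∧ 40 + j ≠ 74 ∧ 40 + j ≠ 111 := by omega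
    simp only [this, ne_eq, not_false_eq_true, Function.update_of_ne]
    exact f4 _ (by simp; omega)
  · simp [e70]
  · simp [hm3.o]
  · simp
  · simp [hm3.k.c3]
  · simpa using hb

/-- Move the minimum of the priority queue to the output. -/
def popOut : Cmd :=
  pqPop ;; .cond (.lt 62 70) (blk [.op .sub 62 70 3]) .skip ;; .store 9 62 ;; blk [.op .add 9 9 4]

/-- The queue minimum does not exceed `th`, so the value written is exactly `th` in both branches. A
smaller word is not faithful and is replaced. -/
theorem wp_popOut {c : Ctx} (hc : c.Ok) {r A : ℕ → Word} {m : FState} {t : ℕ} {Q : Post}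
    {X Y : Run} {th o ins pn : ℕ} {bad : Finset ℕ} (hm : Mach c r A X Y th o ins pn)
    (h : Core c A m bad X Y th o th ins pn) (hpn : pn ≠ 0) (h70 : (r 70).val = th)
    (hroot : (nval A 1).val ≤ th) (ht : t + 60 * c.l + 40 * c.K + 170 ≤ c.P.lim m.a)
    (hQ : ∀ r' A' m' t' bad', Mach c r' A' X Y th (o + 1) ins (pn - 1) →
      Core c A' m' bad' X Y th (o + 1) th ins (pn - 1) →
      t' ≤ t + 60 * c.l + 40 * c.K + 170 → Q r' A' m' t') :
    wp c.P popOut Q r A m t := by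
  have hP := hc.ok
  have hM := hP.hM
  have hol := h.o_le hc
  have hK : c.P.K c.S = c.K := rfl
  have hlt : ∀ p ∈ liveF c X Y o, p < 2 * c.n := fun p hp => by have := h.live_lt hc hp; omega
  refine wp_hide fun Q' hQ' => ?_
  refine wp_seq (by omega) (wp_pqPop hP hm.k hc.hl h.pq hm.pn h.ins_le hpn hlt
    (h.good.unused fun x hx => by cases x <;> first | rfl | exact absurd hx (by simp [mem_pqL_g]))
    (by omega) ?_)
  intro r1 A1 m1 t1 F1 fr1 ev1 hpq1 e61 e62 hs62 hg1 hA1 ht1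
  have hlim1 := c.P.lim_mono ev1.a_le
  have hm1 : ∀ r2 : ℕ → Word, (∀ x ∈ keepRegs, x ≠ 9 → r2 x = r1 x) → (r2 9).val = o + 1 →
      Mach c r2 A1 X Y th (o + 1) ins (pn - 1) := by
    intro r2 h2 h9
    have hf : ∀ x ∈ keepRegs, x ≠ 9 → x ≠ 61 → r2 x = r x := by
      intro x hx h3 h4
      rw [h2 x hx h3, fr1.1 x (by revert h4; clear h3; revert hx; revert x; decide)]
    refine hm.setX (fun x hx hx' => hf x hx (by rintro rfl; simp at hx') (by rintro rfl; simp at hx')) ?_ ?_ ?_ h9 ?_ ?_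
    · intro k j hj
      have := hm.tf
      refine hA1 _ ?_
      unfold slotA; omega
    · refine hm.x.congr ?_ ?_ ?_ ?_ ?_ hm.tf3.1 hA1 <;> exact hf _ (by decide) (by decide) (by decide)
    · rw [hf 8 (by decide) (by decide) (by decide)]; exact hm.lo
    · rw [hf 60 (by decide) (by decide) (by decide)]; exact hm.ins
    · rw [h2 61 (by decide) (by decide)]; exact e61
  have f70 : (r1 70).val = th := by rw [fr1.1 70 (by decide)]; exact h70
  have f9 : (r1 9).val = o := by rw [fr1.1 9 (by decide)]; exact hm.o
  have f4 : (r1 4).val = 1 := by rw [fr1.1 4 (by decide)]; exact hm.k.c4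
  have key : ∀ r2 t2, (∀ x, x ≠ 62 → r2 x = r1 x) → (r2 62).val = th → (r2 62).src = (r1 62).src →
      t2 ≤ t1 + 7 → wp c.P (.store 9 62 ;; blk [.op .add 9 9 4]) Q' r2 A1 m1 t2 := by
    intro r2 t2 f2 e1 e2 ht2
    refine wp_seq (by omega) (wp_store (by omega) fun m3 ⟨F3, ev3⟩ => ?_)
    have hlim3 := c.P.lim_mono ev3.a_le
    rw [f2 9 (by decide), f9]
    have hcore := h.emit_pop hc hpn (w := r2 62) (ev1.trans' (ev3.mono (Set.empty_subset _)))
      (hpq1.ev ev3 (by simp)) (hg1.ev ev3 (by simp)) e2 e1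
    have ha : (m3.put o (r2 62)).a = m3.a := rfl
    refine wp_blk _ (by simp [ha]; omega) ?_
    simp [wpB, Op.ok, Op.ev, f2, f9, f4]
    refine ⟨by omega, hQ' _ _ _ _ (hQ _ _ _ _ _ (hm1 _ (fun x hx h9 => ?_) (by simp)) hcore (by omega))⟩
    have : x ≠ 62 := by clear h9; revert hx; revert x; decide
    simp [h9, f2, this]
  refine wp_seq (by omega) (wp_cond (by omega) (fun h1 => ?_) fun h1 => ?_)
  · simp only [Test.ev, f70] at h1
    refine wp_blk _ (by simp; omega) ?_
    simp [wpB, Op.ok, Op.ev]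
    have e3 : (r1 3).val = 0 := by rw [fr1.1 3 (by decide), hm.k.c3]
    refine key _ _ (fun x hx => by simp [hx]) (by simp [f70, e3]) ?_ (by omega)
    simp
    -- Faithful elements of the queue are at least `th` by now, so a word below `th` has no
    -- provenance to lose.
    by_contra hne
    have := hs62 (Ne.symm hne)
    omega
  · simp only [Test.ev, f70] at h1
    exact wp_skip (by omega) (key _ _ (fun _ _ => rfl) (by omega) rfl (by omega))

/-- If a run provided the bound, the heads of its front block, being restricted to its separator,
cannot exceed `th`, so the block was written completely and its credit becomes available. -/
theorem Merging.commit {c r A m} {X Y : Run} {lo o bad ins pn th oo ci w ci' w'} {q : Prop} (hc : c.Ok)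
    (h : Merging c r A m X Y lo o bad ins pn th oo X.fe ci w Y.fe ci' w')
    (hb : Bound A X Y lo pn th q) (hnx : X.kl = X.kf + c.S + 1 ∨ X.u = X.h)
    (hny : Y.kl = Y.kf + c.S + 1 ∨ Y.u = Y.h) :
    Core c A m bad (X.done ci) (Y.done ci') th oo th ins pn ∧
      (¬ q → (X.kf < X.kl ∧ ci = X.fe) ∨ (Y.kf < Y.kl ∧ ci' = Y.fe)) := by
  have hx := h.fx.le
  have hy := h.fy.le
  have hcard := h.core.card
  have hale := h.core.ale
  have h1 := ((h.tent.doneX h.core.gx hx.1 (by omega)).swap.doneX h.core.gy hy.1 (by omega)).swap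
  have sx : ∀ p, ci ≤ p → p < X.fe → p ∉ bad → th < (m.mem p).val := fun p h2 h3 h4 => by
    rcases h.fx.skip with h5 | h5
    · omega
    · exact h5.1 p h2 h3 h4
  have sy : ∀ p, ci' ≤ p → p < Y.fe → p ∉ bad → th < (m.mem p).val := fun p h2 h3 h4 => by
    rcases h.fy.skip with h5 | h5
    · omega
    · exact h5.1 p h2 h3 h4
  refine ⟨{ h1 with
    pq := h1.pq.raise fun hne => ?_
    vx := h1.vx.raise h.core.vx h.core.gx hc.ok.hS (by omega) hnx hx.1 hb.x sx
    vy := h1.vy.raise h.core.vy h.core.gy hc.ok.hS (by omega) hny hy.1 hb.y sy }, fun hq => ?_⟩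
  · by_cases e : pn = 0
    · subst e
      exact absurd (h1.pq.root_zero hc.ok.hS) hne
    · exact hb.pq e
  · rcases hb.run hq with ⟨h2, h3⟩ | ⟨h2, h3⟩
    · refine Or.inl ⟨h2, ?_⟩
      rcases h.fx.skip with h5 | h5
      · exact h5
      · have := h5.2.2; omega
    · refine Or.inr ⟨h2, ?_⟩
      rcases h.fy.skip with h5 | h5
      · exact h5
      · have := h5.2.2; omega

/-- Make the tentative output final. -/
def phaseCommit : Cmd :=
  commit ;; swapRegs ;; commit ;; blk [.mov 9 73, .mov 8 70] ;; .cond (.eq 71 12) popOut .skip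

/-- The phase is paid by the source of its bound: by the credit of the extracted element, or by that
of the block used up. -/
theorem wp_phaseCommit {c : Ctx} (hc : c.Ok) {r A : ℕ → Word} {m : FState} {t : ℕ} {Q : Post}
    {X Y : Run} {lo o bad ins pn th oo ci w ci' w'}
    (h : Merging c r A m X Y lo o bad ins pn th oo X.fe ci w Y.fe ci' w')
    (hb : Bound A X Y lo pn th ((r 71).val = 2)) (hnx : X.kl = X.kf + c.S + 1 ∨ X.u = X.h)
    (hny : Y.kl = Y.kf + c.S + 1 ∨ Y.u = Y.h) (hkx : X.kl + 2 * (X.h - X.u) ≤ 2 * c.n + c.n * ins)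
    (hky : Y.kl + 2 * (Y.h - Y.u) ≤ 2 * c.n + c.n * ins)
    (htime : t + 500 + X.pot c + Y.pot c + c.cp * pn + c.Rest ≤
      c.P.A0 + c.Bh * ins + (if (r 71).val = 2 then c.cp - (60 * c.l + 40 * c.K + 170) else 2000 * c.bb))
    (ht : t + 200 + (if (r 71).val = 2 then 60 * c.l + 40 * c.K + 170 else 0) ≤ c.P.lim m.a)
    (hQ : ∀ r' A' m' t' X' Y' lo' o' bad' pn',
      Inv c r' A' m' (t' + 100) X' Y' lo' o' bad' ins pn' → Q r' A' m' t') :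
    wp c.P phaseCommit Q r A m t := by
  obtain ⟨hcore, hpay⟩ := h.commit hc hb hnx hny
  have hP := hc.ok
  have hxM := h.core.index_lt hc (show X.kl ≤ 2 * c.n + c.n * ins by omega)
  have hyM := h.core.index_lt hc (show Y.kl ≤ 2 * c.n + c.n * ins by omega)
  have hpx := X.done_pot c ci
  have hpy := Y.done_pot c ci'
  obtain ⟨dx1, dx2, dx3, dx4⟩ := X.done_fields ci
  obtain ⟨dy1, dy2, dy3, dy4⟩ := Y.done_fields ci'
  have hcp : c.cp = 5000 * c.K + 200 * c.l + 5000 := rfl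
  refine wp_hide fun Q' hQ' => ?_
  refine wp_seq (by omega) (wp_commit hc h.mach h.core.gx.klS (by omega) h.fx.r_ci h.fx.r_fe (by omega) ?_)
  intro r1 A1 t1 hm1 f1 hA1 ht1
  refine wp_seq (by omega) (wp_swapRegs (by omega) fun r2 f2 => ?_)
  have hm2 : Mach c r2 A1 Y (X.done ci) lo o ins pn := hm1.swap fun x hx => f2 x (by
    revert hx; revert x; decide)
  have g : ∀ x, x ∉ [20, 40, 110, 111] → x < 20 ∨ 50 < x → r2 x = r x := by
    intro x hx h1
    simp only [List.mem_cons, List.not_mem_nil, or_false, not_or] at hx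
    rw [f2 x (by omega)]
    unfold swapIdx
    rw [if_neg (by omega), if_neg (by omega), f1 x (by omega) (by omega) (by omega)]
  have e29 := h.fy.r_ci
  have e26 := h.fy.r_fe
  refine wp_seq (by omega) (wp_commit hc hm2 h.core.gy.klS (by omega) (i := ci')
    (by rw [f2 29 (by decide)]; simp [swapIdx, f1]; exact e29)
    (by rw [f2 26 (by decide)]; simp [swapIdx, f1]; exact e26) (by omega) ?_)
  intro r3 A3 t3 hm3 f3 hA3 ht3
  have e73 : (r3 73).val = oo := by
    rw [f3 _ (by decide) (by decide) (by decide), g _ (by decide) (by decide)]; exact h.r_oo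
  have e70 : (r3 70).val = th := by
    rw [f3 _ (by decide) (by decide) (by decide), g _ (by decide) (by decide)]; exact h.r_th
  have e71 : r3 71 = r 71 := by
    rw [f3 _ (by decide) (by decide) (by decide), g _ (by decide) (by decide)]
  refine wp_blk_seq (by simp; omega) ?_
  simp [wpB]
  refine wp_abs fun r4 hr4 => ?_
  have hm4 : Mach c r4 A3 (Y.done ci') (X.done ci) th oo ins pn := by
    refine hm3.setX (fun x hx hx' => ?_) (fun _ _ _ => rfl) ?_ (by simp [hr4, e70]) (by simp [hr4, e73])
      (by simp [hr4, hm3.ins]) (by simp [hr4, hm3.pn])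
    · have h1 : x ≠ 8 := by rintro rfl; simp at hx'
      have h2 : x ≠ 9 := by rintro rfl; simp at hx'
      simp [hr4, h1, h2]
    · refine hm3.x.congr ?_ ?_ ?_ ?_ ?_ hm3.tf3.1 (ArrHi.refl _) <;> simp [hr4]
  have hA13 : ∀ x, 6 ≤ x % 16 → A3 x = A x := fun x hx => (hA3 x hx).trans (hA1 x hx)
  have hcore4 := (hcore.arr hA13).swap
  refine wp_cond (by omega) (fun h1 => ?_) fun h1 => ?_
  · simp [Test.ev, hr4, e71, hm3.k.c12] at h1
    rw [if_pos h1] at htime ht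
    obtain ⟨hpn, hroot⟩ := hb.pop h1
    have er : nval A3 1 = nval A 1 := hA13 _ (by decide)
    refine wp_popOut hc hm4 hcore4 hpn (by simp [hr4, e70]) (by rw [er]; exact hroot) (by omega) ?_
    intro r5 A5 m5 t5 bad5 hm5 hcore5 ht5
    have hmul : c.cp * pn = c.cp * (pn - 1) + c.cp := by
      obtain ⟨k, rfl⟩ : ∃ k, pn = k + 1 := ⟨pn - 1, by omega⟩
      rw [Nat.add_sub_cancel]; ring
    exact hQ' _ _ _ _ (hQ _ _ _ _ _ _ _ _ _ _ ⟨hm5, hcore5, by rw [dy1, dy2, dy3]; exact hky,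
      by rw [dx1, dx2, dx3]; exact hkx, by omega⟩)
  · simp [Test.ev, hr4, e71, hm3.k.c12] at h1
    rw [if_neg h1] at htime ht
    refine wp_skip (by omega) (hQ' _ _ _ _ (hQ _ _ _ _ _ _ _ _ _ _ ⟨hm4, hcore4, by rw [dy1, dy2, dy3]; exact hky,
      by rw [dx1, dx2, dx3]; exact hkx, ?_⟩))
    rcases hpay h1 with ⟨h2, h3⟩ | ⟨h2, h3⟩
    · have := hpx.2 h2 h3; omega
    · have := hpy.2 h2 h3; omega

/-- Remove two words that are out of order from the front block of the first run. -/
def phaseFail : Cmd :=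
  blk [.mov 90 25, .op .sub 91 28 4] ;; remove ;; blk [.op .add 29 25 12] ;; setFront

/-- The words of the runs were only copied, and the output pointer was not advanced, so the
tentative output is simply forgotten. The fault behind the descent pays for the wasted phase and for
the two new elements of the queue. -/
theorem wp_phaseFail {c : Ctx} (hc : c.Ok) {r A : ℕ → Word} {m : FState} {t : ℕ} {Q : Post}
    {X Y : Run} {lo o bad ins pn a} (h : Failed c r A m X Y lo o bad ins pn a)
    (hkx : X.kl + 2 * (X.h - X.u) ≤ 2 * c.n + c.n * ins)
    (hky : Y.kl + 2 * (Y.h - Y.u) ≤ 2 * c.n + c.n * ins)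
    (htime : t + X.pot c + Y.pot c + c.cp * pn + c.Rest ≤ c.P.A0 + c.Bh * ins + 500 * c.bb + 1000)
    (hQ : ∀ r' A' m' t' X' Y' lo' o' bad' ins' pn',
      Inv c r' A' m' (t' + 100) X' Y' lo' o' bad' ins' pn' → Q r' A' m' t') :
    wp c.P phaseFail Q r A m t := by
  have hP := hc.ok
  have hM := hP.hM
  have hx := h.le
  have hx2 := h.lt
  have hfe := h.core.fe_le hc
  obtain ⟨g1, g2, g3⟩ := Run.fe_lt (show a < X.fe by omega)
  have hlimb : c.P.A0 + c.Bh * ins + 2 * c.Bh ≤ c.P.lim m.a := by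
    rcases h.bad with hb | hb <;> exact h.core.lim_bad hc hb
  have hBh := hc.hBh
  have hbK : c.bb ≤ c.K := Nat.min_le_left _ _
  have hcp : c.cp = 5000 * c.K + 200 * c.l + 5000 := rfl
  refine wp_hide fun Q' hQ' => ?_
  refine wp_blk_seq (by simp; omega) ?_
  simp [wpB, Op.ok, Op.ev, h.r_i, h.mach.k.c4]
  have hrem := Run.removed_front (c := c) (R := X) (a := a) h.core.gx g1 (by omega) (by omega)
  refine wp_seq (by omega) (wp_remove hc (h.mach.k.congr fun x _ _ _ _ _ _ => by
      rw [Function.update_of_ne (by omega), Function.update_of_ne (by omega)]) h.core (by simp [h.mach.ins])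
    (by simp [h.mach.pn]) (by simp [h.r_fs, g2]) (by simp) hrem h.bad (by omega) ?_)
  intro r4 A4 m4 t4 bad4 fr4 hcore4 e60 e61 hA4 ht4
  have hlim4 := c.P.lim_mono fr4.2.2.2
  have f4 : ∀ x ∈ keepRegs, x ∉ [60, 61] → r4 x = r x := by
    intro x hx hx'
    have h1 : x ∉ [60, 61] → x ∈ keepRegs → remove.clob x = false ∧ x ≠ 90 ∧ x ≠ 91 := by
      revert x; decide
    obtain ⟨h2, h3, h4⟩ := h1 hx' hx
    rw [fr4.1 x h2, Function.update_of_ne h4, Function.update_of_ne h3]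
  have e25 : (r4 25).val = X.fs := by rw [fr4.1 25 (by decide)]; simp [h.r_fs]
  refine wp_blk_seq (by simp; omega) ?_
  simp [wpB, Op.ok, Op.ev, e25, f4 12 (by decide) (by decide), h.mach.k.c12]
  refine ⟨by omega, ?_⟩
  refine wp_abs fun r5 hr5 => ?_
  have hm5 : Mach c r5 A4 X Y lo o (ins + 2) (pn + 2) := by
    have hf : ∀ x ∈ keepRegs, x ∉ [60, 61] → r5 x = r x := by
      intro x hx hx'
      have : x ≠ 29 := by clear hx'; revert hx; revert x; decide
      rw [hr5, Function.update_of_ne this, f4 x hx hx']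
    refine h.mach.setX (fun x hx hx' => hf x hx ?_) ?_ ?_ ?_ ?_ ?_ ?_
    · simp at hx' ⊢; omega
    · intro k j hj
      have := h.mach.tf
      refine hA4 _ ?_
      unfold slotA; omega
    · refine h.mach.x.congr ?_ ?_ ?_ ?_ ?_ h.mach.tf3.1 hA4 <;> exact hf _ (by decide) (by decide)
    · rw [hf 8 (by decide) (by decide)]; exact h.mach.lo
    · rw [hf 9 (by decide) (by decide)]; exact h.mach.o
    · simp [hr5, e60]
    · simp [hr5, e61]
  have hkM := h.core.index_lt hc (show X.kl ≤ 2 * c.n + c.n * ins by omega)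
  refine wp_setFront hc hm5 g1 h.core.gx.klS (by omega) (i := X.S X.kf + 2) (by simp [hr5, g2]) (by omega) ?_
  intro r6 A6 t6 hm6 f6 hA6 ht6
  have h7 : c.Bh * (ins + 2) = c.Bh * ins + 2 * c.Bh := by ring
  have h8 : c.cp * (pn + 2) = c.cp * pn + 2 * c.cp := by ring
  have h9 : (X.cut (X.S X.kf + 2)).pot c = X.pot c := rfl
  refine hQ' _ _ _ _ (hQ _ _ _ _ _ _ _ _ _ _ _ ⟨hm6, hcore4.arr hA6, ?_, ?_, ?_⟩)
  · change X.kl + 2 * (X.h - X.u) ≤ _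
    rw [mul_add]; omega
  · rw [mul_add]; omega
  · rw [h7, h8, h9]; omega

/-- Merge the front blocks of the two runs. -/
def phase : Cmd := phasePre ;; mergeLoop ;; .cond (.eq 75 3) phaseCommit phaseFail

-- A phase starts only when neither run can be extended, which is the hypothesis of the counting
-- argument. Its length is at most that of two blocks.
set_option maxHeartbeats 1000000 in
theorem wp_phase {c : Ctx} (hc : c.Ok) {r A : ℕ → Word} {m : FState} {t T : ℕ} {Q : Post}
    {X Y : Run} {lo o ins pn : ℕ} {bad : Finset ℕ} (h : Inv c r A m T X Y lo o bad ins pn)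
    (hT : t ≤ T + 100) (hnx : X.kl = X.kf + c.S + 1 ∨ X.u = X.h)
    (hny : Y.kl = Y.kf + c.S + 1 ∨ Y.u = Y.h) (ho : o < c.n + (c.phi - c.plo))
    (hQ : ∀ r' A' m' t' X' Y' lo' o' bad' ins' pn',
      Inv c r' A' m' (t' + 100) X' Y' lo' o' bad' ins' pn' → Q r' A' m' t') :
    wp c.P phase Q r A m t := by
  obtain ⟨hm, hcore, hkx, hky, htime⟩ := h
  have hbb := c.bb_pos hc
  have hbK : c.bb ≤ c.K := Nat.min_le_left _ _
  have hcp : c.cp = 5000 * c.K + 200 * c.l + 5000 := rfl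
  have hlim0 := hcore.lim_ge hc
  have hSS := hc.ok.hS
  have hempty : ∀ R : Run, R.Geo c.K c.S c.w → (R.kl = R.kf + c.S + 1 ∨ R.u = R.h) → ¬ R.kf < R.kl →
      R.size = 0 := by
    intro R hg hn hk
    have hu : R.u = R.h := hn.resolve_left (by omega)
    unfold Run.size
    rw [Finset.Ico_eq_empty (by omega)]
    simp [hu]
  -- Otherwise both runs and the queue would be empty, although the output is not yet complete.
  have hne : X.kf < X.kl ∨ Y.kf < Y.kl ∨ pn ≠ 0 := by
    by_contra hcon
    simp only [not_or, not_not] at hcon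
    have h1 := hempty X hcore.gx hnx hcon.1
    have h2 := hempty Y hcore.gy hny hcon.2.1
    have h3 := hcore.cnt
    have := hcore.no
    omega
  have hpotx : X.kf < X.kl → 2000 * c.bb ≤ X.pot c := fun hk => by
    have : 2000 * c.bb * 1 ≤ 2000 * c.bb * (X.kl - X.kf) := Nat.mul_le_mul_left _ (by omega)
    unfold Run.pot; omega
  have hpoty : Y.kf < Y.kl → 2000 * c.bb ≤ Y.pot c := fun hk => by
    have : 2000 * c.bb * 1 ≤ 2000 * c.bb * (Y.kl - Y.kf) := Nat.mul_le_mul_left _ (by omega)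
    unfold Run.pot; omega
  have hpotp : pn ≠ 0 → c.cp ≤ c.cp * pn := fun hk => Nat.le_mul_of_pos_right _ (by omega)
  -- Whichever input is nonempty holds this much credit. It covers the phase until its outcome is
  -- known.
  have hav : t + 2000 * c.bb ≤ c.P.lim m.a + 100 := by
    rcases hne with h1 | h1 | h1
    · have := hpotx h1; omega
    · have := hpoty h1; omega
    · have := hpotp h1; omega
  have hxM := hcore.index_lt hc (show X.kl ≤ 2 * c.n + c.n * ins by omega)
  have hyM := hcore.index_lt hc (show Y.kl ≤ 2 * c.n + c.n * ins by omega)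
  refine wp_hide fun Q' hQ' => ?_
  refine wp_seq (by omega) (wp_phasePre hc hm hcore (by omega) (by omega) hne (by omega) ?_)
  intro r1 m1 t1 bad1 th w w' ha1 hmg hb ht1
  have hlim1 := c.P.lim_mono ha1
  have hrem := hmg.r_rem
  have hf1 := hmg.core.fe_le hc
  have hf2 := hmg.core.swap.fe_le hc
  refine wp_seq (by omega) (wp_mergeLoop hc hmg (by omega) ?_)
  intro r2 m2 t2 X2 Y2 bad2 fr2 hXY hres ht2
  have hlim2 := c.P.lim_mono fr2.2.2.2
  have e71 : r2 71 = r1 71 := fr2.1 71 (by decide)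
  have hall : (X2.kl = X2.kf + c.S + 1 ∨ X2.u = X2.h) ∧ (Y2.kl = Y2.kf + c.S + 1 ∨ Y2.u = Y2.h) ∧
      X2.kl + 2 * (X2.h - X2.u) ≤ 2 * c.n + c.n * ins ∧ Y2.kl + 2 * (Y2.h - Y2.u) ≤ 2 * c.n + c.n * ins ∧
      X2.pot c + Y2.pot c = X.pot c + Y.pot c ∧ Bound A X2 Y2 lo pn th ((r2 71).val = 2) := by
    rw [e71]
    rcases hXY with ⟨rfl, rfl⟩ | ⟨rfl, rfl⟩
    · exact ⟨hny, hnx, hky, hkx, by omega, hb⟩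
    · exact ⟨hnx, hny, hkx, hky, rfl, ⟨hb.lo_le, hb.y, hb.x, hb.pq, hb.pop, fun h => (hb.run h).symm⟩⟩
  obtain ⟨hnx2, hny2, hkx2, hky2, hpot2, hb2⟩ := hall
  rcases hres with ⟨oo, ci, v, ci', v', hmg2⟩ | ⟨a, hfail⟩
  · refine wp_cond (by omega) (fun _ => ?_) fun h1 => ?_
    · have hlimc : t2 + 200 + (if (r2 71).val = 2 then 60 * c.l + 40 * c.K + 170 else 0) + 1 ≤ c.P.lim m2.a ∧
        t2 + 1 + 500 + X2.pot c + Y2.pot c + c.cp * pn + c.Rest ≤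
      c.P.A0 + c.Bh * ins + (if (r2 71).val = 2 then c.cp - (60 * c.l + 40 * c.K + 170) else 2000 * c.bb) := by
        clear hQ hQ' hxM hyM hnx2 hny2 hkx2 hky2 hkx hky hnx hny hXY hempty hpotx hpoty
        split_ifs with h5
        · have := hpotp (hb2.pop h5).1
          clear hne
          constructor <;> omega
        · constructor <;> omega
      exact wp_phaseCommit hc hmg2 hb2 hnx2 hny2 hkx2 hky2 hlimc.2 (by omega)
        (fun r' A' m' t' X' Y' lo' o' bad' pn' h => hQ' _ _ _ _ (hQ _ _ _ _ _ _ _ _ _ _ _ h))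
    · simp [Test.ev, hmg2.r_ok, hmg2.mach.k.c3] at h1
  · refine wp_cond (by omega) (fun h1 => ?_) fun _ => ?_
    · simp [Test.ev, hfail.r_fail, hfail.mach.k.c3] at h1
    · exact wp_phaseFail hc hfail hkx2 hky2 (by omega)
        (fun r' A' m' t' X' Y' lo' o' bad' ins' pn' h => hQ' _ _ _ _ (hQ _ _ _ _ _ _ _ _ _ _ _ h))

/-! ### The main loop of a merge. -/

/-- Extend the verified part of a run, or merge the front blocks, until all keys are merged. -/
def drive : Cmd :=
  .loop (.lt 9 10) (
    blk [.op .sub 110 21 20, .op .sub 110 7 110, .op .sub 111 23 22, .op .mul 110 110 111,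
      .op .sub 111 41 40, .op .sub 111 7 111, .op .sub 112 43 42, .op .mul 111 111 112] ;;
    .cond (.lt 3 110) ext (.cond (.lt 3 111) (swapRegs ;; ext) phase))

theorem Inv.ev {c : Ctx} (hc : c.Ok) {r A : ℕ → Word} {m m' : FState} {T : ℕ} {X Y : Run} {lo o : ℕ}
    {bad F : Finset ℕ} {ins pn : ℕ} (h : Inv c r A m T X Y lo o bad ins pn) (e : EvF c.P.δ ∅ F m m') :
    Inv c r A m' T X Y lo o (bad ∪ F) ins pn :=
  ⟨h.mach, h.core.ev hc e, h.kx, h.ky, h.time⟩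

theorem need_lt {c : Ctx} (hc : c.Ok) {X : Run} (hin : X.h ≤ c.phi) :
    (c.S + 1 - (X.kl - X.kf)) * (X.h - X.u) < c.P.M := by
  have h1 := hc.hM
  have h2 := hc.hphi
  have h3 := hc.ok.hSδ
  calc _ ≤ (c.P.δ + 1) * c.n := Nat.mul_le_mul (by omega) (by omega)
    _ = c.n * c.P.δ + c.n := by ring
    _ < c.P.M := by
      have : c.n * (2 * c.P.δ) = c.n * c.P.δ + c.n * c.P.δ := by ring
      omega

/-- There is no separate termination argument: each round preserves the amortised time inequality,
and the time limit does the rest. -/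
theorem wp_drive {c : Ctx} (hc : c.Ok) {r A : ℕ → Word} {m : FState} {t : ℕ} {Q : Post}
    {X Y lo o ins pn bad} (h : Inv c r A m (t + 100) X Y lo o bad ins pn)
    (hQ : ∀ r' A' m' t' X' Y' lo' o' bad' ins' pn', Frame c.P.δ drive r A m r' A' m' →
      Inv c r' A' m' t' X' Y' lo' o' bad' ins' pn' → c.n + (c.phi - c.plo) ≤ o' → Q r' A' m' t') :
    wp c.P drive Q r A m t := by
  suffices hh : wp c.P drive (fun r' A' m' t' => ∃ X' Y' lo' o' bad' ins' pn',
      Inv c r' A' m' t' X' Y' lo' o' bad' ins' pn' ∧ c.n + (c.phi - c.plo) ≤ o') r A m t from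
    wp_mono _ (wp_frame _ hh) fun r' A' m' t' h => by
      obtain ⟨⟨X', Y', lo', o', b, i, p, h, h'⟩, hf⟩ := h
      exact hQ r' A' m' t' X' Y' lo' o' b i p hf h h'
  refine ⟨fun r A m t => ∃ X Y lo o bad ins pn, Inv c r A m (t + 100) X Y lo o bad ins pn, ?_,
    ⟨X, Y, lo, o, bad, ins, pn, h⟩, ?_⟩
  · rintro r1 A1 m1 t1 m2 ⟨X', Y', lo', o', b, i, p, h⟩ ⟨F, ev⟩
    exact ⟨X', Y', lo', o', _, i, p, h.ev hc ev⟩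
  clear h hQ X Y lo o bad ins pn r A m t
  rintro r A m t ⟨X, Y, lo, o, bad, ins, pn, h⟩
  have hlim := h.core.lim_ge hc
  have htime := h.time
  have hm := h.mach
  refine ⟨by omega, fun hb => ?_, fun hb => ?_⟩
  swap
  · simp only [Test.ev, hm.o, hm.oend] at hb
    exact ⟨X, Y, lo, o, bad, ins, pn, ⟨hm, h.core, h.kx, h.ky, by omega⟩, by omega⟩
  simp only [Test.ev, hm.o, hm.oend] at hb
  refine wp_hide fun Q' hQ' => ?_
  have b1 := need_lt hc h.core.xin.2
  have b2 := need_lt hc h.core.yin.2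
  have g1 := h.core.gx.kle
  have g2 := h.core.gy.kle
  have g3 := h.core.gx.klS
  have g4 := h.core.gy.klS
  obtain ⟨x1, x2, x3, x4, -⟩ := hm.x
  obtain ⟨y1, y2, y3, y4, -⟩ := hm.y
  simp only [Nat.reduceAdd] at x2 x3 x4 y2 y3 y4
  refine wp_blk_seq (by simp; omega) ?_
  -- One product per run tests two conditions at once: it is positive if and only if a slot is free
  -- and unverified words remain.
  simp [wpB, Op.ok, Op.ev, x1, x2, x3, x4, y1, y2, y3, y4, hm.k.c7]
  refine ⟨b1, b2, ?_⟩
  refine wp_abs fun r1 hr1 => ?_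
  have f1 : ∀ x, x ≠ 110 → x ≠ 111 → x ≠ 112 → r1 x = r x := fun x _ _ _ => by
    rw [hr1]; simp [*]
  have hI1 : Inv c r1 A m (t + 100) X Y lo o bad ins pn := h.congr fun x hx => by
    refine f1 x ?_ ?_ ?_ <;> revert hx <;> revert x <;> decide
  have e3 : (r1 3).val = 0 := by rw [hI1.mach.k.c3]
  have e110 : (r1 110).val = (c.S + 1 - (X.kl - X.kf)) * (X.h - X.u) := by simp [hr1]
  have e111 : (r1 111).val = (c.S + 1 - (Y.kl - Y.kf)) * (Y.h - Y.u) := by simp [hr1]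
  refine wp_cond (by omega) (fun hx => ?_) fun hx => ?_
  · simp only [Test.ev, e3, e110] at hx
    have hx1 := Nat.pos_of_mul_pos_right hx
    have hx2 := Nat.pos_of_mul_pos_left hx
    exact wp_ext hc hI1 (by omega) (by omega) (by omega) fun _ _ _ _ _ _ _ _ _ h =>
      hQ' _ _ _ _ ⟨_, _, _, _, _, _, _, h⟩
  have hx' : c.S + 1 - (X.kl - X.kf) = 0 ∨ X.h - X.u = 0 := by
    simp only [Test.ev, e3, e110] at hx
    rcases Nat.eq_zero_or_pos ((c.S + 1 - (X.kl - X.kf)) * (X.h - X.u)) with h | h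
    · exact Nat.mul_eq_zero.1 h
    · exact absurd h hx
  have u1 := h.core.gx.uh
  have u2 := h.core.gy.uh
  refine wp_cond (by omega) (fun hy => ?_) fun hy => ?_
  · simp only [Test.ev, e3, e111] at hy
    have hy1 := Nat.pos_of_mul_pos_right hy
    have hy2 := Nat.pos_of_mul_pos_left hy
    refine wp_seq (by omega) (wp_swapRegs (by omega) fun r2 hr2 => ?_)
    refine wp_ext hc (hI1.swap fun x hx => hr2 x ?_) (by omega) (by omega) (by omega)
      fun _ _ _ _ _ _ _ _ _ h => hQ' _ _ _ _ ⟨_, _, _, _, _, _, _, h⟩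
    clear hx'; revert hx; revert x; decide
  · have hy' : c.S + 1 - (Y.kl - Y.kf) = 0 ∨ Y.h - Y.u = 0 := by
      simp only [Test.ev, e3, e111] at hy
      rcases Nat.eq_zero_or_pos ((c.S + 1 - (Y.kl - Y.kf)) * (Y.h - Y.u)) with h | h
      · exact Nat.mul_eq_zero.1 h
      · exact absurd h hy
    exact wp_phase hc hI1 (by omega) (by omega) (by omega) (by omega)
      fun _ _ _ _ _ _ _ _ _ _ _ h => hQ' _ _ _ _ ⟨_, _, _, _, _, _, _, h⟩

/-! ### The state between merges. -/

/-- The state between two merges: all keys are in the words `p < n`, and any two of them in the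
relation `R` are in order. -/
structure Outer (P : Par) (n S : ℕ) (A : ℕ → Word) (m : FState) (R : ℕ → ℕ → Prop)
    (bad : Finset ℕ) (ins : ℕ) : Prop where
  pq : PQ n S A m.mem ins 0 0
  good : Good n (rd noReg A m.mem) m.cor (pqL n S A {p | p < n} ∅)
  clean : ∀ p < n, (m.mem p).src ≠ none → p ∉ bad
  sorted : ∀ p q, p < q → q < n → R p q → p ∉ bad → q ∉ bad → (m.mem p).val ≤ (m.mem q).val
  card : 2 * bad.card + ins ≤ 2 * m.a
  ale : m.a ≤ P.δ

theorem Outer.ev {P : Par} {n S : ℕ} {A : ℕ → Word} {m m' : FState} {R : ℕ → ℕ → Prop}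
    {bad F : Finset ℕ} {ins : ℕ} (h : Outer P n S A m R bad ins) (e : EvF P.δ ∅ F m m') :
    Outer P n S A m' R (bad ∪ F) ins where
  pq := h.pq.ev e (by simp)
  good := h.good.ev e (by simp)
  clean := fun p hp hs => by
    obtain ⟨h1, h2⟩ := e.src_ne (by simp) hs
    rw [h2] at hs
    simp [h.clean p hp hs, h1]
  sorted := fun p q h1 h2 h3 h4 h5 => by
    obtain ⟨a1, a2⟩ := e.val h4
    obtain ⟨b1, b2⟩ := e.val h5
    rw [a2, b2]
    exact h.sorted p q h1 h2 h3 a1 b1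
  card := by
    have := e.card; have := h.card; have := Finset.card_union_le bad F; omega
  ale := e.le h.ale

theorem Outer.mono {P : Par} {n S : ℕ} {A : ℕ → Word} {m : FState} {R R' : ℕ → ℕ → Prop}
    {bad : Finset ℕ} {ins : ℕ} (h : Outer P n S A m R bad ins)
    (hR : ∀ p q, p < q → q < n → R' p q → R p q) : Outer P n S A m R' bad ins :=
  ⟨h.pq, h.good, h.clean, fun p q h1 h2 h3 => h.sorted p q h1 h2 (hR p q h1 h2 h3), h.card, h.ale⟩

/-- A run without verified blocks. -/
def Run.fresh (b h : ℕ) : Run := ⟨b, 0, 0, b, h, fun _ => 0, fun _ => 0, fun _ => 0⟩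

theorem Run.fresh_cell {b h p : ℕ} : (Run.fresh b h).Cell p ↔ b ≤ p ∧ p < h := by
  simp [Run.fresh, Run.Cell, Run.Blk, Run.Zone]

theorem Run.fresh_geo {b h K S w : ℕ} (h1 : b ≤ h) (h2 : h ≤ b + w) : (Run.fresh b h).Geo K S w :=
  ⟨le_rfl, Nat.zero_le _, fun _ _ h => absurd h (Nat.not_lt_zero _),
    fun _ _ h => absurd h (Nat.not_lt_zero _), le_rfl, h1, h2,
    fun _ _ _ h => absurd h (Nat.not_lt_zero _)⟩

theorem Run.fresh_val {b h : ℕ} {mem : ℕ → Word} {bad : Finset ℕ}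
    (hs : ∀ p q, b ≤ p → p < q → q < h → p ∉ bad → q ∉ bad → (mem p).val ≤ (mem q).val) :
    (Run.fresh b h).Val mem bad 0 :=
  ⟨fun p q hp hq hpq => hs p q (fresh_cell.1 hp).1 hpq (fresh_cell.1 hq).2,
    fun _ _ h => absurd h.1.2 (Nat.not_lt_zero _), fun _ _ _ h => absurd h.1.2 (Nat.not_lt_zero _),
    fun _ _ h => absurd h (Nat.not_lt_zero _), fun _ _ _ => Nat.zero_le _, fun _ _ _ => Nat.zero_le _⟩

/-- At the start all words of both runs are unverified. Their order is supplied by the relation kept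
between merges, and the output and the queue are empty. -/
theorem Outer.core {c : Ctx} (hc : c.Ok) {A m bad ins mid} (h : Outer c.P c.n c.S A m c.Rel bad ins)
    (h1 : c.plo ≤ mid) (h2 : mid ≤ c.phi) (h3 : mid ≤ c.plo + c.w) (h4 : c.phi ≤ mid + c.w)
    (hX : ∀ p q, c.plo ≤ p → p < q → q < mid → c.Rel p q)
    (hY : ∀ p q, mid ≤ p → p < q → q < c.phi → c.Rel p q) :
    Core c A m bad (.fresh c.plo mid) (.fresh mid c.phi) 0 c.n 0 ins 0 := by
  have hphi := hc.hphi
  have hl : ∀ p, p ∈ liveF c (.fresh c.plo mid) (.fresh mid c.phi) c.n ↔ p < c.n := by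
    intro p
    simp only [liveF, Run.fresh_cell, Set.mem_ofPred_eq]
    omega
  refine ⟨h.pq, Run.fresh_geo h1 h3, Run.fresh_geo h2 h4,
    Run.fresh_val fun p q a b d => h.sorted p q b (by omega) (hX p q a b d),
    Run.fresh_val fun p q a b d => h.sorted p q b (by omega) (hY p q a b d), ⟨le_rfl, h2⟩, ⟨h1, le_rfl⟩,
    Or.inl le_rfl, ?_, fun p hp => h.clean p ((hl p).1 hp), fun p q a b _ _ => h.sorted p q a b,
    fun p q a b d => by omega, fun p a b => by omega, le_rfl, ?_, h.card, h.ale, Nat.zero_le _⟩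
  · rw [show liveF c (.fresh c.plo mid) (.fresh mid c.phi) c.n = {p | p < c.n} from Set.ext hl]
    exact h.good
  · simp [Run.size, Run.fresh]; omega

/-- The state after a merge, when the result has been moved back. -/
theorem Core.outer_of_moved {c : Ctx} (hc : c.Ok) {A m bad} {X Y : Run} {lo o ins pn}
    (h : Core c A m bad X Y lo o lo ins pn) (ho : c.n + (c.phi - c.plo) ≤ o) {m' : FState} {F : Finset ℕ}
    (ev : EvF c.P.δ (deadZone o c.phi (c.phi - c.plo)) F (m.moved o c.phi (c.phi - c.plo)) m')
    {R : ℕ → ℕ → Prop} (hR : ∀ p q, p < q → q < c.n → R p q → (c.plo ≤ p ∧ q < c.phi) ∨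
      (¬ (c.plo ≤ p ∧ p < c.phi) ∧ ¬ (c.plo ≤ q ∧ q < c.phi) ∧ c.Rel p q)) :
    pn = 0 ∧ Outer c.P c.n c.S A m' R (sbad bad o c.phi (c.phi - c.plo) ∪ F) ins := by
  have hphi := hc.hphi
  have hplo := hc.hplo
  have hcnt := h.cnt
  have hno := h.no
  obtain rfl : o = c.n + (c.phi - c.plo) := by omega
  obtain rfl : pn = 0 := by omega
  have hempty : ∀ R : Run, R.size = 0 → ∀ p, ¬ R.Cell p := by
    intro R hR p hp
    unfold Run.size at hR
    rcases hp with ⟨k, ⟨h1, h2⟩, h3, h4⟩ | ⟨h1, h2⟩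
    · have := Finset.single_le_sum (f := fun k => R.E k - R.S k) (fun _ _ => Nat.zero_le _)
        (Finset.mem_Ico.2 ⟨h1, h2⟩)
      omega
    · omega
  have hl : ∀ p, p ∈ liveF c X Y (c.n + (c.phi - c.plo)) ↔
      (p < c.n ∧ ¬ (c.plo ≤ p ∧ p < c.phi)) ∨ c.n ≤ p ∧ p < c.n + (c.phi - c.plo) := by
    intro p
    have h1 := hempty X (by omega) p
    have h2 := hempty Y (by omega) p
    simp only [liveF, Set.mem_ofPred_eq, h1, h2, false_or]
  obtain ⟨e, he⟩ : ∃ e, e = c.phi - c.plo := ⟨_, rfl⟩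
  rw [← he] at h ho ev hno hcnt hl ⊢
  have hlive : ∀ p, p ∈ {p | p < c.n} ↔ p ∉ deadZone (c.n + e) c.phi e ∧
      og (c.n + e) c.phi e p ∈ liveF c X Y (c.n + e) := by
    intro p
    rw [hl]
    simp only [deadZone, Set.mem_ofPred_eq, og]
    split_ifs <;> omega
  have hmv : ∀ p < c.n, p ∉ sbad bad (c.n + e) c.phi e ∪ F → og (c.n + e) c.phi e p ∉ bad ∧
      m'.mem p = m.mem (og (c.n + e) c.phi e p) := fun p hp hpb =>
    ev.moved_good bad (by omega) (by omega) ((hlive p).1 hp).1 hpb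
  refine ⟨rfl, ?_, ?_, ?_, ?_, ?_, ev.le h.ale⟩
  · have hpq5 : PQ c.n c.S A (m.moved (c.n + e) c.phi e).mem ins 0 lo := by
      refine ⟨h.pq.toPQ0.congr (fun p hp => ?_) (fun _ _ => ⟨rfl, rfl⟩) fun _ => rfl, h.pq.tree⟩
      rw [moved_mem]
      unfold og
      rw [if_neg (by omega)]
    have h1 := hpq5.ev ev fun p hp => by
      simp only [deadZone, Set.mem_ofPred_eq] at hp
      omega
    exact ⟨⟨h1.leaf, h1.occ, h1.size, h1.min, fun _ _ _ _ _ => Nat.zero_le _,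
      fun _ _ _ _ => Nat.zero_le _, h1.sum⟩, h1.tree⟩
  · refine (h.good.moved (by omega) (by omega) (by omega) (by omega) (fun p hp => ?_) hlive
      fun p h1 h2 _ hp => ?_).ev ev fun p hp => ?_
    · rw [hl] at hp; omega
    · rw [hl] at hp; omega
    · rcases hp with hp | ⟨g, -, j, -, rfl⟩
      · exact ((hlive p).1 hp).1
      · simp only [deadZone, Set.mem_ofPred_eq]; unfold pcell; omega
  · intro p hp hsr
    exact ev.moved_src bad (by omega) (by omega) ((hlive p).1 hp).1 hsr fun h1 =>
      h.clean _ ((hlive p).1 hp).2 h1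
  · intro p q hpq hq hr hp' hq'
    obtain ⟨a1, a2⟩ := hmv p (by omega) hp'
    obtain ⟨b1, b2⟩ := hmv q hq hq'
    rw [a2, b2]
    rcases hR p q hpq hq hr with h1 | ⟨h1, h2, h3⟩
    · have e1 : og (c.n + e) c.phi e p = p + (c.n + e) - c.phi := by unfold og; rw [if_pos (by omega)]
      have e2 : og (c.n + e) c.phi e q = q + (c.n + e) - c.phi := by unfold og; rw [if_pos (by omega)]
      rw [e1] at a1 ⊢
      rw [e2] at b1 ⊢
      exact h.osort _ _ (by omega) (by omega) (by omega) a1 b1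
    · have e1 : og (c.n + e) c.phi e p = p := by unfold og; rw [if_neg (by omega)]
      have e2 : og (c.n + e) c.phi e q = q := by unfold og; rw [if_neg (by omega)]
      rw [e1] at a1 ⊢
      rw [e2] at b1 ⊢
      exact h.outer p q hpq hq h1 h2 h3 a1 b1
  · have h1 := Finset.card_union_le (sbad bad (c.n + e) c.phi e) F
    have h2 := sbad_card bad (c.n + e) c.phi e
    have h3 := ev.card
    have h4 := h.card
    simp only [FState.moved] at h3
    omega

/-- Merge the runs of length `r 100` that start at `r 101`. -/
def merge : Cmd :=
  blk [.op .add 102 101 100, .op .sub 110 102 0, .op .sub 102 102 110, .op .add 103 102 100,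
    .op .sub 110 103 0, .op .sub 103 103 110, .set 8 0, .mov 9 0, .op .sub 10 103 101,
    .op .add 10 10 0, .mov 20 3, .mov 21 3, .mov 22 101, .mov 23 102, .mov 24 3, .mov 40 3, .mov 41 3,
    .mov 42 102, .mov 43 103, .set 44 3] ;;
  drive ;; blk [.mov 92 9, .mov 93 103, .op .sub 94 103 101] ;; moveDown

/-- Each fresh run of length at most `w` needs credit `16000 * w`. The remaining `200 * w` and
`Rest` cover the set-up and the move of the output back to its place. -/
theorem wp_merge {c : Ctx} (hc : c.Ok) {r A : ℕ → Word} {m : FState} {t : ℕ} {Q : Post} {bad ins mid R}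
    {t₀ : ℕ} (h : Outer c.P c.n c.S A m c.Rel bad ins) (hk : Consts c.P c.n c.S r)
    (e60 : (r 60).val = ins) (e61 : (r 61).val = 0) (e100 : (r 100).val = c.w)
    (e101 : (r 101).val = c.plo) (hwn : c.w ≤ c.n) (hp : c.plo ≤ c.n) (hmid : mid = min (c.plo + c.w) c.n)
    (hphi : c.phi = min (mid + c.w) c.n)
    (hX : ∀ p q, c.plo ≤ p → p < q → q < mid → c.Rel p q)
    (hY : ∀ p q, mid ≤ p → p < q → q < c.phi → c.Rel p q)
    (hR : ∀ p q, p < q → q < c.n → R p q → (c.plo ≤ p ∧ q < c.phi) ∨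
      (¬ (c.plo ≤ p ∧ p < c.phi) ∧ ¬ (c.plo ≤ q ∧ q < c.phi) ∧ c.Rel p q))
    (hRest : c.Rest = 20 * (c.phi - c.plo) + 20 + t₀) (ht : t + 32200 * c.w + c.Rest ≤ c.P.A0 + c.Bh * ins)
    (hQ : ∀ r' A' m' t' bad' ins', Frame c.P.δ merge r A m r' A' m' →
      Outer c.P c.n c.S A' m' R bad' ins' → (r' 60).val = ins' → (r' 61).val = 0 → Consts c.P c.n c.S r' →
      t' + t₀ ≤ c.P.A0 + c.Bh * ins' → Q r' A' m' t') :
    wp c.P merge Q r A m t := by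
  suffices hh : wp c.P merge (fun r' A' m' t' => ∃ bad' ins',
      Outer c.P c.n c.S A' m' R bad' ins' ∧ (r' 60).val = ins' ∧ (r' 61).val = 0 ∧ Consts c.P c.n c.S r' ∧
      t' + t₀ ≤ c.P.A0 + c.Bh * ins') r A m t from
    wp_mono _ (wp_frame _ hh) fun r' A' m' t' h => by
      obtain ⟨⟨b, i, h1, h2, h3, h4, h5⟩, hf⟩ := h
      exact hQ r' A' m' t' b i hf h1 h2 h3 h4 h5
  have hw := hc.hw
  have hM := hc.ok.hM
  have hbb : c.bb ≤ c.w := Nat.min_le_right _ _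
  have hcore := h.core hc (mid := mid) (by omega) (by omega) (by omega) (by omega) hX hY
  have hlim := hcore.lim_ge hc
  have k0 := hk.c0
  refine wp_hide fun Q' hQ' => ?_
  refine wp_blk_seq (by simp; omega) ?_
  simp [wpB, Op.ok, Op.ev, e100, e101, k0]
  -- Truncated subtraction computes a minimum: `x - (x - n) = min x n`.
  have e1 : c.plo + c.w - (c.plo + c.w - c.n) = mid := by omega
  rw [e1]
  have e2 : mid + c.w - (mid + c.w - c.n) = c.phi := by omega
  rw [e2]
  refine ⟨by omega, by omega, by omega, by omega, by omega, ?_⟩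
  refine wp_abs fun r1 hr1 => ?_
  have f1 : ∀ x ∈ keepRegs, x ∉ [8, 9, 10, 20, 21, 22, 23, 24, 40, 41, 42, 43, 44] → r1 x = r x := by
    intro x hx hx'
    have : x ≠ 102 ∧ x ≠ 103 ∧ x ≠ 110 := by clear hx'; revert hx; revert x; decide
    simp at hx'
    rw [hr1]; simp [this, hx']
  have hk1 : Consts c.P c.n c.S r1 := hk.congr fun x a b d e g i => f1 x (by
    simp [keepRegs]; omega) (by simp; omega)
  have k3 := hk.c3
  have hmach : Mach c r1 A (.fresh c.plo mid) (.fresh mid c.phi) 0 c.n ins 0 := by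
    refine ⟨hk1, ⟨?_, ?_, ?_, ?_, fun k _ h => absurd h (Nat.not_lt_zero _)⟩,
      ⟨?_, ?_, ?_, ?_, fun k _ h => absurd h (Nat.not_lt_zero _)⟩, Or.inl ⟨?_, ?_⟩, ?_, ?_, ?_, ?_, ?_⟩
    all_goals first
      | rw [f1 60 (by decide) (by decide)]; exact e60
      | rw [f1 61 (by decide) (by decide)]; exact e61
      | simp [hr1, k3, k0, e101, Run.fresh]
    omega
  have hpots : ∀ b h : ℕ, h ≤ b + c.w → (Run.fresh b h).pot c ≤ 16000 * c.w := by
    intro b h hh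
    change 8000 * (h - b) + 2000 * c.bb * 0 + (if b < h then 8000 * c.bb else 0) ≤ _
    rw [mul_zero]
    split_ifs <;> omega
  have hp1 := hpots c.plo mid (by omega)
  have hp2 := hpots mid c.phi (by omega)
  have e103 : (r1 103).val = c.phi := by simp [hr1]
  have e101' : (r1 101).val = c.plo := by simp [hr1, e101]
  refine wp_seq (by omega) (wp_drive hc (X := .fresh c.plo mid) (Y := .fresh mid c.phi)
    ⟨hmach, hcore, ?_, ?_, by omega⟩ ?_)
  · change 0 + 2 * (mid - c.plo) ≤ _; omega
  · change 0 + 2 * (c.phi - mid) ≤ _; omega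
  intro r2 A2 m2 t2 X Y lo o bad2 ins2 pn2 fr2 hI ho
  have htime := hI.time
  have hlim2 := hI.core.lim_ge hc
  have g103 : (r2 103).val = c.phi := by rw [fr2.1 103 (by decide)]; exact e103
  have g101 : (r2 101).val = c.plo := by rw [fr2.1 101 (by decide)]; exact e101'
  refine wp_blk_seq (by simp; omega) ?_
  simp [wpB, Op.ok, Op.ev]
  have hm2 := hI.mach
  have ho2 := hI.core.no
  have hplo := hc.hplo
  have hcphi := hc.hphi
  refine wp_moveDown (s := o) (d := c.phi) (c := c.phi - c.plo) (by simp [hm2.k.c3]) (by simp [hm2.k.c4])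
    (by simp [hm2.o]) (by simp [g103]) (by simp [g103, g101]) (by omega) (by omega) (by omega) (by omega) ?_
  intro r3 A3 m3 t3 F fr3 ev _ ht3
  obtain ⟨rfl, hout⟩ := hI.core.outer_of_moved hc ho ev hR
  obtain rfl : A3 = A2 := fr3.2.1 (by decide)
  have f3 : ∀ x ∈ keepRegs, r3 x = r2 x := by
    intro x hx
    have : moveDown.clob x = false ∧ x ≠ 92 ∧ x ≠ 93 ∧ x ≠ 94 := by revert hx; revert x; decide
    rw [fr3.1 x this.1]; simp [this]
  refine hQ' _ _ _ _ ⟨_, ins2, hout, ?_, ?_, ?_, by omega⟩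
  · rw [f3 60 (by decide)]; exact hm2.ins
  · rw [f3 61 (by decide)]; exact hm2.pn
  · exact hm2.k.congr fun x a b d e g i => f3 x (by simp [keepRegs]; omega)

/-! ### Levels of the mergesort. -/

/-- Words in order while runs of length `w` are merged, when the words below `lo` are done. -/
def InOrder (w lo p q : ℕ) : Prop :=
  (∃ j, j * w ≤ p ∧ q < (j + 1) * w) ∨ (q < lo ∧ ∃ j, j * (2 * w) ≤ p ∧ q < (j + 1) * (2 * w))

/-- The next merge establishes the order of further words. -/
theorem InOrder.next {w j₀ phi n p q : ℕ} (hphi : phi = min (j₀ * (2 * w) + 2 * w) n) (hpq : p < q)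
    (hq : q < n) (h : InOrder w (j₀ * (2 * w) + 2 * w) p q) : (j₀ * (2 * w) ≤ p ∧ q < phi) ∨
      (¬ (j₀ * (2 * w) ≤ p ∧ p < phi) ∧ ¬ (j₀ * (2 * w) ≤ q ∧ q < phi) ∧ InOrder w (j₀ * (2 * w)) p q) := by
  rcases h with ⟨j, h1, h2⟩ | ⟨h0, j, h1, h2⟩
  · have e : j₀ * (2 * w) = 2 * j₀ * w := by ring
    have e2 : (2 * j₀ + 2) * w = 2 * j₀ * w + 2 * w := by ring
    rcases lt_or_ge j (2 * j₀) with hj | hj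
    · have : (j + 1) * w ≤ 2 * j₀ * w := Nat.mul_le_mul_right _ hj
      exact Or.inr ⟨by omega, by omega, Or.inl ⟨j, h1, h2⟩⟩
    · rcases lt_or_ge j (2 * j₀ + 2) with hj' | hj'
      · have h3 : 2 * j₀ * w ≤ j * w := Nat.mul_le_mul_right _ hj
        have h4 : (j + 1) * w ≤ (2 * j₀ + 2) * w := Nat.mul_le_mul_right _ hj'
        exact Or.inl ⟨by omega, by omega⟩
      · have : (2 * j₀ + 2) * w ≤ j * w := Nat.mul_le_mul_right _ hj'
        exact Or.inr ⟨by omega, by omega, Or.inl ⟨j, h1, h2⟩⟩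
  · rcases lt_trichotomy j j₀ with hj | rfl | hj
    · have : (j + 1) * (2 * w) ≤ j₀ * (2 * w) := Nat.mul_le_mul_right _ hj
      exact Or.inr ⟨by omega, by omega, Or.inr ⟨by omega, j, h1, h2⟩⟩
    · exact Or.inl ⟨h1, by omega⟩
    · have h3 : (j₀ + 1) * (2 * w) ≤ j * (2 * w) := Nat.mul_le_mul_right _ hj
      have h4 : (j₀ + 1) * (2 * w) = j₀ * (2 * w) + 2 * w := by ring
      omega

/-- Merge all pairs of neighbouring runs of length `r 100`. -/
def level : Cmd :=
  blk [.mov 101 3] ;; .loop (.lt 101 0) (merge ;; blk [.op .add 101 101 100, .op .add 101 101 100])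

/-- The parameters of the sorting algorithm fit together. -/
structure Par.Fit (P : Par) (n S l Bh : ℕ) : Prop where
  ok : P.Ok n S
  hl : S ≤ 2 ^ l
  hB : P.B = 2 * Bh
  hBh : 30000 * P.K S + 1000 * l + 30000 ≤ Bh
  hM : 4 * n + n * (2 * P.δ) + 10 ≤ P.M

theorem Outer.lim_ge {P : Par} {n S l Bh : ℕ} (hP : P.Fit n S l Bh) {A m R bad ins}
    (h : Outer P n S A m R bad ins) : P.A0 + Bh * ins ≤ P.lim m.a := by
  have h1 := h.card
  have h3 : Bh * ins ≤ Bh * (2 * m.a) := Nat.mul_le_mul_left _ (by omega)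
  unfold Par.lim
  rw [hP.hB]
  calc _ ≤ P.A0 + Bh * (2 * m.a) := by omega
    _ = _ := by ring

/-- The state of the sorting algorithm, with time credit `V`. -/
structure Sorting (P : Par) (n S Bh : ℕ) (R : ℕ → ℕ → Prop) (w V : ℕ) (bad : Finset ℕ) (ins : ℕ)
    (r A : ℕ → Word) (m : FState) (t : ℕ) : Prop where
  outer : Outer P n S A m R bad ins
  k : Consts P n S r
  r_ins : (r 60).val = ins
  r_pn : (r 61).val = 0
  r_w : (r 100).val = w
  time : t + V ≤ P.A0 + Bh * ins

/-- A merge of runs of length `w` advances by `2 * w` words and uses up the credit `17000` of each.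
The last pair may reach beyond `n`, hence `n + 2 * w`. -/
theorem wp_level {P : Par} {n S l Bh w V ins t : ℕ} {r A : ℕ → Word} {m : FState} {bad : Finset ℕ}
    {Q : Post} (hP : P.Fit n S l Bh) (hw : 1 ≤ w) (hwn : w < n)
    (h : Sorting P n S Bh (InOrder w 0) w (17000 * (n + 2 * w) + V + 40) bad ins r A m t)
    (hQ : ∀ r' A' m' t' bad' ins', Sorting P n S Bh (InOrder (2 * w) 0) w V bad' ins' r' A' m' t' →
      Q r' A' m' t') : wp P level Q r A m t := by
  have hM := hP.ok.hM
  have hlim := h.outer.lim_ge hP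
  have htime := h.time
  refine wp_blk_seq (by simp; omega) ?_
  simp [wpB, h.k.c3]
  refine ⟨fun r A m t => ∃ j bad ins, (r 101).val = j * (2 * w) ∧ j * (2 * w) ≤ n + 2 * w ∧
    Sorting P n S Bh (InOrder w (j * (2 * w))) w (17000 * (n + 2 * w - j * (2 * w)) + V + 20) bad ins r A m t,
    ?_, ?_, ?_⟩
  · rintro r A m t m' ⟨j, bad, ins, h1, h2, h3⟩ ⟨F, e⟩
    exact ⟨j, _, ins, h1, h2, h3.outer.ev e, h3.k, h3.r_ins, h3.r_pn, h3.r_w, h3.time⟩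
  · refine ⟨0, bad, ins, by simp, by omega, by simpa using h.outer, h.k.congr fun x _ _ _ _ _ _ => ?_, ?_, ?_,
      ?_, ?_⟩
    · rw [Function.update_of_ne (by omega)]
    · simpa using h.r_ins
    · simpa using h.r_pn
    · simpa using h.r_w
    · simp; omega
  · clear h htime hlim
    rintro r A m t ⟨j, bad, ins, e101, hj, h⟩
    have hlim := h.outer.lim_ge hP
    have htime := h.time
    obtain ⟨plo, hplo⟩ : ∃ plo, plo = j * (2 * w) := ⟨_, rfl⟩
    have e2 : (j + 1) * (2 * w) = plo + 2 * w := by rw [hplo]; ring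
    have e3 : 2 * j * w = plo := by rw [hplo]; ring
    have e4 : (2 * j + 1) * w = plo + w := by rw [hplo]; ring
    have e5 : (2 * j + 1 + 1) * w = plo + 2 * w := by rw [hplo]; ring
    rw [← hplo] at e101 hj h htime
    refine ⟨by omega, fun hb => ?_, fun hb => ?_⟩
    · simp only [Test.ev, e101, h.k.c0] at hb
      refine wp_hide fun Q' hQ' => ?_
      obtain ⟨phi, hphi⟩ : ∃ phi, phi = min (plo + 2 * w) n := ⟨_, rfl⟩
      -- The reserve `Rest` consists of the move back to the input words, the remaining merges of
      -- this level and the credit `V` of the later levels.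
      let c : Ctx := ⟨P, n, S, l, plo, phi, w, Bh,
        20 * (phi - plo) + 20 + (17000 * (n + 2 * w - (plo + 2 * w)) + V + 40), InOrder w plo⟩
      have hc : c.Ok := ⟨hP.ok, hP.hl, hP.hB, hP.hBh, by simp only [c]; omega, by simp only [c]; omega, hw,
        hP.hM⟩
      refine wp_seq (by omega) (wp_merge (c := c) hc (mid := min (plo + w) n) (R := InOrder w (plo + 2 * w))
        h.outer h.k h.r_ins h.r_pn h.r_w e101 hwn.le hb.le rfl (by simp only [c]; omega) ?_ ?_ ?_ rfl
        (by simp only [c]; omega) ?_)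
      · intro p q h1 h2 h3
        change plo ≤ p at h1
        -- The two runs of the `j`-th pair are the runs numbered `2 * j` and `2 * j + 1` of length
        -- `w`.
        exact Or.inl ⟨2 * j, by omega, by omega⟩
      · intro p q h1 h2 h3
        change q < phi at h3
        exact Or.inl ⟨2 * j + 1, by omega, by omega⟩
      · intro p q h1 h2 h3
        change (plo ≤ p ∧ q < phi) ∨ (¬ (plo ≤ p ∧ p < phi) ∧ ¬ (plo ≤ q ∧ q < phi) ∧ InOrder w plo p q)
        rw [hplo] at h3 hphi ⊢
        exact h3.next hphi h1 h2
      intro r1 A1 m1 t1 bad1 ins1 fr1 ho e60 e61 hk1 ht1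
      have hlim1 := ho.lim_ge hP
      change t1 + (17000 * (n + 2 * w - (plo + 2 * w)) + V + 40) ≤ P.A0 + Bh * ins1 at ht1
      have g100 : (r1 100).val = w := by rw [fr1.1 100 (by decide)]; exact h.r_w
      have g101 : (r1 101).val = plo := by rw [fr1.1 101 (by decide)]; exact e101
      change wp P _ Q' r1 A1 m1 t1
      refine wp_blk _ (by simp; omega) ?_
      simp [wpB, Op.ok, Op.ev, g100, g101]
      refine ⟨by omega, by omega, hQ' _ _ _ _ ⟨j + 1, bad1, ins1, ?_, ?_, ?_, ?_, ?_, ?_, ?_, ?_⟩⟩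
      · simp; omega
      · omega
      · rw [e2]; exact ho
      · exact hk1.congr fun x _ _ _ _ _ _ => by rw [Function.update_of_ne (by omega)]
      · simpa using e60
      · simpa using e61
      · simpa using g100
      · rw [e2]; omega
    · simp only [Test.ev, e101, h.k.c0] at hb
      refine hQ _ _ _ _ bad ins ⟨h.outer.mono fun p q h1 h2 h3 => ?_, h.k, h.r_ins, h.r_pn, h.r_w, by omega⟩
      rcases h3 with h3 | ⟨h3, -⟩
      · exact Or.inr ⟨by omega, h3⟩
      · omega

/-- Sorting in the presence of memory faults: the parameters `n`, `S`, `δ` are in the registers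
`0`, `1`, `2`. -/
def ssort : Cmd :=
  blk [.set 4 1, .set 5 16, .op .div 6 2 1, .op .add 6 6 4, .op .add 7 1 4, .set 12 2, .set 13 128,
    .set 14 134, .set 15 136, .op .add 16 0 0, .set 60 0, .set 61 0, .set 100 1] ;;
  .loop (.lt 100 0) (level ;; blk [.op .add 100 100 100])

/-- There are `Nat.clog 2 n` levels with credit `60000 * n` each. Insertions and `bad` are carried
over from level to level, so every fault is charged only once in the whole run. -/
theorem wp_ssort {P : Par} {n S l Bh : ℕ} {r A : ℕ → Word} {m : FState} {Q : Post}
    (hP : P.Fit n S l Bh) (h : Outer P n S A m (fun _ _ => False) ∅ 0)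
    (hA0 : P.A0 = 60000 * n * Nat.clog 2 n + 100) (e0 : (r 0).val = n) (e1 : (r 1).val = S)
    (e2 : (r 2).val = P.δ) (e3 : r 3 = ⟨0, none⟩)
    (hQ : ∀ r' A' m' t' bad' ins', Outer P n S A' m' (fun _ _ => True) bad' ins' → t' ≤ P.lim m'.a →
      Q r' A' m' t') : wp P ssort Q r A m 0 := by
  have hM := hP.ok.hM
  have hSδ := hP.ok.hSδ
  have hlim := h.lim_ge hP
  have hdiv := Nat.div_le_self P.δ S
  refine wp_blk_seq (by simp; omega) ?_
  simp [wpB, Op.ok, Op.ev, e0, e1, e2]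
  refine ⟨by omega, by omega, by omega, by omega, by omega, by omega, by omega, by omega, by omega, by omega,
    by omega, ?_⟩
  refine ⟨fun r A m t => ∃ i bad ins, Sorting P n S Bh (InOrder (2 ^ i) 0) (2 ^ i)
    (60000 * n * (Nat.clog 2 n - i) + 40) bad ins r A m t, ?_, ?_, ?_⟩
  · rintro r A m t m' ⟨i, bad, ins, h3⟩ ⟨F, e⟩
    exact ⟨i, _, ins, h3.outer.ev e, h3.k, h3.r_ins, h3.r_pn, h3.r_w, h3.time⟩
  · refine ⟨0, ∅, 0, h.mono fun p q h1 h2 h3 => ?_, ?_, by simp, by simp, by simp, ?_⟩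
    -- Runs of length one contain no two different addresses, so nothing needs to be known about the
    -- input.
    · rcases h3 with ⟨j, h3, h4⟩ | ⟨h3, -⟩ <;> omega
    · constructor <;> simp [e0, e1, e3, Par.K]
      omega
    · rw [hA0, Nat.sub_zero]; omega
  · clear h hlim
    rintro r A m t ⟨i, bad, ins, h⟩
    have hlim := h.outer.lim_ge hP
    have htime := h.time
    have hw : 1 ≤ 2 ^ i := Nat.one_le_two_pow
    have hpow : 2 ^ (i + 1) = 2 * 2 ^ i := by ring
    obtain ⟨w, hwi⟩ : ∃ w, w = 2 ^ i := ⟨_, rfl⟩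
    rw [← hwi] at hw h hpow
    refine ⟨by omega, fun hb => ?_, fun hb => ?_⟩
    · simp only [Test.ev, h.r_w, h.k.c0] at hb
      have hi : i < Nat.clog 2 n := (Nat.lt_clog_iff_pow_lt (by norm_num)).2 (by omega)
      obtain ⟨k, hk⟩ : ∃ k, Nat.clog 2 n - i = k + 1 := ⟨Nat.clog 2 n - i - 1, by omega⟩
      have hk' : Nat.clog 2 n - (i + 1) = k := by omega
      have e : 60000 * n * (k + 1) = 60000 * n * k + 60000 * n := by ring
      rw [hk, e] at htime
      refine wp_hide fun Q' hQ' => ?_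
      -- As `w < n`, the level needs less than `17000 * (3 * n)`; the rest of `60000 * n` absorbs
      -- the constants.
      refine wp_seq (by omega) (wp_level hP (V := 60000 * n * k + 60) hw hb
        ⟨h.outer, h.k, h.r_ins, h.r_pn, h.r_w, by omega⟩ ?_)
      intro r1 A1 m1 t1 bad1 ins1 h1
      have hlim1 := h1.outer.lim_ge hP
      have htime1 := h1.time
      refine wp_blk _ (by simp; omega) ?_
      simp [wpB, Op.ok, Op.ev, h1.r_w]
      refine ⟨by omega, hQ' _ _ _ _ ⟨i + 1, bad1, ins1, ?_, ?_, ?_, ?_, ?_, ?_⟩⟩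
      · rw [hpow]; exact h1.outer
      · exact h1.k.congr fun x _ _ _ _ _ _ => by rw [Function.update_of_ne (by omega)]
      · simpa using h1.r_ins
      · simpa using h1.r_pn
      · simp; omega
      · rw [hk']; omega
    · simp only [Test.ev, h.r_w, h.k.c0] at hb
      -- Now `n ≤ w`, so all words lie in the first run.
      refine hQ _ _ _ _ bad ins (h.outer.mono fun p q h1 h2 _ => Or.inl ⟨0, ?_, ?_⟩) (by omega) <;> omega

theorem ssort_wf : ssort.wf = true := by decide

/-! ### Numerical bounds and the conclusion. -/

theorem clog_bound {S : ℕ} (hS : 1 ≤ S) : (Nat.clog 2 S : ℝ) ≤ Real.logb 2 S + 1 := by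
  have h := Real.natCeil_logb_natCast 2 S
  rw [Nat.cast_ofNat] at h
  rw [← h]
  exact (Nat.ceil_lt_add_one (Real.logb_nonneg (by norm_num) (by exact_mod_cast hS))).le

/-- For `n ≥ 2` the logarithm is at least one, so rounding up at most doubles it. -/
theorem nlog_bound (n : ℕ) : (n : ℝ) * Nat.clog 2 n ≤ 2 * (n * Real.logb 2 n) + 1 := by
  rcases Nat.lt_or_ge n 2 with h | h
  · interval_cases n <;> simp
  · have h2 : (2 : ℝ) ≤ n := by exact_mod_cast h
    have h1 : 1 ≤ Real.logb 2 n := by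
      rw [Real.le_logb_iff_rpow_le (by norm_num) (by linarith)]; simpa using h2
    have h3 := clog_bound (S := n) (by omega)
    nlinarith

/-- The parameters of a run of the sorting algorithm. -/
def par (n S δ M C : ℕ) : Par where
  M := M
  cap := C * S
  δ := δ
  A0 := 60000 * n * Nat.clog 2 n + 100
  B := 2 * (30000 * (δ / S + 1) + 1000 * Nat.clog 2 S + 30000)

theorem par_fit {n S δ M C : ℕ} (hS : 1 ≤ S) (hSδ : S ≤ δ) (hC : 200 ≤ C) (hM : (n + δ + 2) ^ C ≤ M) :
    (par n S δ M C).Fit n S (Nat.clog 2 S) (30000 * (δ / S + 1) + 1000 * Nat.clog 2 S + 30000) := by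
  have h1 : (n + δ + 2) ^ 12 ≤ M := (Nat.pow_le_pow_right (by omega) (by omega)).trans hM
  have h2 : 2 ^ 10 * (n + δ + 2) ^ 2 ≤ M := by
    refine le_trans ?_ h1
    rw [show 12 = 10 + 2 from rfl, pow_add]
    exact Nat.mul_le_mul_right _ (Nat.pow_le_pow_left (by omega) _)
  refine ⟨⟨hS, hSδ, ?_, ?_⟩, Nat.le_pow_clog (by norm_num) _, rfl, le_rfl, ?_⟩
  · change 1000 * (n + δ + 2) ≤ M
    nlinarith
  · change 128 + 32 * S ≤ C * S
    nlinarith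
  · change 4 * n + n * (2 * δ) + 10 ≤ M
    nlinarith

/-- Since `1 ≤ δ / S`, the additive constants in the price of a fault are absorbed by `δ / S`; those
of the fault-free part go into the summand `1`. -/
theorem par_lim {n S δ M C α t : ℕ} (hS : 1 ≤ S) (hSδ : S ≤ δ) (hC : 200000 ≤ C)
    (ht : t ≤ (par n S δ M C).lim α) :
    (t : ℝ) ≤ C * (1 + n * Real.logb 2 n + α * ((δ : ℝ) / S + Real.logb 2 S)) := by
  have hS' : (1 : ℝ) ≤ S := by exact_mod_cast hS
  have h1 : (1 : ℝ) ≤ (δ : ℝ) / S := by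
    rw [le_div_iff₀ (by linarith)]; simpa using (by exact_mod_cast hSδ : (S : ℝ) ≤ δ)
  have h2 : ((δ / S : ℕ) : ℝ) ≤ (δ : ℝ) / S := Nat.cast_div_le
  have h3 := clog_bound hS
  have h4 : 0 ≤ Real.logb 2 S := Real.logb_nonneg (by norm_num) hS'
  have h5 := nlog_bound n
  have h6 : 0 ≤ (n : ℝ) * Real.logb 2 n := by
    rcases Nat.eq_zero_or_pos n with rfl | h
    · simp
    · exact mul_nonneg (by positivity) (Real.logb_nonneg (by norm_num) (by exact_mod_cast h))
  have hC' : (200000 : ℝ) ≤ C := by exact_mod_cast hC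
  have ht' : (t : ℝ) ≤ 60000 * (n * Nat.clog 2 n) + 100 +
      2 * (30000 * ((δ / S : ℕ) + 1) + 1000 * Nat.clog 2 S + 30000) * α := by
    have : (t : ℝ) ≤ (((par n S δ M C).lim α : ℕ) : ℝ) := by exact_mod_cast ht
    simp only [Par.lim, par] at this
    push_cast at this ⊢
    linarith
  have h7 : 2 * (30000 * (((δ / S : ℕ) : ℝ) + 1) + 1000 * Nat.clog 2 S + 30000) * α ≤
      200000 * ((δ : ℝ) / S + Real.logb 2 S) * α :=
    mul_le_mul_of_nonneg_right (by linarith) (by positivity)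
  have h8 : 200000 * (1 + n * Real.logb 2 n + α * ((δ : ℝ) / S + Real.logb 2 S)) ≤
      C * (1 + n * Real.logb 2 n + α * ((δ : ℝ) / S + Real.logb 2 S)) :=
    mul_le_mul_of_nonneg_right hC' (by positivity)
  linarith

theorem outer_initial {n S δ M C : ℕ} (X : Fin n → ℕ) :
    Outer (par n S δ M C) n S (initial ssort n S δ X).safe
      ⟨(initial ssort n S δ X).faulty, (initial ssort n S δ X).corrupted, 0⟩ (fun _ _ => False) ∅ 0 := by
  have hA : ∀ x, 128 ≤ x → (initial ssort n S δ X).safe x = ⟨0, none⟩ := fun x hx => by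
    simp only [initial]
    rw [if_neg (by omega), if_neg (by omega), if_neg (by omega)]
  have hw : ∀ i, nwin (initial ssort n S δ X).safe i = 0 := fun i => by
    unfold nwin; rw [hA _ (by omega)]
  have hn : ∀ i, ncnt (initial ssort n S δ X).safe i = 0 := fun i => by
    unfold ncnt; rw [hA _ (by omega)]
  have hz : ∀ g, gsz S (initial ssort n S δ X).safe g = 0 := fun g => by simp [gsz, hw, hn]
  refine ⟨⟨⟨by simp [hw], by simp [hn], by simp [hz], by simp [hn], by simp, by simp, by simp [hz]⟩,
    fun i _ _ => ⟨by simp [hw], by simp [hw], by simp [hw]⟩⟩, ⟨?_, fun i hi _ => ⟨.f i, Or.inl hi, ?_⟩⟩,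
    by simp, by simp, by simp, by simp⟩
  · have hlive : ∀ x ∈ pqL n S (initial ssort n S δ X).safe {p | p < n} ∅, ∃ p, x = .f p ∧ p < n := by
      rintro (p | x | x) hx
      · rcases hx with hx | ⟨g, -, i, hi, -⟩
        · exact ⟨p, rfl, hx⟩
        · simp [hn] at hi
      · obtain ⟨g, -, h, -⟩ := hx
        exact absurd (hw _) h
      · exact absurd hx (by simp [mem_pqL_g])
    rintro x hx y hy i h1 h2
    obtain ⟨p, rfl, hp⟩ := hlive x hx
    obtain ⟨q, rfl, hq⟩ := hlive y hy
    simp [rd, initial, hp] at h1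
    simp [rd, initial, hq] at h2
    rw [h1, h2]
  · simp [rd, initial, hi]

/-- The final state is faithfully sorted. -/
theorem Outer.sorts {P : Par} {n S α : ℕ} {A : ℕ → Word} {c : Config} {bad ins} {X : Fin n → ℕ}
    (hX : Function.Injective X)
    (h : Outer P n S A ⟨c.faulty, c.corrupted, α⟩ (fun _ _ => True) bad ins)
    (ht : ∀ a i, (c.faulty a).src = some i → ∃ hi : i < n, (c.faulty a).val = X ⟨i, hi⟩) :
    FaithfullySorted n X c := by
  have hg : ∀ g < S, gsz S A g = 0 := fun g hg =>
    (Finset.sum_eq_zero_iff.1 h.pq.sum) g (Finset.mem_range.2 hg)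
  refine ⟨fun i hi => ?_, fun p q hpq hq i j hi hj => ?_⟩
  · obtain ⟨x, hx, e⟩ := h.good.2 i i.2 hi
    have : ∃ p, x = .f p ∧ p < n := by
      rcases x with p | x | x
      · rcases hx with hx | ⟨g, hgS, k, hk, -⟩
        · exact ⟨p, rfl, hx⟩
        · have := hg g hgS
          unfold gsz at this
          omega
      · obtain ⟨g, hgS, h1, -⟩ := hx
        have := hg g hgS
        unfold gsz at this
        rw [if_neg h1] at this
        omega
      · exact absurd hx (by simp [mem_pqL_g])
    obtain ⟨p, rfl, hp⟩ := this
    obtain ⟨_, hv⟩ := ht p i e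
    refine ⟨p, hp, ?_⟩
    change (c.faulty p).src = some (i : ℕ) at e
    rw [← hv, ← e]
  · obtain ⟨_, h1⟩ := ht p i hi
    obtain ⟨_, h2⟩ := ht q j hj
    have h3 := h.sorted p q hpq hq trivial (h.clean p (by omega) (by simp [hi]))
      (h.clean q hq (by simp [hj]))
    simp only [h1, h2, Fin.eta] at h3
    -- Equal values would mean the same key at two live words, which `Good` excludes.
    refine lt_of_le_of_ne h3 fun e => ?_
    have e' := hX e
    subst e'
    have := h.good.1 (.f p) (Or.inl (by change p < n; omega)) (.f q) (Or.inl hq) i hi hj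
    simp only [Loc.f.injEq] at this
    omega

/-- The final assertion includes the time bound, so the bound holds whether or not code is left: in
the former case it is read off the precondition of the next instruction. -/
theorem ssort_correct {C : ℕ} (hC : 200000 ≤ C) {n S δ M : ℕ} (hS : 1 ≤ S) (hSδ : S ≤ δ)
    (hM : (n + δ + 2) ^ C ≤ M) {X : Fin n → ℕ} (hX : Function.Injective X) {t α : ℕ} {c : Config}
    (hR : Reaches M (C * S) (initial ssort n S δ X) t α c) (hα : α ≤ δ) :
    (t : ℝ) ≤ C * (1 + n * Real.logb 2 n + α * ((δ : ℝ) / S + Real.logb 2 S)) ∧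
      (c.code = [] → FaithfullySorted n X c) := by
  have hfit := par_fit hS hSδ (by omega) hM
  obtain ⟨r, A, -, -, h⟩ := wp_sound (P := par n S δ M C)
    (Q := fun _ A m t => (∃ bad ins, Outer (par n S δ M C) n S A m (fun _ _ => True) bad ins) ∧
      t ≤ (par n S δ M C).lim m.a)
    (by have := hfit.ok.hcap; omega)
    (by
      rintro r A m t m' ⟨⟨bad, ins, h⟩, h2⟩ ⟨F, e⟩
      exact ⟨⟨_, _, h.ev e⟩, h2.trans (Par.lim_mono _ e.a_le)⟩)
    rfl ssort_wf (r₀ := (initial ssort n S δ X).safe) ⟨fun _ _ => rfl, fun _ _ _ => rfl⟩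
    (wp_ssort hfit (outer_initial X) rfl rfl rfl rfl rfl
      fun _ _ _ _ _ _ h1 h2 => ⟨⟨_, _, h1⟩, h2⟩) hR hα
  constructor
  · refine par_lim (M := M) hS hSδ hC ?_
    cases hcode : c.code with
    | nil => rw [hcode] at h; exact h.2
    | cons p k => rw [hcode] at h; exact (Nat.le_succ _).trans (wp_time h)
  · intro hcode
    rw [hcode] at h
    obtain ⟨⟨bad, ins, h⟩, -⟩ := h
    exact h.sorts hX hR.truthful.2

end FaultyRAM

theorem theorem1 :
    ∃ (P : FaultyRAM.Cmd) (C : ℕ),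
      ∀ n S δ M : ℕ, 1 ≤ S → S ≤ δ → (n + δ + 2) ^ C ≤ M →
      ∀ X : Fin n → ℕ, Function.Injective X → (∀ i, X i < M) →
      ∀ (t α : ℕ) (c : FaultyRAM.Config),
        FaultyRAM.Reaches M (C * S) (FaultyRAM.initial P n S δ X) t α c → α ≤ δ →
        (t : ℝ) ≤ C * (1 + n * Real.logb 2 n + α * ((δ : ℝ) / S + Real.logb 2 S)) ∧
        (c.code = [] → FaultyRAM.FaithfullySorted n X c) := by
  -- The constant is made opaque, as it appears as an exponent and must not be evaluated.
  obtain ⟨C, hC⟩ : ∃ C : ℕ, 200000 ≤ C := ⟨_, le_rfl⟩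
  exact ⟨FaultyRAM.ssort, C, fun n S δ M hS hSδ hM X hX _ t α c hR hα =>
    FaultyRAM.ssort_correct hC hS hSδ hM hX hR hα⟩
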